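/- Let $\mathsf S$ be one of the following categories of "spaces": (i) Hausdorff topological spaces; (ii) separated (Hausdorff) locally ringed spaces; (iii) $C^\infty$-manifolds; (iv) complex manifolds (manifolds are Hausdorff and second countable, each of a fixed finite dimension); (v) separated (Hausdorff) complex analytic spaces; (vi) smooth separated schemes over a field; (vii) separated schemes over a base scheme. "Étale" means local isomorphism in cases (i)–(v) and étale morphism of schemes in cases (vi)–(vii); $\mathsf S$ carries the topology of open covers in cases (i)–(v) and the étale topology in cases (vi)–(vii). A groupoid in $\mathsf S$ is a datum $X_\bullet=(X_0,X_1,\iota,s,t,c)$ in $\mathsf S$, for which $X_1\times_{X_0}X_1$ exists, such that $\operatorname{Hom}(M,X_\bullet)$ is a groupoid for every $M\in\mathsf S$. Morphisms are internal functors and 2-morphisms of these are internal natural transformations. An $\mathsf S$-groupoid is a groupoid in $\mathsf S$ with $s,t$ étale that is separated, i.e. $(s,t)\colon X_1\to X_0\times X_0$ is proper (in cases (i)–(v): a proper map of the underlying topological spaces to the product space). A morphism $f\colon Z_\bullet\to X_\bullet$ is an acyclic fibration if $f_0$ is étale and surjective and the square formed by $f_1$, $f_0\times f_0$ and the maps $(s,t)$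 is Cartesian. A stack over $\mathsf S$ is a category over $\mathsf S$, fibered in groupoids, whose morphisms form sheaves and in which descent data are effective; stacks form a 2-category, with functors over $\mathsf S$ as 1-morphisms and natural transformations over the identity as 2-morphisms. For an $\mathsf S$-groupoid $X_\bullet$, the associated stack $[X_\bullet]$ is a stack with a morphism $j_X\colon X_\bullet\to[X_\bullet]$ from the category over $\mathsf S$ given by $M\mapsto\operatorname{Hom}(M,X_\bullet)$ such that for every stack $\mathcal Y$ composition with $j_X$ is an equivalence $\operatorname{Hom}([X_\bullet],\mathcal Y)\to\operatorname{Hom}(X_\bullet,\mathcal Y)$. An $\mathsf S$-orbifold is a stack equivalent to $[X_\bullet]$ for some $\mathsf S$-groupoid $X_\bullet$; let $\mathsf S\text{-}\mathtt{Orbi}$ be the full sub-2-category of orbifolds. The $\mathsf S$-groupoids form a bicategory $\mathcal G$ as follows. A 1-morphism $X_\bullet\to Y_\bullet$ is a diagram $X_\bullet\xleftarrow{\,s\,}Z_\bullet\xrightarrow{\,f\,}Y_\bullet$ of $\mathsf S$-groupoids in which $s$ is an acyclic fibration. A 2-morphism from $(Z_\bullet,s,f)$ to $(Z'_\bullet,s',f')$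 is a 2-morphism from $f\circ\mathrm{pr}_1$ to $f'\circ\mathrm{pr}_2$ on the naive fiber product $Z_\bullet\times^{\mathrm{nv}}_{X_\bullet}Z'_\bullet$, which is given by $Z_i\times_{X_i}Z'_i$, $i=0,1$. The composite of $X_\bullet\leftarrow Z_\bullet\to Y_\bullet$ and $Y_\bullet\leftarrow T_\bullet\to W_\bullet$ is $X_\bullet\leftarrow Z_\bullet\times^{\mathrm{nv}}_{Y_\bullet}T_\bullet\to W_\bullet$. (In each of the seven cases $\mathsf S$ has the properties that make these fiber products and compositions well defined; this is part of the claim.) Proposition. The bicategory $\mathcal G$ is equivalent to the 2-category $\mathsf S\text{-}\mathtt{Orbi}$. More precisely, there is a pseudofunctor $F\colon\mathcal G\to\mathsf S\text{-}\mathtt{Orbi}$ that induces equivalences $\mathcal G(X_\bullet,Y_\bullet)\to\operatorname{Hom}(F(X_\bullet),F(Y_\bullet))$ and for which every orbifold is equivalent to some $F(X_\bullet)$, together with morphisms $j_X\colon X_\bullet\to F(X_\bullet)$ that exhibit $F(X_\bullet)$ as the associated stack $[X_\bullet]$, such that for every 1-morphism $X_\bullet\xleftarrow{s}Z_\bullet\xrightarrow{f}Y_\bullet$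 the composites $F(Z_\bullet,s,f)\circ j_X\circ s$ and $j_Y\circ f$ are isomorphic. -/

import Mathlib

open CategoryTheory CategoryTheory.Limits

universe v u

set_option linter.unusedSectionVars false
set_option linter.checkUnivs false

namespace Orbi

/-- A category of "spaces": a category with the notions of étale morphism, of surjective morphism,
of properness of a map `(s, t) : A ⟶ B × B`, and with a Grothendieck topology. This is only a
container for the data; the categories of interest are constructed below. -/
structure SpaceCat where
  Obj : Type u
  [cat : Category.{v} Obj]
  etale : MorphismProperty Obj
  surj : MorphismProperty Obj
  ProperPair : ∀ {A B : Obj}, (A ⟶ B) → (A ⟶ B) → Prop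
  topology : GrothendieckTopology Obj

attribute [instance] SpaceCat.cat

variable {S : SpaceCat.{v, u}}

/-- A groupoid in a category of spaces: objects `G₀`, `G₁` with identity `ι`, source `s`,
target `t` and composition `c : G₁ ×_{G₀} G₁ ⟶ G₁` (first `a`, then `b`, where `t a = s b`), such
that `Hom(M, -)` sends these data to a groupoid for every `M`. -/
structure GroupoidIn (S : SpaceCat.{v, u}) where
  G₀ : S.Obj
  G₁ : S.Obj
  s : G₁ ⟶ G₀
  t : G₁ ⟶ G₀
  ι : G₀ ⟶ G₁
  [hasPullback : HasPullback t s]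
  c : pullback t s ⟶ G₁
  ι_s : ι ≫ s = 𝟙 G₀
  ι_t : ι ≫ t = 𝟙 G₀
  c_s : c ≫ s = pullback.fst t s ≫ s
  c_t : c ≫ t = pullback.snd t s ≫ t
  id_comp : ∀ {M : S.Obj} (a : M ⟶ G₁) (h : ((a ≫ s) ≫ ι) ≫ t = a ≫ s),
    pullback.lift ((a ≫ s) ≫ ι) a h ≫ c = a
  comp_id : ∀ {M : S.Obj} (a : M ⟶ G₁) (h : a ≫ t = ((a ≫ t) ≫ ι) ≫ s),
    pullback.lift a ((a ≫ t) ≫ ι) h ≫ c = a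
  assoc : ∀ {M : S.Obj} (a b d : M ⟶ G₁) (h : a ≫ t = b ≫ s) (h' : b ≫ t = d ≫ s)
    (h₁ : (pullback.lift a b h ≫ c) ≫ t = d ≫ s) (h₂ : a ≫ t = (pullback.lift b d h' ≫ c) ≫ s),
    pullback.lift (pullback.lift a b h ≫ c) d h₁ ≫ c =
      pullback.lift a (pullback.lift b d h' ≫ c) h₂ ≫ c
  exists_inv : ∀ {M : S.Obj} (a : M ⟶ G₁), ∃ (b : M ⟶ G₁) (h : a ≫ t = b ≫ s)
    (h' : b ≫ t = a ≫ s), pullback.lift a b h ≫ c = (a ≫ s) ≫ ι ∧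
      pullback.lift b a h' ≫ c = (a ≫ t) ≫ ι

attribute [instance] GroupoidIn.hasPullback

namespace GroupoidIn

open Classical in
/-- The composite `a` then `b` of two `M`-valued arrows with `t a = s b`
(with the value `a` if they are not composable). -/
noncomputable def mul (X : GroupoidIn S) {M : S.Obj} (a b : M ⟶ X.G₁) : M ⟶ X.G₁ :=
  if h : a ≫ X.t = b ≫ X.s then pullback.lift a b h ≫ X.c else a

section
variable (X : GroupoidIn S) {M N : S.Obj} {a b d : M ⟶ X.G₁}

attribute [simp] ι_s ι_t c_s c_t
attribute [local simp] pullback.lift_fst pullback.lift_snd pullback.lift_fst_assoc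
  pullback.lift_snd_assoc

@[simp] lemma ι_s_assoc {A : S.Obj} (h : X.G₀ ⟶ A) : X.ι ≫ X.s ≫ h = h := by
  rw [← Category.assoc, X.ι_s, Category.id_comp]

@[simp] lemma ι_t_assoc {A : S.Obj} (h : X.G₀ ⟶ A) : X.ι ≫ X.t ≫ h = h := by
  rw [← Category.assoc, X.ι_t, Category.id_comp]

lemma mul_eq (h : a ≫ X.t = b ≫ X.s) : X.mul a b = pullback.lift a b h ≫ X.c := dif_pos h

lemma mul_s (h : a ≫ X.t = b ≫ X.s) : X.mul a b ≫ X.s = a ≫ X.s := by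
  simp [mul_eq X h]

lemma mul_t (h : a ≫ X.t = b ≫ X.s) : X.mul a b ≫ X.t = b ≫ X.t := by
  simp [mul_eq X h]

lemma comp_mul (q : N ⟶ M) (h : a ≫ X.t = b ≫ X.s) :
    q ≫ X.mul a b = X.mul (q ≫ a) (q ≫ b) := by
  rw [mul_eq X h, mul_eq X (by simp [h]), ← Category.assoc]
  congr 1
  apply pullback.hom_ext <;> simp

lemma mul_assoc (h : a ≫ X.t = b ≫ X.s) (h' : b ≫ X.t = d ≫ X.s) :
    X.mul (X.mul a b) d = X.mul a (X.mul b d) := by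
  have h₁ : X.mul a b ≫ X.t = d ≫ X.s := by rw [mul_t X h, h']
  have h₂ : a ≫ X.t = X.mul b d ≫ X.s := by rw [mul_s X h', h]
  rw [mul_eq X h₁, mul_eq X h₂]
  simp only [mul_eq X h, mul_eq X h'] at h₁ h₂ ⊢
  exact X.assoc a b d h h' h₁ h₂

lemma one_mul {x : M ⟶ X.G₀} (h : a ≫ X.s = x) : X.mul (x ≫ X.ι) a = a := by
  subst h
  rw [mul_eq X (by simp)]
  exact X.id_comp a _

lemma mul_one {x : M ⟶ X.G₀} (h : a ≫ X.t = x) : X.mul a (x ≫ X.ι) = a := by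
  subst h
  rw [mul_eq X (by simp)]
  exact X.comp_id a _

lemma exists_mul_inv (a : M ⟶ X.G₁) : ∃ b : M ⟶ X.G₁, b ≫ X.s = a ≫ X.t ∧ b ≫ X.t = a ≫ X.s ∧
    X.mul a b = (a ≫ X.s) ≫ X.ι ∧ X.mul b a = (a ≫ X.t) ≫ X.ι := by
  obtain ⟨b, h, h', e, e'⟩ := X.exists_inv a
  exact ⟨b, h.symm, h', by rw [mul_eq X h, e], by rw [mul_eq X h', e']⟩

lemma mul_left_cancel (h : a ≫ X.t = b ≫ X.s) (h' : a ≫ X.t = d ≫ X.s)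
    (e : X.mul a b = X.mul a d) : b = d := by
  obtain ⟨a', h₁, h₂, -, h₄⟩ := X.exists_mul_inv a
  have := congrArg (X.mul a') e
  rwa [← mul_assoc X h₂ h, ← mul_assoc X h₂ h', h₄, one_mul X h.symm, one_mul X h'.symm] at this

end

/-- A morphism of groupoids in `S` (an internal functor). -/
@[ext]
structure Hom (X Y : GroupoidIn S) where
  f₀ : X.G₀ ⟶ Y.G₀
  f₁ : X.G₁ ⟶ Y.G₁
  f₁_s : f₁ ≫ Y.s = X.s ≫ f₀
  f₁_t : f₁ ≫ Y.t = X.t ≫ f₀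
  ι_f₁ : X.ι ≫ f₁ = f₀ ≫ Y.ι
  mul_f₁ : ∀ {M : S.Obj} (a b : M ⟶ X.G₁), a ≫ X.t = b ≫ X.s →
    X.mul a b ≫ f₁ = Y.mul (a ≫ f₁) (b ≫ f₁)

attribute [simp] Hom.f₁_s Hom.f₁_t Hom.ι_f₁

section
variable {X Y : GroupoidIn S} (F : Hom X Y) {A : S.Obj}

@[simp] lemma Hom.f₁_s_assoc (h : Y.G₀ ⟶ A) : F.f₁ ≫ Y.s ≫ h = X.s ≫ F.f₀ ≫ h := by
  rw [← Category.assoc, F.f₁_s, Category.assoc]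

@[simp] lemma Hom.f₁_t_assoc (h : Y.G₀ ⟶ A) : F.f₁ ≫ Y.t ≫ h = X.t ≫ F.f₀ ≫ h := by
  rw [← Category.assoc, F.f₁_t, Category.assoc]

@[simp] lemma Hom.ι_f₁_assoc (h : Y.G₁ ⟶ A) : X.ι ≫ F.f₁ ≫ h = F.f₀ ≫ Y.ι ≫ h := by
  rw [← Category.assoc, F.ι_f₁, Category.assoc]

end

instance : Category (GroupoidIn S) where
  Hom := Hom
  id X :=
    { f₀ := 𝟙 _
      f₁ := 𝟙 _
      f₁_s := by simp
      f₁_t := by simp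
      ι_f₁ := by simp
      mul_f₁ := by simp }
  comp F G :=
    { f₀ := F.f₀ ≫ G.f₀
      f₁ := F.f₁ ≫ G.f₁
      f₁_s := by simp
      f₁_t := by simp
      ι_f₁ := by simp
      mul_f₁ := fun a b h => by
        rw [← Category.assoc, F.mul_f₁ a b h, G.mul_f₁ _ _ (by simp [reassoc_of% h])]
        simp }
  id_comp F := by ext <;> simp
  comp_id F := by ext <;> simp
  assoc F G H := by ext <;> simp

@[ext]
lemma hom_ext {X Y : GroupoidIn S} {F G : X ⟶ Y} (h₀ : F.f₀ = G.f₀) (h₁ : F.f₁ = G.f₁) : F = G :=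
  Hom.ext h₀ h₁

@[simp] lemma id_f₀ (X : GroupoidIn S) : Hom.f₀ (𝟙 X) = 𝟙 X.G₀ := rfl
@[simp] lemma id_f₁ (X : GroupoidIn S) : Hom.f₁ (𝟙 X) = 𝟙 X.G₁ := rfl
@[simp] lemma comp_f₀ {X Y Z : GroupoidIn S} (F : X ⟶ Y) (G : Y ⟶ Z) :
    (F ≫ G).f₀ = F.f₀ ≫ G.f₀ := rfl
@[simp] lemma comp_f₁ {X Y Z : GroupoidIn S} (F : X ⟶ Y) (G : Y ⟶ Z) :
    (F ≫ G).f₁ = F.f₁ ≫ G.f₁ := rfl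

/-- A 2-morphism between morphisms of groupoids in `S` (an internal natural transformation). -/
@[ext]
structure Trans {X Y : GroupoidIn S} (F G : X ⟶ Y) where
  τ : X.G₀ ⟶ Y.G₁
  τ_s : τ ≫ Y.s = F.f₀
  τ_t : τ ≫ Y.t = G.f₀
  naturality : Y.mul (X.s ≫ τ) G.f₁ = Y.mul F.f₁ (X.t ≫ τ)

/-- A separated étale groupoid. -/
class IsSGroupoid (X : GroupoidIn S) : Prop where
  etale_s : S.etale X.s
  etale_t : S.etale X.t
  separated : S.ProperPair X.s X.t

/-- Acyclic fibrations: `f₀` is étale and surjective, and the square formed by `f₁`, `f₀ × f₀` and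
the maps `(s, t)` is Cartesian (spelled out on points). -/
class IsAcyclicFib {Z X : GroupoidIn S} (F : Z ⟶ X) : Prop where
  etale : S.etale F.f₀
  surj : S.surj F.f₀
  cartesian : ∀ {M : S.Obj} (z z' : M ⟶ Z.G₀) (x : M ⟶ X.G₁), x ≫ X.s = z ≫ F.f₀ →
    x ≫ X.t = z' ≫ F.f₀ → ∃! w : M ⟶ Z.G₁, w ≫ Z.s = z ∧ w ≫ Z.t = z' ∧ w ≫ F.f₁ = x

end GroupoidIn

/-- Properties of a category of spaces that are needed to compose spans of groupoids and
2-morphisms between them: étale (surjective) maps are stable under composition and base change,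
fiber products along étale maps exist, étale surjective maps are effective epimorphisms, and
properness of `(s, t)` is stable under base change along `f₀ × f₀` with `f₀` étale. -/
class SpaceCat.IsGeometric (S : SpaceCat.{v, u}) : Prop where
  etale_mul : S.etale.IsMultiplicative
  etale_baseChange : S.etale.IsStableUnderBaseChange
  etaleSurj_mul : (S.etale ⊓ S.surj).IsMultiplicative
  etaleSurj_baseChange : (S.etale ⊓ S.surj).IsStableUnderBaseChange
  hasPullback : ∀ {A B D : S.Obj} (f : A ⟶ B) (g : D ⟶ B), S.etale g → HasPullback f g
  effectiveEpi : ∀ {A B : S.Obj} (f : A ⟶ B), S.etale f → S.surj f → EffectiveEpi f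
  properPair : ∀ {X₀ X₁ Z₀ Z₁ : S.Obj} (s t : X₁ ⟶ X₀) (s' t' : Z₁ ⟶ Z₀) (f₀ : Z₀ ⟶ X₀)
    (f₁ : Z₁ ⟶ X₁), S.etale s → S.etale t → S.etale f₀ → f₁ ≫ s = s' ≫ f₀ → f₁ ≫ t = t' ≫ f₀ →
    (∀ {M : S.Obj} (z z' : M ⟶ Z₀) (x : M ⟶ X₁), x ≫ s = z ≫ f₀ → x ≫ t = z' ≫ f₀ →
      ∃! w : M ⟶ Z₁, w ≫ s' = z ∧ w ≫ t' = z' ∧ w ≫ f₁ = x) →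
    S.ProperPair s t → S.ProperPair s' t'

namespace GroupoidIn

variable [S.IsGeometric]

section etale

open SpaceCat

instance : S.etale.IsMultiplicative := IsGeometric.etale_mul
instance : S.etale.IsStableUnderBaseChange := IsGeometric.etale_baseChange
instance : (S.etale ⊓ S.surj).IsMultiplicative := IsGeometric.etaleSurj_mul
instance : (S.etale ⊓ S.surj).IsStableUnderBaseChange := IsGeometric.etaleSurj_baseChange

attribute [local simp] pullback.lift_fst pullback.lift_snd pullback.lift_fst_assoc
  pullback.lift_snd_assoc

lemma etale_of_cartesian {X₀ X₁ Z₀ Z₁ : S.Obj} (s t : X₁ ⟶ X₀) (s' t' : Z₁ ⟶ Z₀) (f₀ : Z₀ ⟶ X₀)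
    (f₁ : Z₁ ⟶ X₁) (hs : S.etale s) (hf : S.etale f₀) (h₁ : f₁ ≫ s = s' ≫ f₀)
    (h₂ : f₁ ≫ t = t' ≫ f₀)
    (H : ∀ {M : S.Obj} (z z' : M ⟶ Z₀) (x : M ⟶ X₁), x ≫ s = z ≫ f₀ → x ≫ t = z' ≫ f₀ →
      ∃! w : M ⟶ Z₁, w ≫ s' = z ∧ w ≫ t' = z' ∧ w ≫ f₁ = x) :
    S.etale f₁ ∧ S.etale s' := by
  have := IsGeometric.hasPullback s f₀ hf
  have := IsGeometric.hasPullback (pullback.fst s f₀ ≫ t) f₀ hf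
  let k : Z₁ ⟶ pullback (pullback.fst s f₀ ≫ t) f₀ :=
    pullback.lift (pullback.lift f₁ s' h₁) t' (by simp [h₂])
  obtain ⟨w, ⟨w₁, w₂, w₃⟩, -⟩ := H (pullback.fst (pullback.fst s f₀ ≫ t) f₀ ≫ pullback.snd s f₀)
    (pullback.snd (pullback.fst s f₀ ≫ t) f₀)
    (pullback.fst (pullback.fst s f₀ ≫ t) f₀ ≫ pullback.fst s f₀)
    (by simp [pullback.condition]) (by simp [pullback.condition])
  have hk : IsIso k := by
    refine ⟨w, ?_, ?_⟩
    · obtain ⟨v, -, hv⟩ := H s' t' f₁ h₁ h₂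
      rw [hv (k ≫ w) (by simp [k, w₁, w₂, w₃]), hv (𝟙 _) (by simp)]
    · apply pullback.hom_ext
      · apply pullback.hom_ext <;> simp [k, w₁, w₃]
      · simp [k, w₂]
  have e₁ : S.etale (pullback.fst (pullback.fst s f₀ ≫ t) f₀) := S.etale.pullback_fst _ _ hf
  have ek : S.etale k := MorphismProperty.of_isIso _ k
  constructor
  · have : f₁ = k ≫ pullback.fst (pullback.fst s f₀ ≫ t) f₀ ≫ pullback.fst s f₀ := by simp [k]
    rw [this]
    exact S.etale.comp_mem _ _ ek (S.etale.comp_mem _ _ e₁ (S.etale.pullback_fst _ _ hf))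
  · have : s' = k ≫ pullback.fst (pullback.fst s f₀ ≫ t) f₀ ≫ pullback.snd s f₀ := by simp [k]
    rw [this]
    exact S.etale.comp_mem _ _ ek (S.etale.comp_mem _ _ e₁ (S.etale.pullback_snd _ _ hs))

lemma IsAcyclicFib.etale_f₁ {Z X : GroupoidIn S} (F : Z ⟶ X) [IsSGroupoid X] [IsAcyclicFib F] :
    S.etale F.f₁ :=
  (etale_of_cartesian X.s X.t Z.s Z.t F.f₀ F.f₁ IsSGroupoid.etale_s IsAcyclicFib.etale F.f₁_s
    F.f₁_t IsAcyclicFib.cartesian).1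

instance {A D B : GroupoidIn S} (F : A ⟶ B) (G : D ⟶ B) [IsAcyclicFib G] :
    HasPullback F.f₀ G.f₀ := SpaceCat.IsGeometric.hasPullback _ _ IsAcyclicFib.etale

instance {A D B : GroupoidIn S} (F : A ⟶ B) (G : D ⟶ B) [IsSGroupoid B] [IsAcyclicFib G] :
    HasPullback F.f₁ G.f₁ := SpaceCat.IsGeometric.hasPullback _ _ (IsAcyclicFib.etale_f₁ G)

end etale

end GroupoidIn

namespace GroupoidIn

variable {M N : S.Obj}

section lift
variable {Z X : GroupoidIn S} (F : Z ⟶ X) [IsAcyclicFib F]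

open Classical in
/-- For an acyclic fibration `F : Z ⟶ X`, the unique arrow `z ⟶ z'` of `Z` over an arrow
`x : F z ⟶ F z'` of `X`. -/
noncomputable def lift (z z' : M ⟶ Z.G₀) (x : M ⟶ X.G₁) : M ⟶ Z.G₁ :=
  if h : x ≫ X.s = z ≫ F.f₀ ∧ x ≫ X.t = z' ≫ F.f₀ then
    (IsAcyclicFib.cartesian z z' x h.1 h.2).choose else z ≫ Z.ι

variable {z z' z'' : M ⟶ Z.G₀} {x y : M ⟶ X.G₁}

lemma lift_spec (h : x ≫ X.s = z ≫ F.f₀) (h' : x ≫ X.t = z' ≫ F.f₀) :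
    lift F z z' x ≫ Z.s = z ∧ lift F z z' x ≫ Z.t = z' ∧ lift F z z' x ≫ F.f₁ = x := by
  rw [lift, dif_pos ⟨h, h'⟩]
  exact (IsAcyclicFib.cartesian z z' x h h').choose_spec.1

lemma lift_s (h : x ≫ X.s = z ≫ F.f₀) (h' : x ≫ X.t = z' ≫ F.f₀) : lift F z z' x ≫ Z.s = z :=
  (lift_spec F h h').1

lemma lift_t (h : x ≫ X.s = z ≫ F.f₀) (h' : x ≫ X.t = z' ≫ F.f₀) : lift F z z' x ≫ Z.t = z' :=
  (lift_spec F h h').2.1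

lemma lift_f₁ (h : x ≫ X.s = z ≫ F.f₀) (h' : x ≫ X.t = z' ≫ F.f₀) : lift F z z' x ≫ F.f₁ = x :=
  (lift_spec F h h').2.2

lemma lift_ext {w w' : M ⟶ Z.G₁} (h : w ≫ Z.s = w' ≫ Z.s) (h' : w ≫ Z.t = w' ≫ Z.t)
    (h₁ : w ≫ F.f₁ = w' ≫ F.f₁) : w = w' :=
  (IsAcyclicFib.cartesian (F := F) (w' ≫ Z.s) (w' ≫ Z.t) (w' ≫ F.f₁) (by simp) (by simp)).unique
    ⟨h, h', h₁⟩ ⟨rfl, rfl, rfl⟩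

lemma lift_uniq (w : M ⟶ Z.G₁) (h : w ≫ Z.s = z) (h' : w ≫ Z.t = z') (h₁ : w ≫ F.f₁ = x) :
    lift F z z' x = w := by
  subst h h' h₁
  have := lift_spec F (z := w ≫ Z.s) (z' := w ≫ Z.t) (x := w ≫ F.f₁) (by simp) (by simp)
  exact lift_ext F this.1 this.2.1 this.2.2

lemma comp_lift (q : N ⟶ M) (h : x ≫ X.s = z ≫ F.f₀) (h' : x ≫ X.t = z' ≫ F.f₀) :
    q ≫ lift F z z' x = lift F (q ≫ z) (q ≫ z') (q ≫ x) := by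
  symm
  apply lift_uniq <;> simp [lift_spec F h h']

lemma lift_mul (h : x ≫ X.s = z ≫ F.f₀) (h' : x ≫ X.t = z' ≫ F.f₀) (k : y ≫ X.s = z' ≫ F.f₀)
    (k' : y ≫ X.t = z'' ≫ F.f₀) :
    lift F z z'' (X.mul x y) = Z.mul (lift F z z' x) (lift F z' z'' y) := by
  have e : lift F z z' x ≫ Z.t = lift F z' z'' y ≫ Z.s := by rw [lift_t F h h', lift_s F k k']
  apply lift_uniq
  · rw [mul_s _ e, lift_s F h h']
  · rw [mul_t _ e, lift_t F k k']
  · rw [F.mul_f₁ _ _ e, lift_f₁ F h h', lift_f₁ F k k']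

lemma lift_one {x₀ : M ⟶ X.G₀} (h : z ≫ F.f₀ = x₀) : lift F z z (x₀ ≫ X.ι) = z ≫ Z.ι := by
  subst h
  apply lift_uniq <;> simp

end lift

section nfp

open SpaceCat

variable [S.IsGeometric] {A B D : GroupoidIn S} (F : A ⟶ B) (G : D ⟶ B) [IsSGroupoid B]
  [IsAcyclicFib G]

attribute [local simp] pullback.lift_fst pullback.lift_snd pullback.lift_fst_assoc
  pullback.lift_snd_assoc pullback.condition

/-- The source map of the naive fiber product. -/
noncomputable def nfpS : pullback F.f₁ G.f₁ ⟶ pullback F.f₀ G.f₀ :=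
  pullback.lift (pullback.fst _ _ ≫ A.s) (pullback.snd _ _ ≫ D.s)
    (by simp only [Category.assoc, ← Hom.f₁_s]; simp only [← Category.assoc, pullback.condition])

/-- The target map of the naive fiber product. -/
noncomputable def nfpT : pullback F.f₁ G.f₁ ⟶ pullback F.f₀ G.f₀ :=
  pullback.lift (pullback.fst _ _ ≫ A.t) (pullback.snd _ _ ≫ D.t)
    (by simp only [Category.assoc, ← Hom.f₁_t]; simp only [← Category.assoc, pullback.condition])

@[simp] lemma nfpS_fst : nfpS F G ≫ pullback.fst _ _ = pullback.fst _ _ ≫ A.s := by simp [nfpS]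
@[simp] lemma nfpS_fst_assoc {E : S.Obj} (h : A.G₀ ⟶ E) :
    nfpS F G ≫ pullback.fst _ _ ≫ h = pullback.fst _ _ ≫ A.s ≫ h := by
  simp [← Category.assoc]
@[simp] lemma nfpS_snd : nfpS F G ≫ pullback.snd _ _ = pullback.snd _ _ ≫ D.s := by simp [nfpS]
@[simp] lemma nfpS_snd_assoc {E : S.Obj} (h : D.G₀ ⟶ E) :
    nfpS F G ≫ pullback.snd _ _ ≫ h = pullback.snd _ _ ≫ D.s ≫ h := by
  simp [← Category.assoc]
@[simp] lemma nfpT_fst : nfpT F G ≫ pullback.fst _ _ = pullback.fst _ _ ≫ A.t := by simp [nfpT]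
@[simp] lemma nfpT_fst_assoc {E : S.Obj} (h : A.G₀ ⟶ E) :
    nfpT F G ≫ pullback.fst _ _ ≫ h = pullback.fst _ _ ≫ A.t ≫ h := by
  simp [← Category.assoc]
@[simp] lemma nfpT_snd : nfpT F G ≫ pullback.snd _ _ = pullback.snd _ _ ≫ D.t := by simp [nfpT]
@[simp] lemma nfpT_snd_assoc {E : S.Obj} (h : D.G₀ ⟶ E) :
    nfpT F G ≫ pullback.snd _ _ ≫ h = pullback.snd _ _ ≫ D.t ≫ h := by
  simp [← Category.assoc]

lemma nfp_cartesian (p p' : M ⟶ pullback F.f₀ G.f₀) (a : M ⟶ A.G₁)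
    (h : a ≫ A.s = p ≫ pullback.fst _ _) (h' : a ≫ A.t = p' ≫ pullback.fst _ _) :
    ∃! w : M ⟶ pullback F.f₁ G.f₁, w ≫ nfpS F G = p ∧ w ≫ nfpT F G = p' ∧
      w ≫ pullback.fst _ _ = a := by
  have k : (a ≫ F.f₁) ≫ B.s = (p ≫ pullback.snd _ _) ≫ G.f₀ := by
    simp [← pullback.condition, reassoc_of% h]
  have k' : (a ≫ F.f₁) ≫ B.t = (p' ≫ pullback.snd _ _) ≫ G.f₀ := by
    simp [← pullback.condition, reassoc_of% h']
  refine ⟨pullback.lift a (lift G _ _ _) (lift_f₁ G k k').symm, ⟨?_, ?_, ?_⟩, ?_⟩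
  · apply pullback.hom_ext
    · simp [h]
    · simpa using lift_s G k k'
  · apply pullback.hom_ext
    · simp [h']
    · simpa using lift_t G k k'
  · simp
  · rintro w ⟨rfl, rfl, rfl⟩
    apply pullback.hom_ext
    · simp
    · rw [pullback.lift_snd]
      symm
      apply lift_uniq <;> simp

lemma etale_nfp_fst : S.etale (pullback.fst F.f₀ G.f₀) :=
  S.etale.pullback_fst _ _ IsAcyclicFib.etale

variable [IsSGroupoid A]

lemma nfp_etale : S.etale (nfpS F G) ∧ S.etale (nfpT F G) :=
  ⟨(etale_of_cartesian A.s A.t (nfpS F G) (nfpT F G) _ (pullback.fst _ _) IsSGroupoid.etale_s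
    (etale_nfp_fst F G) (by simp) (by simp) (nfp_cartesian F G)).2,
   (etale_of_cartesian A.t A.s (nfpT F G) (nfpS F G) _ (pullback.fst _ _) IsSGroupoid.etale_t
    (etale_nfp_fst F G) (by simp) (by simp) (fun p p' a h h' => by
      obtain ⟨w, ⟨h₁, h₂, h₃⟩, H⟩ := nfp_cartesian F G p' p a h' h
      exact ⟨w, ⟨h₂, h₁, h₃⟩, fun w' h => H w' ⟨h.2.1, h.1, h.2.2⟩⟩)).2⟩

instance : HasPullback (nfpT F G) (nfpS F G) :=
  IsGeometric.hasPullback _ _ (nfp_etale F G).1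

lemma nfp_fst_mul {a b : M ⟶ pullback F.f₁ G.f₁} (h : a ≫ nfpT F G = b ≫ nfpS F G) :
    (a ≫ pullback.fst _ _) ≫ A.t = (b ≫ pullback.fst _ _) ≫ A.s := by
  have := h =≫ pullback.fst _ _
  simpa using this

lemma nfp_snd_mul {a b : M ⟶ pullback F.f₁ G.f₁} (h : a ≫ nfpT F G = b ≫ nfpS F G) :
    (a ≫ pullback.snd _ _) ≫ D.t = (b ≫ pullback.snd _ _) ≫ D.s := by
  have := h =≫ pullback.snd _ _
  simpa using this

/-- The (componentwise) composition of arrows of the naive fiber product. -/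
noncomputable def nfpMul {a b : M ⟶ pullback F.f₁ G.f₁} (h : a ≫ nfpT F G = b ≫ nfpS F G) :
    M ⟶ pullback F.f₁ G.f₁ :=
  pullback.lift (A.mul (a ≫ pullback.fst _ _) (b ≫ pullback.fst _ _))
    (D.mul (a ≫ pullback.snd _ _) (b ≫ pullback.snd _ _)) (by
      rw [F.mul_f₁ _ _ (nfp_fst_mul F G h), G.mul_f₁ _ _ (nfp_snd_mul F G h)]
      simp)

lemma comp_nfpMul (q : N ⟶ M) {a b : M ⟶ pullback F.f₁ G.f₁} (h : a ≫ nfpT F G = b ≫ nfpS F G) :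
    q ≫ nfpMul F G h = nfpMul F G (a := q ≫ a) (b := q ≫ b) (by simp [h]) := by
  apply pullback.hom_ext
  · simp [nfpMul, comp_mul A q (nfp_fst_mul F G h)]
  · simp [nfpMul, comp_mul D q (nfp_snd_mul F G h)]

lemma lift_nfpMul {a b : M ⟶ pullback F.f₁ G.f₁} (h : a ≫ nfpT F G = b ≫ nfpS F G) :
    pullback.lift a b h ≫ nfpMul F G (pullback.condition (f := nfpT F G) (g := nfpS F G)) =
      nfpMul F G h := by
  rw [comp_nfpMul]
  congr 1 <;> simp

/-- The naive fiber product `A ×_B D`, with objects `A₀ ×_{B₀} D₀` and arrows `A₁ ×_{B₁} D₁`. -/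
noncomputable def nfp : GroupoidIn S where
  G₀ := pullback F.f₀ G.f₀
  G₁ := pullback F.f₁ G.f₁
  s := nfpS F G
  t := nfpT F G
  ι := pullback.lift (pullback.fst _ _ ≫ A.ι) (pullback.snd _ _ ≫ D.ι) (by
    simp only [Category.assoc, Hom.ι_f₁]; simp only [← Category.assoc, pullback.condition])
  c := nfpMul F G (pullback.condition (f := nfpT F G) (g := nfpS F G))
  ι_s := by apply pullback.hom_ext <;> simp
  ι_t := by apply pullback.hom_ext <;> simp
  c_s := by
    have h := pullback.condition (f := nfpT F G) (g := nfpS F G)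
    apply pullback.hom_ext
    · simp [nfpMul, mul_s A (nfp_fst_mul F G h)]
    · simp [nfpMul, mul_s D (nfp_snd_mul F G h)]
  c_t := by
    have h := pullback.condition (f := nfpT F G) (g := nfpS F G)
    apply pullback.hom_ext
    · simp [nfpMul, mul_t A (nfp_fst_mul F G h)]
    · simp [nfpMul, mul_t D (nfp_snd_mul F G h)]
  id_comp a h := by
    rw [lift_nfpMul]
    apply pullback.hom_ext
    · simpa [nfpMul] using one_mul A (a := a ≫ pullback.fst _ _) rfl
    · simpa [nfpMul] using one_mul D (a := a ≫ pullback.snd _ _) rfl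
  comp_id a h := by
    rw [lift_nfpMul]
    apply pullback.hom_ext
    · simpa [nfpMul] using mul_one A (a := a ≫ pullback.fst _ _) rfl
    · simpa [nfpMul] using mul_one D (a := a ≫ pullback.snd _ _) rfl
  assoc a b d h h' h₁ h₂ := by
    simp only [lift_nfpMul] at h₁ h₂ ⊢
    apply pullback.hom_ext
    · simpa [nfpMul] using mul_assoc A (nfp_fst_mul F G h) (nfp_fst_mul F G h')
    · simpa [nfpMul] using mul_assoc D (nfp_snd_mul F G h) (nfp_snd_mul F G h')
  exists_inv a := by
    obtain ⟨b, hb₁, hb₂, hb₃, hb₄⟩ := exists_mul_inv A (a ≫ pullback.fst _ _)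
    obtain ⟨d, hd₁, hd₂, hd₃, hd₄⟩ := exists_mul_inv D (a ≫ pullback.snd _ _)
    have e : b ≫ F.f₁ = d ≫ G.f₁ := by
      refine mul_left_cancel B (a := a ≫ pullback.fst _ _ ≫ F.f₁) ?_ ?_ ?_
      · simp [reassoc_of% hb₁]
        simp only [← Hom.f₁_t, pullback.condition_assoc]
      · simp only [pullback.condition, Category.assoc, Hom.f₁_s, reassoc_of% hd₁, Hom.f₁_t]
      · have h₁ := F.mul_f₁ _ _ hb₁.symm
        have h₂ := G.mul_f₁ _ _ hd₁.symm
        rw [hb₃] at h₁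
        rw [hd₃] at h₂
        simp only [Category.assoc] at h₁ h₂
        rw [← h₁, pullback.condition, ← h₂]
        simp only [Hom.ι_f₁, ← Hom.f₁_s_assoc, pullback.condition_assoc]
    refine ⟨pullback.lift b d e, ?_, ?_, ?_, ?_⟩
    · apply pullback.hom_ext <;> simp [hb₁, hd₁]
    · apply pullback.hom_ext <;> simp [hb₂, hd₂]
    · rw [lift_nfpMul]
      apply pullback.hom_ext <;> simp [nfpMul, hb₃, hd₃]
    · rw [lift_nfpMul]
      apply pullback.hom_ext <;> simp [nfpMul, hb₄, hd₄]

/-- The first projection of the naive fiber product. -/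
noncomputable def nfpFst : nfp F G ⟶ A where
  f₀ := pullback.fst _ _
  f₁ := pullback.fst _ _
  f₁_s := by simp [nfp]
  f₁_t := by simp [nfp]
  ι_f₁ := by simp [nfp]
  mul_f₁ a b h := by
    rw [mul_eq _ h]
    exact (congrArg (· ≫ pullback.fst _ _) (lift_nfpMul F G h)).trans (by simp [nfpMul]; rfl)

/-- The second projection of the naive fiber product. -/
noncomputable def nfpSnd : nfp F G ⟶ D where
  f₀ := pullback.snd _ _
  f₁ := pullback.snd _ _
  f₁_s := by simp [nfp]
  f₁_t := by simp [nfp]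
  ι_f₁ := by simp [nfp]
  mul_f₁ a b h := by
    rw [mul_eq _ h]
    exact (congrArg (· ≫ pullback.snd _ _) (lift_nfpMul F G h)).trans (by simp [nfpMul]; rfl)

instance : IsAcyclicFib (nfpFst F G) where
  etale := etale_nfp_fst F G
  surj := ((S.etale ⊓ S.surj).pullback_fst _ _ ⟨IsAcyclicFib.etale, IsAcyclicFib.surj⟩).2
  cartesian := nfp_cartesian F G

instance : IsSGroupoid (nfp F G) where
  etale_s := (nfp_etale F G).1
  etale_t := (nfp_etale F G).2
  separated := IsGeometric.properPair A.s A.t _ _ (pullback.fst _ _) (pullback.fst _ _)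
    IsSGroupoid.etale_s IsSGroupoid.etale_t (etale_nfp_fst F G) (nfpS_fst F G).symm
    (nfpT_fst F G).symm (nfp_cartesian F G) IsSGroupoid.separated

section
variable {F G}

/-- The `M`-valued object of the naive fiber product with the given components. -/
noncomputable def nfpPair (a : M ⟶ A.G₀) (d : M ⟶ D.G₀) (h : a ≫ F.f₀ = d ≫ G.f₀) :
    M ⟶ (nfp F G).G₀ := pullback.lift a d h

/-- The `M`-valued arrow of the naive fiber product with the given components. -/
noncomputable def nfpPair₁ (a : M ⟶ A.G₁) (d : M ⟶ D.G₁) (h : a ≫ F.f₁ = d ≫ G.f₁) :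
    M ⟶ (nfp F G).G₁ := pullback.lift a d h

end

section
variable (a : M ⟶ A.G₀) (d : M ⟶ D.G₀) (h : a ≫ F.f₀ = d ≫ G.f₀)
variable (a₁ : M ⟶ A.G₁) (d₁ : M ⟶ D.G₁) (h₁ : a₁ ≫ F.f₁ = d₁ ≫ G.f₁)

@[simp] lemma nfpPair_fst : nfpPair a d h ≫ (nfpFst F G).f₀ = a := pullback.lift_fst _ _ _
@[simp] lemma nfpPair_snd : nfpPair a d h ≫ (nfpSnd F G).f₀ = d := pullback.lift_snd _ _ _
@[simp] lemma nfpPair₁_fst : nfpPair₁ a₁ d₁ h₁ ≫ (nfpFst F G).f₁ = a₁ := pullback.lift_fst _ _ _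
@[simp] lemma nfpPair₁_snd : nfpPair₁ a₁ d₁ h₁ ≫ (nfpSnd F G).f₁ = d₁ := pullback.lift_snd _ _ _

@[simp] lemma nfpPair_fst_assoc {E : S.Obj} (k : A.G₀ ⟶ E) :
    nfpPair a d h ≫ (nfpFst F G).f₀ ≫ k = a ≫ k := by rw [← Category.assoc, nfpPair_fst]
@[simp] lemma nfpPair_snd_assoc {E : S.Obj} (k : D.G₀ ⟶ E) :
    nfpPair a d h ≫ (nfpSnd F G).f₀ ≫ k = d ≫ k := by rw [← Category.assoc, nfpPair_snd]
@[simp] lemma nfpPair₁_fst_assoc {E : S.Obj} (k : A.G₁ ⟶ E) :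
    nfpPair₁ a₁ d₁ h₁ ≫ (nfpFst F G).f₁ ≫ k = a₁ ≫ k := by rw [← Category.assoc, nfpPair₁_fst]
@[simp] lemma nfpPair₁_snd_assoc {E : S.Obj} (k : D.G₁ ⟶ E) :
    nfpPair₁ a₁ d₁ h₁ ≫ (nfpSnd F G).f₁ ≫ k = d₁ ≫ k := by rw [← Category.assoc, nfpPair₁_snd]

lemma nfp_condition : (nfpFst F G).f₀ ≫ F.f₀ = (nfpSnd F G).f₀ ≫ G.f₀ := pullback.condition

lemma nfp_condition₁ : (nfpFst F G).f₁ ≫ F.f₁ = (nfpSnd F G).f₁ ≫ G.f₁ := pullback.condition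

variable {F G} in
lemma nfp_ext {p p' : M ⟶ (nfp F G).G₀} (h : p ≫ (nfpFst F G).f₀ = p' ≫ (nfpFst F G).f₀)
    (h' : p ≫ (nfpSnd F G).f₀ = p' ≫ (nfpSnd F G).f₀) : p = p' := pullback.hom_ext h h'

variable {F G} in
lemma nfp_ext₁ {p p' : M ⟶ (nfp F G).G₁} (h : p ≫ (nfpFst F G).f₁ = p' ≫ (nfpFst F G).f₁)
    (h' : p ≫ (nfpSnd F G).f₁ = p' ≫ (nfpSnd F G).f₁) : p = p' := pullback.hom_ext h h'

end

end nfp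
end GroupoidIn

/-- Separated étale groupoids in `S`. -/
structure SGroupoid (S : SpaceCat.{v, u}) where
  gpd : GroupoidIn S
  [isSGroupoid : gpd.IsSGroupoid]

attribute [instance] SGroupoid.isSGroupoid

open GroupoidIn

/-- A span `X ← Z → Y` of separated étale groupoids whose left leg is an acyclic fibration. -/
structure Span (X Y : GroupoidIn S) where
  Z : GroupoidIn S
  [isSGroupoid : Z.IsSGroupoid]
  s : Z ⟶ X
  [isAcyclicFib : IsAcyclicFib s]
  f : Z ⟶ Y

attribute [instance] Span.isSGroupoid Span.isAcyclicFib

namespace Span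

variable [S.IsGeometric] {X Y : GroupoidIn S} [IsSGroupoid X]

/-- A 2-morphism from `X ← Z → Y` to `X ← Z' → Y`: a 2-morphism between the two composite
morphisms from the naive fiber product `Z ×_X Z'` to `Y`. -/
abbrev Hom₂ (σ τ : Span X Y) : Type v :=
  Trans (nfpFst σ.s τ.s ≫ σ.f) (nfpSnd σ.s τ.s ≫ τ.f)

variable {M N : S.Obj}

section glue
variable {Z : GroupoidIn S} (F : Z ⟶ X) [IsAcyclicFib F] (z₀ : M ⟶ X.G₀)

lemma exists_cover : ∃ (N : S.Obj) (q : N ⟶ M) (w : N ⟶ Z.G₀), w ≫ F.f₀ = q ≫ z₀ ∧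
    EffectiveEpi q ∧ ∀ {L : S.Obj} (p : L ⟶ M) (v : L ⟶ Z.G₀), v ≫ F.f₀ = p ≫ z₀ →
      ∃ k : L ⟶ N, k ≫ q = p ∧ k ≫ w = v := by
  have := SpaceCat.IsGeometric.hasPullback z₀ F.f₀ IsAcyclicFib.etale
  have h := (S.etale ⊓ S.surj).pullback_fst z₀ F.f₀ ⟨IsAcyclicFib.etale, IsAcyclicFib.surj⟩
  exact ⟨pullback z₀ F.f₀, pullback.fst _ _, pullback.snd _ _, pullback.condition.symm,
    SpaceCat.IsGeometric.effectiveEpi _ h.1 h.2, fun p v e =>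
      ⟨pullback.lift p v e.symm, pullback.lift_fst _ _ _, pullback.lift_snd _ _ _⟩⟩

/-- Two maps agree if they agree after all base changes along which `z₀` lifts to `Z`. -/
lemma cover_ext {Y : S.Obj} {u v : M ⟶ Y}
    (h : ∀ {N : S.Obj} (q : N ⟶ M) (w : N ⟶ Z.G₀), w ≫ F.f₀ = q ≫ z₀ → q ≫ u = q ≫ v) :
    u = v := by
  obtain ⟨N, q, w, hw, hq, -⟩ := exists_cover F z₀
  exact (cancel_epi q).1 (h q w hw)

lemma exists_glue {Y : S.Obj}
    (e : ∀ {N : S.Obj} (q : N ⟶ M) (w : N ⟶ Z.G₀), w ≫ F.f₀ = q ≫ z₀ → (N ⟶ Y))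
    (nat : ∀ {N L : S.Obj} (p : L ⟶ N) (q : N ⟶ M) (w : N ⟶ Z.G₀) (h : w ≫ F.f₀ = q ≫ z₀),
      p ≫ e q w h = e (p ≫ q) (p ≫ w) (by simp [h]))
    (indep : ∀ {N : S.Obj} (q : N ⟶ M) (w w' : N ⟶ Z.G₀) (h : w ≫ F.f₀ = q ≫ z₀)
      (h' : w' ≫ F.f₀ = q ≫ z₀), e q w h = e q w' h') :
    ∃ g : M ⟶ Y, ∀ {N : S.Obj} (q : N ⟶ M) (w : N ⟶ Z.G₀) (h : w ≫ F.f₀ = q ≫ z₀),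
      q ≫ g = e q w h := by
  obtain ⟨N, q, w, hw, hq, H⟩ := exists_cover F z₀
  have key : ∀ {L : S.Obj} (g₁ g₂ : L ⟶ N), g₁ ≫ q = g₂ ≫ q →
      g₁ ≫ e q w hw = g₂ ≫ e q w hw := by
    intro L g₁ g₂ hg
    rw [nat, nat]
    simp only [hg]
    apply indep
  refine ⟨EffectiveEpi.desc q (e q w hw) key, fun {L} p v hv => ?_⟩
  obtain ⟨k, rfl, rfl⟩ := H p v hv
  rw [Category.assoc, EffectiveEpi.fac, nat]

end glue

/-- An extended 2-morphism between spans: a natural family of arrows `σ.f z ⟶ τ.f z'` of `Y`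
indexed by the arrows `x : σ.s z ⟶ τ.s z'` of `X`. -/
structure ECell (σ τ : Span X Y) where
  app : ∀ {M : S.Obj} (z : M ⟶ σ.Z.G₀) (z' : M ⟶ τ.Z.G₀) (x : M ⟶ X.G₁),
    x ≫ X.s = z ≫ σ.s.f₀ → x ≫ X.t = z' ≫ τ.s.f₀ → (M ⟶ Y.G₁)
  app_s : ∀ {M : S.Obj} (z : M ⟶ σ.Z.G₀) (z' : M ⟶ τ.Z.G₀) (x : M ⟶ X.G₁)
    (h : x ≫ X.s = z ≫ σ.s.f₀) (h' : x ≫ X.t = z' ≫ τ.s.f₀), app z z' x h h' ≫ Y.s = z ≫ σ.f.f₀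
  app_t : ∀ {M : S.Obj} (z : M ⟶ σ.Z.G₀) (z' : M ⟶ τ.Z.G₀) (x : M ⟶ X.G₁)
    (h : x ≫ X.s = z ≫ σ.s.f₀) (h' : x ≫ X.t = z' ≫ τ.s.f₀), app z z' x h h' ≫ Y.t = z' ≫ τ.f.f₀
  nat : ∀ {M N : S.Obj} (q : N ⟶ M) (z : M ⟶ σ.Z.G₀) (z' : M ⟶ τ.Z.G₀) (x : M ⟶ X.G₁)
    (h : x ≫ X.s = z ≫ σ.s.f₀) (h' : x ≫ X.t = z' ≫ τ.s.f₀), q ≫ app z z' x h h' =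
      app (q ≫ z) (q ≫ z') (q ≫ x) (by simp [h]) (by simp [h'])
  left : ∀ {M : S.Obj} (a : M ⟶ σ.Z.G₁) (z z₁ : M ⟶ σ.Z.G₀) (z' : M ⟶ τ.Z.G₀) (x y : M ⟶ X.G₁)
    (h : x ≫ X.s = z ≫ σ.s.f₀) (h' : x ≫ X.t = z' ≫ τ.s.f₀)
    (k : y ≫ X.s = z₁ ≫ σ.s.f₀) (k' : y ≫ X.t = z' ≫ τ.s.f₀), a ≫ σ.Z.s = z₁ → a ≫ σ.Z.t = z →
    y = X.mul (a ≫ σ.s.f₁) x → app z₁ z' y k k' = Y.mul (a ≫ σ.f.f₁) (app z z' x h h')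
  right : ∀ {M : S.Obj} (b : M ⟶ τ.Z.G₁) (z : M ⟶ σ.Z.G₀) (z' z₁ : M ⟶ τ.Z.G₀) (x y : M ⟶ X.G₁)
    (h : x ≫ X.s = z ≫ σ.s.f₀) (h' : x ≫ X.t = z' ≫ τ.s.f₀)
    (k : y ≫ X.s = z ≫ σ.s.f₀) (k' : y ≫ X.t = z₁ ≫ τ.s.f₀), b ≫ τ.Z.s = z' → b ≫ τ.Z.t = z₁ →
    y = X.mul x (b ≫ τ.s.f₁) → app z z₁ y k k' = Y.mul (app z z' x h h') (b ≫ τ.f.f₁)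

namespace ECell

section basic
variable {σ τ : Span X Y}

open Classical in
/-- The total version of `ECell.app`. -/
noncomputable def ev (η : ECell σ τ) (z : M ⟶ σ.Z.G₀) (z' : M ⟶ τ.Z.G₀) (x : M ⟶ X.G₁) :
    M ⟶ Y.G₁ :=
  if h : x ≫ X.s = z ≫ σ.s.f₀ ∧ x ≫ X.t = z' ≫ τ.s.f₀ then η.app z z' x h.1 h.2
  else z ≫ σ.f.f₀ ≫ Y.ι

variable (η : ECell σ τ) {z : M ⟶ σ.Z.G₀} {z' : M ⟶ τ.Z.G₀} {x : M ⟶ X.G₁}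
  (h : x ≫ X.s = z ≫ σ.s.f₀) (h' : x ≫ X.t = z' ≫ τ.s.f₀)


lemma ev_eq (h : x ≫ X.s = z ≫ σ.s.f₀) (h' : x ≫ X.t = z' ≫ τ.s.f₀) :
    η.ev z z' x = η.app z z' x h h' := dif_pos ⟨h, h'⟩

lemma ev_s (h : x ≫ X.s = z ≫ σ.s.f₀) (h' : x ≫ X.t = z' ≫ τ.s.f₀) :
    η.ev z z' x ≫ Y.s = z ≫ σ.f.f₀ := by rw [η.ev_eq h h', η.app_s]

lemma ev_t (h : x ≫ X.s = z ≫ σ.s.f₀) (h' : x ≫ X.t = z' ≫ τ.s.f₀) :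
    η.ev z z' x ≫ Y.t = z' ≫ τ.f.f₀ := by rw [η.ev_eq h h', η.app_t]

lemma comp_ev (h : x ≫ X.s = z ≫ σ.s.f₀) (h' : x ≫ X.t = z' ≫ τ.s.f₀)
    (q : N ⟶ M) : q ≫ η.ev z z' x = η.ev (q ≫ z) (q ≫ z') (q ≫ x) := by
  rw [η.ev_eq h h', η.nat, η.ev_eq]

lemma ev_left (h : x ≫ X.s = z ≫ σ.s.f₀) (h' : x ≫ X.t = z' ≫ τ.s.f₀)
    (a : M ⟶ σ.Z.G₁) (ha : a ≫ σ.Z.t = z) :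
    η.ev (a ≫ σ.Z.s) z' (X.mul (a ≫ σ.s.f₁) x) = Y.mul (a ≫ σ.f.f₁) (η.ev z z' x) := by
  have e : (a ≫ σ.s.f₁) ≫ X.t = x ≫ X.s := by simp [h, ← ha]
  rw [η.ev_eq h h', η.ev_eq (by rw [mul_s X e]; simp) (by rw [mul_t X e, h'])]
  exact η.left a z _ z' x _ h h' _ _ rfl ha rfl

lemma ev_right (h : x ≫ X.s = z ≫ σ.s.f₀) (h' : x ≫ X.t = z' ≫ τ.s.f₀)
    (b : M ⟶ τ.Z.G₁) (hb : b ≫ τ.Z.s = z') :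
    η.ev z (b ≫ τ.Z.t) (X.mul x (b ≫ τ.s.f₁)) = Y.mul (η.ev z z' x) (b ≫ τ.f.f₁) := by
  have e : x ≫ X.t = (b ≫ τ.s.f₁) ≫ X.s := by simp [h', ← hb]
  rw [η.ev_eq h h', η.ev_eq (by rw [mul_s X e, h]) (by rw [mul_t X e]; simp)]
  exact η.right b z z' _ x _ h h' _ _ hb rfl rfl

lemma ext' {η θ : ECell σ τ} (H : ∀ {M : S.Obj} (z : M ⟶ σ.Z.G₀) (z' : M ⟶ τ.Z.G₀)
    (x : M ⟶ X.G₁), x ≫ X.s = z ≫ σ.s.f₀ → x ≫ X.t = z' ≫ τ.s.f₀ → η.ev z z' x = θ.ev z z' x) :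
    η = θ := by
  have : @η.app = @θ.app := by
    funext M z z' x h h'
    rw [← η.ev_eq h h', ← θ.ev_eq h h', H z z' x h h']
  cases η; cases θ
  congr

end basic

section pt
variable {σ τ : Span X Y}

/-- The value of a 2-morphism at a pair of `M`-valued points over the same point of `X`. -/
noncomputable def pt (θ : Hom₂ σ τ) (z : M ⟶ σ.Z.G₀) (z' : M ⟶ τ.Z.G₀)
    (h : z ≫ σ.s.f₀ = z' ≫ τ.s.f₀) : M ⟶ Y.G₁ := nfpPair z z' h ≫ θ.τ

variable (θ : Hom₂ σ τ) {z : M ⟶ σ.Z.G₀} {z' : M ⟶ τ.Z.G₀} (h : z ≫ σ.s.f₀ = z' ≫ τ.s.f₀)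

lemma pt_s : pt θ z z' h ≫ Y.s = z ≫ σ.f.f₀ := by
  simp [pt, θ.τ_s]

lemma pt_t : pt θ z z' h ≫ Y.t = z' ≫ τ.f.f₀ := by
  simp [pt, θ.τ_t]

lemma comp_pt (q : N ⟶ M) : q ≫ pt θ z z' h = pt θ (q ≫ z) (q ≫ z') (by simp [h]) := by
  simp only [pt, ← Category.assoc]
  congr 1
  apply nfp_ext <;> simp

lemma pt_naturality (a : M ⟶ σ.Z.G₁) (b : M ⟶ τ.Z.G₁) (e : a ≫ σ.s.f₁ = b ≫ τ.s.f₁)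
    {z₁ : M ⟶ σ.Z.G₀} {z₁' : M ⟶ τ.Z.G₀} (h₁ : z₁ ≫ σ.s.f₀ = z₁' ≫ τ.s.f₀)
    (ha : a ≫ σ.Z.s = z) (hb : b ≫ τ.Z.s = z') (ha' : a ≫ σ.Z.t = z₁) (hb' : b ≫ τ.Z.t = z₁') :
    Y.mul (pt θ z z' h) (b ≫ τ.f.f₁) = Y.mul (a ≫ σ.f.f₁) (pt θ z₁ z₁' h₁) := by
  have := congrArg (nfpPair₁ a b e ≫ ·) θ.naturality
  rw [comp_mul, comp_mul] at this
  · have e₁ : nfpPair₁ a b e ≫ (nfp σ.s τ.s).s = nfpPair z z' h := by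
      apply nfp_ext
      · simp [← Hom.f₁_s, ha]
      · simp [← Hom.f₁_s, hb]
    have e₂ : nfpPair₁ a b e ≫ (nfp σ.s τ.s).t = nfpPair z₁ z₁' h₁ := by
      apply nfp_ext
      · simp [← Hom.f₁_t, ha']
      · simp [← Hom.f₁_t, hb']
    simpa [pt, ← e₁, ← e₂] using this
  · simp [θ.τ_s]
  · simp [θ.τ_t]

/-- The 2-morphism of spans given by the restriction of an extended 2-morphism to identities. -/
noncomputable def toHom₂ (η : ECell σ τ) : Hom₂ σ τ where
  τ := η.ev (nfpFst σ.s τ.s).f₀ (nfpSnd σ.s τ.s).f₀ ((nfpFst σ.s τ.s).f₀ ≫ σ.s.f₀ ≫ X.ι)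
  τ_s := by rw [η.ev_s (by simp) (by simp [nfp_condition])]; simp
  τ_t := by rw [η.ev_t (by simp) (by simp [nfp_condition])]; simp
  naturality := by
    rw [η.comp_ev (by simp) (by simp [nfp_condition]), η.comp_ev (by simp) (by simp [nfp_condition])]
    simp only [comp_f₁]
    rw [← η.ev_right (by simp) (by simp [nfp_condition]) _ (Hom.f₁_s _),
      ← η.ev_left (by simp) (by simp [nfp_condition]) _ (Hom.f₁_t _), Hom.f₁_s, Hom.f₁_t,
      ← nfp_condition₁]
    congr 1
    rw [← Category.assoc _ σ.s.f₀ X.ι, ← Category.assoc _ _ X.ι, ← Category.assoc _ _ X.ι,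
      one_mul X (by simp [← Hom.f₁_s_assoc]), X.mul_one (by simp [← Hom.f₁_t_assoc])]

lemma pt_toHom₂ (η : ECell σ τ) : pt η.toHom₂ z z' h = η.ev z z' (z ≫ σ.s.f₀ ≫ X.ι) := by
  rw [pt, toHom₂, η.comp_ev (by simp) (by simp [nfp_condition])]
  simp

lemma toHom₂_ext {θ θ' : Hom₂ σ τ} (H : ∀ {M : S.Obj} (z : M ⟶ σ.Z.G₀) (z' : M ⟶ τ.Z.G₀)
    (h : z ≫ σ.s.f₀ = z' ≫ τ.s.f₀), pt θ z z' h = pt θ' z z' h) : θ = θ' := by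
  have key : ∀ θ : Hom₂ σ τ, pt θ (nfpFst σ.s τ.s).f₀ (nfpSnd σ.s τ.s).f₀ (nfp_condition _ _) =
      θ.τ := by
    intro θ
    have : nfpPair (nfpFst σ.s τ.s).f₀ (nfpSnd σ.s τ.s).f₀ (nfp_condition _ _) = 𝟙 _ := by
      apply nfp_ext <;> simp
    rw [pt, this, Category.id_comp]
  ext
  rw [← key, ← key, H]

/-- The value of the extension of a 2-morphism, computed after a base change along which the
source of `x` lifts to the apex of `τ`. -/
noncomputable def extVal (z : M ⟶ σ.Z.G₀) (z' w : M ⟶ τ.Z.G₀) (x : M ⟶ X.G₁)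
    (h : w ≫ τ.s.f₀ = z ≫ σ.s.f₀) : M ⟶ Y.G₁ :=
  Y.mul (pt θ z w h.symm) (lift τ.s w z' x ≫ τ.f.f₁)

section
variable {w w' : M ⟶ τ.Z.G₀} {x : M ⟶ X.G₁} (hw : w ≫ τ.s.f₀ = z ≫ σ.s.f₀)
  (hx : x ≫ X.s = z ≫ σ.s.f₀) (hx' : x ≫ X.t = z' ≫ τ.s.f₀)

lemma extVal_aux (hx : x ≫ X.s = z ≫ σ.s.f₀) (hx' : x ≫ X.t = z' ≫ τ.s.f₀) :
    pt θ z w hw.symm ≫ Y.t = (lift τ.s w z' x ≫ τ.f.f₁) ≫ Y.s := by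
  rw [pt_t, Category.assoc, Hom.f₁_s, ← Category.assoc, lift_s τ.s (by rw [hx, hw]) hx']

lemma extVal_s (hx : x ≫ X.s = z ≫ σ.s.f₀) (hx' : x ≫ X.t = z' ≫ τ.s.f₀) :
    extVal θ z z' w x hw ≫ Y.s = z ≫ σ.f.f₀ := by
  rw [extVal, mul_s _ (extVal_aux θ hw hx hx'), pt_s]

lemma extVal_t (hx : x ≫ X.s = z ≫ σ.s.f₀) (hx' : x ≫ X.t = z' ≫ τ.s.f₀) :
    extVal θ z z' w x hw ≫ Y.t = z' ≫ τ.f.f₀ := by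
  rw [extVal, mul_t _ (extVal_aux θ hw hx hx'), Category.assoc, Hom.f₁_t, ← Category.assoc,
    lift_t τ.s (by rw [hx, hw]) hx']

lemma comp_extVal (hx : x ≫ X.s = z ≫ σ.s.f₀) (hx' : x ≫ X.t = z' ≫ τ.s.f₀)
    (q : N ⟶ M) : q ≫ extVal θ z z' w x hw =
    extVal θ (q ≫ z) (q ≫ z') (q ≫ w) (q ≫ x) (by simp [hw]) := by
  rw [extVal, comp_mul _ _ (extVal_aux θ hw hx hx'), comp_pt, extVal,
    ← comp_lift τ.s q (by rw [hx, hw]) hx']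
  simp only [Category.assoc]

lemma extVal_left (hx : x ≫ X.s = z ≫ σ.s.f₀) (hx' : x ≫ X.t = z' ≫ τ.s.f₀)
    (a : M ⟶ σ.Z.G₁) {z₁ : M ⟶ σ.Z.G₀} (ha : a ≫ σ.Z.s = z₁) (ha' : a ≫ σ.Z.t = z)
    (hw' : w' ≫ τ.s.f₀ = z₁ ≫ σ.s.f₀) : extVal θ z₁ z' w' (X.mul (a ≫ σ.s.f₁) x) hw' =
      Y.mul (a ≫ σ.f.f₁) (extVal θ z z' w x hw) := by
  have h₁ : (a ≫ σ.s.f₁) ≫ X.s = w' ≫ τ.s.f₀ := by simp [hw', ← ha]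
  have h₂ : (a ≫ σ.s.f₁) ≫ X.t = w ≫ τ.s.f₀ := by simp [hw, ← ha']
  have h₃ : x ≫ X.s = w ≫ τ.s.f₀ := by rw [hx, hw]
  have hl : lift τ.s w' w (a ≫ σ.s.f₁) ≫ τ.Z.t = lift τ.s w z' x ≫ τ.Z.s := by
    rw [lift_t τ.s h₁ h₂, lift_s τ.s h₃ hx']
  have e₂ := pt_naturality θ hw'.symm a (lift τ.s w' w (a ≫ σ.s.f₁)) (lift_f₁ τ.s h₁ h₂).symm
    hw.symm ha (lift_s τ.s h₁ h₂) ha' (lift_t τ.s h₁ h₂)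
  rw [extVal, lift_mul τ.s h₁ h₂ h₃ hx', τ.f.mul_f₁ _ _ hl, ← mul_assoc Y, e₂, mul_assoc Y, extVal]
  · rw [pt_s, ← ha']; simp
  · exact extVal_aux θ hw hx hx'
  · rw [pt_t, Category.assoc, Hom.f₁_s, ← Category.assoc, lift_s τ.s h₁ h₂]
  · simp [reassoc_of% hl]

lemma extVal_right (hx : x ≫ X.s = z ≫ σ.s.f₀) (hx' : x ≫ X.t = z' ≫ τ.s.f₀)
    (b : M ⟶ τ.Z.G₁) {z₁ : M ⟶ τ.Z.G₀} (hb : b ≫ τ.Z.s = z') (hb' : b ≫ τ.Z.t = z₁) :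
    extVal θ z z₁ w (X.mul x (b ≫ τ.s.f₁)) hw =
      Y.mul (extVal θ z z' w x hw) (b ≫ τ.f.f₁) := by
  have h₃ : x ≫ X.s = w ≫ τ.s.f₀ := by rw [hx, hw]
  have hl : lift τ.s w z' x ≫ τ.Z.t = b ≫ τ.Z.s := by rw [lift_t τ.s h₃ hx', hb]
  have : lift τ.s w z₁ (X.mul x (b ≫ τ.s.f₁)) = τ.Z.mul (lift τ.s w z' x) b := by
    rw [lift_mul τ.s h₃ hx' (by simp [← hb]) (by simp [← hb']),
      lift_uniq τ.s b hb hb' rfl]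
  rw [extVal, this, τ.f.mul_f₁ _ _ hl, ← mul_assoc Y (extVal_aux θ hw hx hx'), extVal]
  simp [reassoc_of% hl]

lemma extVal_indep (hx : x ≫ X.s = z ≫ σ.s.f₀) (hx' : x ≫ X.t = z' ≫ τ.s.f₀)
    (hw' : w' ≫ τ.s.f₀ = z ≫ σ.s.f₀) :
    extVal θ z z' w x hw = extVal θ z z' w' x hw' := by
  have := extVal_left θ hw' hx hx' (z ≫ σ.Z.ι) (by simp) (by simp) hw
  simp only [Category.assoc, Hom.ι_f₁] at this
  rw [← Category.assoc, ← Category.assoc, one_mul Y (extVal_s _ _ hx hx')] at this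
  rw [← this]
  simp only [one_mul X hx]

lemma exists_ext (hx : x ≫ X.s = z ≫ σ.s.f₀) (hx' : x ≫ X.t = z' ≫ τ.s.f₀) :
    ∃ g : M ⟶ Y.G₁, ∀ {N : S.Obj} (q : N ⟶ M) (w : N ⟶ τ.Z.G₀)
    (h : w ≫ τ.s.f₀ = (q ≫ z) ≫ σ.s.f₀), q ≫ g = extVal θ (q ≫ z) (q ≫ z') w (q ≫ x) h := by
  obtain ⟨g, hg⟩ := exists_glue τ.s (z ≫ σ.s.f₀)
    (fun q w h => extVal θ (q ≫ z) (q ≫ z') w (q ≫ x) (by simp [h]))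
    (fun p q w h => by
      rw [comp_extVal _ _ (by simp [hx]) (by simp [hx'])]
      simp only [Category.assoc])
    (fun q w w' h h' => extVal_indep θ _ (by simp [hx]) (by simp [hx']) _)
  exact ⟨g, fun q w h => hg q w (by simpa using h)⟩

end

section
variable {x : M ⟶ X.G₁} (hx : x ≫ X.s = z ≫ σ.s.f₀) (hx' : x ≫ X.t = z' ≫ τ.s.f₀)

/-- The value of the extension of a 2-morphism. -/
noncomputable def extApp : M ⟶ Y.G₁ := (exists_ext θ hx hx').choose

lemma comp_extApp (q : N ⟶ M) (w : N ⟶ τ.Z.G₀) (h : w ≫ τ.s.f₀ = (q ≫ z) ≫ σ.s.f₀) :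
    q ≫ extApp θ hx hx' = extVal θ (q ≫ z) (q ≫ z') w (q ≫ x) h :=
  (exists_ext θ hx hx').choose_spec q w h

lemma extApp_s : extApp θ hx hx' ≫ Y.s = z ≫ σ.f.f₀ := by
  apply cover_ext τ.s (z ≫ σ.s.f₀)
  intro N q w hw
  rw [← Category.assoc, comp_extApp θ hx hx' q w (by simp [hw]),
    extVal_s _ _ (by simp [hx]) (by simp [hx'])]
  simp

lemma extApp_t : extApp θ hx hx' ≫ Y.t = z' ≫ τ.f.f₀ := by
  apply cover_ext τ.s (z ≫ σ.s.f₀)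
  intro N q w hw
  rw [← Category.assoc, comp_extApp θ hx hx' q w (by simp [hw]),
    extVal_t _ _ (by simp [hx]) (by simp [hx'])]
  simp

end

/-- The extension of a 2-morphism of spans to an extended 2-morphism. -/
noncomputable def ofHom₂ (θ : Hom₂ σ τ) : ECell σ τ where
  app z z' x h h' := extApp θ h h'
  app_s z z' x h h' := extApp_s θ h h'
  app_t z z' x h h' := extApp_t θ h h'
  nat q z z' x h h' := by
    apply cover_ext τ.s (q ≫ z ≫ σ.s.f₀)
    intro N p w hw
    rw [← Category.assoc, comp_extApp θ h h' (p ≫ q) w (by simp [hw]),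
      comp_extApp _ _ _ p w (by simp [hw])]
    simp only [Category.assoc]
  left a z z₁ z' x y h h' k k' ha ha' hy := by
    subst hy
    have hc : (a ≫ σ.f.f₁) ≫ Y.t = extApp θ h h' ≫ Y.s := by rw [extApp_s, ← ha']; simp
    have hc' : (a ≫ σ.s.f₁) ≫ X.t = x ≫ X.s := by rw [h, ← ha']; simp
    apply cover_ext τ.s (z₁ ≫ σ.s.f₀)
    intro N q w hw
    apply cover_ext τ.s (q ≫ z ≫ σ.s.f₀)
    intro L p v hv
    rw [← Category.assoc, ← Category.assoc p q, comp_mul _ _ hc,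
      comp_extApp θ h h' (p ≫ q) v (by simp [hv]),
      comp_extApp θ k k' (p ≫ q) (p ≫ w) (by simp [hw])]
    simp only [comp_mul _ _ hc']
    simp only [← Category.assoc (p ≫ q) a]
    exact extVal_left θ _ (by simp [h]) (by simp [h']) _ (by simp [ha]) (by simp [ha']) _
  right b z z' z₁ x y h h' k k' hb hb' hy := by
    subst hy
    have hc : extApp θ h h' ≫ Y.t = (b ≫ τ.f.f₁) ≫ Y.s := by rw [extApp_t, ← hb]; simp
    have hc' : x ≫ X.t = (b ≫ τ.s.f₁) ≫ X.s := by rw [h', ← hb]; simp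
    apply cover_ext τ.s (z ≫ σ.s.f₀)
    intro N q w hw
    rw [comp_mul _ _ hc, comp_extApp θ h h' q w (by simp [hw]),
      comp_extApp θ k k' q w (by simp [hw])]
    simp only [comp_mul _ _ hc']
    simp only [← Category.assoc q b]
    exact extVal_right θ _ (by simp [h]) (by simp [h']) _ (by simp [hb]) (by simp [hb'])

lemma ofHom₂_ev {x : M ⟶ X.G₁} (hx : x ≫ X.s = z ≫ σ.s.f₀) (hx' : x ≫ X.t = z' ≫ τ.s.f₀) :
    (ofHom₂ θ).ev z z' x = extApp θ hx hx' := ev_eq _ hx hx'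

/-- 2-morphisms of spans are the same as extended 2-morphisms. -/
noncomputable def equiv (σ τ : Span X Y) : Hom₂ σ τ ≃ ECell σ τ where
  toFun := ofHom₂
  invFun := toHom₂
  left_inv θ := by
    apply toHom₂_ext
    intro M z z' h
    rw [pt_toHom₂, ofHom₂_ev θ (by simp) (by simp [h]), ← Category.id_comp (extApp _ _ _),
      comp_extApp _ _ _ (𝟙 M) z' (by simp [h])]
    simp only [Category.id_comp]
    rw [extVal, ← Category.assoc, lift_one τ.s h.symm]
    simp only [Category.assoc, Hom.ι_f₁]
    rw [← Category.assoc, Y.mul_one (pt_t _ _)]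
  right_inv η := by
    apply ext'
    intro M z z' x h h'
    rw [ofHom₂_ev _ h h']
    apply cover_ext τ.s (z ≫ σ.s.f₀)
    intro N q w hw
    rw [comp_extApp _ _ _ q w (by simp [hw]), extVal, pt_toHom₂, ← ev_right, lift_t, lift_f₁,
      ← Category.assoc _ _ X.ι, one_mul X, comp_ev _ h h']
    all_goals try (simp [h, h', hw])
    rw [lift_s] <;> simp [h, h', hw]

end pt
end ECell
end Span

open GroupoidIn

namespace GroupoidIn

instance [S.IsGeometric] {A B D : GroupoidIn S} (F : A ⟶ B) (G : B ⟶ D) [IsAcyclicFib F]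
    [IsAcyclicFib G] : IsAcyclicFib (F ≫ G) where
  etale := S.etale.comp_mem _ _ IsAcyclicFib.etale IsAcyclicFib.etale
  surj := ((S.etale ⊓ S.surj).comp_mem F.f₀ G.f₀ ⟨IsAcyclicFib.etale, IsAcyclicFib.surj⟩
    ⟨IsAcyclicFib.etale, IsAcyclicFib.surj⟩).2
  cartesian z z' x h h' := by
    have k : x ≫ D.s = (z ≫ F.f₀) ≫ G.f₀ := by simpa using h
    have k' : x ≫ D.t = (z' ≫ F.f₀) ≫ G.f₀ := by simpa using h'
    have l := lift_spec G k k'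
    have m := lift_spec F l.1 l.2.1
    refine ⟨lift F z z' (lift G _ _ x), ⟨m.1, m.2.1, ?_⟩, ?_⟩
    · rw [comp_f₁, ← Category.assoc, m.2.2, l.2.2]
    · rintro w ⟨rfl, rfl, rfl⟩
      apply lift_ext F m.1.symm m.2.1.symm
      rw [m.2.2]
      symm
      apply lift_uniq <;> simp

instance [S.IsGeometric] (X : GroupoidIn S) : IsAcyclicFib (𝟙 X) where
  etale := S.etale.id_mem _
  surj := ((S.etale ⊓ S.surj).id_mem X.G₀).2
  cartesian z z' x h h' := ⟨x, ⟨by simpa using h, by simpa using h', by simp⟩, fun y hy => by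
    simpa using hy.2.2⟩

@[simp] lemma lift_id [S.IsGeometric] {M : S.Obj} (X : GroupoidIn S) (z z' : M ⟶ X.G₀)
    (x : M ⟶ X.G₁) (h : x ≫ X.s = z) (h' : x ≫ X.t = z') : lift (𝟙 X) z z' x = x :=
  lift_uniq _ _ h h' (by simp)

end GroupoidIn

namespace Span

variable [S.IsGeometric] {X Y W V : GroupoidIn S} [IsSGroupoid X]

/-- The identity span. -/
noncomputable def id (X : GroupoidIn S) [IsSGroupoid X] : Span X X where
  Z := X
  s := 𝟙 X
  f := 𝟙 X

/-- The composition of spans, through the naive fiber product `σ.Z ×_Y τ.Z`. -/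
noncomputable def comp [IsSGroupoid Y] (σ : Span X Y) (τ : Span Y W) : Span X W where
  Z := nfp σ.f τ.s
  s := nfpFst σ.f τ.s ≫ σ.s
  f := nfpSnd σ.f τ.s ≫ τ.f

variable {M N : S.Obj}

namespace ECell

section ofMap
variable {σ τ : Span X Y} (φ : σ.Z ⟶ τ.Z) (hs : φ ≫ τ.s = σ.s) (hf : φ ≫ τ.f = σ.f)

lemma map_s₀ (hs : φ ≫ τ.s = σ.s) :
    φ.f₀ ≫ τ.s.f₀ = σ.s.f₀ := by rw [← hs, comp_f₀]

lemma map_s₁ (hs : φ ≫ τ.s = σ.s) :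
    φ.f₁ ≫ τ.s.f₁ = σ.s.f₁ := by rw [← hs, comp_f₁]

lemma map_s₀_assoc (hs : φ ≫ τ.s = σ.s)
    {z : M ⟶ σ.Z.G₀} : (z ≫ φ.f₀) ≫ τ.s.f₀ = z ≫ σ.s.f₀ := by
  rw [Category.assoc, map_s₀ φ hs]

/-- The extended 2-morphism given by a map of apices that is compatible with the legs. -/
noncomputable def ofMap : ECell σ τ where
  app z z' x _ _ := lift τ.s (z ≫ φ.f₀) z' x ≫ τ.f.f₁
  app_s z z' x h h' := by
    have := lift_s τ.s (z := z ≫ φ.f₀) (by rw [h, map_s₀_assoc φ hs]) h'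
    rw [Category.assoc, Hom.f₁_s, ← Category.assoc, this, ← hf, Category.assoc, comp_f₀]
  app_t z z' x h h' := by
    have := lift_t τ.s (z := z ≫ φ.f₀) (by rw [h, map_s₀_assoc φ hs]) h'
    rw [Category.assoc, Hom.f₁_t, ← Category.assoc, this]
  nat q z z' x h h' := by
    rw [← Category.assoc, comp_lift τ.s q (by rw [h, map_s₀_assoc φ hs]) h', Category.assoc]
  left a z z₁ z' x y h h' k k' ha ha' hy := by
    have h₀ : x ≫ X.s = (z ≫ φ.f₀) ≫ τ.s.f₀ := by rw [h, map_s₀_assoc φ hs]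
    have h₁ := lift_uniq τ.s (a ≫ φ.f₁) (z := z₁ ≫ φ.f₀) (z' := z ≫ φ.f₀) (x := a ≫ σ.s.f₁)
      (by simp [← ha]) (by simp [← ha']) (by simp [map_s₁ φ hs])
    rw [hy, lift_mul τ.s (by simp [← ha, map_s₀ φ hs]) (by simp [← ha', map_s₀ φ hs]) h₀ h',
      Hom.mul_f₁, h₁, ← hf, comp_f₁, Category.assoc]
    rw [h₁, lift_s τ.s h₀ h', ← ha']
    simp
  right b z z' z₁ x y h h' k k' hb hb' hy := by
    have h₀ : x ≫ X.s = (z ≫ φ.f₀) ≫ τ.s.f₀ := by rw [h, map_s₀_assoc φ hs]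
    have h₁ := lift_uniq τ.s b hb hb' rfl
    rw [hy, lift_mul τ.s h₀ h' (by simp [← hb]) (by simp [← hb']), Hom.mul_f₁, h₁]
    rw [h₁, lift_t τ.s h₀ h', hb]

/-- The inverse of `ofMap`. -/
noncomputable def ofMapInv : ECell τ σ where
  app z z' x _ _ := lift τ.s z (z' ≫ φ.f₀) x ≫ τ.f.f₁
  app_s z z' x h h' := by
    have := lift_s τ.s (z' := z' ≫ φ.f₀) h (by rw [h', map_s₀_assoc φ hs])
    rw [Category.assoc, Hom.f₁_s, ← Category.assoc, this]
  app_t z z' x h h' := by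
    have := lift_t τ.s (z' := z' ≫ φ.f₀) h (by rw [h', map_s₀_assoc φ hs])
    rw [Category.assoc, Hom.f₁_t, ← Category.assoc, this, ← hf, Category.assoc, comp_f₀]
  nat q z z' x h h' := by
    rw [← Category.assoc, comp_lift τ.s q h (by rw [h', map_s₀_assoc φ hs]), Category.assoc]
  left a z z₁ z' x y h h' k k' ha ha' hy := by
    have h₀ : x ≫ X.t = (z' ≫ φ.f₀) ≫ τ.s.f₀ := by rw [h', map_s₀_assoc φ hs]
    have h₁ := lift_uniq τ.s a ha ha' rfl
    rw [hy, lift_mul τ.s (by simp [← ha]) (by simp [← ha']) h h₀, Hom.mul_f₁, h₁]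
    rw [h₁, lift_s τ.s h h₀, ha']
  right b z z' z₁ x y h h' k k' hb hb' hy := by
    have h₀ : x ≫ X.t = (z' ≫ φ.f₀) ≫ τ.s.f₀ := by rw [h', map_s₀_assoc φ hs]
    have h₁ := lift_uniq τ.s (b ≫ φ.f₁) (z := z' ≫ φ.f₀) (z' := z₁ ≫ φ.f₀) (x := b ≫ σ.s.f₁)
      (by simp [← hb]) (by simp [← hb']) (by simp [map_s₁ φ hs])
    rw [hy, lift_mul τ.s h h₀ (by simp [← hb, map_s₀ φ hs]) (by simp [← hb', map_s₀ φ hs]),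
      Hom.mul_f₁, h₁, ← hf, comp_f₁, Category.assoc]
    rw [h₁, lift_t τ.s h h₀, ← hb]
    simp

variable {z : M ⟶ σ.Z.G₀} {z' : M ⟶ τ.Z.G₀} {x : M ⟶ X.G₁}

lemma ofMap_ev (h : x ≫ X.s = z ≫ σ.s.f₀) (h' : x ≫ X.t = z' ≫ τ.s.f₀) :
    (ofMap φ hs hf).ev z z' x = lift τ.s (z ≫ φ.f₀) z' x ≫ τ.f.f₁ := ev_eq _ h h'

lemma ofMapInv_ev (h : x ≫ X.s = z' ≫ τ.s.f₀) (h' : x ≫ X.t = z ≫ σ.s.f₀) :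
    (ofMapInv φ hs hf).ev z' z x = lift τ.s z' (z ≫ φ.f₀) x ≫ τ.f.f₁ := ev_eq _ h h'

end ofMap

/-- The identity. -/
noncomputable def one (σ : Span X Y) : ECell σ σ := ofMap (𝟙 σ.Z) (by simp) (by simp)

lemma one_ev {σ : Span X Y} {z z' : M ⟶ σ.Z.G₀} {x : M ⟶ X.G₁} (h : x ≫ X.s = z ≫ σ.s.f₀)
    (h' : x ≫ X.t = z' ≫ σ.s.f₀) : (one σ).ev z z' x = lift σ.s z z' x ≫ σ.f.f₁ := by
  rw [one, ofMap_ev _ _ _ h h']; simp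

section comp
variable {ρ σ τ : Span X Y} (η : ECell ρ σ) (θ : ECell σ τ)

/-- The value of the vertical composite, computed after a base change along which the source of
`x` lifts to the apex of `σ`. -/
noncomputable def compVal (z : M ⟶ ρ.Z.G₀) (z' : M ⟶ τ.Z.G₀) (w : M ⟶ σ.Z.G₀) (x : M ⟶ X.G₁) :
    M ⟶ Y.G₁ :=
  Y.mul (η.ev z w (z ≫ ρ.s.f₀ ≫ X.ι)) (θ.ev w z' x)

section
variable {z : M ⟶ ρ.Z.G₀} {z' : M ⟶ τ.Z.G₀} {w w' : M ⟶ σ.Z.G₀} {x : M ⟶ X.G₁}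
  (hw : w ≫ σ.s.f₀ = z ≫ ρ.s.f₀) (hx : x ≫ X.s = z ≫ ρ.s.f₀) (hx' : x ≫ X.t = z' ≫ τ.s.f₀)


lemma compVal_aux (hw : w ≫ σ.s.f₀ = z ≫ ρ.s.f₀) (hx : x ≫ X.s = z ≫ ρ.s.f₀) (hx' : x ≫ X.t = z' ≫ τ.s.f₀) :
    η.ev z w (z ≫ ρ.s.f₀ ≫ X.ι) ≫ Y.t = θ.ev w z' x ≫ Y.s := by
  rw [ev_t _ (by simp) (by simp [hw]), ev_s _ (by simp [hw, hx]) hx']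

lemma compVal_s (hw : w ≫ σ.s.f₀ = z ≫ ρ.s.f₀) (hx : x ≫ X.s = z ≫ ρ.s.f₀) (hx' : x ≫ X.t = z' ≫ τ.s.f₀) :
    compVal η θ z z' w x ≫ Y.s = z ≫ ρ.f.f₀ := by
  rw [compVal, mul_s _ (compVal_aux η θ hw hx hx'), ev_s _ (by simp) (by simp [hw])]

lemma compVal_t (hw : w ≫ σ.s.f₀ = z ≫ ρ.s.f₀) (hx : x ≫ X.s = z ≫ ρ.s.f₀) (hx' : x ≫ X.t = z' ≫ τ.s.f₀) :
    compVal η θ z z' w x ≫ Y.t = z' ≫ τ.f.f₀ := by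
  rw [compVal, mul_t _ (compVal_aux η θ hw hx hx'), ev_t _ (by simp [hw, hx]) hx']

lemma comp_compVal (hw : w ≫ σ.s.f₀ = z ≫ ρ.s.f₀) (hx : x ≫ X.s = z ≫ ρ.s.f₀) (hx' : x ≫ X.t = z' ≫ τ.s.f₀)
    (q : N ⟶ M) :
    q ≫ compVal η θ z z' w x = compVal η θ (q ≫ z) (q ≫ z') (q ≫ w) (q ≫ x) := by
  rw [compVal, comp_mul _ _ (compVal_aux η θ hw hx hx'), comp_ev _ (by simp) (by simp [hw]),
    comp_ev _ (by simp [hx, hw]) hx', compVal]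
  simp

lemma compVal_left (hw : w ≫ σ.s.f₀ = z ≫ ρ.s.f₀) (hx : x ≫ X.s = z ≫ ρ.s.f₀) (hx' : x ≫ X.t = z' ≫ τ.s.f₀)
    (a : M ⟶ ρ.Z.G₁) {z₁ : M ⟶ ρ.Z.G₀} (ha : a ≫ ρ.Z.s = z₁) (ha' : a ≫ ρ.Z.t = z)
    (hw' : w' ≫ σ.s.f₀ = z₁ ≫ ρ.s.f₀) : compVal η θ z₁ z' w' (X.mul (a ≫ ρ.s.f₁) x) =
      Y.mul (a ≫ ρ.f.f₁) (compVal η θ z z' w x) := by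
  have h₁ : (a ≫ ρ.s.f₁) ≫ X.s = w' ≫ σ.s.f₀ := by simp [hw', ← ha]
  have h₂ : (a ≫ ρ.s.f₁) ≫ X.t = w ≫ σ.s.f₀ := by simp [hw, ← ha']
  have h₃ : x ≫ X.s = w ≫ σ.s.f₀ := by rw [hx, hw]
  obtain ⟨l₁, l₂, l₃⟩ := lift_spec σ.s h₁ h₂
  have e₁ := θ.ev_left h₃ hx' _ l₂
  have e₂ := η.ev_right (z := z₁) (z' := w') (x := z₁ ≫ ρ.s.f₀ ≫ X.ι) (by simp) (by simp [hw'])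
    _ l₁
  have e₃ := η.ev_left (z := z) (z' := w) (x := z ≫ ρ.s.f₀ ≫ X.ι) (by simp) (by simp [hw]) a ha'
  rw [l₁, l₃] at e₁
  rw [l₂, l₃, ← Category.assoc, one_mul X (by simp [← ha])] at e₂
  rw [← Category.assoc z, X.mul_one (by simp [← ha']), ha] at e₃
  simp only [Category.assoc] at e₂ e₃
  rw [compVal, e₁, ← mul_assoc Y, ← e₂, e₃, mul_assoc Y, compVal]
  · rw [η.ev_s] <;> simp [← ha', hw]
  · exact compVal_aux η θ hw hx hx'
  · rw [η.ev_t (by simp) (by simp [hw']), Category.assoc, Hom.f₁_s, ← Category.assoc, l₁]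
  · rw [θ.ev_s h₃ hx', Category.assoc, Hom.f₁_t, ← Category.assoc, l₂]

lemma compVal_right (hw : w ≫ σ.s.f₀ = z ≫ ρ.s.f₀) (hx : x ≫ X.s = z ≫ ρ.s.f₀) (hx' : x ≫ X.t = z' ≫ τ.s.f₀)
    (b : M ⟶ τ.Z.G₁) {z₁ : M ⟶ τ.Z.G₀} (hb : b ≫ τ.Z.s = z')
    (hb' : b ≫ τ.Z.t = z₁) :
    compVal η θ z z₁ w (X.mul x (b ≫ τ.s.f₁)) =
      Y.mul (compVal η θ z z' w x) (b ≫ τ.f.f₁) := by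
  have h₃ : x ≫ X.s = w ≫ σ.s.f₀ := by rw [hx, hw]
  rw [compVal, ← hb', θ.ev_right h₃ hx' b hb, ← mul_assoc Y (compVal_aux η θ hw hx hx'), compVal]
  rw [θ.ev_t h₃ hx', ← hb]
  simp

lemma compVal_indep (hw : w ≫ σ.s.f₀ = z ≫ ρ.s.f₀) (hx : x ≫ X.s = z ≫ ρ.s.f₀) (hx' : x ≫ X.t = z' ≫ τ.s.f₀)
    (hw' : w' ≫ σ.s.f₀ = z ≫ ρ.s.f₀) :
    compVal η θ z z' w x = compVal η θ z z' w' x := by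
  have := compVal_left η θ hw' hx hx' (z ≫ ρ.Z.ι) (by simp) (by simp) hw
  simp only [Category.assoc, Hom.ι_f₁] at this
  rw [← Category.assoc, ← Category.assoc, one_mul Y (compVal_s _ _ hw' hx hx'),
    one_mul X hx] at this
  exact this

end

section
variable {z : M ⟶ ρ.Z.G₀} {z' : M ⟶ τ.Z.G₀} {x : M ⟶ X.G₁} (hx : x ≫ X.s = z ≫ ρ.s.f₀)
  (hx' : x ≫ X.t = z' ≫ τ.s.f₀)

lemma exists_comp (hx : x ≫ X.s = z ≫ ρ.s.f₀) (hx' : x ≫ X.t = z' ≫ τ.s.f₀) :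
    ∃ g : M ⟶ Y.G₁, ∀ {N : S.Obj} (q : N ⟶ M) (w : N ⟶ σ.Z.G₀),
    w ≫ σ.s.f₀ = q ≫ z ≫ ρ.s.f₀ → q ≫ g = compVal η θ (q ≫ z) (q ≫ z') w (q ≫ x) := by
  obtain ⟨g, hg⟩ := exists_glue σ.s (z ≫ ρ.s.f₀)
    (fun q w h => compVal η θ (q ≫ z) (q ≫ z') w (q ≫ x))
    (fun p q w h => by
      rw [comp_compVal _ _ (by simp [h]) (by simp [hx]) (by simp [hx'])]
      simp only [Category.assoc])
    (fun q w w' h h' => compVal_indep η θ (by simp [h]) (by simp [hx]) (by simp [hx'])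
      (by simp [h']))
  exact ⟨g, fun q w h => hg q w h⟩

/-- The value of the vertical composite. -/
noncomputable def compApp : M ⟶ Y.G₁ := (exists_comp η θ hx hx').choose

lemma comp_compApp (q : N ⟶ M) (w : N ⟶ σ.Z.G₀) (h : w ≫ σ.s.f₀ = q ≫ z ≫ ρ.s.f₀) :
    q ≫ compApp η θ hx hx' = compVal η θ (q ≫ z) (q ≫ z') w (q ≫ x) :=
  (exists_comp η θ hx hx').choose_spec q w h

lemma compApp_s : compApp η θ hx hx' ≫ Y.s = z ≫ ρ.f.f₀ := by
  apply cover_ext σ.s (z ≫ ρ.s.f₀)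
  intro N q w hw
  rw [← Category.assoc, comp_compApp η θ hx hx' q w hw,
    compVal_s _ _ (by simp [hw]) (by simp [hx]) (by simp [hx'])]
  simp

lemma compApp_t : compApp η θ hx hx' ≫ Y.t = z' ≫ τ.f.f₀ := by
  apply cover_ext σ.s (z ≫ ρ.s.f₀)
  intro N q w hw
  rw [← Category.assoc, comp_compApp η θ hx hx' q w hw,
    compVal_t _ _ (by simp [hw]) (by simp [hx]) (by simp [hx'])]
  simp

end

/-- The vertical composition: locally it is the composition of the values. -/
noncomputable def comp : ECell ρ τ where
  app z z' x h h' := compApp η θ h h'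
  app_s z z' x h h' := compApp_s η θ h h'
  app_t z z' x h h' := compApp_t η θ h h'
  nat q z z' x h h' := by
    apply cover_ext σ.s (q ≫ z ≫ ρ.s.f₀)
    intro N p w hw
    rw [← Category.assoc, comp_compApp η θ h h' (p ≫ q) w (by simp [hw]),
      comp_compApp _ _ _ _ p w (by simp [hw])]
    simp only [Category.assoc]
  left a z z₁ z' x y h h' k k' ha ha' hy := by
    subst hy
    have hc : (a ≫ ρ.f.f₁) ≫ Y.t = compApp η θ h h' ≫ Y.s := by rw [compApp_s, ← ha']; simp
    have hc' : (a ≫ ρ.s.f₁) ≫ X.t = x ≫ X.s := by rw [h, ← ha']; simp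
    apply cover_ext σ.s (z₁ ≫ ρ.s.f₀)
    intro N q w hw
    apply cover_ext σ.s (q ≫ z ≫ ρ.s.f₀)
    intro L p v hv
    rw [← Category.assoc, ← Category.assoc p q, comp_mul _ _ hc,
      comp_compApp η θ h h' (p ≫ q) v (by simp [hv]),
      comp_compApp η θ k k' (p ≫ q) (p ≫ w) (by simp [hw]), comp_mul _ _ hc']
    simp only [← Category.assoc (p ≫ q) a]
    exact compVal_left η θ (by simp [hv]) (by simp [h]) (by simp [h']) _ (by simp [ha])
      (by simp [ha']) (by simp [hw])
  right b z z' z₁ x y h h' k k' hb hb' hy := by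
    subst hy
    have hc : compApp η θ h h' ≫ Y.t = (b ≫ τ.f.f₁) ≫ Y.s := by rw [compApp_t, ← hb]; simp
    have hc' : x ≫ X.t = (b ≫ τ.s.f₁) ≫ X.s := by rw [h', ← hb]; simp
    apply cover_ext σ.s (z ≫ ρ.s.f₀)
    intro N q w hw
    rw [comp_mul _ _ hc, comp_compApp η θ h h' q w (by simp [hw]),
      comp_compApp η θ k k' q w (by simp [hw]), comp_mul _ _ hc']
    simp only [← Category.assoc q b]
    exact compVal_right η θ (by simp [hw]) (by simp [h]) (by simp [h']) _ (by simp [hb])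
      (by simp [hb'])

lemma comp_ev_eq {z : M ⟶ ρ.Z.G₀} {w : M ⟶ σ.Z.G₀} {z' : M ⟶ τ.Z.G₀} {x y : M ⟶ X.G₁}
    (h₁ : x ≫ X.s = z ≫ ρ.s.f₀) (h₂ : x ≫ X.t = w ≫ σ.s.f₀) (h₃ : y ≫ X.s = w ≫ σ.s.f₀)
    (h₄ : y ≫ X.t = z' ≫ τ.s.f₀) :
    (η.comp θ).ev z z' (X.mul x y) = Y.mul (η.ev z w x) (θ.ev w z' y) := by
  have hxy : x ≫ X.t = y ≫ X.s := by rw [h₂, h₃]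
  have k : X.mul x y ≫ X.s = z ≫ ρ.s.f₀ := by rw [mul_s X hxy, h₁]
  have k' : X.mul x y ≫ X.t = z' ≫ τ.s.f₀ := by rw [mul_t X hxy, h₄]
  rw [ev_eq _ k k']
  apply cover_ext σ.s (z ≫ ρ.s.f₀)
  intro N q v hv
  have a₁ : (q ≫ x) ≫ X.s = v ≫ σ.s.f₀ := by simp [h₁, hv]
  have a₂ : (q ≫ x) ≫ X.t = (q ≫ w) ≫ σ.s.f₀ := by simp [h₂]
  obtain ⟨l₁, l₂, l₃⟩ := lift_spec σ.s a₁ a₂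
  have e₁ := θ.ev_left (z := q ≫ w) (z' := q ≫ z') (x := q ≫ y) (by simp [h₃]) (by simp [h₄]) _ l₂
  have e₂ := η.ev_right (z := q ≫ z) (z' := v) (x := q ≫ z ≫ ρ.s.f₀ ≫ X.ι) (by simp) (by simp [hv])
    _ l₁
  rw [l₁, l₃] at e₁
  rw [l₂, l₃, ← Category.assoc, ← Category.assoc, one_mul X (by simp [h₁])] at e₂
  rw [comp_mul _ _ (by rw [η.ev_t h₁ h₂, θ.ev_s h₃ h₄]), η.comp_ev h₁ h₂, θ.comp_ev h₃ h₄, e₂]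
  refine (comp_compApp η θ k k' q v hv).trans ?_
  rw [compVal, comp_mul _ _ hxy, e₁, ← mul_assoc Y]
  · simp
  · rw [η.ev_t (by simp) (by simp [hv]), Category.assoc, Hom.f₁_s, ← Category.assoc, l₁]
  · rw [θ.ev_s (by simp [h₃]) (by simp [h₄]), Category.assoc, Hom.f₁_t, ← Category.assoc, l₂]

/-- The value of a composite at a pair with a common intermediate point over the source. -/
lemma comp_ev_one {z : M ⟶ ρ.Z.G₀} {w : M ⟶ σ.Z.G₀} {z' : M ⟶ τ.Z.G₀} {x : M ⟶ X.G₁}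
    (hw : w ≫ σ.s.f₀ = z ≫ ρ.s.f₀) (h : x ≫ X.s = z ≫ ρ.s.f₀) (h' : x ≫ X.t = z' ≫ τ.s.f₀) :
    (η.comp θ).ev z z' x = Y.mul (η.ev z w (z ≫ ρ.s.f₀ ≫ X.ι)) (θ.ev w z' x) := by
  rw [← η.comp_ev_eq θ (by simp) (by simp [hw]) (by rw [h, hw]) h', ← Category.assoc, one_mul X h]

lemma comp_ev_one' {z : M ⟶ ρ.Z.G₀} {w : M ⟶ σ.Z.G₀} {z' : M ⟶ τ.Z.G₀} {x : M ⟶ X.G₁}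
    (hw : w ≫ σ.s.f₀ = z' ≫ τ.s.f₀) (h : x ≫ X.s = z ≫ ρ.s.f₀) (h' : x ≫ X.t = z' ≫ τ.s.f₀) :
    (η.comp θ).ev z z' x = Y.mul (η.ev z w x) (θ.ev w z' (z' ≫ τ.s.f₀ ≫ X.ι)) := by
  rw [← η.comp_ev_eq θ h (by rw [h', hw]) (by simp [hw]) (by simp), ← Category.assoc,
    X.mul_one h']

end comp

end ECell
end Span

namespace GroupoidIn

variable [S.IsGeometric] {A B D T : GroupoidIn S} (F : A ⟶ B) (G : D ⟶ B) [IsSGroupoid A]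
  [IsSGroupoid B] [IsAcyclicFib G]

lemma nfp_w : nfpFst F G ≫ F = nfpSnd F G ≫ G :=
  hom_ext (nfp_condition F G) (nfp_condition₁ F G)

variable {F G}

/-- The universal property of the naive fiber product. -/
noncomputable def nfpLift (a : T ⟶ A) (d : T ⟶ D) (h : a ≫ F = d ≫ G) : T ⟶ nfp F G :=
  have h₀ : a.f₀ ≫ F.f₀ = d.f₀ ≫ G.f₀ := by rw [← comp_f₀, h, comp_f₀]
  have h₁ : a.f₁ ≫ F.f₁ = d.f₁ ≫ G.f₁ := by rw [← comp_f₁, h, comp_f₁]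
  { f₀ := nfpPair a.f₀ d.f₀ h₀
    f₁ := nfpPair₁ a.f₁ d.f₁ h₁
    f₁_s := by
      apply nfp_ext
      · simp [← Hom.f₁_s]
      · simp [← Hom.f₁_s]
    f₁_t := by
      apply nfp_ext
      · simp [← Hom.f₁_t]
      · simp [← Hom.f₁_t]
    ι_f₁ := by
      apply nfp_ext₁ <;> simp
    mul_f₁ := fun x y hxy => by
      have e : (x ≫ nfpPair₁ a.f₁ d.f₁ h₁) ≫ (nfp F G).t =
          (y ≫ nfpPair₁ a.f₁ d.f₁ h₁) ≫ (nfp F G).s := by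
        apply nfp_ext
        · simp only [Category.assoc, ← Hom.f₁_t, ← Hom.f₁_s, nfpPair₁_fst_assoc]
          simp [reassoc_of% hxy]
        · simp only [Category.assoc, ← Hom.f₁_t, ← Hom.f₁_s, nfpPair₁_snd_assoc]
          simp [reassoc_of% hxy]
      apply nfp_ext₁
      · rw [Hom.mul_f₁ _ _ _ e]
        simp [a.mul_f₁ _ _ hxy]
      · rw [Hom.mul_f₁ _ _ _ e]
        simp [d.mul_f₁ _ _ hxy] }

@[simp] lemma nfpLift_fst (a : T ⟶ A) (d : T ⟶ D) (h : a ≫ F = d ≫ G) :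
    nfpLift a d h ≫ nfpFst F G = a := hom_ext (nfpPair_fst ..) (nfpPair₁_fst ..)

@[simp] lemma nfpLift_snd (a : T ⟶ A) (d : T ⟶ D) (h : a ≫ F = d ≫ G) :
    nfpLift a d h ≫ nfpSnd F G = d := hom_ext (nfpPair_snd ..) (nfpPair₁_snd ..)

@[simp] lemma nfpLift_fst₀ (a : T ⟶ A) (d : T ⟶ D) (h : a ≫ F = d ≫ G) :
    (nfpLift a d h).f₀ ≫ (nfpFst F G).f₀ = a.f₀ := nfpPair_fst ..

@[simp] lemma nfpLift_snd₀ (a : T ⟶ A) (d : T ⟶ D) (h : a ≫ F = d ≫ G) :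
    (nfpLift a d h).f₀ ≫ (nfpSnd F G).f₀ = d.f₀ := nfpPair_snd ..

end GroupoidIn

open GroupoidIn

namespace Span

variable [S.IsGeometric] {X Y W V : GroupoidIn S} [IsSGroupoid X] [IsSGroupoid Y] [IsSGroupoid W]
  [IsSGroupoid V]
variable {M N : S.Obj}

/-- The first projection of the apex of a composite. -/
noncomputable def fst (σ : Span X Y) (τ : Span Y W) : (σ.comp τ).Z ⟶ σ.Z := nfpFst σ.f τ.s

/-- The second projection of the apex of a composite. -/
noncomputable def snd (σ : Span X Y) (τ : Span Y W) : (σ.comp τ).Z ⟶ τ.Z := nfpSnd σ.f τ.s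

section
variable (σ : Span X Y) (τ : Span Y W)

lemma comp_s : (σ.comp τ).s = fst σ τ ≫ σ.s := rfl
lemma comp_f : (σ.comp τ).f = snd σ τ ≫ τ.f := rfl
@[simp] lemma comp_s₀ : (σ.comp τ).s.f₀ = (fst σ τ).f₀ ≫ σ.s.f₀ := rfl
@[simp] lemma comp_f₀ : (σ.comp τ).f.f₀ = (snd σ τ).f₀ ≫ τ.f.f₀ := rfl
@[simp] lemma comp_s₁ : (σ.comp τ).s.f₁ = (fst σ τ).f₁ ≫ σ.s.f₁ := rfl
@[simp] lemma comp_f₁ : (σ.comp τ).f.f₁ = (snd σ τ).f₁ ≫ τ.f.f₁ := rfl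
lemma cond₀ : (fst σ τ).f₀ ≫ σ.f.f₀ = (snd σ τ).f₀ ≫ τ.s.f₀ := nfp_condition _ _
lemma cond : fst σ τ ≫ σ.f = snd σ τ ≫ τ.s := nfp_w _ _
lemma cond₁ : (fst σ τ).f₁ ≫ σ.f.f₁ = (snd σ τ).f₁ ≫ τ.s.f₁ := nfp_condition₁ _ _

end

/-- For `z, z'` points of the apex of `σ` and an arrow `x` of `X` between their images, the arrow
of `Y` between their images. -/
noncomputable def lf (σ : Span X Y) (z z' : M ⟶ σ.Z.G₀) (x : M ⟶ X.G₁) : M ⟶ Y.G₁ :=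
  lift σ.s z z' x ≫ σ.f.f₁

section
variable {σ : Span X Y} {z z' z'' : M ⟶ σ.Z.G₀} {x y : M ⟶ X.G₁} (h : x ≫ X.s = z ≫ σ.s.f₀)
  (h' : x ≫ X.t = z' ≫ σ.s.f₀)


lemma lf_s (h : x ≫ X.s = z ≫ σ.s.f₀) (h' : x ≫ X.t = z' ≫ σ.s.f₀) :
    lf σ z z' x ≫ Y.s = z ≫ σ.f.f₀ := by
  rw [lf, Category.assoc, Hom.f₁_s, ← Category.assoc, lift_s σ.s h h']

lemma lf_t (h : x ≫ X.s = z ≫ σ.s.f₀) (h' : x ≫ X.t = z' ≫ σ.s.f₀) :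
    lf σ z z' x ≫ Y.t = z' ≫ σ.f.f₀ := by
  rw [lf, Category.assoc, Hom.f₁_t, ← Category.assoc, lift_t σ.s h h']

lemma comp_lf (h : x ≫ X.s = z ≫ σ.s.f₀) (h' : x ≫ X.t = z' ≫ σ.s.f₀)
    (q : N ⟶ M) : q ≫ lf σ z z' x = lf σ (q ≫ z) (q ≫ z') (q ≫ x) := by
  rw [lf, ← Category.assoc, comp_lift σ.s q h h', lf]

lemma lf_mul (h : x ≫ X.s = z ≫ σ.s.f₀) (h' : x ≫ X.t = z' ≫ σ.s.f₀)
    (k : y ≫ X.s = z' ≫ σ.s.f₀) (k' : y ≫ X.t = z'' ≫ σ.s.f₀) :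
    lf σ z z'' (X.mul x y) = Y.mul (lf σ z z' x) (lf σ z' z'' y) := by
  rw [lf, lift_mul σ.s h h' k k', σ.f.mul_f₁, lf, lf]
  rw [lift_t σ.s h h', lift_s σ.s k k']


lemma lf_arrow (a : M ⟶ σ.Z.G₁) (ha : a ≫ σ.Z.s = z) (ha' : a ≫ σ.Z.t = z') :
    lf σ z z' (a ≫ σ.s.f₁) = a ≫ σ.f.f₁ := by
  rw [lf, lift_uniq σ.s a ha ha' rfl]

lemma lf_one {x₀ : M ⟶ X.G₀} (hx : z ≫ σ.s.f₀ = x₀) : lf σ z z (x₀ ≫ X.ι) = z ≫ σ.f.f₀ ≫ Y.ι := by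
  rw [lf, lift_one σ.s hx, Category.assoc, Hom.ι_f₁]

lemma lf_id {z z' : M ⟶ (Span.id X).Z.G₀} {x : M ⟶ X.G₁} (h : x ≫ X.s = z ≫ (Span.id X).s.f₀)
    (h' : x ≫ X.t = z' ≫ (Span.id X).s.f₀) : lf (Span.id X) z z' x = x := by
  have := lift_id X z z' x (h.trans (Category.comp_id _)) (h'.trans (Category.comp_id _))
  exact (congrArg (· ≫ 𝟙 X.G₁) this).trans (Category.comp_id _)

lemma lf_comp {τ : Span Y W} {p p' : M ⟶ (σ.comp τ).Z.G₀} (h : x ≫ X.s = p ≫ (fst σ τ).f₀ ≫ σ.s.f₀)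
    (h' : x ≫ X.t = p' ≫ (fst σ τ).f₀ ≫ σ.s.f₀) :
    lf (σ.comp τ) p p' x = lf τ (p ≫ (snd σ τ).f₀) (p' ≫ (snd σ τ).f₀)
      (lf σ (p ≫ (fst σ τ).f₀) (p' ≫ (fst σ τ).f₀) x) := by
  obtain ⟨l₁, l₂, l₃⟩ := lift_spec (σ.comp τ).s (z := p) (z' := p') h h'
  have e₁ : lift σ.s (p ≫ (fst σ τ).f₀) (p' ≫ (fst σ τ).f₀) x =
      lift (σ.comp τ).s p p' x ≫ (fst σ τ).f₁ := by
    apply lift_uniq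
    · rw [Category.assoc, Hom.f₁_s, ← Category.assoc, l₁]
    · rw [Category.assoc, Hom.f₁_t, ← Category.assoc, l₂]
    · rw [Category.assoc, ← comp_s₁, l₃]
  have e₂ : lift τ.s (p ≫ (snd σ τ).f₀) (p' ≫ (snd σ τ).f₀)
      (lift (σ.comp τ).s p p' x ≫ (fst σ τ).f₁ ≫ σ.f.f₁) =
      lift (σ.comp τ).s p p' x ≫ (snd σ τ).f₁ := by
    apply lift_uniq
    · rw [Category.assoc, Hom.f₁_s, ← Category.assoc, l₁]
    · rw [Category.assoc, Hom.f₁_t, ← Category.assoc, l₂]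
    · rw [Category.assoc, ← cond₁]
  rw [lf, lf, lf, e₁, Category.assoc, e₂, comp_f₁, Category.assoc]

end

namespace ECell

section
variable {ρ σ τ υ : Span X V}

lemma one_ev_lf {z z' : M ⟶ σ.Z.G₀} {x : M ⟶ X.G₁} (h : x ≫ X.s = z ≫ σ.s.f₀)
    (h' : x ≫ X.t = z' ≫ σ.s.f₀) : (one σ).ev z z' x = lf σ z z' x := one_ev h h'

/-- A vertical composite can be computed after a base change along which an intermediate point
exists. -/
lemma comp_ext {η : ECell ρ σ} {θ : ECell σ τ} {κ : ECell ρ τ}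
    (H : ∀ {M : S.Obj} (z : M ⟶ ρ.Z.G₀) (z' : M ⟶ τ.Z.G₀) (w : M ⟶ σ.Z.G₀) (x : M ⟶ X.G₁),
      w ≫ σ.s.f₀ = z ≫ ρ.s.f₀ → x ≫ X.s = z ≫ ρ.s.f₀ → x ≫ X.t = z' ≫ τ.s.f₀ →
      V.mul (η.ev z w (z ≫ ρ.s.f₀ ≫ X.ι)) (θ.ev w z' x) = κ.ev z z' x) : η.comp θ = κ := by
  apply ext'
  intro M z z' x h h'
  apply cover_ext σ.s (z ≫ ρ.s.f₀)
  intro N q w hw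
  rw [comp_ev _ h h', comp_ev _ h h', comp_ev_one (w := w), H] <;> simp [h, h', hw]

lemma one_comp (η : ECell σ τ) : (one σ).comp η = η := by
  apply ext'
  intro M z z' x h h'
  rw [comp_ev_one _ _ rfl h h', one_ev_lf (by simp) (by simp), ← Category.assoc, lf_one rfl,
    ← Category.assoc, one_mul V (ev_s _ h h')]

lemma comp_one (η : ECell σ τ) : η.comp (one τ) = η := by
  apply ext'
  intro M z z' x h h'
  rw [comp_ev_one' _ _ rfl h h', one_ev_lf (by simp) (by simp), ← Category.assoc, lf_one rfl,
    ← Category.assoc, V.mul_one (ev_t _ h h')]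

lemma comp_assoc (η : ECell ρ σ) (θ : ECell σ τ) (κ : ECell τ υ) :
    (η.comp θ).comp κ = η.comp (θ.comp κ) := by
  apply comp_ext
  intro M z z' v x hv h h'
  apply cover_ext σ.s (z ≫ ρ.s.f₀)
  intro N q w hw
  have hw' : w ≫ σ.s.f₀ = (q ≫ z) ≫ ρ.s.f₀ := by simp [hw]
  have hv' : (q ≫ v) ≫ τ.s.f₀ = (q ≫ z) ≫ ρ.s.f₀ := by simp [hv]
  have hx : (q ≫ x) ≫ X.s = (q ≫ z) ≫ ρ.s.f₀ := by simp [h]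
  have hx' : (q ≫ x) ≫ X.t = (q ≫ z') ≫ υ.s.f₀ := by simp [h']
  rw [comp_mul, comp_ev _ (by simp) (by simp [hv]), comp_ev _ (by simp [h, hv]) h',
    comp_ev _ h h', comp_ev_one η θ hw' (by simp) (by simp [hv]),
    comp_ev_one η _ hw' hx hx', comp_ev_one θ κ (w := q ≫ v) (by simp [hw, hv]) (by simp [h, hw]) hx',
    mul_assoc]
  · simp [reassoc_of% hw]
  · rw [ev_t _ (by simp) (by simp [hw]), ev_s _ (by simp [hw]) (by simp [hv])]
  · rw [ev_t _ (by simp [hw]) (by simp [hv]), ev_s _ (by simp [h, hv]) hx']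
  · rw [ev_t _ (by simp) (by simp [hv]), ev_s _ (by simp [h, hv]) h']

variable (φ : σ.Z ⟶ τ.Z) (hs : φ ≫ τ.s = σ.s) (hf : φ ≫ τ.f = σ.f)

lemma ofMap_ev' {z : M ⟶ σ.Z.G₀} {z' : M ⟶ τ.Z.G₀} {x : M ⟶ X.G₁} (h : x ≫ X.s = z ≫ σ.s.f₀)
    (h' : x ≫ X.t = z' ≫ τ.s.f₀) : (ofMap φ hs hf).ev z z' x = lf τ (z ≫ φ.f₀) z' x :=
  ofMap_ev φ hs hf h h'

lemma ofMapInv_ev' {z : M ⟶ σ.Z.G₀} {z' : M ⟶ τ.Z.G₀} {x : M ⟶ X.G₁} (h : x ≫ X.s = z' ≫ τ.s.f₀)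
    (h' : x ≫ X.t = z ≫ σ.s.f₀) : (ofMapInv φ hs hf).ev z' z x = lf τ z' (z ≫ φ.f₀) x :=
  ofMapInv_ev φ hs hf h h'

lemma ofMap_comp_ev (θ : ECell τ υ) {z : M ⟶ σ.Z.G₀} {z' : M ⟶ υ.Z.G₀} {x : M ⟶ X.G₁}
    (h : x ≫ X.s = z ≫ σ.s.f₀) (h' : x ≫ X.t = z' ≫ υ.s.f₀) :
    ((ofMap φ hs hf).comp θ).ev z z' x = θ.ev (z ≫ φ.f₀) z' x := by
  have e : (z ≫ φ.f₀) ≫ τ.s.f₀ = z ≫ σ.s.f₀ := map_s₀_assoc φ hs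
  rw [comp_ev_one _ _ e h h', ofMap_ev' _ _ _ (by simp) (by simp [map_s₀ φ hs]), ← Category.assoc,
    lf_one e, ← Category.assoc, one_mul V (ev_s _ (by rw [h, e]) h')]

lemma comp_ofMapInv_ev (θ : ECell υ τ) {z : M ⟶ υ.Z.G₀} {z' : M ⟶ σ.Z.G₀} {x : M ⟶ X.G₁}
    (h : x ≫ X.s = z ≫ υ.s.f₀) (h' : x ≫ X.t = z' ≫ σ.s.f₀) :
    (θ.comp (ofMapInv φ hs hf)).ev z z' x = θ.ev z (z' ≫ φ.f₀) x := by
  have e : (z' ≫ φ.f₀) ≫ τ.s.f₀ = z' ≫ σ.s.f₀ := map_s₀_assoc φ hs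
  rw [comp_ev_one' _ _ e h h', ofMapInv_ev' _ _ _ (by simp [map_s₀ φ hs]) (by simp),
    ← Category.assoc, lf_one e, ← Category.assoc, V.mul_one (ev_t _ h (by rw [h', e]))]

lemma lf_map (hs : φ ≫ τ.s = σ.s) (hf : φ ≫ τ.f = σ.f)
    {z z' : M ⟶ σ.Z.G₀} {x : M ⟶ X.G₁} (h : x ≫ X.s = z ≫ σ.s.f₀)
    (h' : x ≫ X.t = z' ≫ σ.s.f₀) : lf τ (z ≫ φ.f₀) (z' ≫ φ.f₀) x = lf σ z z' x := by
  obtain ⟨l₁, l₂, l₃⟩ := lift_spec σ.s h h'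
  rw [lf, lift_uniq τ.s (lift σ.s z z' x ≫ φ.f₁), Category.assoc, ← GroupoidIn.comp_f₁, hf, lf]
  · rw [Category.assoc, Hom.f₁_s, ← Category.assoc, l₁]
  · rw [Category.assoc, Hom.f₁_t, ← Category.assoc, l₂]
  · rw [Category.assoc, map_s₁ φ hs, l₃]

lemma ofMap_comp_ofMapInv : (ofMap φ hs hf).comp (ofMapInv φ hs hf) = one σ := by
  apply ext'
  intro M z z' x h h'
  rw [ofMap_comp_ev _ _ _ _ h h', ofMapInv_ev' _ _ _ (by simp [map_s₀ φ hs, h]) h',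
    lf_map φ hs hf h h', one_ev_lf h h']

lemma ofMapInv_comp_ofMap : (ofMapInv φ hs hf).comp (ofMap φ hs hf) = one τ := by
  apply comp_ext
  intro M z z' w x hw h h'
  have e : (w ≫ φ.f₀) ≫ τ.s.f₀ = w ≫ σ.s.f₀ := map_s₀_assoc φ hs
  rw [ofMapInv_ev' _ _ _ (by simp) (by simp [hw]), ofMap_ev' _ _ _ (by rw [h, hw]) h',
    ← lf_mul (by simp) (by simp [map_s₀ φ hs, hw]) (by simp [map_s₀ φ hs, hw, h]) h', one_ev_lf h h',
    ← Category.assoc, one_mul X h]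

lemma ofMap_eq_ofMapInv (ψ : τ.Z ⟶ σ.Z) (hs' : ψ ≫ σ.s = τ.s) (hf' : ψ ≫ σ.f = τ.f)
    (e : ψ ≫ φ = 𝟙 _) : ofMap ψ hs' hf' = ofMapInv φ hs hf := by
  apply ext'
  intro M z z' x h h'
  have e₀ : ψ.f₀ ≫ φ.f₀ = 𝟙 _ := by rw [← GroupoidIn.comp_f₀, e, id_f₀]
  rw [ofMap_ev' _ _ _ h h', ofMapInv_ev' _ _ _ h h', ← lf_map φ hs hf _ h', Category.assoc, e₀,
    Category.comp_id]
  rw [h, map_s₀_assoc ψ hs']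

end

/-- Right whiskering. -/
noncomputable def whiskerRight {σ τ : Span X Y} (θ : ECell σ τ) (ρ : Span Y W) :
    ECell (σ.comp ρ) (τ.comp ρ) where
  app p p' x _ _ := lf ρ (p ≫ (snd σ ρ).f₀) (p' ≫ (snd τ ρ).f₀)
    (θ.ev (p ≫ (fst σ ρ).f₀) (p' ≫ (fst τ ρ).f₀) x)
  app_s p p' x h h' := by
    simp only [comp_s₀, ← Category.assoc] at h h'
    rw [lf_s] <;> simp [θ.ev_s h h', θ.ev_t h h', cond₀]
  app_t p p' x h h' := by
    simp only [comp_s₀, ← Category.assoc] at h h'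
    rw [lf_t] <;> simp [θ.ev_s h h', θ.ev_t h h', cond₀]
  nat q p p' x h h' := by
    simp only [comp_s₀, ← Category.assoc] at h h'
    rw [comp_lf, θ.comp_ev h h'] <;> simp [θ.ev_s h h', θ.ev_t h h', cond₀]
  left a p p₁ p' x y h h' k k' ha ha' hy := by
    simp only [comp_s₀, ← Category.assoc] at h h'
    subst hy ha
    have e := θ.ev_left h h' (a ≫ (fst σ ρ).f₁) (by simp [← ha'])
    simp only [Category.assoc, Hom.f₁_s] at e
    simp only [comp_s₁, comp_f₁, Category.assoc]
    rw [e, ← Category.assoc a, cond₁, Category.assoc,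
      lf_mul (z' := p ≫ (snd σ ρ).f₀), ← Category.assoc a (snd σ ρ).f₁ ρ.s.f₁, lf_arrow, Category.assoc]
    all_goals first
      | (simp [← ha']; done)
      | (rw [θ.ev_s h h']; simp [cond₀])
      | (rw [θ.ev_t h h']; simp [cond₀])
  right b p p' p₁ x y h h' k k' hb hb' hy := by
    simp only [comp_s₀, ← Category.assoc] at h h'
    subst hy hb'
    have e := θ.ev_right h h' (b ≫ (fst τ ρ).f₁) (by simp [← hb])
    simp only [Category.assoc, Hom.f₁_t] at e
    simp only [comp_s₁, comp_f₁, Category.assoc]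
    rw [e, ← Category.assoc b, cond₁, Category.assoc,
      lf_mul (z' := p' ≫ (snd τ ρ).f₀), ← Category.assoc b (snd τ ρ).f₁ ρ.s.f₁, lf_arrow, Category.assoc]
    all_goals first
      | (simp [← hb]; done)
      | (rw [θ.ev_s h h']; simp [cond₀])
      | (rw [θ.ev_t h h']; simp [cond₀])

lemma whiskerRight_ev {σ τ : Span X Y} (θ : ECell σ τ) (ρ : Span Y W) {p : M ⟶ (σ.comp ρ).Z.G₀}
    {p' : M ⟶ (τ.comp ρ).Z.G₀} {x : M ⟶ X.G₁} (h : x ≫ X.s = p ≫ (fst σ ρ).f₀ ≫ σ.s.f₀)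
    (h' : x ≫ X.t = p' ≫ (fst τ ρ).f₀ ≫ τ.s.f₀) :
    (θ.whiskerRight ρ).ev p p' x = lf ρ (p ≫ (snd σ ρ).f₀) (p' ≫ (snd τ ρ).f₀)
      (θ.ev (p ≫ (fst σ ρ).f₀) (p' ≫ (fst τ ρ).f₀) x) := ev_eq _ h h'

/-- Left whiskering. -/
noncomputable def whiskerLeft (σ : Span X Y) {ρ τ : Span Y W} (θ : ECell ρ τ) :
    ECell (σ.comp ρ) (σ.comp τ) where
  app p p' x _ _ := θ.ev (p ≫ (snd σ ρ).f₀) (p' ≫ (snd σ τ).f₀)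
    (lf σ (p ≫ (fst σ ρ).f₀) (p' ≫ (fst σ τ).f₀) x)
  app_s p p' x h h' := by
    simp only [comp_s₀, ← Category.assoc] at h h'
    rw [θ.ev_s] <;> simp [lf_s h h', lf_t h h', cond₀]
  app_t p p' x h h' := by
    simp only [comp_s₀, ← Category.assoc] at h h'
    rw [θ.ev_t] <;> simp [lf_s h h', lf_t h h', cond₀]
  nat q p p' x h h' := by
    simp only [comp_s₀, ← Category.assoc] at h h'
    rw [θ.comp_ev, comp_lf h h'] <;> simp [lf_s h h', lf_t h h', cond₀]
  left a p p₁ p' x y h h' k k' ha ha' hy := by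
    simp only [comp_s₀, ← Category.assoc] at h h'
    subst hy ha
    have e := θ.ev_left (z := p ≫ (snd σ ρ).f₀) (z' := p' ≫ (snd σ τ).f₀)
      (x := lf σ (p ≫ (fst σ ρ).f₀) (p' ≫ (fst σ τ).f₀) x) (by simp [lf_s h h', cond₀])
      (by simp [lf_t h h', cond₀]) (a ≫ (snd σ ρ).f₁) (by simp [← ha'])
    simp only [Category.assoc, Hom.f₁_s] at e
    simp only [comp_s₁, comp_f₁, Category.assoc]
    rw [← e, ← cond₁, ← Category.assoc a (fst σ ρ).f₁,
      lf_mul (z' := p ≫ (fst σ ρ).f₀), lf_arrow, Category.assoc]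
    all_goals simp [h, h', ← ha']
  right b p p' p₁ x y h h' k k' hb hb' hy := by
    simp only [comp_s₀, ← Category.assoc] at h h'
    subst hy hb'
    have e := θ.ev_right (z := p ≫ (snd σ ρ).f₀) (z' := p' ≫ (snd σ τ).f₀)
      (x := lf σ (p ≫ (fst σ ρ).f₀) (p' ≫ (fst σ τ).f₀) x) (by simp [lf_s h h', cond₀])
      (by simp [lf_t h h', cond₀]) (b ≫ (snd σ τ).f₁) (by simp [← hb])
    simp only [Category.assoc, Hom.f₁_t] at e
    simp only [comp_s₁, comp_f₁, Category.assoc]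
    rw [← e, ← cond₁, ← Category.assoc b (fst σ τ).f₁,
      lf_mul (z' := p' ≫ (fst σ τ).f₀), lf_arrow, Category.assoc]
    all_goals simp [h, h', ← hb]

lemma whiskerLeft_ev (σ : Span X Y) {ρ τ : Span Y W} (θ : ECell ρ τ) {p : M ⟶ (σ.comp ρ).Z.G₀}
    {p' : M ⟶ (σ.comp τ).Z.G₀} {x : M ⟶ X.G₁} (h : x ≫ X.s = p ≫ (fst σ ρ).f₀ ≫ σ.s.f₀)
    (h' : x ≫ X.t = p' ≫ (fst σ τ).f₀ ≫ σ.s.f₀) :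
    (θ.whiskerLeft σ).ev p p' x = θ.ev (p ≫ (snd σ ρ).f₀) (p' ≫ (snd σ τ).f₀)
      (lf σ (p ≫ (fst σ ρ).f₀) (p' ≫ (fst σ τ).f₀) x) := ev_eq _ h h'

end ECell
end Span

open GroupoidIn

namespace Span

variable [S.IsGeometric] {X Y W V U : GroupoidIn S} [IsSGroupoid X] [IsSGroupoid Y] [IsSGroupoid W]
  [IsSGroupoid V] [IsSGroupoid U] {M N : S.Obj}

section coherence
variable (σ : Span X Y) (τ : Span Y W) (ρ : Span W V)

/-- The associativity isomorphism on apices. -/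
noncomputable def asc : ((σ.comp τ).comp ρ).Z ⟶ (σ.comp (τ.comp ρ)).Z :=
  nfpLift (fst (σ.comp τ) ρ ≫ fst σ τ)
    (nfpLift (fst (σ.comp τ) ρ ≫ snd σ τ) (snd (σ.comp τ) ρ)
      (by rw [Category.assoc]; exact cond (σ.comp τ) ρ))
    (by
      rw [comp_s, Category.assoc, cond]
      exact (Category.assoc _ _ _).symm.trans ((nfpLift_fst _ _ _ =≫ τ.s).symm.trans
        (Category.assoc _ _ _)))

/-- The inverse of the associativity isomorphism on apices. -/
noncomputable def asci : (σ.comp (τ.comp ρ)).Z ⟶ ((σ.comp τ).comp ρ).Z :=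
  nfpLift
    (nfpLift (fst σ (τ.comp ρ)) (snd σ (τ.comp ρ) ≫ fst τ ρ)
      (by rw [Category.assoc]; exact cond σ (τ.comp ρ)))
    (snd σ (τ.comp ρ) ≫ snd τ ρ)
    (((Category.assoc _ _ _).symm.trans (nfpLift_snd _ _ _ =≫ τ.f)).trans
      ((Category.assoc _ _ _).trans ((snd σ (τ.comp ρ) ≫= cond τ ρ).trans
        (Category.assoc _ _ _).symm)))

@[simp] lemma asc_fst : asc σ τ ρ ≫ fst σ (τ.comp ρ) = fst (σ.comp τ) ρ ≫ fst σ τ :=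
  nfpLift_fst _ _ _
@[simp] lemma asc_snd_fst : asc σ τ ρ ≫ snd σ (τ.comp ρ) ≫ fst τ ρ = fst (σ.comp τ) ρ ≫ snd σ τ :=
  (Category.assoc _ _ _).symm.trans ((nfpLift_snd _ _ _ =≫ _).trans (nfpLift_fst _ _ _))
@[simp] lemma asc_snd_snd : asc σ τ ρ ≫ snd σ (τ.comp ρ) ≫ snd τ ρ = snd (σ.comp τ) ρ :=
  (Category.assoc _ _ _).symm.trans ((nfpLift_snd _ _ _ =≫ _).trans (nfpLift_snd _ _ _))
@[simp] lemma asci_snd : asci σ τ ρ ≫ snd (σ.comp τ) ρ = snd σ (τ.comp ρ) ≫ snd τ ρ :=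
  nfpLift_snd _ _ _
@[simp] lemma asci_fst_fst : asci σ τ ρ ≫ fst (σ.comp τ) ρ ≫ fst σ τ = fst σ (τ.comp ρ) :=
  (Category.assoc _ _ _).symm.trans ((nfpLift_fst _ _ _ =≫ _).trans (nfpLift_fst _ _ _))
@[simp] lemma asci_fst_snd : asci σ τ ρ ≫ fst (σ.comp τ) ρ ≫ snd σ τ =
    snd σ (τ.comp ρ) ≫ fst τ ρ :=
  (Category.assoc _ _ _).symm.trans ((nfpLift_fst _ _ _ =≫ _).trans (nfpLift_snd _ _ _))

@[simp] lemma asc_fst_assoc {T : GroupoidIn S} (k : σ.Z ⟶ T) :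
    asc σ τ ρ ≫ fst σ (τ.comp ρ) ≫ k = fst (σ.comp τ) ρ ≫ fst σ τ ≫ k := by
  rw [← Category.assoc, asc_fst, Category.assoc]
@[simp] lemma asc_snd_fst_assoc {T : GroupoidIn S} (k : τ.Z ⟶ T) :
    asc σ τ ρ ≫ snd σ (τ.comp ρ) ≫ fst τ ρ ≫ k = fst (σ.comp τ) ρ ≫ snd σ τ ≫ k := by
  have := asc_snd_fst σ τ ρ =≫ k
  simpa only [Category.assoc] using this

lemma comp_hom_ext {T : GroupoidIn S} {F G : T ⟶ (σ.comp τ).Z} (h : F ≫ fst σ τ = G ≫ fst σ τ)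
    (h' : F ≫ snd σ τ = G ≫ snd σ τ) : F = G := by
  apply GroupoidIn.hom_ext
  · exact nfp_ext (congrArg Hom.f₀ h) (congrArg Hom.f₀ h')
  · exact nfp_ext₁ (congrArg Hom.f₁ h) (congrArg Hom.f₁ h')

lemma asc_asci : asc σ τ ρ ≫ asci σ τ ρ = 𝟙 _ := by
  apply comp_hom_ext
  · apply comp_hom_ext <;> simp
  · simp

lemma asci_asc : asci σ τ ρ ≫ asc σ τ ρ = 𝟙 _ := by
  apply comp_hom_ext
  · simp
  · apply comp_hom_ext <;> simp

lemma asc_s : asc σ τ ρ ≫ (σ.comp (τ.comp ρ)).s = ((σ.comp τ).comp ρ).s := by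
  rw [comp_s, ← Category.assoc, asc_fst, Category.assoc]; rfl

lemma asc_f : asc σ τ ρ ≫ (σ.comp (τ.comp ρ)).f = ((σ.comp τ).comp ρ).f := by
  rw [comp_f, comp_f τ, ← Category.assoc, ← Category.assoc, Category.assoc _ _ (snd τ ρ),
    asc_snd_snd]; rfl

lemma asci_s : asci σ τ ρ ≫ ((σ.comp τ).comp ρ).s = (σ.comp (τ.comp ρ)).s := by
  rw [← asc_s, ← Category.assoc, asci_asc, Category.id_comp]

lemma asci_f : asci σ τ ρ ≫ ((σ.comp τ).comp ρ).f = (σ.comp (τ.comp ρ)).f := by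
  rw [← asc_f, ← Category.assoc, asci_asc, Category.id_comp]

@[simp] lemma asc_fst₀ : (asc σ τ ρ).f₀ ≫ (fst σ (τ.comp ρ)).f₀ =
    (fst (σ.comp τ) ρ).f₀ ≫ (fst σ τ).f₀ := congrArg Hom.f₀ (asc_fst σ τ ρ)
@[simp] lemma asc_snd_fst₀ : (asc σ τ ρ).f₀ ≫ (snd σ (τ.comp ρ)).f₀ ≫ (fst τ ρ).f₀ =
    (fst (σ.comp τ) ρ).f₀ ≫ (snd σ τ).f₀ := congrArg Hom.f₀ (asc_snd_fst σ τ ρ)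
@[simp] lemma asc_snd_snd₀ : (asc σ τ ρ).f₀ ≫ (snd σ (τ.comp ρ)).f₀ ≫ (snd τ ρ).f₀ =
    (snd (σ.comp τ) ρ).f₀ := congrArg Hom.f₀ (asc_snd_snd σ τ ρ)
@[simp] lemma asci_snd₀ : (asci σ τ ρ).f₀ ≫ (snd (σ.comp τ) ρ).f₀ =
    (snd σ (τ.comp ρ)).f₀ ≫ (snd τ ρ).f₀ := congrArg Hom.f₀ (asci_snd σ τ ρ)
@[simp] lemma asci_fst_fst₀ : (asci σ τ ρ).f₀ ≫ (fst (σ.comp τ) ρ).f₀ ≫ (fst σ τ).f₀ =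
    (fst σ (τ.comp ρ)).f₀ := congrArg Hom.f₀ (asci_fst_fst σ τ ρ)
@[simp] lemma asci_fst_snd₀ : (asci σ τ ρ).f₀ ≫ (fst (σ.comp τ) ρ).f₀ ≫ (snd σ τ).f₀ =
    (snd σ (τ.comp ρ)).f₀ ≫ (fst τ ρ).f₀ := congrArg Hom.f₀ (asci_fst_snd σ τ ρ)
@[simp] lemma asc_fst₀_assoc {A : S.Obj} (k : σ.Z.G₀ ⟶ A) :
    (asc σ τ ρ).f₀ ≫ (fst σ (τ.comp ρ)).f₀ ≫ k = (fst (σ.comp τ) ρ).f₀ ≫ (fst σ τ).f₀ ≫ k := by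
  rw [← Category.assoc, asc_fst₀, Category.assoc]
@[simp] lemma asci_fst_fst₀_assoc {A : S.Obj} (k : σ.Z.G₀ ⟶ A) :
    (asci σ τ ρ).f₀ ≫ (fst (σ.comp τ) ρ).f₀ ≫ (fst σ τ).f₀ ≫ k = (fst σ (τ.comp ρ)).f₀ ≫ k := by
  simp only [← asci_fst_fst₀, Category.assoc]

@[simp] lemma asc_snd_fst₀_assoc {A : S.Obj} (k : τ.Z.G₀ ⟶ A) :
    (asc σ τ ρ).f₀ ≫ (snd σ (τ.comp ρ)).f₀ ≫ (fst τ ρ).f₀ ≫ k =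
      (fst (σ.comp τ) ρ).f₀ ≫ (snd σ τ).f₀ ≫ k := by
  have := (asc_snd_fst₀ σ τ ρ) =≫ k
  simpa only [Category.assoc] using this

lemma snd_s : snd (Span.id X) σ ≫ σ.s = ((Span.id X).comp σ).s := (cond (Span.id X) σ).symm
lemma snd_f : snd (Span.id X) σ ≫ σ.f = ((Span.id X).comp σ).f := rfl
lemma fst_s : fst σ (Span.id Y) ≫ σ.s = (σ.comp (Span.id Y)).s := rfl
lemma fst_f : fst σ (Span.id Y) ≫ σ.f = (σ.comp (Span.id Y)).f := cond σ (Span.id Y)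

end coherence

end Span

open GroupoidIn

namespace Span

variable [S.IsGeometric] {X Y W V U : GroupoidIn S} [IsSGroupoid X] [IsSGroupoid Y] [IsSGroupoid W]
  [IsSGroupoid V] [IsSGroupoid U] {M N : S.Obj}

namespace ECell

/-! ### The laws of the bicategory of spans, for extended 2-morphisms -/

lemma conj_ev {σ σ' τ τ' : Span X Y} (φ : σ.Z ⟶ σ'.Z) (hs : φ ≫ σ'.s = σ.s) (hf : φ ≫ σ'.f = σ.f)
    (ψ : τ.Z ⟶ τ'.Z) (ks : ψ ≫ τ'.s = τ.s) (kf : ψ ≫ τ'.f = τ.f) (θ : ECell σ' τ')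
    {z : M ⟶ σ.Z.G₀} {z' : M ⟶ τ.Z.G₀} {x : M ⟶ X.G₁} (h : x ≫ X.s = z ≫ σ.s.f₀)
    (h' : x ≫ X.t = z' ≫ τ.s.f₀) :
    ((ofMap φ hs hf).comp (θ.comp (ofMapInv ψ ks kf))).ev z z' x =
      θ.ev (z ≫ φ.f₀) (z' ≫ ψ.f₀) x := by
  rw [ofMap_comp_ev _ _ _ _ h h', comp_ofMapInv_ev _ _ _ _ (by rw [h, map_s₀_assoc φ hs]) h']

lemma whiskerLeft_one (σ : Span X Y) (ρ : Span Y W) :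
    whiskerLeft σ (one ρ) = one (σ.comp ρ) := by
  apply ext'
  intro M p p' x h h'
  have h₁ : x ≫ X.s = (p ≫ (fst σ ρ).f₀) ≫ σ.s.f₀ := by simpa using h
  have h₁' : x ≫ X.t = (p' ≫ (fst σ ρ).f₀) ≫ σ.s.f₀ := by simpa using h'
  rw [whiskerLeft_ev _ _ h h', one_ev_lf h h', lf_comp h h', one_ev_lf]
  · rw [lf_s h₁ h₁']; simp [cond₀]
  · rw [lf_t h₁ h₁']; simp [cond₀]

lemma one_whiskerRight (σ : Span X Y) (ρ : Span Y W) :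
    whiskerRight (one σ) ρ = one (σ.comp ρ) := by
  apply ext'
  intro M p p' x h h'
  rw [whiskerRight_ev _ _ h h', one_ev_lf h h', lf_comp h h', one_ev_lf]
  · simpa using h
  · simpa using h'

lemma whiskerLeft_comp (σ : Span X Y) {ρ τ υ : Span Y W} (η : ECell ρ τ) (θ : ECell τ υ) :
    whiskerLeft σ (η.comp θ) = (whiskerLeft σ η).comp (whiskerLeft σ θ) := by
  symm
  apply comp_ext
  intro M p p' q x hq h h'
  have h₁ : x ≫ X.s = (p ≫ (fst σ ρ).f₀) ≫ σ.s.f₀ := by simpa using h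
  have h₁' : x ≫ X.t = (p' ≫ (fst σ υ).f₀) ≫ σ.s.f₀ := by simpa using h'
  have k : (q ≫ (fst σ τ).f₀) ≫ σ.s.f₀ = (p ≫ (fst σ ρ).f₀) ≫ σ.s.f₀ := by simpa using hq
  have a : ((p ≫ (fst σ ρ).f₀) ≫ σ.s.f₀ ≫ X.ι) ≫ X.s = (p ≫ (fst σ ρ).f₀) ≫ σ.s.f₀ := by simp
  have a' : ((p ≫ (fst σ ρ).f₀) ≫ σ.s.f₀ ≫ X.ι) ≫ X.t = (q ≫ (fst σ τ).f₀) ≫ σ.s.f₀ := by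
    simp [k]
  have b : x ≫ X.s = (q ≫ (fst σ τ).f₀) ≫ σ.s.f₀ := by rw [h₁, k]
  have e : p ≫ (σ.comp ρ).s.f₀ ≫ X.ι = (p ≫ (fst σ ρ).f₀) ≫ σ.s.f₀ ≫ X.ι := by simp
  rw [e, whiskerLeft_ev _ _ (by simp) (by simpa using a'), whiskerLeft_ev _ _ (by simpa using b) h',
    whiskerLeft_ev _ _ h h', ← comp_ev_eq, ← lf_mul a a' b h₁', ← Category.assoc, one_mul X h₁]
  · rw [lf_s a a']; simp [cond₀]
  · rw [lf_t a a']; simp [cond₀]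
  · rw [lf_s b h₁']; simp [cond₀]
  · rw [lf_t b h₁']; simp [cond₀]

lemma comp_whiskerRight {ρ σ τ : Span X Y} (η : ECell ρ σ) (θ : ECell σ τ) (υ : Span Y W) :
    whiskerRight (η.comp θ) υ = (whiskerRight η υ).comp (whiskerRight θ υ) := by
  symm
  apply comp_ext
  intro M p p' q x hq h h'
  have h₁ : x ≫ X.s = (p ≫ (fst ρ υ).f₀) ≫ ρ.s.f₀ := by simpa using h
  have h₁' : x ≫ X.t = (p' ≫ (fst τ υ).f₀) ≫ τ.s.f₀ := by simpa using h'
  have k : (q ≫ (fst σ υ).f₀) ≫ σ.s.f₀ = (p ≫ (fst ρ υ).f₀) ≫ ρ.s.f₀ := by simpa using hq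
  have a : ((p ≫ (fst ρ υ).f₀) ≫ ρ.s.f₀ ≫ X.ι) ≫ X.s = (p ≫ (fst ρ υ).f₀) ≫ ρ.s.f₀ := by simp
  have a' : ((p ≫ (fst ρ υ).f₀) ≫ ρ.s.f₀ ≫ X.ι) ≫ X.t = (q ≫ (fst σ υ).f₀) ≫ σ.s.f₀ := by
    simp [k]
  have b : x ≫ X.s = (q ≫ (fst σ υ).f₀) ≫ σ.s.f₀ := by rw [h₁, k]
  have e : p ≫ (ρ.comp υ).s.f₀ ≫ X.ι = (p ≫ (fst ρ υ).f₀) ≫ ρ.s.f₀ ≫ X.ι := by simp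
  rw [e, whiskerRight_ev _ _ (by simp) (by simpa using a'),
    whiskerRight_ev _ _ (by simpa using b) h', whiskerRight_ev _ _ h h', ← lf_mul,
    ← comp_ev_eq _ _ a a' b h₁', ← Category.assoc, one_mul X h₁]
  · rw [ev_s _ a a']; simp [cond₀]
  · rw [ev_t _ a a']; simp [cond₀]
  · rw [ev_s _ b h₁']; simp [cond₀]
  · rw [ev_t _ b h₁']; simp [cond₀]

lemma id_whiskerLeft {σ τ : Span X Y} (η : ECell σ τ) :
    whiskerLeft (Span.id X) η = (ofMap _ (snd_s σ) (snd_f σ)).comp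
      (η.comp (ofMapInv _ (snd_s τ) (snd_f τ))) := by
  apply ext'
  intro M p p' x h h'
  rw [whiskerLeft_ev _ _ h h', conj_ev _ _ _ _ _ _ _ h h', lf_id]
  · simpa using h
  · simpa using h'

lemma whiskerRight_id {σ τ : Span X Y} (η : ECell σ τ) :
    whiskerRight η (Span.id Y) = (ofMap _ (fst_s σ) (fst_f σ)).comp
      (η.comp (ofMapInv _ (fst_s τ) (fst_f τ))) := by
  apply ext'
  intro M p p' x h h'
  rw [whiskerRight_ev _ _ h h', conj_ev _ _ _ _ _ _ _ h h', lf_id]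
  · rw [ev_s _ (by simpa using h) (by simpa using h'), Category.assoc, cond₀, Category.assoc]
  · rw [ev_t _ (by simpa using h) (by simpa using h'), Category.assoc, cond₀, Category.assoc]

lemma comp_whiskerLeft (σ : Span X Y) (τ : Span Y W) {ρ υ : Span W V} (η : ECell ρ υ) :
    whiskerLeft (σ.comp τ) η = (ofMap _ (asc_s σ τ ρ) (asc_f σ τ ρ)).comp
      ((whiskerLeft σ (whiskerLeft τ η)).comp (ofMapInv _ (asc_s σ τ υ) (asc_f σ τ υ))) := by
  apply ext'
  intro M p p' x h h'
  have h₁ : x ≫ X.s = (p ≫ (fst (σ.comp τ) ρ).f₀ ≫ (fst σ τ).f₀) ≫ σ.s.f₀ := by simpa using h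
  have h₁' : x ≫ X.t = (p' ≫ (fst (σ.comp τ) υ).f₀ ≫ (fst σ τ).f₀) ≫ σ.s.f₀ := by simpa using h'
  rw [whiskerLeft_ev _ _ h h', conj_ev _ _ _ _ _ _ _ h h', whiskerLeft_ev, whiskerLeft_ev,
    lf_comp]
  · simp
  · simpa using h
  · simpa using h'
  · rw [lf_s]
    · simp [cond₀]
    · simpa using h
    · simpa using h'
  · rw [lf_t]
    · simp [cond₀]
    · simpa using h
    · simpa using h'
  · simpa using h
  · simpa using h'

lemma whiskerRight_comp {σ σ' : Span X Y} (η : ECell σ σ') (τ : Span Y W) (ρ : Span W V) :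
    whiskerRight η (τ.comp ρ) = (ofMapInv _ (asc_s σ τ ρ) (asc_f σ τ ρ)).comp
      ((whiskerRight (whiskerRight η τ) ρ).comp (ofMap _ (asc_s σ' τ ρ) (asc_f σ' τ ρ))) := by
  rw [← ofMap_eq_ofMapInv _ _ _ _ (asci_s σ τ ρ) (asci_f σ τ ρ) (asci_asc σ τ ρ),
    ofMap_eq_ofMapInv _ (asci_s σ' τ ρ) (asci_f σ' τ ρ) _ _ _ (asc_asci σ' τ ρ)]
  apply ext'
  intro M p p' x h h'
  rw [whiskerRight_ev _ _ h h', conj_ev _ _ _ _ _ _ _ h h', whiskerRight_ev, whiskerRight_ev,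
    lf_comp]
  · simp
  · rw [ev_s]
    · simp [cond₀]
    · simpa using h
    · simpa using h'
  · rw [ev_t]
    · simp [cond₀]
    · simpa using h
    · simpa using h'
  · simpa using h
  · simpa using h'
  · simpa using h
  · simpa using h'

lemma whisker_assoc (σ : Span X Y) {τ τ' : Span Y W} (η : ECell τ τ') (ρ : Span W V) :
    whiskerRight (whiskerLeft σ η) ρ = (ofMap _ (asc_s σ τ ρ) (asc_f σ τ ρ)).comp
      ((whiskerLeft σ (whiskerRight η ρ)).comp (ofMapInv _ (asc_s σ τ' ρ) (asc_f σ τ' ρ))) := by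
  apply ext'
  intro M p p' x h h'
  rw [whiskerRight_ev _ _ h h', conj_ev _ _ _ _ _ _ _ h h', whiskerLeft_ev, whiskerLeft_ev,
    whiskerRight_ev]
  · simp
  · rw [lf_s]
    · simp [cond₀]
    · simpa using h
    · simpa using h'
  · rw [lf_t]
    · simp [cond₀]
    · simpa using h
    · simpa using h'
  · simpa using h
  · simpa using h'
  · simpa using h
  · simpa using h'

lemma ofMap_congr {σ τ : Span X Y} {φ ψ : σ.Z ⟶ τ.Z} (e : φ = ψ) (hs : φ ≫ τ.s = σ.s)
    (hf : φ ≫ τ.f = σ.f) (ks : ψ ≫ τ.s = σ.s) (kf : ψ ≫ τ.f = σ.f) :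
    ofMap φ hs hf = ofMap ψ ks kf := by
  subst e; rfl

lemma ofMap_comp_ofMap {ρ σ τ : Span X Y} (φ : ρ.Z ⟶ σ.Z) (hs : φ ≫ σ.s = ρ.s)
    (hf : φ ≫ σ.f = ρ.f) (ψ : σ.Z ⟶ τ.Z) (ks : ψ ≫ τ.s = σ.s) (kf : ψ ≫ τ.f = σ.f) :
    (ofMap φ hs hf).comp (ofMap ψ ks kf) = ofMap (φ ≫ ψ) (by rw [Category.assoc, ks, hs])
      (by rw [Category.assoc, kf, hf]) := by
  apply ext'
  intro M z z' x h h'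
  rw [ofMap_comp_ev _ _ _ _ h h', ofMap_ev' _ _ _ (by rw [h, map_s₀_assoc φ hs]) h',
    ofMap_ev' _ _ _ h h', GroupoidIn.comp_f₀, Category.assoc]

section map
variable {σ σ' : Span X Y} (φ : σ.Z ⟶ σ'.Z) (hs : φ ≫ σ'.s = σ.s) (hf : φ ≫ σ'.f = σ.f)
  (τ : Span Y W) (ρ : Span W X)

/-- The map of apices `σ.Z ×_Y τ.Z ⟶ σ'.Z ×_Y τ.Z`. -/
noncomputable def mapR : (σ.comp τ).Z ⟶ (σ'.comp τ).Z :=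
  nfpLift (fst σ τ ≫ φ) (snd σ τ) (by rw [Category.assoc, hf, cond])

/-- The map of apices `ρ.Z ×_X σ.Z ⟶ ρ.Z ×_X σ'.Z`. -/
noncomputable def mapL : (ρ.comp σ).Z ⟶ (ρ.comp σ').Z :=
  nfpLift (fst ρ σ) (snd ρ σ ≫ φ) (by rw [Category.assoc, hs, cond])

@[simp] lemma mapR_fst : mapR φ hf τ ≫ fst σ' τ = fst σ τ ≫ φ := nfpLift_fst _ _ _
@[simp] lemma mapR_snd : mapR φ hf τ ≫ snd σ' τ = snd σ τ := nfpLift_snd _ _ _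
@[simp] lemma mapL_fst : mapL φ hs ρ ≫ fst ρ σ' = fst ρ σ := nfpLift_fst _ _ _
@[simp] lemma mapL_snd : mapL φ hs ρ ≫ snd ρ σ' = snd ρ σ ≫ φ := nfpLift_snd _ _ _

@[simp] lemma mapR_fst_assoc {T : GroupoidIn S} (k : σ'.Z ⟶ T) :
    mapR φ hf τ ≫ fst σ' τ ≫ k = fst σ τ ≫ φ ≫ k := by
  rw [← Category.assoc, mapR_fst, Category.assoc]
@[simp] lemma mapL_snd_assoc {T : GroupoidIn S} (k : σ'.Z ⟶ T) :
    mapL φ hs ρ ≫ snd ρ σ' ≫ k = snd ρ σ ≫ φ ≫ k := by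
  rw [← Category.assoc, mapL_snd, Category.assoc]

lemma mapR_s (hs : φ ≫ σ'.s = σ.s) : mapR φ hf τ ≫ (σ'.comp τ).s = (σ.comp τ).s := by
  rw [comp_s, ← Category.assoc, mapR_fst, Category.assoc, hs, ← comp_s]

lemma mapR_f : mapR φ hf τ ≫ (σ'.comp τ).f = (σ.comp τ).f := by
  rw [comp_f, ← Category.assoc, mapR_snd, ← comp_f]

lemma mapL_s : mapL φ hs ρ ≫ (ρ.comp σ').s = (ρ.comp σ).s := by
  rw [comp_s, ← Category.assoc, mapL_fst, ← comp_s]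

lemma mapL_f (hf : φ ≫ σ'.f = σ.f) : mapL φ hs ρ ≫ (ρ.comp σ').f = (ρ.comp σ).f := by
  rw [comp_f, ← Category.assoc, mapL_snd, Category.assoc, hf, ← comp_f]

lemma whiskerRight_ofMap : whiskerRight (ofMap φ hs hf) τ =
    ofMap (mapR φ hf τ) (mapR_s φ hf τ hs) (mapR_f φ hf τ) := by
  apply ext'
  intro M p p' x h h'
  have e := congrArg Hom.f₀ (mapR_fst φ hf τ)
  have e' := congrArg Hom.f₀ (mapR_snd φ hf τ)
  rw [GroupoidIn.comp_f₀, GroupoidIn.comp_f₀] at e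
  rw [GroupoidIn.comp_f₀] at e'
  have k : x ≫ X.s = p ≫ (mapR φ hf τ).f₀ ≫ (fst σ' τ).f₀ ≫ σ'.s.f₀ := by
    rw [h, comp_s₀, reassoc_of% e, map_s₀ φ hs]
  rw [whiskerRight_ev _ _ h h', ofMap_ev' _ _ _ h h', ofMap_ev', lf_comp, Category.assoc p,
    Category.assoc p, Category.assoc p, e, e']
  · simpa using k
  · exact h'
  · simpa using h
  · simpa using h'

lemma whiskerLeft_ofMap : whiskerLeft ρ (ofMap φ hs hf) =
    ofMap (mapL φ hs ρ) (mapL_s φ hs ρ) (mapL_f φ hs ρ hf) := by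
  apply ext'
  intro M p p' x h h'
  have e := congrArg Hom.f₀ (mapL_fst φ hs ρ)
  have e' := congrArg Hom.f₀ (mapL_snd φ hs ρ)
  rw [GroupoidIn.comp_f₀] at e
  rw [GroupoidIn.comp_f₀, GroupoidIn.comp_f₀] at e'
  have k : x ≫ W.s = p ≫ (mapL φ hs ρ).f₀ ≫ (fst ρ σ').f₀ ≫ ρ.s.f₀ := by
    rw [h, comp_s₀, reassoc_of% e]
  rw [whiskerLeft_ev _ _ h h', ofMap_ev' _ _ _ h h', ofMap_ev', lf_comp, Category.assoc p,
    Category.assoc p, Category.assoc p, e, e']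
  · simpa using k
  · exact h'
  · rw [lf_s]
    · simp [cond₀]
    · simpa using h
    · simpa using h'
  · rw [lf_t]
    · simp [cond₀]
    · simpa using h
    · simpa using h'

end map

lemma pentagon (f : Span X Y) (g : Span Y W) (h : Span W V) (i : Span V U) :
    (whiskerRight (ofMap _ (asc_s f g h) (asc_f f g h)) i).comp
      ((ofMap _ (asc_s f (g.comp h) i) (asc_f f (g.comp h) i)).comp
        (whiskerLeft f (ofMap _ (asc_s g h i) (asc_f g h i)))) =
    (ofMap _ (asc_s (f.comp g) h i) (asc_f (f.comp g) h i)).comp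
      (ofMap _ (asc_s f g (h.comp i)) (asc_f f g (h.comp i))) := by
  rw [whiskerRight_ofMap, whiskerLeft_ofMap, ofMap_comp_ofMap, ofMap_comp_ofMap, ofMap_comp_ofMap]
  apply ofMap_congr
  apply comp_hom_ext
  · simp
  · apply comp_hom_ext
    · simp
    · apply comp_hom_ext
      · simp
      · simp

lemma triangle (f : Span X Y) (g : Span Y W) :
    (ofMap _ (asc_s f (Span.id Y) g) (asc_f f (Span.id Y) g)).comp
      (whiskerLeft f (ofMap _ (snd_s g) (snd_f g))) =
    whiskerRight (ofMap _ (fst_s f) (fst_f f)) g := by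
  rw [whiskerRight_ofMap, whiskerLeft_ofMap, ofMap_comp_ofMap]
  apply ofMap_congr
  apply comp_hom_ext <;> simp

lemma lf_mul_ev {σ τ : Span X Y} (η : ECell σ τ) {z w : M ⟶ σ.Z.G₀} {z' : M ⟶ τ.Z.G₀}
    {x y : M ⟶ X.G₁} (h₁ : x ≫ X.s = z ≫ σ.s.f₀) (h₂ : x ≫ X.t = w ≫ σ.s.f₀)
    (h₃ : y ≫ X.s = w ≫ σ.s.f₀) (h₄ : y ≫ X.t = z' ≫ τ.s.f₀) :
    Y.mul (lf σ z w x) (η.ev w z' y) = η.ev z z' (X.mul x y) := by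
  rw [← one_ev_lf h₁ h₂, ← comp_ev_eq _ _ h₁ h₂ h₃ h₄, one_comp]

lemma ev_mul_lf {σ τ : Span X Y} (η : ECell σ τ) {z : M ⟶ σ.Z.G₀} {w z' : M ⟶ τ.Z.G₀}
    {x y : M ⟶ X.G₁} (h₁ : x ≫ X.s = z ≫ σ.s.f₀) (h₂ : x ≫ X.t = w ≫ τ.s.f₀)
    (h₃ : y ≫ X.s = w ≫ τ.s.f₀) (h₄ : y ≫ X.t = z' ≫ τ.s.f₀) :
    Y.mul (η.ev z w x) (lf τ w z' y) = η.ev z z' (X.mul x y) := by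
  rw [← one_ev_lf h₃ h₄, ← comp_ev_eq _ _ h₁ h₂ h₃ h₄, comp_one]

lemma whisker_exchange {f g : Span X Y} {h i : Span Y W} (θ : ECell f g) (η : ECell h i) :
    (whiskerLeft f η).comp (whiskerRight θ i) = (whiskerRight θ h).comp (whiskerLeft g η) := by
  apply comp_ext
  intro M p p' w x hw hx hx'
  have hp : x ≫ X.s = (p ≫ (fst f h).f₀) ≫ f.s.f₀ := by simpa using hx
  have hp' : x ≫ X.t = (p' ≫ (fst g i).f₀) ≫ g.s.f₀ := by simpa using hx'
  trans η.ev (p ≫ (snd f h).f₀) (p' ≫ (snd g i).f₀) (θ.ev (p ≫ (fst f h).f₀) (p' ≫ (fst g i).f₀) x)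
  · have k : (w ≫ (fst f i).f₀) ≫ f.s.f₀ = (p ≫ (fst f h).f₀) ≫ f.s.f₀ := by simpa using hw
    have a : ((p ≫ (fst f h).f₀) ≫ f.s.f₀ ≫ X.ι) ≫ X.s = (p ≫ (fst f h).f₀) ≫ f.s.f₀ := by simp
    have a' : ((p ≫ (fst f h).f₀) ≫ f.s.f₀ ≫ X.ι) ≫ X.t = (w ≫ (fst f i).f₀) ≫ f.s.f₀ := by
      simp [k]
    have b : x ≫ X.s = (w ≫ (fst f i).f₀) ≫ f.s.f₀ := by rw [hp, k]
    have e : p ≫ (f.comp h).s.f₀ ≫ X.ι = (p ≫ (fst f h).f₀) ≫ f.s.f₀ ≫ X.ι := by simp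
    rw [e, whiskerLeft_ev _ _ (by simp) (by simpa using a'),
      whiskerRight_ev _ _ (by simpa using b) hx', ev_mul_lf, lf_mul_ev _ a a' b hp',
      ← Category.assoc, one_mul X hp]
    · rw [lf_s a a']; simp [cond₀]
    · rw [lf_t a a']; simp [cond₀]
    · rw [ev_s _ b hp']; simp [cond₀]
    · rw [ev_t _ b hp']; simp [cond₀]
  · apply cover_ext (g.comp h).s (p ≫ (f.comp h).s.f₀)
    intro N q v hv
    have h₁ : (q ≫ x) ≫ X.s = (q ≫ p ≫ (fst f h).f₀) ≫ f.s.f₀ := by simp [hp]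
    have h₁' : (q ≫ x) ≫ X.t = (q ≫ p' ≫ (fst g i).f₀) ≫ g.s.f₀ := by simp [hp']
    have k : (v ≫ (fst g h).f₀) ≫ g.s.f₀ = (q ≫ p ≫ (fst f h).f₀) ≫ f.s.f₀ := by simpa using hv
    have a : ((q ≫ p ≫ (fst f h).f₀) ≫ f.s.f₀ ≫ X.ι) ≫ X.s = (q ≫ p ≫ (fst f h).f₀) ≫ f.s.f₀ := by
      simp
    have a' : ((q ≫ p ≫ (fst f h).f₀) ≫ f.s.f₀ ≫ X.ι) ≫ X.t = (v ≫ (fst g h).f₀) ≫ g.s.f₀ := by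
      simp [k]
    have b : (q ≫ x) ≫ X.s = (v ≫ (fst g h).f₀) ≫ g.s.f₀ := by rw [h₁, k]
    have e : (q ≫ p) ≫ (f.comp h).s.f₀ ≫ X.ι = (q ≫ p ≫ (fst f h).f₀) ≫ f.s.f₀ ≫ X.ι := by simp
    rw [comp_ev _ hx hx', comp_ev_one (w := v), e, whiskerRight_ev, whiskerLeft_ev, comp_ev,
      comp_ev _ hp hp']
    rotate_left
    · rw [ev_s _ hp hp']; simp [cond₀]
    · rw [ev_t _ hp hp']; simp [cond₀]
    · simpa using b
    · simpa using h₁'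
    · simp
    · simpa using a'
    · simpa using hv
    · simpa using h₁
    · simpa using h₁'
    simp only [Category.assoc] at a a' b h₁ h₁' ⊢
    have k₁ : (q ≫ p ≫ (fst f h).f₀ ≫ f.s.f₀ ≫ X.ι) ≫ X.s = (q ≫ p ≫ (fst f h).f₀) ≫ f.s.f₀ := by
      simp
    have k₂ : (q ≫ p ≫ (fst f h).f₀ ≫ f.s.f₀ ≫ X.ι) ≫ X.t = (v ≫ (fst g h).f₀) ≫ g.s.f₀ := by
      simpa using a'
    have k₃ : (q ≫ x) ≫ X.s = (v ≫ (fst g h).f₀) ≫ g.s.f₀ := by simpa using b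
    have k₄ : (q ≫ x) ≫ X.t = (q ≫ p' ≫ (fst g i).f₀) ≫ g.s.f₀ := by simpa using h₁'
    rw [lf_mul_ev, ev_mul_lf _ k₁ k₂ k₃ k₄]
    · have : X.mul ((q ≫ p ≫ (fst f h).f₀ ≫ f.s.f₀) ≫ X.ι) (q ≫ x) = q ≫ x :=
        one_mul X (by simpa using h₁)
      simp only [Category.assoc] at this
      rw [this]
    · rw [ev_s _ k₁ k₂]; simp [cond₀]
    · rw [ev_t _ k₁ k₂]; simp [cond₀]
    · rw [lf_s k₃ k₄]; simp [cond₀]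
    · rw [lf_t k₃ k₄]; simp [cond₀]

end ECell

end Span

open GroupoidIn

namespace Span

variable [S.IsGeometric] {X Y W : GroupoidIn S} [IsSGroupoid X] [IsSGroupoid Y] [IsSGroupoid W]
  {σ τ ρ : Span X Y}

open ECell

/-! ### The bicategory of separated étale groupoids and spans

All operations on 2-morphisms are transported along the bijection `ECell.equiv` between 2-morphisms
of spans (defined on the naive fiber product) and extended 2-morphisms. -/

@[simp] lemma ofHom₂_toHom₂ (η : ECell σ τ) : (equiv σ τ) ((equiv σ τ).symm η) = η :=
  (equiv σ τ).apply_symm_apply η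

/-- The vertical composition of 2-morphisms of spans. At points `z` of `ρ.Z`, `w` of `σ.Z` and `z'`
of `τ.Z` over the same point of `X`, it is the composition in `Y`; see `pt_comp₂`. -/
noncomputable def comp₂ (η : Hom₂ ρ σ) (θ : Hom₂ σ τ) : Hom₂ ρ τ :=
  (equiv ρ τ).symm ((equiv ρ σ η).comp (equiv σ τ θ))

lemma pt_comp₂ (η : Hom₂ ρ σ) (θ : Hom₂ σ τ) {M : S.Obj} (z : M ⟶ ρ.Z.G₀) (w : M ⟶ σ.Z.G₀)
    (z' : M ⟶ τ.Z.G₀) (h : z ≫ ρ.s.f₀ = w ≫ σ.s.f₀) (h' : w ≫ σ.s.f₀ = z' ≫ τ.s.f₀) :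
    pt (comp₂ η θ) z z' (h.trans h') = Y.mul (pt η z w h) (pt θ w z' h') := by
  have key : ∀ {σ τ : Span X Y} (θ : Hom₂ σ τ) (z : M ⟶ σ.Z.G₀) (z' : M ⟶ τ.Z.G₀)
      (h : z ≫ σ.s.f₀ = z' ≫ τ.s.f₀),
      pt θ z z' h = (equiv σ τ θ).ev z z' (z ≫ σ.s.f₀ ≫ X.ι) := fun {σ τ} θ z z' h => by
    rw [← pt_toHom₂ h]
    exact congrArg (pt · z z' h) ((equiv σ τ).symm_apply_apply θ).symm
  rw [key, key, key, comp₂, Equiv.apply_symm_apply, comp_ev_one _ _ h.symm (by simp)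
    (by simp [h, h'])]
  simp [reassoc_of% h]

noncomputable instance : Category (Span X Y) where
  Hom σ τ := Hom₂ σ τ
  id σ := (equiv σ σ).symm (one σ)
  comp η θ := comp₂ η θ
  id_comp η := by simp [comp₂, one_comp]
  comp_id η := by simp [comp₂, comp_one]
  assoc η θ κ := by simp [comp₂, comp_assoc]

/-- The isomorphism of spans given by a map of apices that is compatible with the legs. -/
noncomputable def isoOfMap (φ : σ.Z ⟶ τ.Z) (hs : φ ≫ τ.s = σ.s) (hf : φ ≫ τ.f = σ.f) : σ ≅ τ where
  hom := (equiv σ τ).symm (ofMap φ hs hf)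
  inv := (equiv τ σ).symm (ofMapInv φ hs hf)
  hom_inv_id := by
    change (equiv σ σ).symm _ = (equiv σ σ).symm _
    simp [ofMap_comp_ofMapInv]
  inv_hom_id := by
    change (equiv τ τ).symm _ = (equiv τ τ).symm _
    simp [ofMapInv_comp_ofMap]

end Span

namespace SGroupoid

open Orbi.Span Orbi.Span.ECell

variable [S.IsGeometric]

/-- The bicategory of separated étale groupoids, spans through acyclic fibrations, and 2-morphisms
between these. -/
noncomputable instance : Bicategory (SGroupoid S) where
  Hom X Y := Span X.gpd Y.gpd
  id X := Span.id X.gpd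
  comp σ τ := Span.comp σ τ
  homCategory _ _ := inferInstance
  whiskerLeft σ _ _ η := (equiv _ _).symm (ECell.whiskerLeft σ (equiv _ _ η))
  whiskerRight η ρ := (equiv _ _).symm (ECell.whiskerRight (equiv _ _ η) ρ)
  associator σ τ ρ := isoOfMap _ (asc_s σ τ ρ) (asc_f σ τ ρ)
  leftUnitor σ := isoOfMap _ (snd_s σ) (snd_f σ)
  rightUnitor σ := isoOfMap _ (fst_s σ) (fst_f σ)
  whiskerLeft_id := by
    intros
    refine (congrArg (equiv _ _).symm ?_)
    simp [CategoryStruct.id, whiskerLeft_one]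
  whiskerLeft_comp := by
    intros
    refine (congrArg (equiv _ _).symm ?_)
    simp [CategoryStruct.comp, comp₂, ECell.whiskerLeft_comp]
  id_whiskerLeft := by
    intros
    refine (congrArg (equiv _ _).symm ?_)
    simp [CategoryStruct.comp, comp₂, isoOfMap, ECell.id_whiskerLeft]
  comp_whiskerLeft := by
    intros
    refine (congrArg (equiv _ _).symm ?_)
    simp [CategoryStruct.comp, comp₂, isoOfMap, ECell.comp_whiskerLeft]
  id_whiskerRight := by
    intros
    refine (congrArg (equiv _ _).symm ?_)
    simp [CategoryStruct.id, one_whiskerRight]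
  comp_whiskerRight := by
    intros
    refine (congrArg (equiv _ _).symm ?_)
    simp [CategoryStruct.comp, comp₂, ECell.comp_whiskerRight]
  whiskerRight_id := by
    intros
    refine (congrArg (equiv _ _).symm ?_)
    simp [CategoryStruct.comp, comp₂, isoOfMap, ECell.whiskerRight_id]
  whiskerRight_comp := by
    intros
    refine (congrArg (equiv _ _).symm ?_)
    simp [CategoryStruct.comp, comp₂, isoOfMap, ECell.whiskerRight_comp]
  whisker_assoc := by
    intros
    refine (congrArg (equiv _ _).symm ?_)
    simp [CategoryStruct.comp, comp₂, isoOfMap, ECell.whisker_assoc]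
  whisker_exchange := by
    intros
    refine (congrArg (equiv _ _).symm ?_)
    simp [ECell.whisker_exchange]
  pentagon := by
    intros
    refine (congrArg (equiv _ _).symm ?_)
    simp [CategoryStruct.comp, comp₂, isoOfMap, ECell.pentagon]
  triangle := by
    intros
    refine (congrArg (equiv _ _).symm ?_)
    simp [isoOfMap, ECell.triangle]

end SGroupoid

open GroupoidIn

section Stacks

/-- A category over `C` is fibered in groupoids (a "groupoid over `C`") if every morphism of `C`
has a lift with given target and every arrow is strongly cartesian. -/
structure IsFiberedInGroupoids {C : Type u} [Category.{v} C] (𝒳 : BasedCategory.{v, max u v} C) :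
    Prop where
  exists_lift : ∀ {M : C} (a : 𝒳.obj) (f : M ⟶ 𝒳.p.obj a), ∃ (b : 𝒳.obj) (φ : b ⟶ a),
    𝒳.p.IsHomLift f φ
  isStronglyCartesian : ∀ {a b : 𝒳.obj} (φ : a ⟶ b), 𝒳.p.IsStronglyCartesian (𝒳.p.map φ) φ

/-- The category over `C` represented by an object. -/
def overBased {C : Type u} [Category.{v} C] (U : C) : BasedCategory.{v, max u v} C :=
  BasedCategory.ofFunctor (Over.forget U)

/-- A sieve, as a category over `C`. -/
def sieveBased {C : Type u} [Category.{v} C] {U : C} (R : Sieve U) :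
    BasedCategory.{v, max u v} C :=
  BasedCategory.ofFunctor (ObjectProperty.ι (fun f : Over U => R f.hom) ⋙ Over.forget U)

/-- The inclusion of a sieve into the represented category. -/
def sieveIncl {C : Type u} [Category.{v} C] {U : C} (R : Sieve U) : sieveBased R ⟶ overBased U :=
  { ObjectProperty.ι (fun f : Over U => R f.hom) with w := rfl }

/-- A stack over `S`: a category fibered in groupoids such that, for every covering sieve `R` of an
object `U`, the restriction functor from `Hom(U, 𝒳)`, which is the fiber of `𝒳` over `U`, to
`Hom(R, 𝒳)`, which is the category of objects with descent data relative to `R`, is an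
equivalence. (It is fully faithful iff the presheaves of morphisms satisfy the sheaf condition for
`R`, and essentially surjective iff moreover all descent data are effective.) -/
structure IsStack (𝒳 : BasedCategory.{v, max u v} S.Obj) : Prop where
  isFiberedInGroupoids : IsFiberedInGroupoids 𝒳
  descent : ∀ {U : S.Obj} (R : Sieve U), R ∈ S.topology U →
    (Bicategory.precomp 𝒳 (sieveIncl R)).IsEquivalence

/-- A morphism from a category over `S` to a stack exhibits it as the associated stack if it is
universal (in the 2-categorical sense) among the morphisms to stacks. -/
structure IsAssociatedStack {𝒜 𝒳 : BasedCategory.{v, max u v} S.Obj} (j : 𝒜 ⟶ 𝒳) : Prop where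
  isStack : IsStack 𝒳
  universal : ∀ 𝒴 : BasedCategory.{v, max u v} S.Obj, IsStack 𝒴 →
    (Bicategory.precomp 𝒴 j).IsEquivalence

end Stacks

namespace GroupoidIn

/-- An `M`-valued point of `X`, for varying `M`. -/
structure Pt (X : GroupoidIn S) where
  M : S.Obj
  x : M ⟶ X.G₀

/-- A morphism `(M, x) ⟶ (M', x')` is a morphism `a : M ⟶ M'` with an arrow from `x` to the
restriction of `x'` along `a` in the groupoid `Hom(M, X)`. -/
@[ext]
structure Pt.Hom {X : GroupoidIn S} (P Q : Pt X) where
  a : P.M ⟶ Q.M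
  g : P.M ⟶ X.G₁
  g_s : g ≫ X.s = P.x
  g_t : g ≫ X.t = a ≫ Q.x

noncomputable instance (X : GroupoidIn S) : Category (Pt X) where
  Hom := Pt.Hom
  id P := ⟨𝟙 _, P.x ≫ X.ι, by simp, by simp⟩
  comp {P Q R} φ ψ :=
    have h : φ.g ≫ X.t = (φ.a ≫ ψ.g) ≫ X.s := by rw [φ.g_t, Category.assoc, ψ.g_s]
    ⟨φ.a ≫ ψ.a, X.mul φ.g (φ.a ≫ ψ.g), by rw [mul_s X h, φ.g_s],
      by rw [mul_t X h, Category.assoc, ψ.g_t, Category.assoc]⟩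
  id_comp φ := by
    apply Pt.Hom.ext
    · simp
    · simp [one_mul X φ.g_s]
  comp_id φ := by
    apply Pt.Hom.ext
    · simp
    · simp only [← Category.assoc]
      exact X.mul_one φ.g_t
  assoc φ ψ χ := by
    have h : φ.g ≫ X.t = (φ.a ≫ ψ.g) ≫ X.s := by rw [φ.g_t, Category.assoc, ψ.g_s]
    have h' : ψ.g ≫ X.t = (ψ.a ≫ χ.g) ≫ X.s := by rw [ψ.g_t, Category.assoc, χ.g_s]
    apply Pt.Hom.ext
    · simp
    · simp only [comp_mul X _ h', Category.assoc]
      rw [mul_assoc X h]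
      simp only [Category.assoc, ψ.g_t, χ.g_s]

/-- The category over `S` (fibered in groupoids) that is defined by `M ↦ Hom(M, X)`. -/
noncomputable def toBased (X : GroupoidIn S) : BasedCategory.{v, max u v} S.Obj where
  obj := Pt X
  p := { obj := Pt.M, map := fun φ => Pt.Hom.a φ }

/-- The functor over `S` that is defined by a morphism of groupoids. -/
noncomputable def toBasedMap {X Y : GroupoidIn S} (F : X ⟶ Y) : toBased X ⟶ toBased Y where
  obj P := ⟨P.M, P.x ≫ F.f₀⟩
  map φ := ⟨φ.a, φ.g ≫ F.f₁, by simp [reassoc_of% φ.g_s], by simp [reassoc_of% φ.g_t]⟩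
  map_id P := Pt.Hom.ext rfl (by
    change (P.x ≫ X.ι) ≫ F.f₁ = (P.x ≫ F.f₀) ≫ Y.ι
    simp)
  map_comp φ ψ := Pt.Hom.ext rfl (by
    have h : φ.g ≫ X.t = (φ.a ≫ ψ.g) ≫ X.s := by rw [φ.g_t, Category.assoc, ψ.g_s]
    exact (F.mul_f₁ _ _ h).trans (by rw [Category.assoc]; rfl))
  w := rfl

end GroupoidIn

/-- An orbifold: a stack that is equivalent to the associated stack of a separated étale
groupoid. -/
structure IsOrbifold (𝒳 : BasedCategory.{v, max u v} S.Obj) : Prop where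
  isStack : IsStack 𝒳
  exists_groupoid : ∃ (X : SGroupoid S) (𝒴 : BasedCategory.{v, max u v} S.Obj)
    (j : toBased X.gpd ⟶ 𝒴), IsAssociatedStack j ∧ Nonempty (Bicategory.Equivalence 𝒳 𝒴)

/-- Orbifolds in `S`. -/
structure Orbifold (S : SpaceCat.{v, u}) where
  stack : BasedCategory.{v, max u v} S.Obj
  isOrbifold : IsOrbifold stack

/-- The 2-category of orbifolds: a full sub-2-category of the 2-category of categories over `S`. -/
abbrev OrbiCat (S : SpaceCat.{v, u}) :=
  Bicategory.InducedBicategory (BasedCategory.{v, max u v} S.Obj) (Orbifold.stack (S := S))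

/-- A pseudofunctor between bicategories is an equivalence of bicategories if it induces
equivalences of the categories of 1-morphisms and if every object of the target is equivalent
to an object in its image. -/
structure IsBiequivalence {B : Type*} [Bicategory B] {C : Type*} [Bicategory C]
    (F : Pseudofunctor B C) : Prop where
  isEquivalence : ∀ a b : B, (F.mapFunctor a b).IsEquivalence
  essSurj : ∀ c : C, ∃ b : B, Nonempty (Bicategory.Equivalence (F.obj b) c)


section Spaces

open TopologicalSpace AlgebraicGeometry Manifold Opposite
open scoped ContDiff

/-- A category of spaces with underlying topological spaces. Here properness of `(s, t)` and
surjectivity refer to the underlying topological spaces, and the topology is given by the open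
covers, i.e. by the jointly surjective families of injective étale morphisms. -/
def SpaceCat.ofTop (C : Type u) [Category.{v} C] (U : C ⥤ TopCat.{0})
    (et : MorphismProperty C) : SpaceCat.{v, u} where
  Obj := C
  etale := et
  surj := fun _ _ f => Function.Surjective (U.map f)
  ProperPair := fun {A _} s t => IsProperMap (fun x : U.obj A => (U.map s x, U.map t x))
  topology := Precoverage.toGrothendieck
    { coverings := fun X => {R | (∀ ⦃Y : C⦄ (f : Y ⟶ X), R f →
          et f ∧ Function.Injective (U.map f)) ∧
        ∀ x : U.obj X, ∃ (Y : C) (f : Y ⟶ X), R f ∧ x ∈ Set.range (U.map f)} }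

/-- Hausdorff topological spaces; étale means local homeomorphism. -/
def topSpaces : SpaceCat.{0, 1} :=
  SpaceCat.ofTop (ObjectProperty.FullSubcategory fun X : TopCat.{0} => T2Space X)
    (ObjectProperty.ι _) (fun _ _ f => IsLocalHomeomorph f.hom)

/-- A morphism of locally ringed spaces is a local isomorphism if its domain is covered by open
subspaces on which it is an open immersion. -/
def IsLocalIsoLRS {X Y : LocallyRingedSpace.{0}} (f : X ⟶ Y) : Prop :=
  ∀ x : X.toTopCat, ∃ U : Opens X.toTopCat, x ∈ U ∧
    LocallyRingedSpace.IsOpenImmersion (X.ofRestrict U.isOpenEmbedding ≫ f)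

/-- Separated (i.e. Hausdorff) locally ringed spaces; étale means local isomorphism. -/
def lrsSpaces : SpaceCat.{0, 1} :=
  SpaceCat.ofTop
    (ObjectProperty.FullSubcategory fun X : LocallyRingedSpace.{0} => T2Space X.toTopCat)
    (ObjectProperty.ι _ ⋙ LocallyRingedSpace.forgetToTop) (fun _ _ f => IsLocalIsoLRS f.hom)

/-- Manifolds of class `C^n` over `𝕜`: Hausdorff, second countable, without boundary, and of some
finite dimension. -/
structure Mfd (𝕜 : Type) [RCLike 𝕜] (n : WithTop ℕ∞) where
  carrier : Type
  dim : ℕ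
  [topologicalSpace : TopologicalSpace carrier]
  [chartedSpace : ChartedSpace (EuclideanSpace 𝕜 (Fin dim)) carrier]
  [isManifold : IsManifold 𝓘(𝕜, EuclideanSpace 𝕜 (Fin dim)) n carrier]
  [t2Space : T2Space carrier]
  [secondCountable : SecondCountableTopology carrier]

namespace Mfd

attribute [instance] topologicalSpace chartedSpace isManifold t2Space secondCountable

variable {𝕜 : Type} [RCLike 𝕜] {n : WithTop ℕ∞}

/-- Maps of class `C^n`. -/
@[ext]
structure Hom (X Y : Mfd 𝕜 n) where
  toFun : X.carrier → Y.carrier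
  contMDiff : ContMDiff 𝓘(𝕜, EuclideanSpace 𝕜 (Fin X.dim)) 𝓘(𝕜, EuclideanSpace 𝕜 (Fin Y.dim)) n
    toFun

instance : Category (Mfd 𝕜 n) where
  Hom := Hom
  id X := ⟨fun x => x, contMDiff_id⟩
  comp f g := ⟨fun x => g.toFun (f.toFun x), g.contMDiff.comp f.contMDiff⟩

/-- The underlying topological space. -/
def forgetToTop : Mfd 𝕜 n ⥤ TopCat.{0} where
  obj X := TopCat.of X.carrier
  map f := TopCat.ofHom ⟨f.toFun, f.contMDiff.continuous⟩

/-- Local diffeomorphisms. -/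
def localDiffeo : MorphismProperty (Mfd 𝕜 n) := fun X Y f =>
  IsLocalDiffeomorph 𝓘(𝕜, EuclideanSpace 𝕜 (Fin X.dim)) 𝓘(𝕜, EuclideanSpace 𝕜 (Fin Y.dim)) n
    f.toFun

end Mfd

/-- `C^∞` manifolds; étale means local diffeomorphism. -/
noncomputable def smoothManifolds : SpaceCat.{0, 1} := SpaceCat.ofTop (Mfd ℝ ∞) Mfd.forgetToTop Mfd.localDiffeo

/-- Complex manifolds; étale means local biholomorphism. -/
noncomputable def complexManifolds : SpaceCat.{0, 1} := SpaceCat.ofTop (Mfd ℂ ω) Mfd.forgetToTop Mfd.localDiffeo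

/-- Locally ringed spaces over the complex numbers. -/
structure CSpace where
  X : LocallyRingedSpace.{0}
  str : CommRingCat.of ℂ ⟶ LocallyRingedSpace.Γ.obj (op X)

namespace CSpace

/-- Morphisms of locally ringed spaces that are `ℂ`-linear. -/
@[ext]
structure Hom (A B : CSpace) where
  hom : A.X ⟶ B.X
  str_comp : B.str ≫ LocallyRingedSpace.Γ.map hom.op = A.str

instance : Category CSpace where
  Hom := Hom
  id A := ⟨𝟙 A.X, by
    rw [op_id, CategoryTheory.Functor.map_id, Category.comp_id]⟩
  comp f g := ⟨f.hom ≫ g.hom, by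
    rw [op_comp, Functor.map_comp, ← Category.assoc, g.str_comp, f.str_comp]⟩
  id_comp _ := Hom.ext (Category.id_comp _)
  comp_id _ := Hom.ext (Category.comp_id _)
  assoc _ _ _ := Hom.ext (Category.assoc _ _ _)

/-- The underlying topological space. -/
def forgetToTop : CSpace ⥤ TopCat.{0} where
  obj A := A.X.toTopCat
  map f := LocallyRingedSpace.forgetToTop.map f.hom
  map_id _ := LocallyRingedSpace.forgetToTop.map_id _
  map_comp _ _ := LocallyRingedSpace.forgetToTop.map_comp _ _

/-- An open subspace. -/
noncomputable def restrict (A : CSpace) (U : Opens A.X.toTopCat) : CSpace where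
  X := A.X.restrict U.isOpenEmbedding
  str := A.str ≫ LocallyRingedSpace.Γ.map (A.X.ofRestrict U.isOpenEmbedding).op

/-- An open subset of `ℂ^n` with the sheaf of holomorphic functions. -/
noncomputable def domain {n : ℕ} (D : Opens (EuclideanSpace ℂ (Fin n))) : CSpace where
  X := ChartedSpace.locallyRingedSpace 𝓘(ℂ, EuclideanSpace ℂ (Fin n)) D
  str :=
    let R := C^∞⟮𝓘(ℂ, EuclideanSpace ℂ (Fin n)), (⊤ : Opens D); 𝓘(ℂ), ℂ⟯
    (CommRingCat.ofHom (algebraMap ℂ R) : CommRingCat.of ℂ ⟶ CommRingCat.of R)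

/-- A closed immersion onto the subspace defined by finitely many global sections `f₁, …, f_k` of
the target: a closed embedding onto the zero locus of the `f_j` that is surjective on stalks, with
kernel generated by the germs of the `f_j`. -/
structure IsModelEmbedding {A B : CSpace} (i : A ⟶ B) {k : ℕ}
    (f : Fin k → LocallyRingedSpace.Γ.obj (op B.X)) : Prop where
  isClosedEmbedding : Topology.IsClosedEmbedding (forgetToTop.map i)
  range_eq : Set.range (forgetToTop.map i) = B.X.toRingedSpace.zeroLocus (Set.range f)
  surjective : ∀ a : A.X.toTopCat, Function.Surjective (i.hom.stalkMap a)
  ker_eq : ∀ a : A.X.toTopCat, RingHom.ker (i.hom.stalkMap a).hom =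
    Ideal.span (Set.range fun j => B.X.presheaf.germ ⊤ (i.hom.base a) trivial (f j))

/-- Complex (analytic) spaces: locally they are defined by finitely many holomorphic functions on
an open subset of some `ℂ^n`. -/
def IsComplexSpace (A : CSpace) : Prop :=
  ∀ x : A.X.toTopCat, ∃ (U : Opens A.X.toTopCat) (_ : x ∈ U) (n : ℕ)
    (D : Opens (EuclideanSpace ℂ (Fin n))) (k : ℕ)
    (f : Fin k → LocallyRingedSpace.Γ.obj (op (domain D).X)) (i : A.restrict U ⟶ domain D),
    IsModelEmbedding i f

end CSpace

/-- Separated (i.e. Hausdorff) complex spaces; étale means local isomorphism. -/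
def complexSpaces : SpaceCat.{0, 1} :=
  SpaceCat.ofTop
    (ObjectProperty.FullSubcategory fun A : CSpace => A.IsComplexSpace ∧ T2Space A.X.toTopCat)
    (ObjectProperty.ι _ ⋙ CSpace.forgetToTop) (fun _ _ f => IsLocalIsoLRS f.hom.hom)

/-- A category of schemes over `B`, with the étale topology. -/
noncomputable def SpaceCat.ofSchemes (B : Scheme.{0}) (P : ObjectProperty (Over B)) :
    SpaceCat.{0, 1} where
  Obj := P.FullSubcategory
  cat := ObjectProperty.FullSubcategory.category P
  etale := fun _ _ f => AlgebraicGeometry.Etale f.hom.left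
  surj := fun _ _ f => AlgebraicGeometry.Surjective f.hom.left
  ProperPair := fun {_ B'} s t => IsProper (pullback.lift (f := B'.obj.hom) (g := B'.obj.hom)
    s.hom.left t.hom.left (by rw [Over.w, Over.w]))
  topology := Precoverage.toGrothendieck
    { coverings := fun X => {R | (∀ ⦃Y : P.FullSubcategory⦄ (f : Y ⟶ X), R f →
          AlgebraicGeometry.Etale f.hom.left) ∧
        ∀ x : X.obj.left, ∃ (Y : P.FullSubcategory) (f : Y ⟶ X), R f ∧
          x ∈ Set.range f.hom.left} }

/-- Smooth separated schemes over a field. -/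
noncomputable def smoothSchemes (k : Type) [Field k] : SpaceCat.{0, 1} :=
  SpaceCat.ofSchemes (Spec (.of k)) fun X => Smooth X.hom ∧ IsSeparated X.hom

/-- Separated schemes over a base scheme. -/
noncomputable def separatedSchemes (B : Scheme.{0}) : SpaceCat.{0, 1} :=
  SpaceCat.ofSchemes B fun X => IsSeparated X.hom

/-- The basic categories of spaces. -/
inductive SpaceCat.IsBasic : SpaceCat.{0, 1} → Prop
  | top : IsBasic topSpaces
  | lrs : IsBasic lrsSpaces
  | smoothManifold : IsBasic smoothManifolds
  | complexManifold : IsBasic complexManifolds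
  | complexSpace : IsBasic complexSpaces
  | smoothScheme (k : Type) [Field k] : IsBasic (smoothSchemes k)
  | scheme (B : Scheme.{0}) : IsBasic (separatedSchemes B)

end Spaces

end Orbi

namespace Orbi

section Fibered

universe v₁ u₁ v₂ u₂

variable {C : Type u₁} [Category.{v₁} C] {𝒳 : Type u₂} [Category.{v₂} 𝒳]

/-- A functor that is fibered in groupoids, spelled out in terms of lifts of arrows. -/
structure FibG (p : 𝒳 ⥤ C) : Prop where
  exists_lift : ∀ {M : C} (a : 𝒳) (f : M ⟶ p.obj a), ∃ (b : 𝒳) (φ : b ⟶ a), p.IsHomLift f φ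
  exists_fac : ∀ {a b c : 𝒳} {U V W : C} {f : V ⟶ W} {φ : b ⟶ c} {k : U ⟶ V} {ψ : a ⟶ c},
    p.IsHomLift f φ → p.IsHomLift (k ≫ f) ψ → ∃ χ : a ⟶ b, p.IsHomLift k χ ∧ χ ≫ φ = ψ
  hom_ext : ∀ {a b c : 𝒳} {U V : C} {k : U ⟶ V} (φ : b ⟶ c) {χ χ' : a ⟶ b},
    p.IsHomLift k χ → p.IsHomLift k χ' → χ ≫ φ = χ' ≫ φ → χ = χ'

lemma isHomLift_comp {p : 𝒳 ⥤ C} {U V W : C} {f : U ⟶ V} {g : V ⟶ W} {a b c : 𝒳} {φ : a ⟶ b}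
    {ψ : b ⟶ c} (hφ : p.IsHomLift f φ) (hψ : p.IsHomLift g ψ) : p.IsHomLift (f ≫ g) (φ ≫ ψ) :=
  inferInstance

lemma isHomLift_id_comp {p : 𝒳 ⥤ C} {U V : C} {f : U ⟶ V} {a b c : 𝒳} {φ : a ⟶ b}
    {ψ : b ⟶ c} (hφ : p.IsHomLift (𝟙 U) φ) (hψ : p.IsHomLift f ψ) : p.IsHomLift f (φ ≫ ψ) := by
  simpa using isHomLift_comp hφ hψ

lemma isHomLift_comp_id {p : 𝒳 ⥤ C} {U V : C} {f : U ⟶ V} {a b c : 𝒳} {φ : a ⟶ b}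
    {ψ : b ⟶ c} (hφ : p.IsHomLift f φ) (hψ : p.IsHomLift (𝟙 V) ψ) : p.IsHomLift f (φ ≫ ψ) := by
  simpa using isHomLift_comp hφ hψ

lemma isHomLift_id_congr {p : 𝒳 ⥤ C} {U V : C} {a b : 𝒳} {φ : a ⟶ b} (e : U = V)
    (h : p.IsHomLift (𝟙 U) φ) : p.IsHomLift (𝟙 V) φ := e ▸ h

lemma isHomLift_dom {p : 𝒳 ⥤ C} {U V : C} {f : U ⟶ V} {a b : 𝒳} {φ : a ⟶ b}
    (h : p.IsHomLift f φ) : p.obj a = U := IsHomLift.domain_eq p f φ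

lemma isHomLift_cod {p : 𝒳 ⥤ C} {U V : C} {f : U ⟶ V} {a b : 𝒳} {φ : a ⟶ b}
    (h : p.IsHomLift f φ) : p.obj b = V := IsHomLift.codomain_eq p f φ

lemma isHomLift_unique {p : 𝒳 ⥤ C} {U V : C} {f g : U ⟶ V} {a b : 𝒳} {φ : a ⟶ b}
    (h : p.IsHomLift f φ) (h' : p.IsHomLift g φ) : f = g := by
  rw [IsHomLift.fac p f φ, IsHomLift.fac p g φ]

namespace FibG

variable {p : 𝒳 ⥤ C} (hp : FibG p)
include hp

lemma exists_lift' {a : 𝒳} {U V : C} (ha : p.obj a = V) (f : U ⟶ V) :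
    ∃ (b : 𝒳) (φ : b ⟶ a), p.IsHomLift f φ := by
  subst ha
  exact hp.exists_lift a f

lemma exists_fac_id {a b c : 𝒳} {U V : C} {f : U ⟶ V} {φ : b ⟶ c} {ψ : a ⟶ c}
    (hφ : p.IsHomLift f φ) (hψ : p.IsHomLift f ψ) :
    ∃ χ : a ⟶ b, p.IsHomLift (𝟙 U) χ ∧ χ ≫ φ = ψ :=
  hp.exists_fac hφ (k := 𝟙 U) (by simpa using hψ)

lemma isIso_of_id {a b : 𝒳} {U : C} {φ : a ⟶ b} (h : p.IsHomLift (𝟙 U) φ) : IsIso φ := by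
  have hb : p.IsHomLift (𝟙 U) (𝟙 b) := IsHomLift.id (IsHomLift.codomain_eq p (𝟙 U) φ)
  have ha : p.IsHomLift (𝟙 U) (𝟙 a) := IsHomLift.id (IsHomLift.domain_eq p (𝟙 U) φ)
  obtain ⟨χ, hχ, e⟩ := hp.exists_fac_id h hb
  refine ⟨χ, hp.hom_ext φ (isHomLift_id_comp h hχ) ha ?_, e⟩
  rw [Category.assoc, e, Category.comp_id, Category.id_comp]

lemma isIso_of_isIso {a b : 𝒳} {U V : C} {f : U ⟶ V} [IsIso f] {φ : a ⟶ b} (h : p.IsHomLift f φ) :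
    IsIso φ := by
  have hb : p.IsHomLift (𝟙 V) (𝟙 b) := IsHomLift.id (IsHomLift.codomain_eq p f φ)
  have ha : p.IsHomLift (𝟙 U) (𝟙 a) := IsHomLift.id (IsHomLift.domain_eq p f φ)
  obtain ⟨χ, hχ, e⟩ := hp.exists_fac (k := inv f) h (by simpa using hb)
  refine ⟨χ, hp.hom_ext φ (k := 𝟙 U) (by simpa using isHomLift_comp h hχ) ha ?_, e⟩
  rw [Category.assoc, e, Category.comp_id, Category.id_comp]

end FibG

/-- Morphisms can be glued along the covering sieves of `J`. -/
def GluesMor (p : 𝒳 ⥤ C) (J : GrothendieckTopology C) : Prop :=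
  ∀ (a b : 𝒳) (m : p.obj a ⟶ p.obj b) (R : Sieve (p.obj a)), R ∈ J (p.obj a) →
    ∀ (ψ : ∀ {c : 𝒳} (φ : c ⟶ a), R (p.map φ) → (c ⟶ b)),
    (∀ {c : 𝒳} (φ : c ⟶ a) (h : R (p.map φ)), p.map (ψ φ h) = p.map φ ≫ m) →
    (∀ {c d : 𝒳} (θ : d ⟶ c) (φ : c ⟶ a) (h : R (p.map φ)) (h' : R (p.map (θ ≫ φ))),
      ψ (θ ≫ φ) h' = θ ≫ ψ φ h) →
    ∃! Ψ : a ⟶ b, p.map Ψ = m ∧ ∀ {c : 𝒳} (φ : c ⟶ a) (h : R (p.map φ)), φ ≫ Ψ = ψ φ h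

section

variable {p : 𝒳 ⥤ C} {J : GrothendieckTopology C}

lemma GluesMor.existsUnique' (h : GluesMor p J) (hp : FibG p) {a b : 𝒳} (m : p.obj a ⟶ p.obj b)
    {I : Type*} (c : I → 𝒳) (φ : ∀ i, c i ⟶ a) (ψ : ∀ i, c i ⟶ b)
    (hψ : ∀ i, p.map (ψ i) = p.map (φ i) ≫ m)
    (cov : Sieve.ofArrows _ (fun i => p.map (φ i)) ∈ J (p.obj a))
    (compat : ∀ (i j : I) {d : 𝒳} (χ : d ⟶ c i) (χ' : d ⟶ c j), χ ≫ φ i = χ' ≫ φ j →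
      χ ≫ ψ i = χ' ≫ ψ j) :
    ∃! Ψ : a ⟶ b, p.map Ψ = m ∧ ∀ i, φ i ≫ Ψ = ψ i := by
  have key : ∀ {d : 𝒳} (φ' : d ⟶ a), Sieve.ofArrows _ (fun i => p.map (φ i)) (p.map φ') →
      ∃ (i : I) (χ : d ⟶ c i), χ ≫ φ i = φ' := by
    intro d φ' h'
    rw [Sieve.mem_ofArrows_iff] at h'
    obtain ⟨i, k, hk⟩ := h'
    obtain ⟨χ, -, e⟩ := hp.exists_fac (f := p.map (φ i)) (φ := φ i) (k := k) (ψ := φ')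
      inferInstance (by rw [← hk]; infer_instance)
    exact ⟨i, χ, e⟩
  choose i χ hχ using @key
  obtain ⟨Ψ, ⟨hΨ, hΨ'⟩, uniq⟩ := h _ _ m _ cov (fun φ' h' => χ φ' h' ≫ ψ (i φ' h'))
    (fun φ' h' => by
      conv_rhs => rw [← hχ φ' h']
      simp [hψ])
    (fun θ φ' h' h'' => by
      rw [← Category.assoc]
      apply compat
      rw [hχ, Category.assoc, hχ])
  refine ⟨Ψ, ⟨hΨ, fun j => ?_⟩, fun Ψ' h' => uniq _ ⟨h'.1, fun φ' k => ?_⟩⟩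
  · rw [hΨ' (φ j) (Sieve.ofArrows_mk _ _ j), ← Category.id_comp (ψ j)]
    apply compat
    rw [hχ, Category.id_comp]
  · rw [← h'.2, ← Category.assoc, hχ]

/-- Gluing of morphisms along a family of arrows with covering images. -/
lemma GluesMor.existsUnique (h : GluesMor p J) (hp : FibG p) {a b : 𝒳} {U V : C} (m : U ⟶ V)
    (ha : p.obj a = U) (hb : p.obj b = V) {I : Type*} (W : I → C) (f : ∀ i, W i ⟶ U) (c : I → 𝒳)
    (φ : ∀ i, c i ⟶ a) (ψ : ∀ i, c i ⟶ b) (hφ : ∀ i, p.IsHomLift (f i) (φ i))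
    (hψ : ∀ i, p.IsHomLift (f i ≫ m) (ψ i)) (cov : Sieve.ofArrows _ f ∈ J U)
    (compat : ∀ (i j : I) {d : 𝒳} (χ : d ⟶ c i) (χ' : d ⟶ c j), χ ≫ φ i = χ' ≫ φ j →
      χ ≫ ψ i = χ' ≫ ψ j) :
    ∃! Ψ : a ⟶ b, p.IsHomLift m Ψ ∧ ∀ i, φ i ≫ Ψ = ψ i := by
  subst ha hb
  obtain rfl : (fun i => p.obj (c i)) = W := funext fun i => IsHomLift.domain_eq p (f i) (φ i)
  obtain rfl : f = fun i => p.map (φ i) := funext fun i => by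
    have := hφ i
    exact IsHomLift.eq_of_isHomLift p _ _
  have hψ' : ∀ i, p.map (ψ i) = p.map (φ i) ≫ m := fun i => by
    have := hψ i
    exact (IsHomLift.eq_of_isHomLift p _ _).symm
  obtain ⟨Ψ, ⟨h₁, h₂⟩, h₃⟩ := h.existsUnique' hp m c φ ψ hψ' cov compat
  refine ⟨Ψ, ⟨h₁ ▸ inferInstance, h₂⟩, fun Ψ' h' => h₃ _ ⟨?_, h'.2⟩⟩
  have := h'.1
  exact (IsHomLift.eq_of_isHomLift p _ _).symm

lemma GluesMor.ext (h : GluesMor p J) (hp : FibG p) {a b : 𝒳} {U V : C} {m : U ⟶ V}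
    {I : Type*} (W : I → C) (f : ∀ i, W i ⟶ U) (c : I → 𝒳)
    (φ : ∀ i, c i ⟶ a) (hφ : ∀ i, p.IsHomLift (f i) (φ i)) (cov : Sieve.ofArrows _ f ∈ J U)
    {Ψ Ψ' : a ⟶ b} (hΨ : p.IsHomLift m Ψ) (hΨ' : p.IsHomLift m Ψ')
    (e : ∀ i, φ i ≫ Ψ = φ i ≫ Ψ') : Ψ = Ψ' :=
  (h.existsUnique hp m (IsHomLift.domain_eq p m Ψ) (IsHomLift.codomain_eq p m Ψ) W f c φ
    (fun i => φ i ≫ Ψ) hφ (fun i => isHomLift_comp (hφ i) hΨ) cov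
    (fun i j d χ χ' e => by rw [← Category.assoc, e, Category.assoc])).unique
    ⟨hΨ, fun _ => rfl⟩ ⟨hΨ', fun i => (e i).symm⟩

end

end Fibered

section Based

universe v₁ u₁ v₂ u₂ v₃ u₃

variable {C : Type u₁} [Category.{v₁} C]

lemma map_isHomLift {𝒳 : BasedCategory.{v₂, u₂} C} {𝒴 : BasedCategory.{v₃, u₃} C}
    (F : BasedFunctor 𝒳 𝒴) {U V : C} {f : U ⟶ V} {a b : 𝒳.obj} {φ : a ⟶ b}
    (h : 𝒳.p.IsHomLift f φ) : 𝒴.p.IsHomLift f (F.map φ) := inferInstance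

/-- A functor between categories over `C` that preserves lifts is a functor over `C`. -/
def basedFunctorMk {𝒳 : BasedCategory.{v₂, u₂} C} {𝒴 : BasedCategory.{v₃, u₃} C}
    (F : 𝒳.obj ⥤ 𝒴.obj) (hF : ∀ a, 𝒴.p.obj (F.obj a) = 𝒳.p.obj a)
    (h : ∀ {a b : 𝒳.obj} (φ : a ⟶ b), 𝒴.p.IsHomLift (𝒳.p.map φ) (F.map φ)) :
    BasedFunctor 𝒳 𝒴 where
  toFunctor := F
  w := CategoryTheory.Functor.ext hF fun a b φ => by
    have := h φ
    simpa using IsHomLift.fac' 𝒴.p (𝒳.p.map φ) (F.map φ)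

end Based

section Stacks

universe v₁ u₁ v₂ u₂

variable {C : Type u} [Category.{v} C]

lemma IsFiberedInGroupoids.fibG {𝒳 : BasedCategory.{v, max u v} C} (h : IsFiberedInGroupoids 𝒳) :
    FibG 𝒳.p where
  exists_lift a f := h.exists_lift a f
  exists_fac {a b c U V W f φ k ψ} h₁ h₂ := by
    obtain ⟨⟩ := h₁
    have := h.isStronglyCartesian φ
    exact (Functor.IsStronglyCartesian.universal_property 𝒳.p (𝒳.p.map φ) φ k _ rfl ψ).exists
  hom_ext {a b c U V k} φ {χ χ'} h₁ h₂ e := by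
    obtain rfl := IsHomLift.codomain_eq 𝒳.p k χ
    have := h.isStronglyCartesian φ
    exact Functor.IsStronglyCartesian.ext 𝒳.p (𝒳.p.map φ) φ k e

lemma FibG.isFiberedInGroupoids {𝒳 : BasedCategory.{v, max u v} C} (h : FibG 𝒳.p) :
    IsFiberedInGroupoids 𝒳 where
  exists_lift a f := h.exists_lift a f
  isStronglyCartesian φ :=
    { universal_property' := fun {a'} g φ' h' => by
        obtain ⟨χ, h₁, h₂⟩ := h.exists_fac (f := 𝒳.p.map φ) (φ := φ) inferInstance h'
        exact ⟨χ, ⟨h₁, h₂⟩, fun χ' h'' => h.hom_ext φ h''.1 h₁ (h''.2.trans h₂.symm)⟩ }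

/-- Objects can be glued along the covering sieves of `J`. -/
def GluesObj {𝒳 : Type u₂} [Category.{v₂} 𝒳] (p : 𝒳 ⥤ C) (J : GrothendieckTopology C) : Prop :=
  ∀ (U : C) (R : Sieve U), R ∈ J U →
    ∀ D : ObjectProperty.FullSubcategory (fun f : Over U => R f.hom) ⥤ 𝒳,
    (∀ {o o' : ObjectProperty.FullSubcategory (fun f : Over U => R f.hom)} (g : o ⟶ o'),
      p.IsHomLift g.hom.left (D.map g)) →
    ∃ (P : 𝒳) (l : ∀ o, D.obj o ⟶ P), p.obj P = U ∧
      (∀ o, p.IsHomLift o.obj.hom (l o)) ∧ ∀ {o o'} (g : o ⟶ o'), D.map g ≫ l o' = l o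

namespace overBased

variable {U : C}

/-- The object of the represented category that is given by an arrow. -/
def mk {V : C} (f : V ⟶ U) : (overBased U).obj := Over.mk f

/-- The arrow that gives an object of the represented category. -/
def hom (o : (overBased U).obj) : (overBased U).p.obj o ⟶ U := Over.hom o

/-- The arrow to the identity in the represented category. -/
def toTop (o : (overBased U).obj) : o ⟶ mk (𝟙 U) := Over.homMk (Over.hom o) (Category.comp_id _)

lemma comp_toTop {o o' : (overBased U).obj} (g : o ⟶ o') : g ≫ toTop o' = toTop o :=
  Over.OverMorphism.ext (Over.w g)

lemma map_comp_hom {o o' : (overBased U).obj} (g : o ⟶ o') :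
    (overBased U).p.map g ≫ hom o' = hom o := Over.w g

lemma isHomLift_toTop (o : (overBased U).obj) : (overBased U).p.IsHomLift (hom o) (toTop o) :=
  IsHomLift.map (overBased U).p (toTop o)

/-- The arrow over `k` in the represented category. -/
def homMk {o o' : (overBased U).obj} (k : (overBased U).p.obj o ⟶ (overBased U).p.obj o')
    (h : k ≫ hom o' = hom o) : o ⟶ o' := Over.homMk k h

lemma hom_ext {o o' : (overBased U).obj} {g g' : o ⟶ o'}
    (h : (overBased U).p.map g = (overBased U).p.map g') : g = g' := Over.OverMorphism.ext h

end overBased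

open overBased

lemma isHomLift_map_toTop {𝒳 : BasedCategory.{v₂, u₂} C} {U : C}
    (E : BasedFunctor (overBased U) 𝒳) (o : (overBased U).obj) :
    𝒳.p.IsHomLift (overBased.hom o) (E.map (toTop o)) :=
  map_isHomLift E (isHomLift_toTop o)

/-- An object over `U` extends to a functor on the category represented by `U`. -/
lemma exists_pull {𝒳 : BasedCategory.{v₂, u₂} C} (h𝒳 : FibG 𝒳.p) {U : C} {a : 𝒳.obj}
    (ha : 𝒳.p.obj a = U) : ∃ (A : BasedFunctor (overBased U) 𝒳)
    (π : ∀ o : (overBased U).obj, A.obj o ⟶ a), (∀ o, 𝒳.p.IsHomLift (overBased.hom o) (π o)) ∧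
      ∀ {o o'} (g : o ⟶ o'), A.map g ≫ π o' = π o := by
  have key (o : (overBased U).obj) := h𝒳.exists_lift' ha (overBased.hom o)
  choose A π hπ using key
  have key' {o o' : (overBased U).obj} (g : o ⟶ o') := h𝒳.exists_fac (k := (overBased U).p.map g)
    (hπ o') (ψ := π o) (by rw [map_comp_hom]; exact hπ o)
  choose m hm hm' using @key'
  refine ⟨basedFunctorMk (𝒳 := overBased U)
    { obj := A
      map := m
      map_id := fun o => h𝒳.hom_ext (π o) (hm _) (by
          rw [CategoryTheory.Functor.map_id]
          exact IsHomLift.id (isHomLift_dom (hπ o)))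
        (by rw [hm', Category.id_comp])
      map_comp := fun f g => h𝒳.hom_ext (π _) (hm _) (by
          rw [CategoryTheory.Functor.map_comp]
          exact isHomLift_comp (hm f) (hm g))
        (by rw [hm', Category.assoc, hm', hm']) }
    (fun o => isHomLift_dom (hπ o)) (fun g => hm g), π, hπ, fun g => hm' g⟩

/-- The object of a sieve that is given by an arrow. -/
def sieveBased.mk {U V : C} {R : Sieve U} (f : V ⟶ U) (hf : R f) : (sieveBased R).obj :=
  ⟨Over.mk f, hf⟩

lemma sieveBased.property {U : C} {R : Sieve U} (o : (sieveBased R).obj) :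
    R (overBased.hom ((sieveIncl R).obj o)) := ObjectProperty.FullSubcategory.property o

instance {U : C} (R : Sieve U) : (sieveIncl R).toFunctor.Full :=
  inferInstanceAs (ObjectProperty.ι (fun f : Over U => R f.hom)).Full

instance {U : C} (R : Sieve U) : (sieveIncl R).toFunctor.Faithful :=
  inferInstanceAs (ObjectProperty.ι (fun f : Over U => R f.hom)).Faithful

lemma fibG_overBased (U : C) : FibG (overBased U).p where
  exists_lift a f := ⟨mk (f ≫ overBased.hom a), homMk f rfl,
    IsHomLift.map (overBased U).p (homMk (o := mk (f ≫ overBased.hom a)) f rfl)⟩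
  exists_fac {a b c X Y Z f φ k ψ} h₁ h₂ := by
    have ea := isHomLift_dom h₂
    have eb := isHomLift_dom h₁
    have ec := isHomLift_cod h₁
    subst ea eb ec
    obtain rfl := IsHomLift.eq_of_isHomLift (overBased U).p f φ
    have e := IsHomLift.eq_of_isHomLift (overBased U).p (k ≫ (overBased U).p.map φ) ψ
    refine ⟨homMk k ?_, IsHomLift.map (overBased U).p (homMk k _), overBased.hom_ext ?_⟩
    · rw [← map_comp_hom φ, ← map_comp_hom ψ, ← e, Category.assoc]
    · exact (CategoryTheory.Functor.map_comp _ _ _).trans e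
  hom_ext {a b c X Y k} φ χ χ' h₁ h₂ _ := by
    have ea := isHomLift_dom h₁
    have eb := isHomLift_cod h₁
    subst ea eb
    exact overBased.hom_ext ((IsHomLift.eq_of_isHomLift (overBased U).p k χ).symm.trans
      (IsHomLift.eq_of_isHomLift (overBased U).p k χ'))

end Stacks

section IsStack

open overBased

variable {S : SpaceCat.{v, u}} {𝒳 : BasedCategory.{v, max u v} S.Obj}

lemma IsStack.fibG (h : IsStack 𝒳) : FibG 𝒳.p := h.isFiberedInGroupoids.fibG

lemma IsStack.gluesMor (h : IsStack 𝒳) : GluesMor 𝒳.p S.topology := by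
  intro a b m R hR ψ hψ hψ'
  have h𝒳 := h.fibG
  obtain ⟨b', μ, hμ⟩ := h𝒳.exists_lift b m
  obtain ⟨A, π, hπ, hπ'⟩ := exists_pull h𝒳 (a := a) rfl
  obtain ⟨B, ρ, hρ, hρ'⟩ := exists_pull h𝒳 (a := b') (IsHomLift.domain_eq 𝒳.p m μ)
  have eA := h.descent R hR
  have hRo (o : (sieveBased R).obj) : R (𝒳.p.map (π ((sieveIncl R).obj o))) := by
    have h₁ := sieveBased.property o
    have h₂ := hπ ((sieveIncl R).obj o)
    rw [IsHomLift.fac' 𝒳.p (overBased.hom ((sieveIncl R).obj o)) (π ((sieveIncl R).obj o))]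
    apply R.downward_closed
    simpa using h₁
  have hψo (o : (sieveBased R).obj) :
      𝒳.p.IsHomLift (overBased.hom ((sieveIncl R).obj o) ≫ m) (ψ (π _) (hRo o)) := by
    have h₂ := hπ ((sieveIncl R).obj o)
    apply IsHomLift.of_fac' _ _ _ (IsHomLift.domain_eq 𝒳.p (overBased.hom ((sieveIncl R).obj o))
      (π ((sieveIncl R).obj o))) rfl
    rw [hψ, IsHomLift.fac' 𝒳.p (overBased.hom ((sieveIncl R).obj o)) (π ((sieveIncl R).obj o))]
    simp
  have hρμ (o : (overBased (𝒳.p.obj a)).obj) : 𝒳.p.IsHomLift (overBased.hom o ≫ m) (ρ o ≫ μ) :=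
    isHomLift_comp (hρ o) hμ
  have hA {o o' : (overBased (𝒳.p.obj a)).obj} (g : o ⟶ o') :
      𝒳.p.IsHomLift ((overBased _).p.map g) (A.map g) :=
    map_isHomLift A (IsHomLift.map (overBased (𝒳.p.obj a)).p g)
  have hB {o o' : (overBased (𝒳.p.obj a)).obj} (g : o ⟶ o') :
      𝒳.p.IsHomLift ((overBased _).p.map g) (B.map g) :=
    map_isHomLift B (IsHomLift.map (overBased (𝒳.p.obj a)).p g)
  choose α hα hα' using fun o : (sieveBased R).obj => h𝒳.exists_fac_id (hρμ _) (hψo o)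
  let α' : (Bicategory.precomp 𝒳 (sieveIncl R)).obj A ⟶
      (Bicategory.precomp 𝒳 (sieveIncl R)).obj B :=
    { app := α
      naturality := fun o o' g => by
        have e := hπ' ((sieveIncl R).map g)
        refine h𝒳.hom_ext (ρ ((sieveIncl R).obj o') ≫ μ)
          (isHomLift_comp_id (hA ((sieveIncl R).map g)) (hα o'))
          (isHomLift_id_comp (hα o) (hB ((sieveIncl R).map g))) ?_
        have e₁ : (α o ≫ B.map ((sieveIncl R).map g)) ≫ ρ ((sieveIncl R).obj o') ≫ μ =
            ψ (π _) (hRo o) := by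
          rw [Category.assoc, reassoc_of% (hρ' ((sieveIncl R).map g))]
          exact hα' o
        have e₂ : (A.map ((sieveIncl R).map g) ≫ α o') ≫ ρ ((sieveIncl R).obj o') ≫ μ =
            ψ (π _) (hRo o) := by
          rw [Category.assoc, hα', ← hψ' _ _ _ (by rw [e]; exact hRo o)]
          congr 1
        exact e₂.trans e₁.symm
      isHomLift' := hα }
  obtain ⟨β, hβ⟩ : ∃ β : BasedNatTrans A B, ∀ o, β.app ((sieveIncl R).obj o) = α o := by
    obtain ⟨β, hβ⟩ := (Bicategory.precomp 𝒳 (sieveIncl R)).map_surjective α'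
    exact ⟨β, fun o => congrArg (fun γ : BasedNatTrans _ _ => γ.app o) hβ⟩
  let t : (overBased (𝒳.p.obj a)).obj := overBased.mk (𝟙 _)
  have ht : 𝒳.p.IsHomLift (𝟙 (𝒳.p.obj a)) (π t) := hπ t
  have : IsIso (π t) := h𝒳.isIso_of_id ht
  have htρ : 𝒳.p.IsHomLift m (ρ t ≫ μ) := isHomLift_id_comp (hρ t) hμ
  have hinv : 𝒳.p.IsHomLift (𝟙 (𝒳.p.obj a)) (inv (π t)) := inferInstance
  have hβt : 𝒳.p.IsHomLift (𝟙 (𝒳.p.obj a)) (β.app t) := β.isHomLift' t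
  have fac {c : 𝒳.obj} (φ : c ⟶ a) : ∃ χ : c ⟶ A.obj (overBased.mk (𝒳.p.map φ)),
      𝒳.p.IsHomLift (𝟙 _) χ ∧ χ ≫ π (overBased.mk (𝒳.p.map φ)) = φ :=
    h𝒳.exists_fac_id (hπ (overBased.mk (𝒳.p.map φ))) (IsHomLift.map 𝒳.p φ)
  have hΨ : 𝒳.p.IsHomLift m (inv (π t) ≫ β.app t ≫ ρ t ≫ μ) :=
    isHomLift_id_comp hinv (isHomLift_id_comp hβt htρ)
  refine ⟨inv (π t) ≫ β.app t ≫ ρ t ≫ μ, ⟨?_, ?_⟩, ?_⟩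
  · exact (IsHomLift.eq_of_isHomLift 𝒳.p m _).symm
  · intro c φ hφ
    obtain ⟨o, o', ho, hχ⟩ : ∃ (o : (sieveBased R).obj) (o' : (overBased (𝒳.p.obj a)).obj)
        (_ : o' = (sieveIncl R).obj o) (χ : c ⟶ A.obj o'), χ ≫ π o' = φ :=
      ⟨sieveBased.mk (𝒳.p.map φ) hφ, _, rfl, (fac φ).choose, (fac φ).choose_spec.2⟩
    subst ho
    obtain ⟨χ, h₂⟩ := hχ
    let o' := (sieveIncl R).obj o
    change χ ≫ π o' = φ at h₂
    have e₁ : φ = χ ≫ A.map (toTop o') ≫ π t := by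
      rw [hπ' (toTop o'), h₂]
    have e₂ : A.map (toTop o') ≫ β.app t = α o ≫ B.map (toTop o') := by
      rw [← hβ o]; exact β.naturality (toTop o')
    have e₃ : ψ φ hφ = χ ≫ ψ (π o') (hRo o) := by
      rw [← hψ' χ (π o') (hRo o) (by rw [h₂]; exact hφ)]
      congr 1; exact h₂.symm
    have e₄ : α o ≫ ρ o' ≫ μ = ψ (π o') (hRo o) := hα' o
    rw [e₃, ← e₄, ← hρ' (toTop o'), Category.assoc, ← reassoc_of% e₂]
    conv_lhs => rw [e₁]
    simp [t]
    rfl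
  · rintro Ψ ⟨h₁, h₂⟩
    have hΨ' : 𝒳.p.IsHomLift m Ψ := h₁ ▸ IsHomLift.map 𝒳.p Ψ
    have hπΨ (o : (overBased (𝒳.p.obj a)).obj) : 𝒳.p.IsHomLift (overBased.hom o ≫ m) (π o ≫ Ψ) :=
      isHomLift_comp (hπ o) hΨ'
    choose γ hγ hγ' using fun o => h𝒳.exists_fac_id (hρμ o) (hπΨ o)
    let δ : BasedNatTrans A B :=
      { app := γ
        naturality := fun o o' g => by
          refine h𝒳.hom_ext (ρ o' ≫ μ) (isHomLift_comp_id (hA g) (hγ o'))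
            (isHomLift_id_comp (hγ o) (hB g)) ?_
          rw [Category.assoc, hγ', Category.assoc, reassoc_of% (hρ' g), hγ',
            reassoc_of% (hπ' g)]
        isHomLift' := hγ }
    have e : δ = β := by
      refine (Bicategory.precomp 𝒳 (sieveIncl R)).map_injective (X := A) (Y := B) ?_
      apply BasedNatTrans.ext
      ext o
      change γ ((sieveIncl R).obj o) = β.app ((sieveIncl R).obj o)
      rw [hβ]
      refine h𝒳.hom_ext (ρ ((sieveIncl R).obj o) ≫ μ) (hγ _) (hα o) ?_
      rw [hγ', hα', ← h₂]
    have e' : γ t = β.app t := congrArg (fun δ : BasedNatTrans A B => δ.app t) e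
    rw [← e', hγ', IsIso.inv_hom_id_assoc]

lemma IsStack.gluesObj (h : IsStack 𝒳) : GluesObj 𝒳.p S.topology := by
  intro U R hR D hD
  have := h.descent R hR
  let D' : BasedFunctor (sieveBased R) 𝒳 := basedFunctorMk (𝒳 := sieveBased R) D
    (fun o => isHomLift_dom (hD (𝟙 o))) (fun g => hD g)
  let e := (Bicategory.precomp 𝒳 (sieveIncl R)).objObjPreimageIso D'
  let E : BasedFunctor (overBased U) 𝒳 := (Bicategory.precomp 𝒳 (sieveIncl R)).objPreimage D'
  obtain ⟨i, hi, hi'⟩ : ∃ i : ∀ o, D'.obj o ⟶ E.obj ((sieveIncl R).obj o),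
      (∀ o, 𝒳.p.IsHomLift (𝟙 ((sieveBased R).p.obj o)) (i o)) ∧ ∀ {o o'} (g : o ⟶ o'),
        D'.map g ≫ i o' = i o ≫ E.map ((sieveIncl R).map g) :=
    ⟨fun o => e.inv.toNatTrans.app o, fun o => BasedNatTrans.isHomLift' e.inv o,
      fun g => e.inv.toNatTrans.naturality g⟩
  have key {o o' : (sieveBased R).obj} (g : o ⟶ o') :
      D'.map g ≫ i o' ≫ E.map (toTop ((sieveIncl R).obj o')) =
        i o ≫ E.map (toTop ((sieveIncl R).obj o)) := by
    rw [← Category.assoc, hi', Category.assoc, ← E.map_comp, comp_toTop]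
  refine ⟨E.obj (overBased.mk (𝟙 U)), fun o => i o ≫ E.map (toTop ((sieveIncl R).obj o)), E.w_obj _,
    fun o => isHomLift_id_comp (hi o) (isHomLift_map_toTop E ((sieveIncl R).obj o)),
    fun {o o'} g => ?_⟩
  exact key g

end IsStack

end Orbi

namespace Orbi

section LocalEquiv

universe v₁ u₁ v₂ u₂ v₃ u₃ v₄ u₄

variable {C : Type u₁} [Category.{v₁} C] {𝒜 : BasedCategory.{v₂, u₂} C}
  {ℬ : BasedCategory.{v₃, u₃} C} {J : GrothendieckTopology C}

/-- The sieve generated by the images of the arrows from the image of `w` to `b`. -/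
def imageSieve (w : BasedFunctor 𝒜 ℬ) (b : ℬ.obj) : Sieve (ℬ.p.obj b) :=
  Sieve.ofArrows (fun i : Σ a : 𝒜.obj, (w.obj a ⟶ b) => ℬ.p.obj (w.obj i.1))
    (fun i => ℬ.p.map i.2)

/-- A fully faithful functor between categories fibered in groupoids that is locally essentially
surjective. -/
structure IsLocalEquiv (w : BasedFunctor 𝒜 ℬ) (J : GrothendieckTopology C) : Prop where
  source : FibG 𝒜.p
  target : FibG ℬ.p
  full : w.toFunctor.Full
  faithful : w.toFunctor.Faithful
  cov : ∀ b, imageSieve w b ∈ J (ℬ.p.obj b)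

/-- A functor over `C` reflects lifts. -/
lemma isHomLift_of_map (w : BasedFunctor 𝒜 ℬ) {U V : C} {f : U ⟶ V} {a b : 𝒜.obj} {φ : a ⟶ b}
    (h : ℬ.p.IsHomLift f (w.map φ)) : 𝒜.p.IsHomLift f φ := (w.isHomLift_iff f φ).1 h

/-- A cone over the objects of `𝒜` with an arrow to `b`, with values in `𝒴`. -/
structure LocCone (w : BasedFunctor 𝒜 ℬ) {𝒴 : BasedCategory.{v₄, u₄} C} (G : 𝒜.obj → 𝒴.obj)
    (Gm : ∀ {a a' : 𝒜.obj}, (a ⟶ a') → (G a ⟶ G a')) (b : ℬ.obj) (y : 𝒴.obj) {U : C} (m : ℬ.p.obj b ⟶ U) where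
  app : ∀ {a : 𝒜.obj} (_ : w.obj a ⟶ b), G a ⟶ y
  isHomLift : ∀ {a : 𝒜.obj} (k : w.obj a ⟶ b), 𝒴.p.IsHomLift (ℬ.p.map k ≫ m) (app k)
  naturality : ∀ {a a' : 𝒜.obj} (θ : a' ⟶ a) (k : w.obj a ⟶ b),
    Gm θ ≫ app k = app (w.map θ ≫ k)

namespace IsLocalEquiv

variable {w : BasedFunctor 𝒜 ℬ} (h : IsLocalEquiv w J)
  {𝒴 : BasedCategory.{v₄, u₄} C}
include h

lemma exists_map_eq {a a' : 𝒜.obj} {U V : C} {f : U ⟶ V} {φ : w.obj a ⟶ w.obj a'}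
    (hφ : ℬ.p.IsHomLift f φ) : ∃ θ : a ⟶ a', w.map θ = φ ∧ 𝒜.p.IsHomLift f θ := by
  have := h.full
  obtain ⟨θ, rfl⟩ := w.toFunctor.map_surjective φ
  exact ⟨θ, rfl, isHomLift_of_map w hφ⟩

lemma exists_refinement (h𝒴 : FibG 𝒴.p) {G : 𝒜.obj → 𝒴.obj}
    {Gm : ∀ {a a' : 𝒜.obj}, (a ⟶ a') → (G a ⟶ G a')}
    (hG : ∀ {a a' : 𝒜.obj} {U V : C} {f : U ⟶ V} {θ : a ⟶ a'}, 𝒜.p.IsHomLift f θ →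
      𝒴.p.IsHomLift f (Gm θ)) {b : ℬ.obj} {a a' : 𝒜.obj}
    (k : w.obj a ⟶ b) (k' : w.obj a' ⟶ b) {d : 𝒴.obj} (χ : d ⟶ G a) (χ' : d ⟶ G a')
    {y : 𝒴.obj} {lam : G a ⟶ y} {lam' : G a' ⟶ y} {U : C} {m : ℬ.p.obj b ⟶ U} [Mono m]
    (hl : 𝒴.p.IsHomLift (ℬ.p.map k ≫ m) lam) (hl' : 𝒴.p.IsHomLift (ℬ.p.map k' ≫ m) lam')
    (e : χ ≫ lam = χ' ≫ lam')
    (nat : ∀ {a'' : 𝒜.obj} (θ : a'' ⟶ a) (θ' : a'' ⟶ a'), w.map θ ≫ k = w.map θ' ≫ k' →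
      Gm θ ≫ lam = Gm θ' ≫ lam') :
    ∃ (a'' : 𝒜.obj) (θ : a'' ⟶ a) (θ' : a'' ⟶ a') (ε : d ⟶ G a''),
      w.map θ ≫ k = w.map θ' ≫ k' ∧ ε ≫ Gm θ = χ ∧ ε ≫ Gm θ' = χ' := by
  have hd : 𝒴.p.obj (G a) = ℬ.p.obj (w.obj a) := isHomLift_dom hl
  have hd' : 𝒴.p.obj (G a') = ℬ.p.obj (w.obj a') := isHomLift_dom hl'
  have hχ : 𝒴.p.IsHomLift (𝒴.p.map χ ≫ eqToHom hd) χ := inferInstance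
  have hχ' : 𝒴.p.IsHomLift (𝒴.p.map χ' ≫ eqToHom hd') χ' := inferInstance
  have e₁ : (𝒴.p.map χ ≫ eqToHom hd) ≫ ℬ.p.map k = (𝒴.p.map χ' ≫ eqToHom hd') ≫ ℬ.p.map k' := by
    rw [← cancel_mono m, Category.assoc, Category.assoc]
    have h₁ := isHomLift_comp hχ hl
    rw [e] at h₁
    simpa using isHomLift_unique h₁ (isHomLift_comp hχ' hl')
  obtain ⟨a'', θ, hθ⟩ := h.source.exists_lift' (w.w_obj a).symm (𝒴.p.map χ ≫ eqToHom hd)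
  have hwθ := map_isHomLift w hθ
  obtain ⟨φ, hφ, hφ'⟩ := h.target.exists_fac (f := ℬ.p.map k') (φ := k')
    (k := 𝒴.p.map χ' ≫ eqToHom hd') (ψ := w.map θ ≫ k) (IsHomLift.map _ _)
    (by rw [← e₁]; exact isHomLift_comp hwθ (IsHomLift.map ℬ.p k))
  obtain ⟨θ', rfl, hθ'⟩ := h.exists_map_eq hφ
  obtain ⟨ε, hε, hε'⟩ := h𝒴.exists_fac_id (hG hθ) hχ
  refine ⟨a'', θ, θ', ε, hφ'.symm, hε', ?_⟩
  refine h𝒴.hom_ext lam' (isHomLift_id_comp hε (hG hθ')) hχ' ?_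
  rw [Category.assoc, ← nat θ θ' hφ'.symm, ← Category.assoc, hε', e]

/-- A cone induces an arrow on any object that is a colimit of the cone locally. -/
lemma existsUnique_glue (h𝒴 : FibG 𝒴.p) (hm : GluesMor 𝒴.p J) {G : 𝒜.obj → 𝒴.obj}
    {Gm : ∀ {a a' : 𝒜.obj}, (a ⟶ a') → (G a ⟶ G a')}
    (hG : ∀ {a a' : 𝒜.obj} {U V : C} {f : U ⟶ V} {θ : a ⟶ a'}, 𝒜.p.IsHomLift f θ →
      𝒴.p.IsHomLift f (Gm θ)) {b : ℬ.obj}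
    {y y' : 𝒴.obj} (lam : LocCone w G Gm b y (𝟙 _)) {V : C} {m : ℬ.p.obj b ⟶ V}
    (μ : LocCone w G Gm b y' m) (hy : 𝒴.p.obj y = ℬ.p.obj b) (hy' : 𝒴.p.obj y' = V) :
    ∃! Ψ : y ⟶ y', 𝒴.p.IsHomLift m Ψ ∧ ∀ {a : 𝒜.obj} (k : w.obj a ⟶ b),
      lam.app k ≫ Ψ = μ.app k := by
  have hl {a : 𝒜.obj} (k : w.obj a ⟶ b) : 𝒴.p.IsHomLift (ℬ.p.map k) (lam.app k) := by
    simpa using lam.isHomLift k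
  obtain ⟨Ψ, ⟨h₁, h₂⟩, h₃⟩ := hm.existsUnique h𝒴 m hy hy' _ _ _
    (fun i : Σ a : 𝒜.obj, (w.obj a ⟶ b) => lam.app i.2) (fun i => μ.app i.2) (fun i => hl i.2)
    (fun i => μ.isHomLift i.2) (h.cov b) (fun i j d χ χ' e => by
      obtain ⟨a'', θ, θ', ε, e₁, rfl, rfl⟩ := h.exists_refinement h𝒴 hG i.2 j.2 χ χ'
        (lam.isHomLift i.2) (lam.isHomLift j.2) e (fun θ θ' e => by
          rw [lam.naturality, lam.naturality, e])
      rw [Category.assoc, Category.assoc, μ.naturality, μ.naturality, e₁])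
  exact ⟨Ψ, ⟨h₁, fun k => h₂ ⟨_, k⟩⟩, fun Ψ' h' => h₃ _ ⟨h'.1, fun i => h'.2 i.2⟩⟩

lemma ext_of_cone (h𝒴 : FibG 𝒴.p) (hm : GluesMor 𝒴.p J) {G : 𝒜.obj → 𝒴.obj}
    {Gm : ∀ {a a' : 𝒜.obj}, (a ⟶ a') → (G a ⟶ G a')} {b : ℬ.obj}
    {y y' : 𝒴.obj} (lam : LocCone w G Gm b y (𝟙 _)) {V : C} {m : ℬ.p.obj b ⟶ V}
    {Ψ Ψ' : y ⟶ y'} (hΨ : 𝒴.p.IsHomLift m Ψ) (hΨ' : 𝒴.p.IsHomLift m Ψ')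
    (e : ∀ {a : 𝒜.obj} (k : w.obj a ⟶ b), lam.app k ≫ Ψ = lam.app k ≫ Ψ') : Ψ = Ψ' :=
  hm.ext h𝒴 _ _ _ (fun i : Σ a : 𝒜.obj, (w.obj a ⟶ b) => lam.app i.2)
    (fun i => by simpa using lam.isHomLift i.2) (h.cov b) hΨ hΨ' fun i => e i.2

omit h in
/-- The cone that is given by a functor on `ℬ`. -/
def mapCone (w : BasedFunctor 𝒜 ℬ) (G : BasedFunctor ℬ 𝒴) (b : ℬ.obj) :
    LocCone w (fun a => G.obj (w.obj a)) (fun θ => G.map (w.map θ)) b (G.obj b) (𝟙 _) where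
  app k := G.map k
  isHomLift k := by simpa using map_isHomLift G (IsHomLift.map ℬ.p k)
  naturality θ k := (G.map_comp _ _).symm

omit h in
@[simp] lemma mapCone_app (w : BasedFunctor 𝒜 ℬ) (G : BasedFunctor ℬ 𝒴) (b : ℬ.obj) {a : 𝒜.obj}
    (k : w.obj a ⟶ b) : (mapCone w G b).app k = G.map k := rfl

lemma natTrans_ext (h𝒴 : FibG 𝒴.p) (hm : GluesMor 𝒴.p J) {G G' : BasedFunctor ℬ 𝒴}
    {β β' : BasedNatTrans G G'} (e : ∀ a, β.app (w.obj a) = β'.app (w.obj a)) : β = β' := by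
  apply BasedNatTrans.ext
  ext b
  refine h.ext_of_cone h𝒴 hm (mapCone w G b) (β.isHomLift' b) (β'.isHomLift' b) fun {a} k => ?_
  exact (β.naturality k).trans ((congrArg (· ≫ G'.map k) (e a)).trans (β'.naturality k).symm)

lemma exists_natTrans (h𝒴 : FibG 𝒴.p) (hm : GluesMor 𝒴.p J) {G G' : BasedFunctor ℬ 𝒴}
    (α : ∀ a, G.obj (w.obj a) ⟶ G'.obj (w.obj a))
    (hα : ∀ a, 𝒴.p.IsHomLift (𝟙 (𝒜.p.obj a)) (α a))
    (nat : ∀ {a a' : 𝒜.obj} (θ : a ⟶ a'), G.map (w.map θ) ≫ α a' = α a ≫ G'.map (w.map θ)) :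
    ∃ β : BasedNatTrans G G', ∀ a, β.app (w.obj a) = α a := by
  have hα' (a : 𝒜.obj) : 𝒴.p.IsHomLift (𝟙 (ℬ.p.obj (w.obj a))) (α a) := by
    rw [w.w_obj]; exact hα a
  let μ (b : ℬ.obj) : LocCone w (fun a => G.obj (w.obj a)) (fun θ => G.map (w.map θ)) b
      (G'.obj b) (𝟙 _) :=
    { app := fun {a} k => α a ≫ G'.map k
      isHomLift := fun {a} k => by
        rw [Category.comp_id]
        exact isHomLift_id_comp (hα' a) (map_isHomLift G' (IsHomLift.map ℬ.p k))
      naturality := fun {a a'} θ k => by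
        rw [← Category.assoc, nat, Category.assoc, G'.map_comp] }
  have key (b : ℬ.obj) := h.existsUnique_glue h𝒴 hm
    (G := fun a => G.obj (w.obj a)) (Gm := fun θ => G.map (w.map θ))
    (fun hθ => map_isHomLift G (map_isHomLift w hθ)) (mapCone w G b) (μ b) (G.w_obj b) (G'.w_obj b)
  choose β hβ hβ' using fun b => (key b).exists
  replace hβ' (b : ℬ.obj) {a : 𝒜.obj} (k : w.obj a ⟶ b) : G.map k ≫ β b = α a ≫ G'.map k :=
    hβ' b k
  refine ⟨{ app := β, naturality := fun b b' θ => ?_, isHomLift' := hβ }, fun a => ?_⟩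
  · refine h.ext_of_cone h𝒴 hm (mapCone w G b) (m := ℬ.p.map θ)
      (isHomLift_comp_id (map_isHomLift G (IsHomLift.map ℬ.p θ)) (hβ b'))
      (isHomLift_id_comp (hβ b) (map_isHomLift G' (IsHomLift.map ℬ.p θ))) fun {a} k => ?_
    have e₁ := hβ' b' (k ≫ θ)
    have e₂ := hβ' b k
    rw [mapCone_app, reassoc_of% e₂, ← G'.map_comp, ← e₁, G.map_comp, Category.assoc]
  · have := hβ' (w.obj a) (𝟙 _)
    simpa only [G.map_id, G'.map_id, Category.id_comp, Category.comp_id] using this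

/-- The values of a functor on the objects over `b` glue. -/
lemma exists_locCone (ho : GluesObj 𝒴.p J) (G : BasedFunctor 𝒜 𝒴) (b : ℬ.obj) :
    ∃ y : 𝒴.obj, 𝒴.p.obj y = ℬ.p.obj b ∧ Nonempty (LocCone w G.obj G.map b y (𝟙 _)) := by
  have hfaith := h.faithful
  have key (o : ObjectProperty.FullSubcategory
      (fun f : Over (ℬ.p.obj b) => imageSieve w b f.hom)) :
      ∃ (a : 𝒜.obj) (k : w.obj a ⟶ b), ℬ.p.IsHomLift o.obj.hom k := by
    obtain ⟨⟨a, k⟩, g, hg⟩ := (Sieve.mem_ofArrows_iff _ _ _).1 o.property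
    obtain ⟨a', θ, hθ⟩ := h.source.exists_lift' (w.w_obj a).symm g
    refine ⟨a', w.map θ ≫ k, ?_⟩
    rw [hg]
    exact isHomLift_comp (map_isHomLift w hθ) (IsHomLift.map ℬ.p k)
  choose a k hk using key
  have hmap {o o' : ObjectProperty.FullSubcategory
      (fun f : Over (ℬ.p.obj b) => imageSieve w b f.hom)} (g : o ⟶ o') :
      ∃ θ : a o ⟶ a o', 𝒜.p.IsHomLift g.hom.left θ ∧ w.map θ ≫ k o' = k o := by
    obtain ⟨φ, hφ, e⟩ := h.target.exists_fac (hk o') (k := g.hom.left) (ψ := k o)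
      (by rw [Over.w]; exact hk o)
    obtain ⟨θ, rfl, hθ⟩ := h.exists_map_eq hφ
    exact ⟨θ, hθ, e⟩
  choose θ hθ hθ' using @hmap
  have uniq {a₁ a₂ : 𝒜.obj} {U V : C} {f : U ⟶ V} {χ χ' : a₁ ⟶ a₂} (h₁ : 𝒜.p.IsHomLift f χ)
      (h₂ : 𝒜.p.IsHomLift f χ') (k : w.obj a₂ ⟶ b) (e : w.map χ ≫ k = w.map χ' ≫ k) : χ = χ' :=
    w.toFunctor.map_injective (h.target.hom_ext k (map_isHomLift w h₁) (map_isHomLift w h₂) e)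
  obtain ⟨y, l, hy, hl, hl'⟩ := ho _ (imageSieve w b) (h.cov b)
    { obj := fun o => G.obj (a o)
      map := fun g => G.map (θ g)
      map_id := fun o => by
        rw [uniq (hθ (𝟙 o)) (IsHomLift.id ((w.w_obj _).symm.trans (isHomLift_dom (hk o)))) (k o)
          (by rw [hθ', w.map_id, Category.id_comp]), G.map_id]
      map_comp := fun g g' => by
        rw [uniq (hθ (g ≫ g')) (isHomLift_comp (hθ g) (hθ g')) (k _)
          (by rw [hθ', w.map_comp, Category.assoc, hθ', hθ']), G.map_comp] }
    (fun g => map_isHomLift G (hθ g))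
  let o {a' : 𝒜.obj} (k' : w.obj a' ⟶ b) :
      ObjectProperty.FullSubcategory (fun f : Over (ℬ.p.obj b) => imageSieve w b f.hom) :=
    ⟨Over.mk (ℬ.p.map k'), Sieve.ofArrows_mk _ _ (⟨a', k'⟩ : Σ a, (w.obj a ⟶ b))⟩
  have hε {a' : 𝒜.obj} (k' : w.obj a' ⟶ b) : ∃ ε : a' ⟶ a (o k'),
      𝒜.p.IsHomLift (𝟙 (ℬ.p.obj (w.obj a'))) ε ∧ w.map ε ≫ k (o k') = k' := by
    obtain ⟨φ, hφ, e⟩ := h.target.exists_fac_id (hk (o k')) (IsHomLift.map ℬ.p k')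
    obtain ⟨θ, rfl, hθ⟩ := h.exists_map_eq hφ
    exact ⟨θ, hθ, e⟩
  choose ε hε hε' using @hε
  refine ⟨y, hy, ⟨⟨fun k' => G.map (ε k') ≫ l (o k'), fun k' => ?_, fun {a₁ a₂} θ' k' => ?_⟩⟩⟩
  · rw [Category.comp_id]
    exact isHomLift_id_comp (map_isHomLift G (hε k')) (hl (o k'))
  · let g : o (w.map θ' ≫ k') ⟶ o k' :=
      ⟨Over.homMk (ℬ.p.map (w.map θ')) (ℬ.p.map_comp _ _).symm⟩
    have hg : 𝒜.p.IsHomLift (ℬ.p.map (w.map θ')) (θ g) := hθ g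
    have e : θ' ≫ ε k' = ε (w.map θ' ≫ k') ≫ θ g :=
      uniq (isHomLift_comp_id (isHomLift_of_map w (IsHomLift.map ℬ.p (w.map θ'))) (hε k'))
        (isHomLift_id_comp (hε _) hg) (k (o k')) (by
          rw [w.map_comp, w.map_comp, Category.assoc, Category.assoc, hθ', hε', hε'])
    have e' := hl' g
    dsimp only at e'
    rw [← e', ← Category.assoc, ← Category.assoc, ← G.map_comp, ← G.map_comp, e]

lemma exists_extension (h𝒴 : FibG 𝒴.p) (hm : GluesMor 𝒴.p J) (ho : GluesObj 𝒴.p J)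
    (G : BasedFunctor 𝒜 𝒴) : ∃ (E : BasedFunctor ℬ 𝒴) (i : ∀ a, G.obj a ⟶ E.obj (w.obj a)),
      (∀ a, 𝒴.p.IsHomLift (𝟙 (𝒜.p.obj a)) (i a)) ∧
        ∀ {a a' : 𝒜.obj} (θ : a ⟶ a'), G.map θ ≫ i a' = i a ≫ E.map (w.map θ) := by
  choose y hy lam using h.exists_locCone ho G
  replace lam := fun b => (lam b).some
  have hl {b : ℬ.obj} {a : 𝒜.obj} (k : w.obj a ⟶ b) : 𝒴.p.IsHomLift (ℬ.p.map k) ((lam b).app k) := by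
    simpa using (lam b).isHomLift k
  let μ {b b' : ℬ.obj} (θ : b ⟶ b') : LocCone w G.obj G.map b (y b') (ℬ.p.map θ) :=
    { app := fun {a} k => (lam b').app (k ≫ θ)
      isHomLift := fun {a} k => by
        rw [← ℬ.p.map_comp]
        exact hl (k ≫ θ)
      naturality := fun {a a'} χ k => by
        rw [(lam b').naturality, Category.assoc] }
  have key {b b' : ℬ.obj} (θ : b ⟶ b') := h.existsUnique_glue h𝒴 hm
    (G := G.obj) (Gm := G.map) (fun hθ => map_isHomLift G hθ) (lam b) (μ θ) (hy b) (hy b')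
  choose E hE hE' using fun {b b'} (θ : b ⟶ b') => (key θ).exists
  replace hE' {b b' : ℬ.obj} (θ : b ⟶ b') {a : 𝒜.obj} (k : w.obj a ⟶ b) :
    (lam b).app k ≫ E θ = (lam b').app (k ≫ θ) := hE' θ k
  refine ⟨basedFunctorMk
    { obj := y
      map := E
      map_id := fun b => h.ext_of_cone h𝒴 hm (lam b) (hE (𝟙 b))
        (by rw [ℬ.p.map_id]; exact IsHomLift.id (hy b)) fun k => by
          rw [hE', Category.comp_id, Category.comp_id]
      map_comp := fun θ θ' => h.ext_of_cone h𝒴 hm (lam _) (hE (θ ≫ θ'))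
        (by rw [ℬ.p.map_comp]; exact isHomLift_comp (hE θ) (hE θ')) fun k => by
          rw [hE', ← Category.assoc, ← Category.assoc, hE', hE'] } hy hE,
    fun a => (lam (w.obj a)).app (𝟙 _), fun a => ?_, fun {a a'} θ => ?_⟩
  · have := hl (𝟙 (w.obj a))
    rw [ℬ.p.map_id] at this
    exact isHomLift_id_congr (w.w_obj a) this
  · refine ((lam _).naturality θ (𝟙 _)).trans (Eq.trans ?_ (hE' (w.map θ) (𝟙 _)).symm)
    rw [Category.id_comp, Category.comp_id]

end IsLocalEquiv

end LocalEquiv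

section

variable {S : SpaceCat.{v, u}} {𝒜 ℬ 𝒴 : BasedCategory.{v, max u v} S.Obj}

lemma isEquivalence_precomp {w : 𝒜 ⟶ ℬ} (h : IsLocalEquiv w S.topology)
    (h𝒴 : FibG 𝒴.p) (hm : GluesMor 𝒴.p S.topology) (ho : GluesObj 𝒴.p S.topology) :
    (Bicategory.precomp 𝒴 w).IsEquivalence where
  faithful := ⟨fun {G G'} β β' e => h.natTrans_ext h𝒴 hm fun a =>
    congrArg (fun γ : BasedNatTrans _ _ => γ.app a) e⟩
  full := ⟨fun {G G'} α => by
    obtain ⟨β, hβ⟩ := h.exists_natTrans h𝒴 hm (G := G) (G' := G') (fun a => α.toNatTrans.app a)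
      (fun a => α.isHomLift' a) (fun θ => α.toNatTrans.naturality θ)
    exact ⟨β, BasedNatTrans.ext _ _ (NatTrans.ext (funext hβ))⟩⟩
  essSurj := ⟨fun G => by
    obtain ⟨E, i, hi, hi'⟩ := h.exists_extension h𝒴 hm ho G
    let α : BasedNatTrans G ((Bicategory.precomp 𝒴 w).obj E) :=
      { app := i
        naturality := fun _ _ θ => hi' θ
        isHomLift' := hi }
    have : ∀ a, IsIso (α.app a) := fun a => h𝒴.isIso_of_id (hi a)
    have : IsIso α.toNatTrans := NatIso.isIso_of_isIso_app _
    have : IsIso (C := BasedFunctor 𝒜 𝒴) α :=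
      BasedNatIso.isIso_of_toNatTrans_isIso α
    exact ⟨E, ⟨(asIso (C := BasedFunctor 𝒜 𝒴) α).symm⟩⟩⟩

lemma IsLocalEquiv.precomp {w : 𝒜 ⟶ ℬ} (h : IsLocalEquiv w S.topology) (h𝒴 : IsStack 𝒴) :
    (Bicategory.precomp 𝒴 w).IsEquivalence :=
  isEquivalence_precomp h h𝒴.fibG h𝒴.gluesMor h𝒴.gluesObj

lemma isLocalEquiv_sieveIncl {U : S.Obj} (R : Sieve U) (hR : R ∈ S.topology U) :
    IsLocalEquiv (sieveIncl R) S.topology where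
  source :=
    { exists_lift := fun a f => by
        let b : (sieveBased R).obj := sieveBased.mk (f ≫ overBased.hom ((sieveIncl R).obj a))
          (R.downward_closed (sieveBased.property a) f)
        obtain ⟨φ, hφ⟩ := (sieveIncl R).toFunctor.map_surjective (X := b) (Y := a)
          (overBased.homMk f rfl)
        refine ⟨b, φ, isHomLift_of_map (sieveIncl R) ?_⟩
        rw [show (sieveIncl R).map φ = _ from hφ]
        exact IsHomLift.map (overBased U).p (overBased.homMk (o := (sieveIncl R).obj b) f rfl)
      exists_fac := fun {a b c X Y Z f φ k ψ} h₁ h₂ => by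
        obtain ⟨χ, hχ, e⟩ := (fibG_overBased U).exists_fac (map_isHomLift (sieveIncl R) h₁)
          (map_isHomLift (sieveIncl R) h₂)
        obtain ⟨χ, rfl⟩ := (sieveIncl R).toFunctor.map_surjective χ
        exact ⟨χ, isHomLift_of_map _ hχ, (sieveIncl R).toFunctor.map_injective
          (((sieveIncl R).map_comp _ _).trans e)⟩
      hom_ext := fun φ χ χ' h₁ h₂ e => (sieveIncl R).toFunctor.map_injective
        ((fibG_overBased U).hom_ext ((sieveIncl R).map φ) (map_isHomLift (sieveIncl R) h₁)
          (map_isHomLift (sieveIncl R) h₂) (by rw [← (sieveIncl R).map_comp, e,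
            (sieveIncl R).map_comp])) }
  target := fibG_overBased U
  full := inferInstance
  faithful := inferInstance
  cov b := by
    refine S.topology.superset_covering ?_
      (S.topology.pullback_stable (overBased.hom b) hR)
    intro V f hf
    exact Sieve.ofArrows_mk (I := Σ a : (sieveBased R).obj, ((sieveIncl R).obj a ⟶ b))
      (fun i => (overBased U).p.obj ((sieveIncl R).obj i.1))
      (fun i => (overBased U).p.map i.2) ⟨sieveBased.mk (f ≫ overBased.hom b) hf,
        overBased.homMk f rfl⟩

lemma isStack_of_glues (h𝒴 : FibG 𝒴.p) (hm : GluesMor 𝒴.p S.topology)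
    (ho : GluesObj 𝒴.p S.topology) : IsStack 𝒴 where
  isFiberedInGroupoids := h𝒴.isFiberedInGroupoids
  descent R hR := isEquivalence_precomp (isLocalEquiv_sieveIncl R hR) h𝒴 hm ho

end

end Orbi

namespace Orbi

section LocRep

universe w w' v₁ u₁ v₂ u₂

variable {C : Type u₁} [Category.{v₁} C] {𝒜 : Type u₂} [Category.{v₂} 𝒜]

/-- A presheaf `P` on a category `𝒜` over `C` that is locally representable over an object `M` of
`C`: these are the objects over `M` of the stack associated with `𝒜`. -/
structure LocRep (p : 𝒜 ⥤ C) (J : GrothendieckTopology C) where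
  M : C
  val : 𝒜 → Type w
  res : ∀ {a b : 𝒜}, (b ⟶ a) → val a → val b
  res_id : ∀ {a : 𝒜} (x : val a), res (𝟙 a) x = x
  res_comp : ∀ {a b c : 𝒜} (θ : c ⟶ b) (φ : b ⟶ a) (x : val a), res (θ ≫ φ) x = res θ (res φ x)
  π : ∀ {a : 𝒜}, val a → (p.obj a ⟶ M)
  π_res : ∀ {a b : 𝒜} (φ : b ⟶ a) (x : val a), π (res φ x) = p.map φ ≫ π x
  cart : ∀ {a b : 𝒜} (x : val a) (y : val b) (k : p.obj a ⟶ p.obj b), π x = k ≫ π y →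
    ∃! φ : a ⟶ b, p.map φ = k ∧ res φ y = x
  loc : Sieve.ofArrows (fun i : Σ a, val a => p.obj i.1) (fun i => π i.2) ∈ J M
  glue : ∀ {a : 𝒜} (m : p.obj a ⟶ M) (R : Sieve (p.obj a)), R ∈ J (p.obj a) →
    ∀ x : ∀ {c : 𝒜} (χ : c ⟶ a), R (p.map χ) → val c,
    (∀ {c : 𝒜} (χ : c ⟶ a) (h : R (p.map χ)), π (x χ h) = p.map χ ≫ m) →
    (∀ {c d : 𝒜} (θ : d ⟶ c) (χ : c ⟶ a) (h : R (p.map χ)) (h' : R (p.map (θ ≫ χ))),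
      x (θ ≫ χ) h' = res θ (x χ h)) →
    ∃ y : val a, π y = m ∧ ∀ {c : 𝒜} (χ : c ⟶ a) (h : R (p.map χ)), res χ y = x χ h

namespace LocRep

variable {p : 𝒜 ⥤ C} {J : GrothendieckTopology C}

/-- Morphisms of locally representable presheaves. -/
@[ext]
structure Hom (P : LocRep.{w} p J) (Q : LocRep.{w'} p J) where
  f : P.M ⟶ Q.M
  app : ∀ {a : 𝒜}, P.val a → Q.val a
  app_res : ∀ {a b : 𝒜} (φ : b ⟶ a) (x : P.val a), app (P.res φ x) = Q.res φ (app x)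
  π_app : ∀ {a : 𝒜} (x : P.val a), Q.π (app x) = P.π x ≫ f

instance : Category (LocRep.{w} p J) where
  Hom := Hom
  id P := ⟨𝟙 _, fun x => x, fun _ _ => rfl, fun _ => by simp⟩
  comp α β := ⟨α.f ≫ β.f, fun x => β.app (α.app x), fun φ x => by rw [α.app_res, β.app_res],
    fun x => by rw [β.π_app, α.π_app, Category.assoc]⟩
  id_comp α := Hom.ext (by simp) rfl
  comp_id α := Hom.ext (by simp) rfl
  assoc α β γ := Hom.ext (by simp) rfl

@[simp] lemma comp_app {P Q T : LocRep.{w} p J} (α : P ⟶ Q) (β : Q ⟶ T) {a : 𝒜} (x : P.val a) :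
    (α ≫ β).app x = β.app (α.app x) := rfl

@[ext]
lemma hom_ext' {P Q : LocRep.{w} p J} {α β : P ⟶ Q} (h : α.f = β.f)
    (h' : ∀ {a : 𝒜} (x : P.val a), α.app x = β.app x) : α = β :=
  Hom.ext h (by funext a x; exact h' x)

/-- The base of a locally representable presheaf. -/
abbrev base (p : 𝒜 ⥤ C) (J : GrothendieckTopology C) : LocRep.{w} p J ⥤ C where
  obj := M
  map α := Hom.f α

section

variable (hp : FibG p) (hm : GluesMor p J)

include hp in
lemma _root_.Orbi.FibG.exists_iso_lift {b : 𝒜} {V : C} (k : V ⟶ p.obj b) :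
    ∃ (c : 𝒜) (φ : c ⟶ b) (e : V ⟶ p.obj c), IsIso e ∧ e ≫ p.map φ = k := by
  obtain ⟨c, φ, h⟩ := hp.exists_lift b k
  refine ⟨c, φ, eqToHom (isHomLift_dom h).symm, inferInstance, ?_⟩
  rw [IsHomLift.fac' p k φ]
  simp

include hp in
lemma _root_.Orbi.FibG.exists_map_eq {a b c : 𝒜} (φ : b ⟶ c) (ψ : a ⟶ c) (k : p.obj a ⟶ p.obj b)
    (h : p.map ψ = k ≫ p.map φ) : ∃! χ : a ⟶ b, p.map χ = k ∧ χ ≫ φ = ψ := by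
  obtain ⟨χ, h₁, h₂⟩ := hp.exists_fac (IsHomLift.map p φ) (k := k) (ψ := ψ)
    (by rw [← h]; exact IsHomLift.map p ψ)
  refine ⟨χ, ⟨(IsHomLift.eq_of_isHomLift p k χ).symm, h₂⟩, fun χ' h' => ?_⟩
  refine hp.hom_ext φ (k := k) ?_ h₁ (h'.2.trans h₂.symm)
  rw [← h'.1]
  exact IsHomLift.map p χ'

include hm in
lemma sep (P : LocRep.{w} p J) {a : 𝒜} {x y : P.val a} (h : P.π x = P.π y) (R : Sieve (p.obj a))
    (hR : R ∈ J (p.obj a)) (e : ∀ {c : 𝒜} (χ : c ⟶ a), R (p.map χ) → P.res χ x = P.res χ y) :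
    x = y := by
  obtain ⟨φ, ⟨h₁, h₂⟩, -⟩ := P.cart x y (𝟙 _) (by rw [h, Category.id_comp])
  have : φ = 𝟙 a := by
    refine (hm a a (𝟙 _) R hR (fun χ _ => χ) (by simp) (by simp)).unique
      ⟨h₁.trans (by simp), fun {c} χ hχ => ?_⟩ ⟨by simp, by simp⟩
    refine (P.cart (P.res χ x) y (p.map χ) (by rw [P.π_res, h])).unique ⟨?_, ?_⟩ ⟨rfl, ?_⟩
    · rw [p.map_comp, h₁, Category.comp_id]
    · rw [P.res_comp, h₂]
    · rw [e χ hχ]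
  rw [← h₂, this, P.res_id]

include hm in
/-- Morphisms of locally representable presheaves are cartesian. -/
lemma exists_lift (P : LocRep.{w} p J) (Q : LocRep.{w'} p J) (α : Hom P Q) {a : 𝒜} (y : Q.val a)
    (l : p.obj a ⟶ P.M) (h : Q.π y = l ≫ α.f) : ∃! x : P.val a, P.π x = l ∧ α.app x = y := by
  have uniq {a : 𝒜} {x x' : P.val a} (h₁ : P.π x = P.π x') (h₂ : α.app x = α.app x') :
      x = x' := by
    obtain ⟨φ, ⟨k₁, k₂⟩, -⟩ := P.cart x x' (𝟙 _) (by rw [h₁, Category.id_comp])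
    have : φ = 𝟙 a := (Q.cart (α.app x) (α.app x') (𝟙 _) (by rw [h₂, Category.id_comp])).unique
      ⟨k₁, by rw [← α.app_res, k₂]⟩ ⟨p.map_id _, by rw [Q.res_id, h₂]⟩
    rw [← k₂, this, P.res_id]
  have key {c : 𝒜} (χ : c ⟶ a) (hχ : Sieve.pullback l (Sieve.ofArrows _ fun i : Σ a, P.val a =>
      P.π i.2) (p.map χ)) : ∃ x : P.val c, P.π x = p.map χ ≫ l ∧ α.app x = Q.res χ y := by
    obtain ⟨⟨d, ξ⟩, k, hk⟩ := (Sieve.mem_ofArrows_iff _ _ _).1 hχ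
    obtain ⟨φ, ⟨h₁, h₂⟩, -⟩ := Q.cart (Q.res χ y) (α.app ξ) k (by
      rw [Q.π_res, h, α.π_app, reassoc_of% hk])
    exact ⟨P.res φ ξ, by rw [P.π_res, h₁, hk], by rw [α.app_res, h₂]⟩
  choose x hx hx' using @key
  obtain ⟨z, hz, hz'⟩ := P.glue l _ (J.pullback_stable l P.loc) x hx (fun θ χ h₁ h₂ =>
    uniq (by rw [hx, P.π_res, hx, p.map_comp, Category.assoc])
      (by rw [hx', α.app_res, hx', Q.res_comp]))
  refine ⟨z, ⟨hz, ?_⟩, fun z' h' => uniq (h'.1.trans hz.symm) (h'.2.trans (Eq.symm ?_))⟩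
  all_goals
    refine Q.sep hm ?_ _ (J.pullback_stable l P.loc) fun {c} χ hχ => ?_
    · rw [α.π_app, hz, h]
    · rw [← α.app_res, hz' χ hχ, hx']

end

/-- The presheaf that is represented by an object. -/
abbrev yon (hp : FibG p) (hm : GluesMor p J) (a : 𝒜) : LocRep.{v₂} p J where
  M := p.obj a
  val b := b ⟶ a
  res θ φ := θ ≫ φ
  res_id := Category.id_comp
  res_comp θ φ x := Category.assoc θ φ x
  π φ := p.map φ
  π_res θ φ := p.map_comp θ φ
  cart x y k h := hp.exists_map_eq y x k h
  loc := by
    refine J.superset_covering ?_ (J.top_mem _)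
    intro V k _
    have := Sieve.ofArrows_mk (I := Σ b, (b ⟶ a)) (fun i => p.obj i.1) (fun i => p.map i.2) ⟨a, 𝟙 a⟩
    simpa using Sieve.downward_closed _ this k
  glue m R hR x h₁ h₂ := (hm _ _ m R hR x h₁ h₂).exists

section

variable (hp : FibG p) (hm : GluesMor p J)

@[simp] lemma yon_res {a b c : 𝒜} (θ : c ⟶ b) (φ : b ⟶ a) :
    (yon hp hm a).res θ φ = θ ≫ φ := rfl

@[simp] lemma yon_π {a b : 𝒜} (φ : b ⟶ a) : (yon hp hm a).π φ = p.map φ := rfl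

/-- The morphism from a representable presheaf that is given by an element. -/
def ofElem (P : LocRep.{v₂} p J) {a : 𝒜} (x : P.val a) : yon hp hm a ⟶ P where
  f := P.π x
  app φ := P.res φ x
  app_res θ φ := P.res_comp θ φ x
  π_app φ := P.π_res φ x

@[simp] lemma ofElem_app (P : LocRep.{v₂} p J) {a b : 𝒜} (x : P.val a) (φ : b ⟶ a) :
    (ofElem hp hm P x).app φ = P.res φ x := rfl

@[simp] lemma ofElem_f (P : LocRep.{v₂} p J) {a : 𝒜} (x : P.val a) :
    Hom.f (ofElem hp hm P x) = P.π x := rfl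

lemma ofElem_comp {P Q : LocRep.{v₂} p J} (α : P ⟶ Q) {a : 𝒜} (x : P.val a) :
    ofElem hp hm P x ≫ α = ofElem hp hm Q (α.app x) :=
  hom_ext' (α.π_app x).symm fun φ => α.app_res φ x

lemma ofElem_app_id {P : LocRep.{v₂} p J} {a : 𝒜} (α : yon hp hm a ⟶ P) :
    ofElem hp hm P (α.app (𝟙 a)) = α := by
  refine hom_ext' ?_ fun φ => ?_
  · rw [ofElem_f, α.π_app, yon_π, p.map_id, Category.id_comp]
  · rw [ofElem_app, ← α.app_res, yon_res, Category.comp_id]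

/-- The Yoneda embedding. -/
abbrev yoneda : 𝒜 ⥤ LocRep.{v₂} p J where
  obj := yon hp hm
  map φ := ofElem hp hm _ φ
  map_id a := hom_ext' (p.map_id a) fun φ => Category.comp_id φ
  map_comp φ ψ := hom_ext' (p.map_comp φ ψ) fun χ => (Category.assoc χ φ ψ).symm

instance : (yoneda hp hm).Full where
  map_surjective α := ⟨α.app (𝟙 _), ofElem_app_id hp hm α⟩

instance : (yoneda hp hm).Faithful where
  map_injective {a b φ ψ} h := by
    have := congrArg (fun α : yon hp hm a ⟶ yon hp hm b => α.app (𝟙 a)) h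
    simpa only [yoneda, ofElem_app, yon_res, Category.id_comp] using this

lemma isHomLift_base {P Q : LocRep.{w} p J} {U V : C} {g : U ⟶ V} {α : P ⟶ Q}
    (h : (base p J).IsHomLift g α) : ∃ (hU : P.M = U) (hV : Q.M = V),
      g = eqToHom hU.symm ≫ α.f ≫ eqToHom hV :=
  ⟨isHomLift_dom h, isHomLift_cod h, IsHomLift.fac (base p J) g α⟩

/-- The restriction of a locally representable presheaf to an object of `C` over its base. -/
def pull (hp : FibG p) (P : LocRep.{v₁} p J) {V : C} (f : V ⟶ P.M) : LocRep.{v₁} p J where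
  M := V
  val a := { x : (p.obj a ⟶ V) × P.val a // x.1 ≫ f = P.π x.2 }
  res φ x := ⟨(p.map φ ≫ x.1.1, P.res φ x.1.2), by simp [P.π_res, x.2]⟩
  res_id x := Subtype.ext (Prod.ext (by simp) (P.res_id _))
  res_comp θ φ x := Subtype.ext (Prod.ext (by simp) (P.res_comp _ _ _))
  π x := x.1.1
  π_res φ x := rfl
  cart := by
    rintro a b ⟨⟨x, ξ⟩, hx⟩ ⟨⟨y, η⟩, hy⟩ k (rfl : x = k ≫ y)
    obtain ⟨φ, ⟨h₁, h₂⟩, h₃⟩ := P.cart ξ η k (by rw [← hx, ← hy, Category.assoc])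
    refine ⟨φ, ⟨h₁, Subtype.ext (Prod.ext (by simp [h₁]) h₂)⟩, fun φ' h' => h₃ φ' ⟨h'.1, ?_⟩⟩
    exact congrArg (fun z => z.1.2) h'.2
  loc := by
    refine J.superset_covering ?_ (J.pullback_stable f P.loc)
    intro W j hj
    obtain ⟨⟨d, ξ⟩, k, hk⟩ := (Sieve.mem_ofArrows_iff _ _ _).1 hj
    obtain ⟨c, φ, e, he, h⟩ := hp.exists_iso_lift k
    have h' : (inv e ≫ j) ≫ f = P.π (P.res φ ξ) := by
      rw [P.π_res, Category.assoc, hk, ← h]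
      simp
    rw [Sieve.mem_ofArrows_iff]
    exact ⟨⟨c, ⟨(inv e ≫ j, P.res φ ξ), h'⟩⟩, e, by simp⟩
  glue {a} m R hR x h₁ h₂ := by
    obtain ⟨y, hy, hy'⟩ := P.glue (m ≫ f) R hR (fun χ h => (x χ h).1.2)
      (fun χ h => by rw [← (x χ h).2, h₁, Category.assoc])
      (fun θ χ h h' => congrArg (fun z => z.1.2) (h₂ θ χ h h'))
    exact ⟨⟨(m, y), hy.symm⟩, rfl, fun χ h => Subtype.ext (Prod.ext (h₁ χ h).symm (hy' χ h))⟩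

include hm in
lemma fibG_base (hp : FibG p) : FibG (base.{v₁} p J) where
  exists_lift P f := ⟨pull hp P f, ⟨f, fun x => x.1.2, fun _ _ => rfl, fun x => x.2.symm⟩,
    IsHomLift.map (base.{v₁} p J) (a := pull hp P f) (b := P) ⟨f, _, _, _⟩⟩
  exists_fac {P Q T U V W f φ k ψ} h₁ h₂ := by
    obtain ⟨rfl, rfl, rfl⟩ := isHomLift_base h₁
    obtain ⟨rfl, _, h₂⟩ := isHomLift_base h₂
    simp only [eqToHom_refl, Category.comp_id, Category.id_comp] at h₂
    choose x hx hx' using fun {a : 𝒜} (y : P.val a) => (exists_lift hm Q T φ (ψ.app y)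
      (P.π y ≫ k) (by rw [ψ.π_app, ← h₂, Category.assoc])).exists
    refine ⟨⟨k, x, fun θ y => ?_, hx⟩, IsHomLift.map (base.{v₁} p J) (a := P) (b := Q) ⟨k, _, _, _⟩,
      hom_ext' h₂ hx'⟩
    exact (exists_lift hm Q T φ (ψ.app (P.res θ y)) (P.π (P.res θ y) ≫ k) (by
      rw [ψ.π_app, ← h₂, Category.assoc])).unique ⟨hx _, hx' _⟩
      ⟨by rw [Q.π_res, hx, P.π_res, Category.assoc], by rw [φ.app_res, hx', ψ.app_res]⟩
  hom_ext {P Q T U V k} φ χ χ' h₁ h₂ e := by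
    have hf : χ.f = χ'.f := by
      obtain ⟨rfl, rfl, rfl⟩ := isHomLift_base h₁
      obtain ⟨_, _, h₂⟩ := isHomLift_base h₂
      simpa using h₂
    refine hom_ext' hf fun y => ?_
    exact (exists_lift hm Q T φ (φ.app (χ.app y)) (Q.π (χ.app y)) (φ.π_app _)).unique ⟨rfl, rfl⟩
      ⟨by rw [χ'.π_app, χ.π_app, hf], (congrArg (fun α : P ⟶ T => α.app y) e).symm⟩

include hp hm in
lemma gluesMor_base : GluesMor (base.{v₂} p J) J := by
  intro P Q m R hR ψ hψ hψ'
  change P.M ⟶ Q.M at m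
  change Sieve P.M at R
  have hv {a : 𝒜} (y : P.val a) (hy : R (P.π y)) : ∃ x : Q.val a, Q.π x = P.π y ≫ m ∧
      ∀ {O : LocRep.{v₂} p J} (φ : O ⟶ P) (hφ : R φ.f) (b : 𝒜) (χ : b ⟶ a) (ζ : O.val b),
        φ.app ζ = P.res χ y → (ψ φ hφ).app ζ = Q.res χ x := by
    have e : Hom.f (ψ (ofElem hp hm P y) hy) = P.π y ≫ m := hψ _ _
    refine ⟨(ψ (ofElem hp hm P y) hy).app (𝟙 a), ?_, fun {O} φ hφ b χ ζ h => ?_⟩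
    · rw [Hom.π_app, e, yon_π, p.map_id]
      exact Category.id_comp _
    · have e₁ : ofElem hp hm O ζ ≫ φ = ofElem hp hm _ χ ≫ ofElem hp hm P y := by
        rw [ofElem_comp, ofElem_comp, h]
        rfl
      have h₁ : R (Hom.f (ofElem hp hm _ χ ≫ ofElem hp hm P y)) := R.downward_closed hy _
      have h₂ : R (Hom.f (ofElem hp hm O ζ ≫ φ)) := R.downward_closed hφ _
      have e₂ := hψ' (ofElem hp hm O ζ) φ hφ h₂
      have e₃ := hψ' (ofElem hp hm _ χ) (ofElem hp hm P y) hy h₁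
      have e₄ : ψ (ofElem hp hm O ζ ≫ φ) h₂ = ψ (ofElem hp hm _ χ ≫ ofElem hp hm P y) h₁ := by
        congr 1
      have e₅ := congrArg (fun α : yon hp hm b ⟶ Q => α.app (𝟙 b)) (e₂.symm.trans (e₄.trans e₃))
      simp only [comp_app, ofElem_app, O.res_id, Category.id_comp] at e₅
      rw [e₅, ← Hom.app_res, yon_res, Category.comp_id]
  choose v hv₁ hv₂ using @hv
  have hv₃ {a b : 𝒜} (y : P.val a) (hy : R (P.π y)) (χ : b ⟶ a) (hy' : R (P.π (P.res χ y))) :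
      v (P.res χ y) hy' = Q.res χ (v y hy) := by
    rw [← Q.res_id (v (P.res χ y) hy'), ← hv₂ (P.res χ y) hy' (ofElem hp hm P y) hy b (𝟙 b) χ
      (by rw [P.res_id, ofElem_app])]
    exact hv₂ y hy (ofElem hp hm P y) hy b χ χ rfl
  have hS {a : 𝒜} (y : P.val a) : R.pullback (P.π y) ∈ J (p.obj a) := J.pullback_stable _ hR
  have hS' {a c : 𝒜} (y : P.val a) (χ : c ⟶ a) (h : R.pullback (P.π y) (p.map χ)) :
      R (P.π (P.res χ y)) := by
    rw [P.π_res]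
    exact h
  have key {a : 𝒜} (y : P.val a) := Q.glue (P.π y ≫ m) (R.pullback (P.π y)) (hS y)
    (fun {c} χ h => v (P.res χ y) (hS' y χ h))
    (fun {c} χ h => by rw [hv₁, P.π_res, Category.assoc])
    (fun {c d} θ χ h h' => by
      have e := hv₃ (P.res χ y) (hS' y χ h) θ (by rw [← P.res_comp]; exact hS' y _ h')
      rw [← e]
      congr 1
      exact P.res_comp _ _ _)
  choose z hz hz' using @key
  have hsep {a : 𝒜} {x x' : Q.val a} (y : P.val a) (h₁ : Q.π x = Q.π x')
      (h₂ : ∀ {c : 𝒜} (χ : c ⟶ a), R.pullback (P.π y) (p.map χ) → Q.res χ x = Q.res χ x') :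
      x = x' := Q.sep hm h₁ _ (hS y) h₂
  let Ψ : P ⟶ Q := ⟨m, z, fun {a b} φ y => hsep (P.res φ y) (by
      rw [hz, Q.π_res, hz, P.π_res, Category.assoc]) fun χ hχ => by
        have hχ' : R.pullback (P.π y) (p.map (χ ≫ φ)) := by
          have := hS' _ χ hχ
          rw [P.π_res, P.π_res, ← Category.assoc, ← p.map_comp] at this
          exact this
        rw [hz' _ _ hχ, ← Q.res_comp, hz' y (χ ≫ φ) hχ']
        congr 1
        exact (P.res_comp _ _ _).symm, hz⟩
  refine ⟨Ψ, ⟨rfl, fun {O} φ hφ => hom_ext' (hψ φ hφ).symm fun {a} ζ => ?_⟩,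
    fun Ψ' h' => hom_ext' h'.1 fun {a} y => ?_⟩
  · have e : (ψ φ hφ).f = φ.f ≫ m := hψ φ hφ
    refine hsep (φ.app ζ) ?_ fun {c} χ hχ => ?_
    · rw [Hom.π_app, Hom.π_app]
      exact congrArg (O.π ζ ≫ ·) e.symm
    · refine (hz' _ _ hχ).trans ?_
      refine Eq.trans ?_ ((ψ φ hφ).app_res χ ζ)
      exact (Q.res_id _).symm.trans
        (hv₂ _ (hS' _ χ hχ) φ hφ c (𝟙 c) _ (by rw [P.res_id, φ.app_res])).symm
  · have e : Ψ'.f = m := h'.1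
    refine hsep y ?_ fun {c} χ hχ => ?_
    · rw [Hom.π_app, hz, e]
    · rw [hz' _ _ hχ, ← Hom.app_res]
      have e₁ := h'.2 (ofElem hp hm P (P.res χ y)) (hS' y χ hχ)
      have e₂ := hv₂ (P.res χ y) (hS' y χ hχ) (ofElem hp hm P (P.res χ y)) (hS' y χ hχ) c (𝟙 c) (𝟙 c) rfl
      rw [← Q.res_id (v _ _), ← e₂, ← e₁, comp_app, ofElem_app, P.res_id]

end

end LocRep

end LocRep

end Orbi

namespace Orbi

section LocRep

universe w w' v₁ u₁ v₂ u₂ v₃ u₃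

variable {C : Type u₁} [Category.{v₁} C] {𝒜 : Type u₂} [Category.{v₂} 𝒜]

namespace LocRep

variable {p : 𝒜 ⥤ C} {J : GrothendieckTopology C}

/-- A diagram of locally representable presheaves over the members of a covering sieve of `U`. -/
structure GlueData (p : 𝒜 ⥤ C) (J : GrothendieckTopology C) (I : Type u₃) [Category.{v₃} I] where
  D : I ⥤ LocRep.{w} p J
  U : C
  h : ∀ o, (D.obj o).M ⟶ U
  comm : ∀ {o o' : I} (g : o ⟶ o'), Hom.f (D.map g) ≫ h o' = h o
  inj : ∀ {o o' : I} {g g' : o ⟶ o'}, Hom.f (D.map g) = Hom.f (D.map g') → g = g'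
  refine : ∀ {V : C} {o o' : I} (k : V ⟶ (D.obj o).M) (k' : V ⟶ (D.obj o').M),
    k ≫ h o = k' ≫ h o' → ∃ (o₁ : I) (g : o₁ ⟶ o) (g' : o₁ ⟶ o') (e : V ⟶ (D.obj o₁).M),
      IsIso e ∧ e ≫ Hom.f (D.map g) = k ∧ e ≫ Hom.f (D.map g') = k'
  cov : Sieve.ofArrows _ h ∈ J U

namespace GlueData

variable {I : Type u₃} [Category.{v₃} I] (G : GlueData.{w} p J I) (hp : FibG p)
  (hm : GluesMor p J)

/-- Two elements agree if they come from a common element. -/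
def Rel {a : 𝒜} {o o' : I} (x : (G.D.obj o).val a) (x' : (G.D.obj o').val a) : Prop :=
  ∃ (o₁ : I) (g : o₁ ⟶ o) (g' : o₁ ⟶ o') (ζ : (G.D.obj o₁).val a),
    (G.D.map g).app ζ = x ∧ (G.D.map g').app ζ = x'

variable {G} {a b : 𝒜} {o o' o'' : I} {x : (G.D.obj o).val a} {x' : (G.D.obj o').val a}
  {x'' : (G.D.obj o'').val a}

lemma rel_map (g : o ⟶ o') (x : (G.D.obj o).val a) : G.Rel x ((G.D.map g).app x) :=
  ⟨o, 𝟙 o, g, x, by rw [G.D.map_id]; rfl, rfl⟩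

lemma Rel.symm (h : G.Rel x x') : G.Rel x' x := by
  obtain ⟨o₁, g, g', ζ, h, h'⟩ := h
  exact ⟨o₁, g', g, ζ, h', h⟩

lemma Rel.res (h : G.Rel x x') (θ : b ⟶ a) :
    G.Rel ((G.D.obj o).res θ x) ((G.D.obj o').res θ x') := by
  obtain ⟨o₁, g, g', ζ, h, h'⟩ := h
  exact ⟨o₁, g, g', (G.D.obj o₁).res θ ζ, by rw [Hom.app_res, h], by rw [Hom.app_res, h']⟩

include hm in
lemma exists_rel (x : (G.D.obj o).val a) (k : p.obj a ⟶ (G.D.obj o').M)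
    (h : (G.D.obj o).π x ≫ G.h o = k ≫ G.h o') :
    ∃ x' : (G.D.obj o').val a, (G.D.obj o').π x' = k ∧ G.Rel x x' := by
  obtain ⟨o₁, g, g', e, -, e₁, e₂⟩ := G.refine _ _ h
  obtain ⟨ζ, h₁, h₂⟩ := (exists_lift hm _ _ (G.D.map g) x e e₁.symm).exists
  exact ⟨(G.D.map g').app ζ, by rw [Hom.π_app, h₁, e₂], o₁, g, g', ζ, h₂, rfl⟩

include hm in
lemma Rel.trans (h : G.Rel x x') (h' : G.Rel x' x'') : G.Rel x x'' := by
  obtain ⟨o₁, g₁, g₁', ζ₁, rfl, rfl⟩ := h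
  obtain ⟨o₂, g₂, g₂', ζ₂, h₂, rfl⟩ := h'
  have e : (G.D.obj o₁).π ζ₁ ≫ G.h o₁ = (G.D.obj o₂).π ζ₂ ≫ G.h o₂ := by
    have := congrArg (fun z => (G.D.obj o').π z ≫ G.h o') h₂
    simp only [Hom.π_app, Category.assoc, G.comm] at this
    exact this.symm
  obtain ⟨o₃, g, g', k, _, e₁, e₂⟩ := G.refine _ _ e
  obtain ⟨ζ, h₃, rfl⟩ := (exists_lift hm _ _ (G.D.map g) ζ₁ k e₁.symm).exists
  have hg : g ≫ g₁' = g' ≫ g₂ := by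
    apply G.inj
    rw [← cancel_epi k]
    have := congrArg (G.D.obj o').π h₂
    rw [Hom.π_app, Hom.π_app] at this
    rw [G.D.map_comp, G.D.map_comp]
    change k ≫ Hom.f _ ≫ Hom.f _ = k ≫ Hom.f _ ≫ Hom.f _
    rw [reassoc_of% e₁, reassoc_of% e₂, this]
  have hζ : (G.D.map g').app ζ = ζ₂ := by
    refine (exists_lift hm _ _ (G.D.map g₂) _ ((G.D.obj o₂).π ζ₂) (Hom.π_app _ _)).unique
      ⟨by rw [Hom.π_app, h₃, e₂], ?_⟩ ⟨rfl, rfl⟩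
    rw [h₂, ← comp_app, ← comp_app, ← G.D.map_comp, ← G.D.map_comp, hg]
  exact ⟨o₃, g ≫ g₁, g' ≫ g₂', ζ, by rw [G.D.map_comp, comp_app],
    by rw [G.D.map_comp, comp_app, hζ]⟩

include hm in
lemma Rel.eq {x₁ x₂ : (G.D.obj o).val a} (h : G.Rel x₁ x₂)
    (e : (G.D.obj o).π x₁ = (G.D.obj o).π x₂) : x₁ = x₂ := by
  obtain ⟨o₁, g, g', ζ, rfl, rfl⟩ := h
  obtain ⟨o₂, g₂, -, k, _, e₁, -⟩ := G.refine ((G.D.obj o₁).π ζ) ((G.D.obj o₁).π ζ) rfl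
  obtain ⟨ζ', h₁, rfl⟩ := (exists_lift hm _ _ (G.D.map g₂) ζ k e₁.symm).exists
  have : g₂ ≫ g = g₂ ≫ g' := by
    apply G.inj
    rw [← cancel_epi k]
    rw [Hom.π_app (G.D.map g), Hom.π_app (G.D.map g')] at e
    rw [G.D.map_comp, G.D.map_comp]
    change k ≫ Hom.f _ ≫ Hom.f _ = k ≫ Hom.f _ ≫ Hom.f _
    rw [reassoc_of% e₁, reassoc_of% e₁, e]
  rw [← comp_app, ← comp_app, ← G.D.map_comp, ← G.D.map_comp, this]

variable (G) in
/-- The elements of the glued presheaf: compatible families of elements. -/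
structure Elem (a : 𝒜) where
  m : p.obj a ⟶ G.U
  x : ∀ {c : 𝒜} (χ : c ⟶ a) {o : I} (k : p.obj c ⟶ (G.D.obj o).M), k ≫ G.h o = p.map χ ≫ m →
    (G.D.obj o).val c
  π_x : ∀ {c : 𝒜} (χ : c ⟶ a) {o : I} (k : p.obj c ⟶ (G.D.obj o).M)
    (h : k ≫ G.h o = p.map χ ≫ m), (G.D.obj o).π (x χ k h) = k
  x_res : ∀ {c d : 𝒜} (θ : d ⟶ c) (χ : c ⟶ a) {o : I} (k : p.obj c ⟶ (G.D.obj o).M)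
    (h : k ≫ G.h o = p.map χ ≫ m) (h' : (p.map θ ≫ k) ≫ G.h o = p.map (θ ≫ χ) ≫ m),
    x (θ ≫ χ) (p.map θ ≫ k) h' = (G.D.obj o).res θ (x χ k h)
  x_rel : ∀ {c : 𝒜} (χ : c ⟶ a) {o o' : I} (k : p.obj c ⟶ (G.D.obj o).M)
    (k' : p.obj c ⟶ (G.D.obj o').M) (h : k ≫ G.h o = p.map χ ≫ m)
    (h' : k' ≫ G.h o' = p.map χ ≫ m), G.Rel (x χ k h) (x χ k' h')

lemma Elem.x_congr (y : Elem G a) {c : 𝒜} {χ χ' : c ⟶ a} (e : χ = χ')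
    {k k' : p.obj c ⟶ (G.D.obj o).M} (e' : k = k') (h : k ≫ G.h o = p.map χ ≫ y.m) :
    y.x χ k h = y.x χ' k' (by rw [← e, ← e', h]) := by
  subst e e'; rfl

lemma Elem.ext' {y y' : Elem G a} (h : y.m = y'.m) (h' : ∀ {c : 𝒜} (χ : c ⟶ a) {o : I}
    (k : p.obj c ⟶ (G.D.obj o).M) (h₁ : k ≫ G.h o = p.map χ ≫ y.m)
    (h₂ : k ≫ G.h o = p.map χ ≫ y'.m), y.x χ k h₁ = y'.x χ k h₂) : y = y' := by
  obtain ⟨m, x⟩ := y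
  obtain ⟨m', x'⟩ := y'
  obtain rfl : m = m' := h
  congr 1
  funext c χ o k h
  exact h' χ k h h

/-- Restriction of compatible families. -/
def Elem.res (φ : b ⟶ a) (y : Elem G a) : Elem G b where
  m := p.map φ ≫ y.m
  x χ o k h := y.x (χ ≫ φ) k (by rw [h, p.map_comp, Category.assoc])
  π_x χ o k h := y.π_x _ _ _
  x_res θ χ o k h h' := by
    rw [← y.x_res θ (χ ≫ φ) k (by rw [h, p.map_comp, Category.assoc])
      (by rw [h', p.map_comp, p.map_comp, p.map_comp]; simp only [Category.assoc])]
    exact y.x_congr (Category.assoc _ _ _) rfl _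
  x_rel χ o o' k k' h h' := y.x_rel _ _ _ _ _

variable (G) in
include hm in
/-- The family that is given by an element of a member of the diagram. -/
lemma exists_elem {o : I} {a : 𝒜} (η : (G.D.obj o).val a) : ∃ y : Elem G a,
    y.m = (G.D.obj o).π η ≫ G.h o ∧ ∀ {c : 𝒜} (χ : c ⟶ a) {o' : I}
    (k : p.obj c ⟶ (G.D.obj o').M) (h : k ≫ G.h o' = p.map χ ≫ y.m),
      G.Rel ((G.D.obj o).res χ η) (y.x χ k h) := by
  have key {c : 𝒜} (χ : c ⟶ a) {o' : I} (k : p.obj c ⟶ (G.D.obj o').M)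
      (h : k ≫ G.h o' = p.map χ ≫ (G.D.obj o).π η ≫ G.h o) :=
    exists_rel hm ((G.D.obj o).res χ η) k (by rw [h, LocRep.π_res, Category.assoc])
  choose x hx hx' using @key
  refine ⟨⟨(G.D.obj o).π η ≫ G.h o, x, hx, fun {c d} θ χ {o'} k h h' => ?_,
    fun {c} χ {o₁ o₂} k k' h h' => (hx' χ k h).symm.trans hm (hx' χ k' h')⟩, rfl, hx'⟩
  refine Rel.eq hm ((hx' _ _ h').symm.trans hm ?_) (by rw [hx, LocRep.π_res, hx])
  rw [LocRep.res_comp]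
  exact (hx' χ k h).res θ

include hp hm in
lemma Elem.cart (y : Elem G a) (y' : Elem G b) (k : p.obj a ⟶ p.obj b) (h : y.m = k ≫ y'.m) :
    ∃! φ : a ⟶ b, p.map φ = k ∧ y'.res φ = y := by
  have key {c : 𝒜} (χ : c ⟶ a) {o : I} (l : p.obj c ⟶ (G.D.obj o).M)
      (hl : l ≫ G.h o = p.map χ ≫ y.m) : ∃! ψ : c ⟶ b, p.map ψ = p.map χ ≫ k ∧
      ∀ h', y'.x ψ l h' = y.x χ l hl := by
    obtain ⟨c', β, e, _, he⟩ := hp.exists_iso_lift (p.map χ ≫ k)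
    have hl' : (inv e ≫ l) ≫ G.h o = p.map β ≫ y'.m := by
      rw [Category.assoc, hl, h, IsIso.inv_comp_eq, ← Category.assoc, ← Category.assoc, he]
    have hx (φ : c ⟶ c') (hφ : p.map φ = e) (h') : y'.x (φ ≫ β) l h' =
        (G.D.obj o).res φ (y'.x β (inv e ≫ l) hl') := by
      rw [← y'.x_res φ β _ hl' (by rw [Category.assoc, hl', p.map_comp, Category.assoc])]
      exact y'.x_congr rfl (by rw [hφ]; simp) _
    obtain ⟨φ, ⟨h₁, h₂⟩, h₃⟩ := (G.D.obj o).cart (y.x χ l hl) (y'.x β (inv e ≫ l) hl') e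
      (by rw [y.π_x, y'.π_x, IsIso.hom_inv_id_assoc])
    refine ⟨φ ≫ β, ⟨by rw [p.map_comp, h₁, he], fun h' => by rw [hx φ h₁, h₂]⟩, fun ψ hψ => ?_⟩
    obtain ⟨φ', ⟨h₄, rfl⟩, -⟩ := hp.exists_map_eq β ψ e (by rw [hψ.1, he])
    rw [h₃ φ' ⟨h₄, by rw [← hx φ' h₄, hψ.2]; rw [hl, h, p.map_comp, h₄, he, Category.assoc]⟩]
  have key' {c : 𝒜} (χ : c ⟶ a) (ψ : c ⟶ b) (hψ : p.map ψ = p.map χ ≫ k) {o o' : I}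
      (l : p.obj c ⟶ (G.D.obj o).M) (hl : l ≫ G.h o = p.map χ ≫ y.m)
      (l' : p.obj c ⟶ (G.D.obj o').M) (hl' : l' ≫ G.h o' = p.map χ ≫ y.m) (h')
      (e : y'.x ψ l h' = y.x χ l hl) (h'') : y'.x ψ l' h'' = y.x χ l' hl' := by
    refine Rel.eq hm ((y'.x_rel ψ l' l h'' h').trans hm ?_) (by rw [y'.π_x, y.π_x])
    rw [e]
    exact y.x_rel χ _ _ _ _
  let R : Sieve (p.obj a) := (Sieve.ofArrows _ G.h).pullback y.m
  have hR : R ∈ J (p.obj a) := J.pullback_stable _ G.cov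
  have hR' {c : 𝒜} (χ : c ⟶ a) (hχ : R (p.map χ)) : ∃ (o : I) (l : p.obj c ⟶ (G.D.obj o).M),
      l ≫ G.h o = p.map χ ≫ y.m := by
    obtain ⟨o, l, hl⟩ := (Sieve.mem_ofArrows_iff _ _ _).1 hχ
    exact ⟨o, l, hl.symm⟩
  have key₂ {c : 𝒜} (χ : c ⟶ a) (hχ : R (p.map χ)) : ∃! ψ : c ⟶ b, p.map ψ = p.map χ ≫ k ∧
      ∀ {o : I} (l : p.obj c ⟶ (G.D.obj o).M) (hl : l ≫ G.h o = p.map χ ≫ y.m) h',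
        y'.x ψ l h' = y.x χ l hl := by
    obtain ⟨o, l, hl⟩ := hR' χ hχ
    obtain ⟨ψ, ⟨h₁, h₂⟩, h₃⟩ := key χ l hl
    refine ⟨ψ, ⟨h₁, fun l' hl' h' => ?_⟩, fun ψ' h' => h₃ ψ' ⟨h'.1, h'.2 l hl⟩⟩
    have h'' : l ≫ G.h o = p.map ψ ≫ y'.m := by rw [hl, h₁, h, Category.assoc]
    exact key' χ ψ h₁ l hl l' hl' h'' (h₂ h'') h'
  choose ψ hψ hψ' using fun {c} (χ : c ⟶ a) hχ => (key₂ χ hχ).exists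
  obtain ⟨φ, ⟨h₁, h₂⟩, h₃⟩ := hm a b k R hR ψ hψ (fun {c d} θ χ hχ hχ' => by
    refine (key₂ (θ ≫ χ) hχ').unique ⟨hψ _ _, fun l hl h' => hψ' _ _ l hl h'⟩
      ⟨by rw [p.map_comp, hψ, p.map_comp, Category.assoc], fun {o} l hl h' => ?_⟩
    obtain ⟨o', l', hl'⟩ := hR' χ hχ
    have e₁ : l' ≫ G.h o' = p.map (ψ χ hχ) ≫ y'.m := by rw [hl', hψ, h, Category.assoc]
    have e₂ : (p.map θ ≫ l') ≫ G.h o' = p.map (θ ≫ χ) ≫ y.m := by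
      rw [Category.assoc, hl', p.map_comp, Category.assoc]
    have e₃ : (p.map θ ≫ l') ≫ G.h o' = p.map (θ ≫ ψ χ hχ) ≫ y'.m := by
      rw [Category.assoc, e₁, p.map_comp, Category.assoc]
    refine key' (θ ≫ χ) (θ ≫ ψ χ hχ) (by rw [p.map_comp, hψ, p.map_comp, Category.assoc])
      (p.map θ ≫ l') e₂ l hl e₃ ?_ h'
    rw [y'.x_res θ _ l' e₁, y.x_res θ χ l' hl', hψ' χ hχ l' hl'])
  refine ⟨φ, ⟨h₁, Elem.ext' (by rw [h, ← h₁]; rfl) fun {c} χ {o} l k₁ k₂ => ?_⟩,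
    fun φ' h' => h₃ φ' ⟨h'.1, fun {c} χ hχ => ?_⟩⟩
  · have hχ : R (p.map χ) := (Sieve.mem_ofArrows_iff _ _ _).2 ⟨o, l, k₂.symm⟩
    refine Eq.trans ?_ (hψ' χ hχ l k₂ (by rw [k₂, hψ, h, Category.assoc]))
    exact y'.x_congr (h₂ χ hχ) rfl _
  · refine (key₂ χ hχ).unique ⟨by rw [p.map_comp, h'.1], fun {o} l hl h'' => ?_⟩
      ⟨hψ _ _, fun l hl h' => hψ' _ _ l hl h'⟩
    obtain ⟨h₄, rfl⟩ := h'
    rfl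

/-- The glued presheaf. -/
def glued (G : GlueData.{w} p J I) (hp : FibG p) (hm : GluesMor p J) : LocRep p J where
  M := G.U
  val := Elem G
  res := Elem.res
  res_id y := Elem.ext' (by simp [Elem.res]) fun χ o k h h' => y.x_congr (Category.comp_id χ) rfl _
  res_comp θ φ y := Elem.ext' (by simp [Elem.res]) fun χ o k h h' =>
    y.x_congr (Category.assoc _ _ _).symm rfl _
  π := Elem.m
  π_res φ y := rfl
  cart := Elem.cart hp hm
  loc := by
    refine J.transitive G.cov _ fun {V} f hf => ?_
    obtain ⟨o, l, rfl⟩ := (Sieve.mem_ofArrows_iff _ _ _).1 hf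
    rw [Sieve.pullback_comp]
    refine J.pullback_stable _ (J.superset_covering ?_ (G.D.obj o).loc)
    rintro W j hj
    obtain ⟨⟨a, η⟩, j, rfl⟩ := (Sieve.mem_ofArrows_iff _ _ _).1 hj
    obtain ⟨y, hy, -⟩ := G.exists_elem hm η
    rw [Sieve.pullback_apply, Sieve.mem_ofArrows_iff]
    exact ⟨⟨a, y⟩, j, by rw [hy, Category.assoc]⟩
  glue {a} m R hR ξ hξ hξ' := by
    have hS {c : 𝒜} (χ : c ⟶ a) : R.pullback (p.map χ) ∈ J (p.obj c) := J.pullback_stable _ hR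
    have hS' {c d : 𝒜} {χ : c ⟶ a} {θ : d ⟶ c} (h : R.pullback (p.map χ) (p.map θ)) :
        R (p.map (θ ≫ χ)) := by
      rw [p.map_comp]
      exact h
    have hv {c : 𝒜} {χ : c ⟶ a} (hχ : R (p.map χ)) {o : I} {k : p.obj c ⟶ (G.D.obj o).M}
        (h : k ≫ G.h o = p.map χ ≫ m) : k ≫ G.h o = p.map (𝟙 c) ≫ (ξ χ hχ).m := by
      rw [hξ, p.map_id, Category.id_comp, h]
    let v {c : 𝒜} (χ : c ⟶ a) (hχ : R (p.map χ)) {o : I} (k : p.obj c ⟶ (G.D.obj o).M)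
        (h : k ≫ G.h o = p.map χ ≫ m) : (G.D.obj o).val c := (ξ χ hχ).x (𝟙 c) k (hv hχ h)
    have v_congr {c : 𝒜} {χ χ' : c ⟶ a} {o : I} {k k' : p.obj c ⟶ (G.D.obj o).M} (e : χ = χ')
        (e' : k = k') (hχ hχ' h h') : v χ hχ k h = v χ' hχ' k' h' := by
      subst e e'; rfl
    have v_eq {c d : 𝒜} (χ : c ⟶ a) (hχ : R (p.map χ)) (θ : d ⟶ c) (hθ : R (p.map (θ ≫ χ)))
        {o : I} (k : p.obj d ⟶ (G.D.obj o).M) (h) (h') :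
        (ξ χ hχ).x θ k h' = v (θ ≫ χ) hθ k h := by
      have key {y y' : Elem G d} (e : y = y') (h) (h') : y.x (𝟙 d) k h = y'.x (𝟙 d) k h' := by
        subst e; rfl
      refine Eq.trans ?_ (key (hξ' θ χ hχ hθ) _ ?_).symm
      · exact Elem.x_congr _ (Category.id_comp _).symm rfl _
      · rw [← hξ' θ χ hχ hθ]
        exact hv hθ h
    have v_res {c d : 𝒜} (χ : c ⟶ a) (hχ : R (p.map χ)) (θ : d ⟶ c) (hθ : R (p.map (θ ≫ χ)))
        {o : I} (k : p.obj c ⟶ (G.D.obj o).M) (h) (h') :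
        v (θ ≫ χ) hθ (p.map θ ≫ k) h' = (G.D.obj o).res θ (v χ hχ k h) := by
      have h₁ : (p.map θ ≫ k) ≫ G.h o = p.map (θ ≫ 𝟙 c) ≫ (ξ χ hχ).m := by
        rw [Category.assoc, hv hχ h]
        simp
      rw [← Elem.x_res _ θ (𝟙 c) k (hv hχ h) h₁, ← v_eq χ hχ θ hθ _ h' (by simpa using h₁)]
      exact Elem.x_congr _ (Category.comp_id θ).symm rfl _
    have hk {c d : 𝒜} {χ : c ⟶ a} (θ : d ⟶ c) {o : I} {k : p.obj c ⟶ (G.D.obj o).M}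
        (h : k ≫ G.h o = p.map χ ≫ m) : (p.map θ ≫ k) ≫ G.h o = p.map (θ ≫ χ) ≫ m := by
      rw [Category.assoc, h, p.map_comp, Category.assoc]
    have key {c : 𝒜} (χ : c ⟶ a) {o : I} (k : p.obj c ⟶ (G.D.obj o).M)
        (h : k ≫ G.h o = p.map χ ≫ m) := (G.D.obj o).glue k (R.pullback (p.map χ)) (hS χ)
      (fun {d} θ hθ => v (θ ≫ χ) (hS' hθ) (p.map θ ≫ k) (hk θ h))
      (fun {d} θ hθ => Elem.π_x _ _ _ _)
      (fun {d d'} θ' θ hθ hθ' => by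
        have h₁ : R (p.map (θ' ≫ θ ≫ χ)) := by
          rw [← Category.assoc]
          exact hS' hθ'
        refine Eq.trans ?_ (v_res (θ ≫ χ) (hS' hθ) θ' h₁ (p.map θ ≫ k) (hk θ h) (hk θ' (hk θ h)))
        exact v_congr (Category.assoc _ _ _) (by rw [p.map_comp, Category.assoc]) (hS' hθ') h₁
          (hk (θ' ≫ θ) h) (hk θ' (hk θ h)))
    choose x hx hx' using @key
    have hx'' {c : 𝒜} (χ : c ⟶ a) {o : I} (k : p.obj c ⟶ (G.D.obj o).M)
        (h : k ≫ G.h o = p.map χ ≫ m) (hχ : R (p.map χ)) : x χ k h = v χ hχ k h := by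
      have hid : R.pullback (p.map χ) (p.map (𝟙 c)) := by simpa using hχ
      rw [← (G.D.obj o).res_id (x χ k h), hx' χ k h (𝟙 c) hid]
      exact v_congr (Category.id_comp _) (by simp) (hS' hid) hχ (hk (𝟙 c) h) h
    refine ⟨⟨m, x, hx, fun {c d} θ χ {o} k h h' => ?_, fun {c} χ {o o'} k k' h h' => ?_⟩, rfl,
      fun {c} χ hχ => Elem.ext' (hξ χ hχ).symm fun {d} θ {o} k h h' => ?_⟩
    · refine LocRep.sep hm _ (by rw [hx, LocRep.π_res, hx]) _ (hS (θ ≫ χ)) fun φ hφ => ?_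
      have hφ' : R.pullback (p.map χ) (p.map (φ ≫ θ)) := by
        rw [p.map_comp]
        rw [p.map_comp] at hφ
        simpa [Sieve.pullback_apply] using hφ
      rw [hx' _ _ _ φ hφ, ← LocRep.res_comp, hx' χ k h _ hφ']
      exact v_congr (Category.assoc _ _ _).symm (by rw [p.map_comp, Category.assoc]) (hS' hφ) (hS' hφ')
        (hk φ (hk θ h)) (hk (φ ≫ θ) h)
    · obtain ⟨z, hz, hz'⟩ := exists_rel hm (x χ k h) k' (by rw [hx, h, h'])
      suffices z = x χ k' h' by rwa [← this]
      refine LocRep.sep hm _ (by rw [hz, hx]) _ (hS χ) fun φ hφ => ?_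
      refine Rel.eq hm ((hz'.res φ).symm.trans hm ?_) (by rw [LocRep.π_res, LocRep.π_res, hz, hx])
      rw [hx' _ _ _ φ hφ, hx' _ _ _ φ hφ]
      exact Elem.x_rel _ _ _ _ _ _
    · have hθ : R (p.map (θ ≫ χ)) := by
        rw [p.map_comp]
        exact R.downward_closed hχ _
      rw [v_eq χ hχ θ hθ k (by rw [h]; simp [Elem.res]) h']
      exact hx'' _ _ _ _

include hm in
lemma exists_glued : ∃ l : ∀ o, Hom (G.D.obj o) (G.glued hp hm), (∀ o, (l o).f = G.h o) ∧
    ∀ {o o'} (g : o ⟶ o') {a : 𝒜} (x : (G.D.obj o).val a),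
      (l o').app ((G.D.map g).app x) = (l o).app x := by
  choose y hy hy' using fun {o : I} {a : 𝒜} (η : (G.D.obj o).val a) => G.exists_elem hm η
  refine ⟨fun o => ⟨G.h o, y, fun {a b} φ η => ?_, hy⟩, fun o => rfl, fun {o o'} g {a} x => ?_⟩
  · refine Elem.ext' (by rw [hy, LocRep.π_res, Category.assoc]; exact congrArg _ (hy η).symm)
      fun {c} χ {o'} k h h' => ?_
    have h₁ : k ≫ G.h o' = p.map (χ ≫ φ) ≫ (y η).m := by
      rw [h', p.map_comp, Category.assoc]; rfl
    refine Rel.eq hm ((hy' _ χ k h).symm.trans hm ?_) ((Elem.π_x _ _ _ _).trans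
      (Elem.π_x _ _ _ _).symm)
    rw [← LocRep.res_comp]
    exact hy' η (χ ≫ φ) k h₁
  · refine Elem.ext' (by rw [hy, hy, Hom.π_app, Category.assoc, G.comm]) fun {c} χ {o₁} k h h' => ?_
    refine Rel.eq hm ((hy' _ χ k h).symm.trans hm ?_) ((Elem.π_x _ _ _ _).trans
      (Elem.π_x _ _ _ _).symm)
    exact ((rel_map g x).res χ).symm.trans hm (hy' _ χ k h')

end GlueData

end LocRep

end LocRep

end Orbi

namespace Orbi

section Transport

universe v₁ u₁ v₂ u₂ v₃ u₃

variable {C : Type u₁} [Category.{v₁} C] {𝒳 : Type u₂} [Category.{v₂} 𝒳] {𝒳' : Type u₃}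
  [Category.{v₃} 𝒳'] {F : 𝒳' ⥤ 𝒳} {p : 𝒳 ⥤ C} {J : GrothendieckTopology C}

lemma isHomLift_functor_comp {U V : C} {f : U ⟶ V} {a b : 𝒳'} {φ : a ⟶ b} :
    (F ⋙ p).IsHomLift f φ ↔ p.IsHomLift f (F.map φ) :=
  ⟨fun _ => IsHomLift.of_fac p f (F.map φ) (IsHomLift.domain_eq (F ⋙ p) f φ)
    (IsHomLift.codomain_eq (F ⋙ p) f φ) (IsHomLift.fac (F ⋙ p) f φ),
    fun _ => IsHomLift.of_fac (F ⋙ p) f φ (IsHomLift.domain_eq p f (F.map φ))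
    (IsHomLift.codomain_eq p f (F.map φ)) (IsHomLift.fac p f (F.map φ))⟩

variable [F.Full] [F.Faithful] (hF : Function.Surjective F.obj) (hp : FibG p)
include hF hp

lemma FibG.comp : FibG (F ⋙ p) where
  exists_lift a f := by
    obtain ⟨b, φ, h⟩ := hp.exists_lift (F.obj a) f
    obtain ⟨b, rfl⟩ := hF b
    obtain ⟨φ, rfl⟩ := F.map_surjective φ
    exact ⟨b, φ, isHomLift_functor_comp.2 h⟩
  exists_fac h₁ h₂ := by
    obtain ⟨χ, h, e⟩ := hp.exists_fac (isHomLift_functor_comp.1 h₁) (isHomLift_functor_comp.1 h₂)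
    obtain ⟨χ, rfl⟩ := F.map_surjective χ
    exact ⟨χ, isHomLift_functor_comp.2 h, F.map_injective (by rw [F.map_comp, e])⟩
  hom_ext φ _ _ h₁ h₂ e := F.map_injective (hp.hom_ext (F.map φ) (isHomLift_functor_comp.1 h₁)
    (isHomLift_functor_comp.1 h₂) (by rw [← F.map_comp, e, F.map_comp]))

lemma GluesMor.functor_comp (hm : GluesMor p J) : GluesMor (F ⋙ p) J := by
  intro a b m R hR ψ hψ hψ'
  let I := Σ c : 𝒳', { φ : c ⟶ a // R ((F ⋙ p).map φ) }
  have cov : Sieve.ofArrows (fun i : I => p.obj (F.obj i.1)) (fun i => p.map (F.map i.2.1)) ∈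
      J (p.obj (F.obj a)) := by
    refine J.superset_covering ?_ hR
    intro V f hf
    obtain ⟨c, φ, e, he, h⟩ := (hp.comp hF).exists_iso_lift (b := a) f
    have hφ : R ((F ⋙ p).map φ) := by
      rw [← IsIso.eq_inv_comp] at h
      rw [h]
      exact R.downward_closed hf _
    rw [Sieve.mem_ofArrows_iff]
    exact ⟨⟨c, φ, hφ⟩, e, h.symm⟩
  obtain ⟨Ψ, ⟨h₁, h₂⟩, h₃⟩ := hm.existsUnique' hp m (fun i : I => F.obj i.1)
    (fun i => F.map i.2.1) (fun i => F.map (ψ i.2.1 i.2.2)) (fun i => hψ i.2.1 i.2.2) cov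
    (fun i j d χ χ' e => by
      obtain ⟨d, rfl⟩ := hF d
      obtain ⟨χ, rfl⟩ := F.map_surjective χ
      obtain ⟨χ', rfl⟩ := F.map_surjective χ'
      rw [← F.map_comp, ← F.map_comp] at e ⊢
      have e' := F.map_injective e
      have k₁ : R ((F ⋙ p).map (χ ≫ i.2.1)) := by
        rw [(F ⋙ p).map_comp]
        exact R.downward_closed i.2.2 _
      have k₂ : R ((F ⋙ p).map (χ' ≫ j.2.1)) := e' ▸ k₁
      rw [← hψ' χ _ i.2.2 k₁, ← hψ' χ' _ j.2.2 k₂]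
      congr 2)
  obtain ⟨Ψ, rfl⟩ := F.map_surjective Ψ
  refine ⟨Ψ, ⟨h₁, fun {c} φ h => F.map_injective ?_⟩, fun Ψ' h' => F.map_injective (h₃ _ ⟨h'.1,
    fun i => ?_⟩)⟩
  · rw [F.map_comp]
    exact h₂ ⟨c, φ, h⟩
  · rw [← F.map_comp, h'.2 i.2.1 i.2.2]

lemma GluesObj.functor_comp (ho : GluesObj p J) : GluesObj (F ⋙ p) J := by
  intro U R hR D hD
  obtain ⟨P, l, hP, hl, hl'⟩ := ho U R hR (D ⋙ F) 
    (fun g => (isHomLift_functor_comp (F := F) (p := p) (φ := D.map g)).1 (hD g))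
  obtain ⟨P, rfl⟩ := hF P
  choose l' hl'' using fun o => F.map_surjective (l o)
  refine ⟨P, l', hP, fun o => ?_, fun {o o'} g => F.map_injective ?_⟩
  · rw [isHomLift_functor_comp, hl'']
    exact hl o
  · rw [F.map_comp, hl'', hl'', ← hl' g]
    rfl

end Transport

section LocRep

universe w w' v₁ u₁ v₂ u₂

variable {C : Type u₁} [Category.{v₁} C] {𝒜 : Type u₂} [Category.{v₂} 𝒜]

namespace LocRep

variable {p : 𝒜 ⥤ C} {J : GrothendieckTopology C}

/-- Every fiber of a locally representable presheaf is a torsor or empty. -/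
lemma small_val {𝒜 : Type u₂} [Category.{v₁} 𝒜] {p : 𝒜 ⥤ C} (P : LocRep.{w} p J) (a : 𝒜) :
    Small.{v₁} (P.val a) := by
  classical
  have key (x : P.val a) : ∃ φ : a ⟶ a, ∃ h : ∃ y : P.val a, P.π y = P.π x,
      P.res φ h.choose = x := by
    have h : ∃ y : P.val a, P.π y = P.π x := ⟨x, rfl⟩
    obtain ⟨φ, h', -⟩ := P.cart x h.choose (𝟙 _) (by rw [h.choose_spec, Category.id_comp])
    exact ⟨φ, h, h'.2⟩
  choose φ h hφ using key
  refine small_of_injective (β := (p.obj a ⟶ P.M) × (a ⟶ a)) (f := fun x => (P.π x, φ x)) ?_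
  intro x x' e
  obtain ⟨e₁, e₂⟩ := Prod.ext_iff.1 e
  dsimp only at e₁ e₂
  rw [← hφ x, ← hφ x', e₂]
  congr! 4

/-- A small model of a locally representable presheaf. -/
noncomputable def shrink (P : LocRep.{w} p J) [∀ a, Small.{w'} (P.val a)] : LocRep.{w'} p J where
  M := P.M
  val a := Shrink.{w'} (P.val a)
  res φ x := equivShrink _ (P.res φ ((equivShrink _).symm x))
  res_id x := by simp [P.res_id]
  res_comp θ φ x := by simp [P.res_comp]
  π x := P.π ((equivShrink _).symm x)
  π_res φ x := by simp [P.π_res]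
  cart x y k h := by
    obtain ⟨φ, ⟨h₁, h₂⟩, h₃⟩ := P.cart _ _ k h
    refine ⟨φ, ⟨h₁, by rw [h₂]; simp⟩, fun φ' h' => h₃ φ' ⟨h'.1, ?_⟩⟩
    rw [← h'.2, Equiv.symm_apply_apply]
  loc := by
    refine J.superset_covering ?_ P.loc
    rw [Sieve.ofArrows, Sieve.generate_le_iff]
    rintro _ _ ⟨⟨a, x⟩⟩
    have := Sieve.ofArrows_mk (I := Σ a, Shrink.{w'} (P.val a)) (fun i => p.obj i.1)
      (fun i => P.π ((equivShrink _).symm i.2)) ⟨a, equivShrink _ x⟩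
    simpa using this
  glue m R hR x h₁ h₂ := by
    obtain ⟨y, hy, hy'⟩ := P.glue m R hR (fun χ h => (equivShrink _).symm (x χ h)) h₁
      (fun θ χ h h' => by rw [h₂ θ χ h h', Equiv.symm_apply_apply])
    exact ⟨equivShrink _ y, by rw [Equiv.symm_apply_apply, hy], fun χ h => by
      rw [Equiv.symm_apply_apply, hy', Equiv.apply_symm_apply]⟩

lemma gluesObj_base {𝒜 : Type u₂} [Category.{v₁} 𝒜] {p : 𝒜 ⥤ C} (hp : FibG p)
    (hm : GluesMor p J) : GluesObj (base.{v₁} p J) J := by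
  intro U R hR D hD
  have hD₁ (o) : (D.obj o).M = o.obj.left := isHomLift_dom (hD (𝟙 o))
  have hD₂ {o o' : ObjectProperty.FullSubcategory (fun f : Over U => R f.hom)} (g : o ⟶ o') : g.hom.left ≫ eqToHom (hD₁ o').symm =
      eqToHom (hD₁ o).symm ≫ Hom.f (D.map g) := by
    obtain ⟨h, h', e⟩ := isHomLift_base (hD g)
    rw [e]
    simp
  let G : GlueData.{v₁} p J (ObjectProperty.FullSubcategory (fun f : Over U => R f.hom)) :=
    { D := D
      U := U
      h := fun o => eqToHom (hD₁ o) ≫ o.obj.hom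
      comm := fun {o o'} g => by
        have := hD₂ g
        rw [← cancel_epi (eqToHom (hD₁ o).symm), ← reassoc_of% this]
        simp
      inj := fun {o o' g g'} e => by
        have h₁ := hD₂ g
        rw [e, ← hD₂ g', cancel_mono] at h₁
        exact ObjectProperty.hom_ext _ (Over.OverMorphism.ext h₁)
      refine := fun {V o o'} k k' e => by
        let o₁ : ObjectProperty.FullSubcategory (fun f : Over U => R f.hom) :=
          ⟨Over.mk ((k ≫ eqToHom (hD₁ o)) ≫ o.obj.hom), R.downward_closed o.property _⟩
        let g : o₁ ⟶ o := ⟨Over.homMk (k ≫ eqToHom (hD₁ o)) rfl⟩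
        let g' : o₁ ⟶ o' := ⟨Over.homMk (k' ≫ eqToHom (hD₁ o')) (by
          simpa [o₁] using e.symm)⟩
        refine ⟨o₁, g, g', eqToHom (hD₁ o₁).symm, inferInstance, ?_, ?_⟩
        · rw [← hD₂ g]
          change (k ≫ eqToHom _) ≫ eqToHom _ = k
          simp
        · rw [← hD₂ g']
          change (k' ≫ eqToHom _) ≫ eqToHom _ = k'
          simp
      cov := by
        refine J.superset_covering ?_ hR
        intro V f hf
        rw [Sieve.mem_ofArrows_iff]
        exact ⟨⟨Over.mk f, hf⟩, eqToHom (hD₁ ⟨Over.mk f, hf⟩).symm, by simp⟩ }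
  obtain ⟨l, hl, hl'⟩ := G.exists_glued hp hm
  have hs : ∀ a, Small.{v₁} ((G.glued hp hm).val a) := small_val _
  let l' (o) : D.obj o ⟶ (G.glued hp hm).shrink :=
    ⟨(l o).f, fun x => equivShrink _ ((l o).app x), fun φ x => by
      change _ = equivShrink _ ((G.glued hp hm).res φ ((equivShrink _).symm (equivShrink _ _)))
      rw [Equiv.symm_apply_apply]
      exact congrArg _ ((l o).app_res φ x), fun x => by
        change (G.glued hp hm).π ((equivShrink _).symm (equivShrink _ _)) = _
        rw [Equiv.symm_apply_apply]
        exact (l o).π_app x⟩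
  refine ⟨(G.glued hp hm).shrink, l', rfl, fun o => ?_, fun {o o'} g => hom_ext' ?_ fun x => ?_⟩
  · refine IsHomLift.of_fac (base p J) _ (l' o) (hD₁ o) rfl ?_
    change o.obj.hom = eqToHom _ ≫ (l o).f ≫ 𝟙 _
    rw [hl]
    change o.obj.hom = eqToHom _ ≫ (eqToHom _ ≫ o.obj.hom) ≫ 𝟙 U
    simp
  · change Hom.f (D.map g) ≫ (l o').f = (l o).f
    rw [hl, hl]
    exact G.comm g
  · exact congrArg (equivShrink _) (hl' g x)

lemma small_hom {𝒜 : Type u₂} [Category.{v₁} 𝒜] {p : 𝒜 ⥤ C} (hp : FibG p) (hm : GluesMor p J)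
    (P Q : LocRep.{v₁} p J) {I : Type v₁} (W : I → C) (f : ∀ i, W i ⟶ P.M)
    (hf : ∀ i, Sieve.ofArrows (fun i : Σ a, P.val a => p.obj i.1) (fun i => P.π i.2) (f i))
    (cov : Sieve.ofArrows W f ∈ J P.M) : Small.{v₁} (P ⟶ Q) := by
  have key (i : I) : ∃ (a : 𝒜) (ζ : P.val a) (e : W i ⟶ p.obj a), e ≫ P.π ζ = f i := by
    obtain ⟨⟨c, ξ⟩, k, hk⟩ := (Sieve.mem_ofArrows_iff _ _ _).1 (hf i)
    obtain ⟨a, φ, e, -, he⟩ := hp.exists_iso_lift k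
    exact ⟨a, P.res φ ξ, e, by rw [P.π_res, reassoc_of% he, hk]⟩
  choose a ζ e he using key
  refine small_of_injective (β := (P.M ⟶ Q.M) × (∀ i, Q.val (a i)))
    (f := fun α => (α.f, fun i => α.app (ζ i))) ?_
  intro α β h
  obtain ⟨h₁, h₂⟩ := Prod.ext_iff.1 h
  dsimp only at h₁ h₂
  refine hom_ext' h₁ fun {b} y => ?_
  refine Q.sep hm (by rw [Hom.π_app, Hom.π_app, h₁]) _ (J.pullback_stable (P.π y) cov)
    fun {c} χ hχ => ?_
  obtain ⟨i, k, hk⟩ := (Sieve.mem_ofArrows_iff _ _ _).1 hχ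
  obtain ⟨φ, ⟨-, h₃⟩, -⟩ := P.cart (P.res χ y) (ζ i) (k ≫ e i) (by
    rw [P.π_res, hk, Category.assoc, he])
  rw [← Hom.app_res, ← Hom.app_res, ← h₃, Hom.app_res, Hom.app_res, congrFun h₂ i]

end LocRep

end LocRep

/-- Every covering sieve contains a small covering family. -/
def HasSmallCovers {C : Type u} [Category.{v} C] (J : GrothendieckTopology C) : Prop :=
  ∀ (M : C) (R : Sieve M), R ∈ J M → ∃ (I : Type v) (W : I → C) (f : ∀ i, W i ⟶ M),
    (∀ i, R (f i)) ∧ Sieve.ofArrows W f ∈ J M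

/-- The existence of associated stacks. -/
theorem exists_isLocalEquiv {S : SpaceCat.{0, 1}} (hS : HasSmallCovers S.topology)
    {𝒜 : BasedCategory.{0, 1} S.Obj} (hp : FibG 𝒜.p) (hm : GluesMor 𝒜.p S.topology) :
    ∃ (𝒳 : BasedCategory.{0, 1} S.Obj) (j : 𝒜 ⟶ 𝒳), IsStack 𝒳 ∧ IsLocalEquiv j S.topology := by
  have : LocallySmall.{0} (LocRep.{0} 𝒜.p S.topology) := ⟨fun P Q => by
    obtain ⟨I, W, f, hf, cov⟩ := hS _ _ P.loc
    exact LocRep.small_hom hp hm P Q W f hf cov⟩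
  let E := ShrinkHoms.equivalence.{0} (LocRep.{0} 𝒜.p S.topology)
  have hE : Function.Surjective E.inverse.obj := fun P => ⟨E.functor.obj P, rfl⟩
  let 𝒳 : BasedCategory.{0, 1} S.Obj :=
    { obj := ShrinkHoms.{1} (LocRep.{0} 𝒜.p S.topology)
      p := E.inverse ⋙ LocRep.base 𝒜.p S.topology }
  have h₁ : FibG 𝒳.p := (LocRep.fibG_base hm hp).comp hE
  have h₂ : GluesMor 𝒳.p S.topology := (LocRep.gluesMor_base hp hm).functor_comp hE
    (LocRep.fibG_base hm hp)
  have h₃ : GluesObj 𝒳.p S.topology := (LocRep.gluesObj_base hp hm).functor_comp hE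
    (LocRep.fibG_base hm hp)
  let j : BasedFunctor 𝒜 𝒳 := basedFunctorMk (LocRep.yoneda hp hm ⋙ E.functor) (fun a => rfl)
    (fun {a b} φ => isHomLift_functor_comp.2 (by
      have h : E.inverse.map (E.functor.map ((LocRep.yoneda hp hm).map φ)) =
          (LocRep.yoneda hp hm).map φ := (equivShrink _).symm_apply_apply _
      refine cast ?_ (IsHomLift.map (LocRep.base 𝒜.p S.topology) ((LocRep.yoneda hp hm).map φ))
      exact congrArg (fun α => (LocRep.base 𝒜.p S.topology).IsHomLift (𝒜.p.map φ) α) h.symm))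
  refine ⟨𝒳, j, isStack_of_glues h₁ h₂ h₃, hp, h₁, ?_, ?_, ?_⟩
  · exact inferInstanceAs (LocRep.yoneda hp hm ⋙ E.functor).Full
  · exact inferInstanceAs (LocRep.yoneda hp hm ⋙ E.functor).Faithful
  · intro P
    refine S.topology.superset_covering ?_ (LocRep.loc (E.inverse.obj P))
    rw [Sieve.ofArrows, Sieve.generate_le_iff]
    rintro _ _ ⟨⟨a, ξ⟩⟩
    refine (Sieve.mem_ofArrows_iff _ _ _).2
      ⟨⟨a, E.functor.map (LocRep.ofElem hp hm (E.inverse.obj P) ξ)⟩, 𝟙 _, ?_⟩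
    have h : E.inverse.map (E.functor.map (LocRep.ofElem hp hm (E.inverse.obj P) ξ)) =
        LocRep.ofElem hp hm (E.inverse.obj P) ξ := (equivShrink _).symm_apply_apply _
    exact (congrArg LocRep.Hom.f h).symm.trans (Category.id_comp _).symm

end Orbi

namespace Orbi

/-- Properties of the topology of a category of spaces: it is subcanonical, étale surjective maps
are coverings, and every covering is refined by an étale surjective map from a disjoint union. -/
structure IsGoodSite (S : SpaceCat.{v, u}) : Prop where
  subcanonical : S.topology.Subcanonical
  generate_mem : ∀ {A B : S.Obj} (f : A ⟶ B), S.etale f → S.surj f →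
    Sieve.generate (Presieve.singleton f) ∈ S.topology B
  exists_disjoint_cover : ∀ {M : S.Obj} (R : Sieve M), R ∈ S.topology M →
    ∃ (N : S.Obj) (q : N ⟶ M) (I : Type v) (U : I → S.Obj) (inc : ∀ i, U i ⟶ N),
      S.etale q ∧ S.surj q ∧ (∀ i, Mono (inc i)) ∧ Sieve.ofArrows U inc ∈ S.topology N ∧
      (∀ i, R (inc i ≫ q)) ∧
      ∀ {i j : I}, i ≠ j → ∀ {L : S.Obj} (a : L ⟶ U i) (b : L ⟶ U j), a ≫ inc i = b ≫ inc j →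
        (⊥ : Sieve L) ∈ S.topology L

namespace IsGoodSite

variable {S : SpaceCat.{v, u}} (hS : IsGoodSite S)
include hS

lemma hasSmallCovers : HasSmallCovers S.topology := by
  intro M R hR
  obtain ⟨N, q, I, U, inc, hq, hq', -, hc, hi, -⟩ := hS.exists_disjoint_cover R hR
  refine ⟨I, U, fun i => inc i ≫ q, hi, ?_⟩
  refine S.topology.transitive (hS.generate_mem q hq hq') _ ?_
  rintro L _ ⟨_, k, _, ⟨⟩, rfl⟩
  refine S.topology.superset_covering ?_ (S.topology.pullback_stable k hc)
  intro K f hf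
  obtain ⟨i, l, hl⟩ := (Sieve.mem_ofArrows_iff _ _ _).1 hf
  exact (Sieve.mem_ofArrows_iff _ _ _).2 ⟨i, l, by rw [← reassoc_of% hl]⟩

lemma existsUnique_glue {M Y : S.Obj} {R : Sieve M} (hR : R ∈ S.topology M)
    (y : ∀ {N : S.Obj} (f : N ⟶ M), R f → (N ⟶ Y))
    (hy : ∀ {N N' : S.Obj} (g : N' ⟶ N) (f : N ⟶ M) (hf : R f) (hgf : R (g ≫ f)),
      y (g ≫ f) hgf = g ≫ y f hf) :
    ∃! h : M ⟶ Y, ∀ {N : S.Obj} (f : N ⟶ M) (hf : R f), f ≫ h = y f hf := by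
  have := hS.subcanonical
  have h : Presieve.IsSheaf S.topology (yoneda.obj Y) :=
    GrothendieckTopology.Subcanonical.isSheaf_of_isRepresentable _
  let y' : Presieve.FamilyOfElements (yoneda.obj Y) R.arrows := fun N f hf => y f hf
  obtain ⟨t, ht, ht'⟩ := h R hR y' ((Presieve.compatible_iff_sieveCompatible y').2
    fun N N' f g hf => hy g f hf _)
  exact ⟨t, fun f hf => ht f hf, fun t' h' => ht' t' fun N f hf => h' f hf⟩

lemma hom_ext {M Y : S.Obj} {R : Sieve M} (hR : R ∈ S.topology M) {h h' : M ⟶ Y}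
    (e : ∀ {N : S.Obj} (f : N ⟶ M), R f → f ≫ h = f ≫ h') : h = h' :=
  (hS.existsUnique_glue hR (fun f _ => f ≫ h') (fun _ _ _ _ => Category.assoc _ _ _)).unique
    (fun f hf => e f hf) (fun _ _ => rfl)

end IsGoodSite

namespace GroupoidIn

variable {S : SpaceCat.{v, u}} {X : GroupoidIn S}

lemma mul_right_cancel {M : S.Obj} {a b d : M ⟶ X.G₁} (h : b ≫ X.t = a ≫ X.s)
    (h' : d ≫ X.t = a ≫ X.s) (e : X.mul b a = X.mul d a) : b = d := by
  obtain ⟨a', h₁, h₂, h₃, -⟩ := X.exists_mul_inv a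
  have := congrArg (X.mul · a') e
  rwa [mul_assoc X h h₁.symm, mul_assoc X h' h₁.symm, h₃, X.mul_one h, X.mul_one h'] at this

variable (X) in
/-- The projection from points of `X` to spaces. -/
noncomputable abbrev Pt.proj : Pt X ⥤ S.Obj where
  obj := Pt.M
  map φ := Pt.Hom.a φ

namespace Pt

@[simp] lemma comp_a {P Q R : Pt X} (φ : P ⟶ Q) (ψ : Q ⟶ R) :
    Hom.a (φ ≫ ψ) = Hom.a φ ≫ Hom.a ψ := rfl

lemma comp_g {P Q R : Pt X} (φ : P ⟶ Q) (ψ : Q ⟶ R) :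
    Hom.g (φ ≫ ψ) = X.mul (Hom.g φ) (Hom.a φ ≫ Hom.g ψ) := rfl

@[simp] lemma id_a (P : Pt X) : Hom.a (𝟙 P) = 𝟙 P.M := rfl

@[ext] lemma hom_ext {P Q : Pt X} {φ ψ : P ⟶ Q} (h : Hom.a φ = Hom.a ψ)
    (h' : Hom.g φ = Hom.g ψ) : φ = ψ := Hom.ext h h'

/-- A morphism of points that is given by an equality. -/
noncomputable def ofEq {P Q : Pt X} (a : P.M ⟶ Q.M) (h : P.x = a ≫ Q.x) : P ⟶ Q :=
  ⟨a, P.x ≫ X.ι, by simp, by simp [h]⟩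

@[simp] lemma ofEq_a {P Q : Pt X} (a : P.M ⟶ Q.M) (h : P.x = a ≫ Q.x) : Hom.a (ofEq a h) = a := rfl

@[simp] lemma ofEq_g {P Q : Pt X} (a : P.M ⟶ Q.M) (h : P.x = a ≫ Q.x) :
    Hom.g (ofEq a h) = P.x ≫ X.ι := rfl

lemma ofEq_comp {P Q R : Pt X} (a : P.M ⟶ Q.M) (h : P.x = a ≫ Q.x) (φ : Q ⟶ R) :
    Hom.g (ofEq a h ≫ φ) = a ≫ Hom.g φ := by
  rw [comp_g, ofEq_g, ofEq_a, X.one_mul]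
  rw [Category.assoc, Hom.g_s, h]

lemma comp_ofEq {P Q R : Pt X} (φ : P ⟶ Q) (a : Q.M ⟶ R.M) (h : Q.x = a ≫ R.x) :
    Hom.g (φ ≫ ofEq a h) = Hom.g φ := by
  rw [comp_g, ofEq_g, ← Category.assoc, X.mul_one (Hom.g_t φ)]

/-- The restriction of a point. -/
abbrev res (P : Pt X) {N : S.Obj} (q : N ⟶ P.M) : Pt X := ⟨N, q ≫ P.x⟩

/-- The projection from the restriction of a point. -/
noncomputable abbrev π (P : Pt X) {N : S.Obj} (q : N ⟶ P.M) : P.res q ⟶ P := ofEq q rfl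

end Pt

variable (X)

lemma fibG_proj : FibG (Pt.proj X) where
  exists_lift P f := ⟨P.res f, P.π f, IsHomLift.map (Pt.proj X) (P.π f)⟩
  exists_fac := by
    intro P Q R U V W f φ k ψ hφ hψ
    obtain rfl : P.M = U := isHomLift_dom hψ
    obtain rfl : Q.M = V := isHomLift_dom hφ
    obtain rfl : R.M = W := isHomLift_cod hφ
    obtain rfl : f = Pt.Hom.a φ := isHomLift_unique hφ (IsHomLift.map (Pt.proj X) φ)
    have e : k ≫ Pt.Hom.a φ = Pt.Hom.a ψ := isHomLift_unique hψ (IsHomLift.map (Pt.proj X) ψ)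
    obtain ⟨b, h₁, h₂, h₃, h₄⟩ := X.exists_mul_inv (k ≫ Pt.Hom.g φ)
    have h : Pt.Hom.g ψ ≫ X.t = b ≫ X.s := by
      rw [h₁, Pt.Hom.g_t, Category.assoc, Pt.Hom.g_t, ← e, Category.assoc]
    let χ : P ⟶ Q := ⟨k, X.mul (Pt.Hom.g ψ) b, by rw [X.mul_s h, Pt.Hom.g_s], by
      rw [X.mul_t h, h₂, Category.assoc, Pt.Hom.g_s]⟩
    refine ⟨χ, IsHomLift.map (Pt.proj X) χ, Pt.hom_ext e ?_⟩
    change X.mul (X.mul _ b) (k ≫ _) = _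
    rw [X.mul_assoc h h₂, h₄, X.mul_one]
    rw [h, h₁]
  hom_ext := by
    intro P Q R U V k φ χ χ' hχ hχ' e
    obtain rfl : P.M = U := isHomLift_dom hχ
    obtain rfl : Q.M = V := isHomLift_cod hχ
    obtain rfl : k = Pt.Hom.a χ := isHomLift_unique hχ (IsHomLift.map (Pt.proj X) χ)
    have e' : Pt.Hom.a χ = Pt.Hom.a χ' := isHomLift_unique hχ' (IsHomLift.map (Pt.proj X) χ')
    refine Pt.hom_ext e' ?_
    have h := congrArg Pt.Hom.g e
    rw [Pt.comp_g, Pt.comp_g, ← e'] at h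
    refine X.mul_right_cancel ?_ ?_ h
    · rw [Pt.Hom.g_t, Category.assoc, Pt.Hom.g_s]
    · rw [Pt.Hom.g_t, Category.assoc, Pt.Hom.g_s, e']

lemma gluesMor_proj (hS : IsGoodSite S) : GluesMor (Pt.proj X) S.topology := by
  intro P Q m R hR ψ h₁ h₂
  have h₁' {N : S.Obj} (f : N ⟶ P.M) (hf : R f) : Pt.Hom.a (ψ (P.π f) hf) = f ≫ m := h₁ _ hf
  have hψ {c : Pt X} (φ : c ⟶ P) (h : R (Pt.Hom.a φ)) :
      Pt.Hom.g (ψ φ h) = X.mul (Pt.Hom.g φ) (Pt.Hom.g (P := P.res (Pt.Hom.a φ)) (ψ (P.π (Pt.Hom.a φ)) h)) := by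
    let θ : c ⟶ P.res (Pt.Hom.a φ) := ⟨𝟙 _, Pt.Hom.g φ, Pt.Hom.g_s φ, by
      rw [Category.id_comp, Pt.Hom.g_t]⟩
    have e : φ = θ ≫ P.π (Pt.Hom.a φ) :=
      Pt.hom_ext (Category.id_comp _).symm (Pt.comp_ofEq θ _ rfl).symm
    have h' : R (Pt.Hom.a (θ ≫ P.π (Pt.Hom.a φ))) := by rw [← e]; exact h
    have e' : ψ φ h = ψ (θ ≫ P.π (Pt.Hom.a φ)) h' := by congr 1
    rw [e', h₂ θ (P.π (Pt.Hom.a φ)) h h', Pt.comp_g]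
    change X.mul _ (𝟙 _ ≫ _) = _
    rw [Category.id_comp]
  obtain ⟨g, hg, -⟩ := hS.existsUnique_glue hR (fun f hf => Pt.Hom.g (ψ (P.π f) hf))
    (fun {N N'} k f hf hkf => by
      let θ : P.res (k ≫ f) ⟶ P.res f := Pt.ofEq k (Category.assoc _ _ _)
      have e : P.π (k ≫ f) = θ ≫ P.π f := Pt.hom_ext rfl (by
        rw [Pt.ofEq_comp, Pt.ofEq_g, Pt.ofEq_g, Category.assoc, Category.assoc, Category.assoc])
      have h' : R (Pt.Hom.a (θ ≫ P.π f)) := hkf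
      have e' : ψ (P.π (k ≫ f)) hkf = ψ (θ ≫ P.π f) h' := by congr 1
      rw [e', h₂ θ (P.π f) hf h', Pt.ofEq_comp])
  let Ψ : P ⟶ Q := ⟨m, g, by
    refine hS.hom_ext hR fun f hf => ?_
    rw [← Category.assoc, hg f hf, Pt.Hom.g_s], by
    refine hS.hom_ext hR fun f hf => ?_
    rw [← Category.assoc, hg f hf, Pt.Hom.g_t, h₁', Category.assoc]⟩
  refine ⟨Ψ, ⟨rfl, fun {c} φ h => Pt.hom_ext (h₁ φ h).symm ?_⟩, fun Ψ' h => Pt.hom_ext h.1 ?_⟩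
  · rw [hψ, ← hg _ h]
    rfl
  · refine hS.hom_ext hR fun f hf => ?_
    have := congrArg Pt.Hom.g (h.2 (P.π f) hf)
    rw [Pt.ofEq_comp] at this
    exact this.trans (hg f hf).symm

end GroupoidIn

open GroupoidIn

section

variable {S : SpaceCat.{v, u}}

lemma IsLocalEquiv.comp {𝒜 ℬ 𝒟 : BasedCategory.{v, max u v} S.Obj} {w : 𝒜 ⟶ ℬ} {w' : ℬ ⟶ 𝒟}
    (h : IsLocalEquiv w S.topology) (h' : IsLocalEquiv w' S.topology) :
    IsLocalEquiv (w ≫ w') S.topology where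
  source := h.source
  target := h'.target
  full :=
    have := h.full
    have := h'.full
    inferInstanceAs (w.toFunctor ⋙ w'.toFunctor).Full
  faithful :=
    have := h.faithful
    have := h'.faithful
    inferInstanceAs (w.toFunctor ⋙ w'.toFunctor).Faithful
  cov d := by
    refine S.topology.transitive (h'.cov d) _ ?_
    intro L f hf
    obtain ⟨⟨b, k⟩, g, hg⟩ := (Sieve.mem_ofArrows_iff _ _ _).1 hf
    subst hg
    obtain ⟨b', φ, hφ⟩ := h.target.exists_lift' (w'.w_obj b).symm g
    obtain rfl : ℬ.p.obj b' = L := isHomLift_dom hφ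
    refine S.topology.superset_covering ?_ (h.cov b')
    intro K l hl
    obtain ⟨⟨a, m⟩, (n : K ⟶ ℬ.p.obj (w.obj a)), hn⟩ := (Sieve.mem_ofArrows_iff _ _ _).1 hl
    change l = n ≫ ℬ.p.map m at hn
    subst hn
    refine (Sieve.mem_ofArrows_iff _ _ _).2 ⟨⟨a, w'.map (m ≫ φ) ≫ k⟩,
      n ≫ eqToHom (w'.w_obj (w.obj a)).symm, ?_⟩
    have e₁ : ℬ.p.map φ = g ≫ eqToHom (isHomLift_cod hφ).symm := by
      simpa using IsHomLift.fac' ℬ.p g φ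
    have e₂ := map_isHomLift w' (IsHomLift.map ℬ.p (m ≫ φ))
    have e₃ : 𝒟.p.map (w'.map (m ≫ φ)) = eqToHom (w'.w_obj (w.obj a)) ≫ ℬ.p.map m ≫ g := by
      refine (IsHomLift.fac' 𝒟.p (ℬ.p.map (m ≫ φ)) (w'.map (m ≫ φ))).trans ?_
      simp [e₁]
    change (n ≫ ℬ.p.map m) ≫ g ≫ 𝒟.p.map k =
      (n ≫ eqToHom (w'.w_obj (w.obj a)).symm) ≫ 𝒟.p.map (w'.map (m ≫ φ) ≫ k)
    rw [𝒟.p.map_comp, e₃]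
    simp only [Category.assoc, eqToHom_trans_assoc, eqToHom_refl, Category.id_comp]

variable [S.IsGeometric]

lemma isLocalEquiv_toBasedMap (hS : IsGoodSite S) {Z X : GroupoidIn S} (F : Z ⟶ X)
    [IsAcyclicFib F] : IsLocalEquiv (toBasedMap F) S.topology where
  source := fibG_proj Z
  target := fibG_proj X
  full := ⟨fun {P Q} (φ : Pt.Hom (X := X) ⟨P.M, P.x ≫ F.f₀⟩ ⟨Q.M, Q.x ≫ F.f₀⟩) => by
    have h₁ : φ.g ≫ X.s = Pt.x P ≫ F.f₀ := φ.g_s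
    have h₂ : φ.g ≫ X.t = (φ.a ≫ Pt.x Q) ≫ F.f₀ := φ.g_t.trans (Category.assoc _ _ _).symm
    let ψ : Pt.Hom P Q := ⟨φ.a, lift F P.x (φ.a ≫ Q.x) φ.g, lift_s F h₁ h₂, lift_t F h₁ h₂⟩
    exact ⟨ψ, Pt.Hom.ext rfl (lift_f₁ F h₁ h₂)⟩⟩
  faithful := ⟨fun {P Q} (φ ψ : Pt.Hom P Q) e => by
    let F' (χ : Pt.Hom P Q) : Pt.Hom (X := X) ⟨P.M, P.x ≫ F.f₀⟩ ⟨Q.M, Q.x ≫ F.f₀⟩ :=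
      (toBasedMap F).map χ
    have e' : F' φ = F' ψ := e
    obtain ⟨h₁, h₂⟩ := Pt.Hom.ext_iff.1 e'
    refine Pt.Hom.ext h₁ (lift_ext F ?_ ?_ h₂)
    · rw [φ.g_s, ψ.g_s]
    · rw [φ.g_t, ψ.g_t]
      exact congrArg (· ≫ _) h₁⟩
  cov P := by
    have : HasPullback (Pt.x P) F.f₀ := SpaceCat.IsGeometric.hasPullback _ _ IsAcyclicFib.etale
    have h := (S.etale ⊓ S.surj).pullback_fst (Pt.x P) F.f₀
      ⟨IsAcyclicFib.etale, IsAcyclicFib.surj⟩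
    refine S.topology.superset_covering ?_ (hS.generate_mem _ h.1 h.2)
    rw [Sieve.generate_le_iff]
    rintro _ _ ⟨⟩
    let Q : Pt Z := ⟨_, pullback.snd (Pt.x P) F.f₀⟩
    let φ : Pt.Hom (X := X) ⟨Q.M, Q.x ≫ F.f₀⟩ P := Pt.ofEq (pullback.fst _ _)
      pullback.condition.symm
    exact (Sieve.mem_ofArrows_iff _ _ _).2 ⟨⟨Q, φ⟩, 𝟙 _, (Category.id_comp _).symm⟩

end

end Orbi

namespace Orbi

open GroupoidIn

/-- A stack associated with a groupoid. -/
structure AssocStack {S : SpaceCat.{v, u}} (X : GroupoidIn S) where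
  stack : BasedCategory.{v, max u v} S.Obj
  j : toBased X ⟶ stack
  isStack : IsStack stack
  isLocalEquiv : IsLocalEquiv j S.topology

namespace AssocStack

variable {S : SpaceCat.{v, u}} {X : GroupoidIn S} (A : AssocStack X)

/-- The functor from the points of `X` to the associated stack. -/
noncomputable def J : Pt X ⥤ A.stack.obj := A.j.toFunctor

instance : A.J.Full := A.isLocalEquiv.full

instance : A.J.Faithful := A.isLocalEquiv.faithful

lemma isHomLift_J {P Q : Pt X} (φ : P ⟶ Q) : A.stack.p.IsHomLift (Pt.Hom.a φ) (A.J.map φ) :=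
  map_isHomLift A.j (IsHomLift.map (toBased X).p φ)

lemma p_J (P : Pt X) : A.stack.p.obj (A.J.obj P) = P.M := A.j.w_obj P

lemma exists_J_map {P Q : Pt X} {f : P.M ⟶ Q.M} {φ : A.J.obj P ⟶ A.J.obj Q}
    (h : A.stack.p.IsHomLift f φ) : ∃ ψ : P ⟶ Q, A.J.map ψ = φ ∧ Pt.Hom.a ψ = f := by
  obtain ⟨ψ, rfl⟩ := A.J.map_surjective φ
  exact ⟨ψ, rfl, isHomLift_unique (A.isHomLift_J ψ) h⟩

lemma hom_ext_of_cover (hS : IsGoodSite S) {P P' : Pt X} {y : A.stack.obj} {U : S.Obj}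
    {m : P.M ⟶ U} {Ψ Ψ' : A.J.obj P ⟶ y} (h : A.stack.p.IsHomLift m Ψ)
    (h' : A.stack.p.IsHomLift m Ψ') (κ : P' ⟶ P) (hκ : S.etale (Pt.Hom.a κ))
    (hκ' : S.surj (Pt.Hom.a κ)) (e : A.J.map κ ≫ Ψ = A.J.map κ ≫ Ψ') : Ψ = Ψ' := by
  refine A.isStack.gluesMor.ext A.isStack.fibG (fun _ : Unit => P'.M) (fun _ => Pt.Hom.a κ) _
    (fun _ => A.J.map κ) (fun _ => A.isHomLift_J κ) ?_ h h' (fun _ => e)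
  refine S.topology.superset_covering ?_ (hS.generate_mem _ hκ hκ')
  rw [Sieve.generate_le_iff]
  rintro _ _ ⟨⟩
  exact Sieve.ofArrows_mk _ _ ()

lemma isIso_J {P Q : Pt X} (φ : P ⟶ Q) [IsIso (Pt.Hom.a φ)] : IsIso φ :=
  (fibG_proj X).isIso_of_isIso (IsHomLift.map (Pt.proj X) φ)

end AssocStack

variable {S : SpaceCat.{v, u}} [S.IsGeometric] {X Y W V : GroupoidIn S} [IsSGroupoid X]

/-- A point of a span together with its images under the two legs. -/
structure SPt (σ : Span X Y) where
  M : S.Obj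
  z : M ⟶ σ.Z.G₀
  x : M ⟶ X.G₀
  y : M ⟶ Y.G₀
  hx : z ≫ σ.s.f₀ = x
  hy : z ≫ σ.f.f₀ = y

namespace SPt

variable {σ τ ρ : Span X Y}

/-- The underlying point of the apex. -/
abbrev pt (P : SPt σ) : Pt σ.Z := ⟨P.M, P.z⟩

/-- The image under the left leg. -/
abbrev src (P : SPt σ) : Pt X := ⟨P.M, P.x⟩

/-- The image under the right leg. -/
abbrev tgt (P : SPt σ) : Pt Y := ⟨P.M, P.y⟩

/-- The image of an arrow under the left leg. -/
abbrev srcMap {P Q : SPt σ} (ω : P.pt ⟶ Q.pt) : P.src ⟶ Q.src :=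
  ⟨(Pt.Hom.a ω :), (Pt.Hom.g ω :) ≫ σ.s.f₁, by simp [reassoc_of% (Pt.Hom.g_s ω), P.hx],
    by simp [reassoc_of% (Pt.Hom.g_t ω), Q.hx]⟩

/-- The image of an arrow under the right leg. -/
abbrev tgtMap {P Q : SPt σ} (ω : P.pt ⟶ Q.pt) : P.tgt ⟶ Q.tgt :=
  ⟨(Pt.Hom.a ω :), (Pt.Hom.g ω :) ≫ σ.f.f₁, by simp [reassoc_of% (Pt.Hom.g_s ω), P.hy],
    by simp [reassoc_of% (Pt.Hom.g_t ω), Q.hy]⟩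

/-- A point of the apex. -/
abbrev mk' (σ : Span X Y) (P : Pt σ.Z) : SPt σ := ⟨P.M, P.x, P.x ≫ σ.s.f₀, P.x ≫ σ.f.f₀, rfl, rfl⟩

/-- The restriction of a point of a span. -/
abbrev res (P : SPt σ) {N : S.Obj} (q : N ⟶ P.M) : SPt σ :=
  ⟨N, q ≫ P.z, q ≫ P.x, q ≫ P.y, by simp [P.hx], by simp [P.hy]⟩

lemma exists_srcMap {P Q : SPt σ} (φ : P.src ⟶ Q.src) : ∃ ω : P.pt ⟶ Q.pt, srcMap ω = φ := by
  have h₁ : Pt.Hom.g φ ≫ X.s = P.z ≫ σ.s.f₀ := by rw [Pt.Hom.g_s, P.hx]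
  have h₂ : Pt.Hom.g φ ≫ X.t = (Pt.Hom.a φ ≫ Q.z) ≫ σ.s.f₀ := by
    rw [Pt.Hom.g_t, Category.assoc, Q.hx]
  exact ⟨⟨(Pt.Hom.a φ :), lift σ.s P.z ((Pt.Hom.a φ :) ≫ Q.z) (Pt.Hom.g φ :), lift_s _ h₁ h₂,
    lift_t _ h₁ h₂⟩, Pt.hom_ext rfl (lift_f₁ _ h₁ h₂)⟩

lemma exists_factor (τ : Span X Y) (P : SPt σ) {Q : Pt X} (φ : P.src ⟶ Q) :
    ∃ (P' : SPt σ) (κ : P'.pt ⟶ P.pt) (R : SPt τ) (φ₁ : P'.src ⟶ R.src) (ψ : R.src ⟶ Q),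
      S.etale (Pt.Hom.a κ) ∧ S.surj (Pt.Hom.a κ) ∧ IsIso (Pt.Hom.a φ₁) ∧
      srcMap κ ≫ φ = φ₁ ≫ ψ := by
  have : HasPullback P.x τ.s.f₀ :=
    SpaceCat.IsGeometric.hasPullback _ _ IsAcyclicFib.etale
  have h := (S.etale ⊓ S.surj).pullback_fst P.x τ.s.f₀ ⟨IsAcyclicFib.etale, IsAcyclicFib.surj⟩
  let P' := P.res (pullback.fst P.x τ.s.f₀)
  let R : SPt τ := ⟨_, pullback.snd P.x τ.s.f₀, _, _, rfl, rfl⟩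
  let κ : P'.pt ⟶ P.pt := Pt.π P.pt _
  let φ₁ : P'.src ⟶ R.src := Pt.ofEq (𝟙 _) (by
    rw [Category.id_comp]
    exact pullback.condition)
  have : IsIso (Pt.Hom.a φ₁) := inferInstanceAs (IsIso (𝟙 _))
  have : IsIso φ₁ := AssocStack.isIso_J φ₁
  exact ⟨P', κ, R, φ₁, inv φ₁ ≫ srcMap κ ≫ φ, h.1, h.2, ‹_›, by simp⟩

end SPt

namespace Span.ECell

variable {σ τ ρ : Span X Y}

/-- The action of an extended 2-morphism. -/
noncomputable def mapHom (η : ECell σ τ) {P : SPt σ} {Q : SPt τ} (φ : P.src ⟶ Q.src) :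
    P.tgt ⟶ Q.tgt :=
  have h₁ : Pt.Hom.g φ ≫ X.s = P.z ≫ σ.s.f₀ := by rw [Pt.Hom.g_s, P.hx]
  have h₂ : Pt.Hom.g φ ≫ X.t = (Pt.Hom.a φ ≫ Q.z) ≫ τ.s.f₀ := by
    rw [Pt.Hom.g_t, Category.assoc, Q.hx]
  ⟨(Pt.Hom.a φ :), η.ev P.z ((Pt.Hom.a φ :) ≫ Q.z) (Pt.Hom.g φ :), by rw [ev_s _ h₁ h₂, P.hy],
    by rw [ev_t _ h₁ h₂, Category.assoc, Q.hy]⟩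

lemma mapHom_g (η : ECell σ τ) {P : SPt σ} {Q : SPt τ} (φ : P.src ⟶ Q.src) :
    Pt.Hom.g (η.mapHom φ) = η.ev P.z (Pt.Hom.a φ ≫ Q.z) (Pt.Hom.g φ) := rfl

lemma g_comp_s {P : SPt σ} {Q : Pt X} (φ : P.src ⟶ Q) : Pt.Hom.g φ ≫ X.s = P.z ≫ σ.s.f₀ := by
  rw [Pt.Hom.g_s, P.hx]

lemma g_comp_t {P : Pt X} {Q : SPt τ} (φ : P ⟶ Q.src) :
    Pt.Hom.g φ ≫ X.t = (Pt.Hom.a φ ≫ Q.z) ≫ τ.s.f₀ := by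
  rw [Pt.Hom.g_t, Category.assoc, Q.hx]

lemma mapHom_left (η : ECell σ τ) {P P' : SPt σ} {Q : SPt τ} (ω : P'.pt ⟶ P.pt)
    (φ : P.src ⟶ Q.src) : η.mapHom (SPt.srcMap ω ≫ φ) = SPt.tgtMap ω ≫ η.mapHom φ := by
  refine Pt.hom_ext rfl ?_
  rw [mapHom_g, Pt.comp_g, Pt.comp_g, mapHom_g]
  have h := η.ev_left (z := (Pt.Hom.a ω :) ≫ P.z) (z' := (Pt.Hom.a ω :) ≫ (Pt.Hom.a φ :) ≫ Q.z)
    (x := Pt.Hom.a ω ≫ Pt.Hom.g φ) (by rw [Category.assoc, g_comp_s, Category.assoc])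
    (by rw [Category.assoc, g_comp_t]; simp only [Category.assoc]) (Pt.Hom.g ω) (Pt.Hom.g_t ω)
  rw [Pt.Hom.g_s] at h
  rw [η.comp_ev (g_comp_s φ) (g_comp_t φ)]
  refine Eq.trans ?_ h
  rw [Pt.comp_a, Category.assoc]

lemma mapHom_right (η : ECell σ τ) {P : SPt σ} {Q Q' : SPt τ} (φ : P.src ⟶ Q.src)
    (ω : Q.pt ⟶ Q'.pt) : η.mapHom (φ ≫ SPt.srcMap ω) = η.mapHom φ ≫ SPt.tgtMap ω := by
  refine Pt.hom_ext rfl ?_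
  rw [mapHom_g, Pt.comp_g, Pt.comp_g, mapHom_g]
  have h := η.ev_right (g_comp_s φ) (g_comp_t φ) (Pt.Hom.a φ ≫ Pt.Hom.g ω)
    (by rw [Category.assoc, Pt.Hom.g_s])
  rw [Category.assoc, Pt.Hom.g_t] at h
  simp only [Category.assoc] at h
  exact (congrArg (fun z => η.ev P.z z _) (Category.assoc _ _ _)).trans h

lemma comp_mapHom (η : ECell σ τ) (θ : ECell τ ρ) {P : SPt σ} {Q : SPt τ} {R : SPt ρ}
    (φ : P.src ⟶ Q.src) (ψ : Q.src ⟶ R.src) :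
    (η.comp θ).mapHom (φ ≫ ψ) = η.mapHom φ ≫ θ.mapHom ψ := by
  refine Pt.hom_ext rfl ?_
  rw [mapHom_g, Pt.comp_g, Pt.comp_g, mapHom_g, mapHom_g]
  have h := comp_ev_eq η θ (z := P.z) (w := Pt.Hom.a φ ≫ Q.z) (z' := Pt.Hom.a φ ≫ Pt.Hom.a ψ ≫ R.z)
    (x := Pt.Hom.g φ) (y := Pt.Hom.a φ ≫ Pt.Hom.g ψ) (g_comp_s φ) (g_comp_t φ)
    (by rw [Category.assoc, g_comp_s, Category.assoc])
    (by rw [Category.assoc, g_comp_t]; simp only [Category.assoc])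
  rw [θ.comp_ev (g_comp_s ψ) (g_comp_t ψ)]
  refine Eq.trans ?_ h
  rw [Pt.comp_a, Category.assoc]

/-- The image of a point under a morphism of spans. -/
abbrev _root_.Orbi.SPt.map (P : SPt σ) (φ : σ.Z ⟶ τ.Z) (hs : φ ≫ τ.s = σ.s) (hf : φ ≫ τ.f = σ.f) :
    SPt τ :=
  ⟨P.M, P.z ≫ φ.f₀, P.x, P.y, by rw [← P.hx, ← hs, GroupoidIn.comp_f₀, Category.assoc],
    by rw [← P.hy, ← hf, GroupoidIn.comp_f₀, Category.assoc]⟩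

lemma ofMap_mapHom (φ : σ.Z ⟶ τ.Z) (hs : φ ≫ τ.s = σ.s) (hf : φ ≫ τ.f = σ.f) {P : SPt σ}
    {Q : SPt τ} (ω : (P.map φ hs hf).pt ⟶ Q.pt) :
    (ofMap φ hs hf).mapHom (P := P) (Q := Q) (SPt.srcMap (P := P.map φ hs hf) ω) =
      SPt.tgtMap (P := P.map φ hs hf) ω := by
  refine Pt.hom_ext rfl ?_
  rw [mapHom_g, ofMap_ev, lift_uniq τ.s (Pt.Hom.g ω) (Pt.Hom.g_s ω) (Pt.Hom.g_t ω) rfl]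
  · exact g_comp_s (P := P) (SPt.srcMap (P := P.map φ hs hf) ω)
  · exact g_comp_t (Q := Q) (SPt.srcMap (P := P.map φ hs hf) ω)

lemma mapHom_injective {η θ : ECell σ τ} (h : ∀ {P : SPt σ} {Q : SPt τ} (φ : P.src ⟶ Q.src),
    η.mapHom φ = θ.mapHom φ) : η = θ := by
  refine ext' fun {M} z z' x hx hx' => ?_
  let P : SPt σ := ⟨M, z, _, _, rfl, rfl⟩
  let Q : SPt τ := ⟨M, z', _, _, rfl, rfl⟩
  let φ : P.src ⟶ Q.src := ⟨𝟙 _, x, hx, by rw [hx', Category.id_comp]⟩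
  have e := congrArg Pt.Hom.g (h φ)
  rw [mapHom_g, mapHom_g] at e
  change η.ev z (𝟙 M ≫ z') x = θ.ev z (𝟙 M ≫ z') x at e
  rwa [Category.id_comp] at e

end Span.ECell

end Orbi

namespace Orbi

open GroupoidIn Orbi.Span

variable {S : SpaceCat.{v, u}} [S.IsGeometric] {X Y W V : GroupoidIn S} [IsSGroupoid X]

/-- A functor between associated stacks that is presented by a span. -/
structure Datum (σ : Span X Y) (A : AssocStack X) (B : AssocStack Y) where
  E : BasedFunctor A.stack B.stack
  i : ∀ P : SPt σ, B.J.obj P.tgt ⟶ E.obj (A.J.obj P.src)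
  isHomLift_i : ∀ P : SPt σ, B.stack.p.IsHomLift (𝟙 P.M) (i P)
  nat : ∀ {P Q : SPt σ} (ω : P.pt ⟶ Q.pt),
    B.J.map (SPt.tgtMap ω) ≫ i Q = i P ≫ E.map (A.J.map (SPt.srcMap ω))

namespace Datum

variable {A : AssocStack X} {B : AssocStack Y} {σ τ ρ : Span X Y}

instance (D : Datum σ A B) (P : SPt σ) : IsIso (D.i P) :=
  B.isStack.fibG.isIso_of_id (D.isHomLift_i P)

lemma isHomLift_E {A : AssocStack X} {B : AssocStack Y} (E : BasedFunctor A.stack B.stack)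
    {P Q : Pt X} (φ : P ⟶ Q) :
    B.stack.p.IsHomLift (Pt.Hom.a φ) (E.map (A.J.map φ)) :=
  map_isHomLift E (A.isHomLift_J φ)

lemma i_congr (D : Datum σ A B) {M : S.Obj} {z z' : M ⟶ σ.Z.G₀} {x : M ⟶ X.G₀} {y : M ⟶ Y.G₀}
    (e : z = z') (hx : z ≫ σ.s.f₀ = x) (hy : z ≫ σ.f.f₀ = y) (hx' : z' ≫ σ.s.f₀ = x)
    (hy' : z' ≫ σ.f.f₀ = y) : D.i ⟨M, z, x, y, hx, hy⟩ = D.i ⟨M, z', x, y, hx', hy'⟩ := by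
  subst e
  rfl

/-- The compatibility of a 2-morphism with an extended 2-morphism at an arrow. -/
def IndAt (D : Datum σ A B) (D' : Datum τ A B) (η : ECell σ τ) (β : BasedNatTrans D.E D'.E)
    {P : SPt σ} {Q : SPt τ} (φ : P.src ⟶ Q.src) : Prop :=
  D.i P ≫ β.app (A.J.obj P.src) ≫ D'.E.map (A.J.map φ) = B.J.map (η.mapHom φ) ≫ D'.i Q

/-- The 2-morphism `β` is induced by the extended 2-morphism `η`. -/
def IsInd (D : Datum σ A B) (D' : Datum τ A B) (η : ECell σ τ) (β : BasedNatTrans D.E D'.E) :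
    Prop :=
  ∀ ⦃P : SPt σ⦄ ⦃Q : SPt τ⦄ (φ : P.src ⟶ Q.src), IndAt D D' η β φ

variable {D : Datum σ A B} {D' : Datum τ A B} {D'' : Datum ρ A B} {η : ECell σ τ} {θ : ECell τ ρ}
  {β β' : BasedNatTrans D.E D'.E} {γ : BasedNatTrans D'.E D''.E}

lemma nat_comp (β : BasedNatTrans D.E D'.E) {P Q : SPt σ} (ω : P.pt ⟶ Q.pt) :
    B.J.map (SPt.tgtMap ω) ≫ D.i Q ≫ β.app (A.J.obj Q.src) =
      D.i P ≫ β.app (A.J.obj P.src) ≫ D'.E.map (A.J.map (SPt.srcMap ω)) := by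
  rw [← Category.assoc, D.nat, Category.assoc]
  exact congrArg _ (β.naturality _)

namespace IndAt

lemma right {P : SPt σ} {Q Q' : SPt τ} {φ : P.src ⟶ Q.src} (h : IndAt D D' η β φ)
    (ω : Q.pt ⟶ Q'.pt) : IndAt D D' η β (φ ≫ SPt.srcMap ω) := by
  unfold IndAt at h ⊢
  rw [η.mapHom_right, A.J.map_comp, D'.E.map_comp, B.J.map_comp, Category.assoc, D'.nat,
    ← reassoc_of% h]

lemma left_iff {P P' : SPt σ} {Q : SPt τ} {φ : P.src ⟶ Q.src} (ω : P'.pt ⟶ P.pt) :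
    IndAt D D' η β (SPt.srcMap ω ≫ φ) ↔
      B.J.map (SPt.tgtMap ω) ≫ D.i P ≫ β.app (A.J.obj P.src) ≫ D'.E.map (A.J.map φ) =
        B.J.map (SPt.tgtMap ω) ≫ B.J.map (η.mapHom φ) ≫ D'.i Q := by
  unfold IndAt
  rw [η.mapHom_left, A.J.map_comp, D'.E.map_comp, B.J.map_comp, Category.assoc,
    ← reassoc_of% (nat_comp β ω)]

lemma isHomLift {P : SPt σ} (β : BasedNatTrans D.E D'.E) {Q : Pt X} (φ : P.src ⟶ Q) :
    B.stack.p.IsHomLift (Pt.Hom.a φ)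
      (D.i P ≫ β.app (A.J.obj P.src) ≫ D'.E.map (A.J.map φ)) :=
  isHomLift_id_comp (D.isHomLift_i P) (isHomLift_id_comp (β.isHomLift (A.p_J P.src))
    (isHomLift_E _ φ))

lemma of_cover (hS : IsGoodSite S) {P P' : SPt σ} {Q : SPt τ} {φ : P.src ⟶ Q.src}
    (ω : P'.pt ⟶ P.pt) (h₁ : S.etale (Pt.Hom.a ω)) (h₂ : S.surj (Pt.Hom.a ω))
    (h : IndAt D D' η β (SPt.srcMap ω ≫ φ)) : IndAt D D' η β φ :=
  B.hom_ext_of_cover hS (isHomLift β φ)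
    (isHomLift_comp_id (B.isHomLift_J (η.mapHom φ)) (D'.isHomLift_i Q)) (SPt.tgtMap ω) h₁ h₂
    ((left_iff ω).1 h)

lemma comp {P : SPt σ} {Q : SPt τ} {R : SPt ρ} {φ : P.src ⟶ Q.src} {ψ : Q.src ⟶ R.src}
    (h : IndAt D D' η β φ) (h' : IndAt D' D'' θ γ ψ) :
    IndAt D D'' (η.comp θ) (BasedNatTrans.comp β γ) (φ ≫ ψ) := by
  unfold IndAt at h h' ⊢
  rw [ECell.comp_mapHom, A.J.map_comp, D''.E.map_comp, B.J.map_comp, Category.assoc, ← h',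
    ← reassoc_of% h]
  have := γ.naturality (A.J.map φ)
  rw [reassoc_of% this]
  simp

end IndAt

namespace IsInd

lemma comp (hS : IsGoodSite S) (h : IsInd D D' η β) (h' : IsInd D' D'' θ γ) :
    IsInd D D'' (η.comp θ) (BasedNatTrans.comp β γ) := by
  intro P Q φ
  obtain ⟨P', κ, R, φ₁, ψ, h₁, h₂, -, e⟩ := P.exists_factor τ φ
  refine IndAt.of_cover hS κ h₁ h₂ ?_
  rw [e]
  exact (h φ₁).comp (h' ψ)

lemma unique (hS : IsGoodSite S) (h : IsInd D D' η β) (h' : IsInd D D' η β') : β = β' := by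
  refine ((isLocalEquiv_toBasedMap hS σ.s).comp A.isLocalEquiv).natTrans_ext B.isStack.fibG
    B.isStack.gluesMor fun (P₀ : Pt σ.Z) => ?_
  let P : SPt σ := SPt.mk' σ P₀
  obtain ⟨P', κ, R, φ₁, -, h₁, h₂, h₃, -⟩ := P.exists_factor τ (𝟙 P.src)
  have := AssocStack.isIso_J φ₁
  have e : β.app (A.J.obj P'.src) = β'.app (A.J.obj P'.src) := by
    have := (h φ₁).trans (h' φ₁).symm
    rwa [cancel_epi, cancel_mono] at this
  change β.app (A.J.obj P.src) = β'.app (A.J.obj P.src)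
  rw [← cancel_epi (D.i P)]
  refine B.hom_ext_of_cover hS (m := 𝟙 P.M)
    (isHomLift_id_comp (D.isHomLift_i P) (β.isHomLift (A.p_J P.src)))
    (isHomLift_id_comp (D.isHomLift_i P) (β'.isHomLift (A.p_J P.src))) (SPt.tgtMap κ) h₁ h₂ ?_
  rw [nat_comp, nat_comp, e]

lemma of_map (φ : σ.Z ⟶ τ.Z) (hs : φ ≫ τ.s = σ.s) (hf : φ ≫ τ.f = σ.f)
    (h : ∀ P : SPt σ, D.i P ≫ β.app (A.J.obj P.src) = D'.i (P.map φ hs hf)) :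
    IsInd D D' (ECell.ofMap φ hs hf) β := by
  intro P Q ψ
  obtain ⟨ω, rfl⟩ := SPt.exists_srcMap (P := P.map φ hs hf) (Q := Q) ψ
  unfold IndAt
  rw [ECell.ofMap_mapHom, D'.nat, ← reassoc_of% (h P)]

end IsInd

section exists_isInd

/-- The point of `σ` given by a point of the naive fiber product. -/
noncomputable abbrev nfpSrc (p : Pt (nfp σ.s τ.s)) : SPt σ :=
  SPt.mk' σ ((toBasedMap (nfpFst σ.s τ.s)).obj p)

/-- The point of `τ` given by a point of the naive fiber product. -/
noncomputable abbrev nfpTgt (p : Pt (nfp σ.s τ.s)) : SPt τ :=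
  SPt.mk' τ ((toBasedMap (nfpSnd σ.s τ.s)).obj p)

/-- The identity between the images of the components of a point of the naive fiber product. -/
noncomputable abbrev nfpEq (p : Pt (nfp σ.s τ.s)) : (nfpSrc p).src ⟶ (nfpTgt p).src :=
  Pt.ofEq (𝟙 p.M) (by
    change (p.x ≫ _) ≫ _ = 𝟙 _ ≫ (p.x ≫ _) ≫ _
    rw [Category.id_comp, Category.assoc, Category.assoc, nfp_condition])

instance (p : Pt (nfp σ.s τ.s)) : IsIso (nfpEq p) :=
  have : IsIso (Pt.Hom.a (nfpEq p)) := inferInstanceAs (IsIso (𝟙 _))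
  AssocStack.isIso_J _

lemma exists_nfp_cover (τ : Span X Y) (P : SPt σ) : ∃ (p : Pt (nfp σ.s τ.s))
    (ω : (nfpSrc p).pt ⟶ P.pt), S.etale (Pt.Hom.a ω) ∧ S.surj (Pt.Hom.a ω) := by
  have : HasPullback P.x τ.s.f₀ :=
    SpaceCat.IsGeometric.hasPullback _ _ IsAcyclicFib.etale
  have h := (S.etale ⊓ S.surj).pullback_fst P.x τ.s.f₀ ⟨IsAcyclicFib.etale, IsAcyclicFib.surj⟩
  let q := nfpPair (F := σ.s) (G := τ.s) (pullback.fst P.x τ.s.f₀ ≫ P.z)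
    (pullback.snd P.x τ.s.f₀) (by
      rw [Category.assoc, P.hx, pullback.condition])
  exact ⟨⟨_, q⟩, Pt.ofEq (pullback.fst P.x τ.s.f₀) (nfpPair_fst _ _ _ _ _), h.1, h.2⟩

/-- Every extended 2-morphism induces a 2-morphism. -/
lemma exists_isInd (hS : IsGoodSite S) (D : Datum σ A B) (D' : Datum τ A B) (η : ECell σ τ) :
    ∃ β : BasedNatTrans D.E D'.E, IsInd D D' η β := by
  let α (p : Pt (nfp σ.s τ.s)) :
      D.E.obj (A.J.obj (nfpSrc p).src) ⟶ D'.E.obj (A.J.obj (nfpSrc p).src) :=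
    inv (D.i (nfpSrc p)) ≫ (B.J.map (η.mapHom (nfpEq p)) ≫ D'.i (nfpTgt p)) ≫
      inv (D'.E.map (A.J.map (nfpEq p)))
  have hα (p) : D.i (nfpSrc p) ≫ α p ≫ D'.E.map (A.J.map (nfpEq p)) =
      B.J.map (η.mapHom (nfpEq p)) ≫ D'.i (nfpTgt p) := by simp [α]
  have hα' (p : Pt (nfp σ.s τ.s)) : B.stack.p.IsHomLift (𝟙 p.M) (α p) := by
    have h₁ : B.stack.p.IsHomLift (𝟙 p.M) (D.i (nfpSrc p)) := D.isHomLift_i (nfpSrc p)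
    have h₂ : B.stack.p.IsHomLift (𝟙 p.M) (D'.E.map (A.J.map (nfpEq p))) :=
      isHomLift_E D'.E (nfpEq p)
    have h₃ : B.stack.p.IsHomLift (𝟙 p.M) (B.J.map (η.mapHom (nfpEq p))) :=
      B.isHomLift_J (η.mapHom (nfpEq p))
    exact isHomLift_comp_id (IsHomLift.lift_id_inv_isIso B.stack.p p.M _) (isHomLift_comp_id
      (isHomLift_comp_id h₃ (D'.isHomLift_i (nfpTgt p)))
      (IsHomLift.lift_id_inv_isIso B.stack.p p.M _))
  have nat {p p' : Pt (nfp σ.s τ.s)} (ω : p ⟶ p') :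
      D.E.map (A.J.map (SPt.srcMap (P := nfpSrc p) (Q := nfpSrc p')
        ((toBasedMap (nfpFst σ.s τ.s)).map ω))) ≫ α p' = α p ≫
      D'.E.map (A.J.map (SPt.srcMap (P := nfpSrc p) (Q := nfpSrc p')
        ((toBasedMap (nfpFst σ.s τ.s)).map ω))) := by
    let ωP : (nfpSrc p).pt ⟶ (nfpSrc p').pt := (toBasedMap (nfpFst σ.s τ.s)).map ω
    let ωQ : (nfpTgt p).pt ⟶ (nfpTgt p').pt := (toBasedMap (nfpSnd σ.s τ.s)).map ω
    have e : SPt.srcMap ωP ≫ nfpEq p' = nfpEq p ≫ SPt.srcMap ωQ := by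
      refine Pt.hom_ext ?_ ?_
      · change Pt.Hom.a ω ≫ 𝟙 _ = 𝟙 _ ≫ Pt.Hom.a ω
        simp
      · refine (Pt.comp_ofEq (SPt.srcMap ωP) _ _).trans
          (Eq.trans ?_ (Pt.ofEq_comp _ _ (SPt.srcMap ωQ)).symm)
        change (Pt.Hom.g ω ≫ _) ≫ _ = 𝟙 _ ≫ (Pt.Hom.g ω ≫ _) ≫ _
        rw [Category.id_comp, Category.assoc, Category.assoc, nfp_condition₁]
    change D.E.map (A.J.map (SPt.srcMap ωP)) ≫ α p' = α p ≫ D'.E.map (A.J.map (SPt.srcMap ωP))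
    rw [← cancel_epi (D.i (nfpSrc p)), ← cancel_mono (D'.E.map (A.J.map (nfpEq p'))),
      ← reassoc_of% (D.nat ωP)]
    simp only [Category.assoc]
    rw [hα, ← D'.E.map_comp, ← A.J.map_comp, e, A.J.map_comp, D'.E.map_comp, reassoc_of% (hα p),
      ← D'.nat, ← B.J.map_comp_assoc, ← B.J.map_comp_assoc, ← η.mapHom_left, ← η.mapHom_right, e]
  obtain ⟨β, hβ⟩ := ((isLocalEquiv_toBasedMap hS (nfpFst σ.s τ.s)).comp
    ((isLocalEquiv_toBasedMap hS σ.s).comp A.isLocalEquiv)).exists_natTrans B.isStack.fibG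
      B.isStack.gluesMor (G := D.E) (G' := D'.E) α hα' nat
  refine ⟨β, fun {P Q} φ => ?_⟩
  obtain ⟨p, ω, h₁, h₂⟩ := exists_nfp_cover τ P
  refine IndAt.of_cover hS ω h₁ h₂ ?_
  obtain ⟨χ, hχ⟩ := SPt.exists_srcMap (inv (nfpEq p) ≫ SPt.srcMap ω ≫ φ)
  rw [IsIso.eq_inv_comp] at hχ
  rw [← hχ]
  refine IndAt.right ?_ χ
  refine Eq.trans ?_ (hα p)
  exact congrArg (fun γ => D.i (nfpSrc p) ≫ γ ≫ D'.E.map (A.J.map (nfpEq p))) (hβ p)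

end exists_isInd

end Datum

end Orbi

namespace Orbi

open GroupoidIn Orbi.Span

variable {S : SpaceCat.{v, u}} [S.IsGeometric] {X Y W V : GroupoidIn S} [IsSGroupoid X]
  [IsSGroupoid Y] [IsSGroupoid W] [IsSGroupoid V]

namespace SPt

variable {σ : Span X Y} {τ : Span Y W}

/-- The first component of a point of a composite. -/
noncomputable abbrev fst (P : SPt (σ.comp τ)) : SPt σ :=
  ⟨P.M, P.z ≫ (Span.fst σ τ).f₀, P.x, P.z ≫ (Span.fst σ τ).f₀ ≫ σ.f.f₀,
    (Category.assoc _ _ _).trans P.hx, Category.assoc _ _ _⟩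

/-- The second component of a point of a composite. -/
noncomputable abbrev snd (P : SPt (σ.comp τ)) : SPt τ :=
  ⟨P.M, P.z ≫ (Span.snd σ τ).f₀, P.z ≫ (Span.fst σ τ).f₀ ≫ σ.f.f₀, P.y,
    by rw [Category.assoc, cond₀], (Category.assoc _ _ _).trans P.hy⟩

/-- The first component of an arrow between points of a composite. -/
noncomputable abbrev fstMap {P Q : SPt (σ.comp τ)} (ω : P.pt ⟶ Q.pt) : P.fst.pt ⟶ Q.fst.pt :=
  ⟨(Pt.Hom.a ω :), (Pt.Hom.g ω :) ≫ (Span.fst σ τ).f₁,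
    by simp [reassoc_of% (Pt.Hom.g_s ω)], by simp [reassoc_of% (Pt.Hom.g_t ω)]⟩

/-- The second component of an arrow between points of a composite. -/
noncomputable abbrev sndMap {P Q : SPt (σ.comp τ)} (ω : P.pt ⟶ Q.pt) : P.snd.pt ⟶ Q.snd.pt :=
  ⟨(Pt.Hom.a ω :), (Pt.Hom.g ω :) ≫ (Span.snd σ τ).f₁,
    by simp [reassoc_of% (Pt.Hom.g_s ω)], by simp [reassoc_of% (Pt.Hom.g_t ω)]⟩

lemma srcMap_fstMap {P Q : SPt (σ.comp τ)} (ω : P.pt ⟶ Q.pt) : srcMap (fstMap ω) = srcMap ω :=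
  Pt.hom_ext rfl (Category.assoc _ _ _)

lemma tgtMap_sndMap {P Q : SPt (σ.comp τ)} (ω : P.pt ⟶ Q.pt) : tgtMap (sndMap ω) = tgtMap ω :=
  Pt.hom_ext rfl (Category.assoc _ _ _)

lemma tgtMap_fstMap {P Q : SPt (σ.comp τ)} (ω : P.pt ⟶ Q.pt) :
    tgtMap (fstMap ω) = srcMap (sndMap ω) :=
  Pt.hom_ext rfl (by
    change (_ ≫ _) ≫ _ = (_ ≫ _) ≫ _
    rw [Category.assoc, Category.assoc, cond₁])

lemma srcMap_ofEq {P Q : SPt σ} (a : P.M ⟶ Q.M) (h : P.z = a ≫ Q.z) (h' : P.x = a ≫ Q.x) :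
    srcMap (P := P) (Q := Q) (Pt.ofEq a h) = Pt.ofEq a h' :=
  Pt.hom_ext rfl (by
    change (P.z ≫ _) ≫ _ = P.x ≫ _
    rw [Category.assoc, Hom.ι_f₁, ← P.hx, Category.assoc])

lemma tgtMap_ofEq {P Q : SPt σ} (a : P.M ⟶ Q.M) (h : P.z = a ≫ Q.z) (h' : P.y = a ≫ Q.y) :
    tgtMap (P := P) (Q := Q) (Pt.ofEq a h) = Pt.ofEq a h' :=
  Pt.hom_ext rfl (by
    change (P.z ≫ _) ≫ _ = P.y ≫ _
    rw [Category.assoc, Hom.ι_f₁, ← P.hy, Category.assoc])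

end SPt

lemma GroupoidIn.Pt.ofEq_id (P : Pt X) (h : P.x = 𝟙 _ ≫ P.x) : Pt.ofEq (𝟙 P.M) h = 𝟙 P := rfl

namespace Datum

/-- The compatibility of a datum with the change of a point. -/
lemma i_naturality {A : AssocStack X} {B : AssocStack Y} {σ : Span X Y} (D : Datum σ A B)
    {P Q : SPt σ} (a : P.M ⟶ Q.M) (h : P.z = a ≫ Q.z)
    (h₁ : P.x = a ≫ Q.x) (h₂ : P.y = a ≫ Q.y) :
    B.J.map (Pt.ofEq (P := P.tgt) (Q := Q.tgt) a h₂) ≫ D.i Q =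
      D.i P ≫ D.E.map (A.J.map (Pt.ofEq (P := P.src) (Q := Q.src) a h₁)) := by
  rw [← SPt.srcMap_ofEq a h, ← SPt.tgtMap_ofEq a h, D.nat]

variable {A : AssocStack X} {B : AssocStack Y} {C : AssocStack W} {T : AssocStack V}

/-- The identity, presented by the identity span. -/
noncomputable def id (A : AssocStack X) : Datum (Span.id X) A A where
  E := BasedFunctor.id A.stack
  i P := A.J.map (Pt.ofEq (P := P.tgt) (Q := P.src) (𝟙 P.M) (by
    rw [Category.id_comp]
    exact P.hy.symm.trans P.hx))
  isHomLift_i P := A.isHomLift_J (Pt.ofEq (P := P.tgt) (Q := P.src) (𝟙 P.M) _)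
  nat {P Q} ω := by
    refine (A.J.map_comp _ _).symm.trans (Eq.trans (congrArg _ ?_) (A.J.map_comp _ _))
    refine Pt.hom_ext ((Category.comp_id _).trans (Category.id_comp _).symm) ?_
    refine (Pt.comp_ofEq (SPt.tgtMap ω) _ _).trans
      (Eq.trans ?_ (Pt.ofEq_comp _ _ (SPt.srcMap ω)).symm)
    exact (Category.id_comp _).symm

/-- The composition, presented by the composition of spans. -/
noncomputable def comp {σ : Span X Y} {τ : Span Y W} (D : Datum σ A B) (D' : Datum τ B C) :
    Datum (σ.comp τ) A C where
  E := BasedFunctor.comp D.E D'.E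
  i P := D'.i P.snd ≫ D'.E.map (D.i P.fst)
  isHomLift_i P := isHomLift_comp_id (D'.isHomLift_i P.snd)
    (map_isHomLift D'.E (D.isHomLift_i P.fst))
  nat {P Q} ω := by
    have h : C.J.map (SPt.tgtMap (SPt.sndMap ω)) ≫ D'.i Q.snd ≫ D'.E.map (D.i Q.fst) =
        (D'.i P.snd ≫ D'.E.map (D.i P.fst)) ≫
          D'.E.map (D.E.map (A.J.map (SPt.srcMap (SPt.fstMap ω)))) := by
      rw [Category.assoc, ← D'.E.map_comp, ← D.nat, SPt.tgtMap_fstMap, D'.E.map_comp,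
        ← reassoc_of% (D'.nat (SPt.sndMap ω))]
    rw [← SPt.tgtMap_sndMap, ← SPt.srcMap_fstMap]
    exact h

section whisker

variable {σ σ' : Span X Y} {τ τ' : Span Y W}

lemma IsInd.whiskerLeft {D₁ : Datum τ B C} {D₂ : Datum τ' B C} {η : ECell τ τ'}
    {β : BasedNatTrans D₁.E D₂.E} (D : Datum σ A B) (h : IsInd D₁ D₂ η β) :
    IsInd (D.comp D₁) (D.comp D₂) (η.whiskerLeft σ) (BasedCategory.whiskerLeft D.E β) := by
  intro P Q φ
  obtain ⟨ω, hω⟩ := SPt.exists_srcMap (P := P.fst) (Q := Q.fst) φ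
  have hω' : φ = SPt.srcMap ω := hω.symm
  subst hω'
  have e : (η.whiskerLeft σ).mapHom (P := P) (Q := Q) (SPt.srcMap ω) =
      η.mapHom (P := P.snd) (Q := Q.snd) (SPt.tgtMap ω) := by
    refine Pt.hom_ext rfl ?_
    have e₁ : lf σ (P.z ≫ (Span.fst σ τ).f₀) ((Pt.Hom.a ω ≫ Q.z) ≫ (Span.fst σ τ').f₀)
        (Pt.Hom.g ω ≫ σ.s.f₁) = Pt.Hom.g ω ≫ σ.f.f₁ :=
      lf_arrow _ (Pt.Hom.g_s ω) ((Pt.Hom.g_t ω).trans (Category.assoc _ _ _).symm)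
    rw [ECell.mapHom_g, ECell.whiskerLeft_ev _ _ (by rw [ECell.g_comp_s, Category.assoc])
      (by rw [ECell.g_comp_t]; simp only [Category.assoc])]
    exact (congrArg _ e₁).trans (congrArg (fun z => η.ev _ z _) (Category.assoc _ _ _))
  have h' := h (P := P.snd) (Q := Q.snd) (SPt.tgtMap ω)
  unfold IndAt at h' ⊢
  rw [e]
  have key : (D₁.i P.snd ≫ D₁.E.map (D.i P.fst)) ≫ β.app (D.E.obj (A.J.obj P.fst.src)) ≫
      D₂.E.map (D.E.map (A.J.map (SPt.srcMap ω))) =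
      C.J.map (η.mapHom (P := P.snd) (Q := Q.snd) (SPt.tgtMap ω)) ≫ D₂.i Q.snd ≫
        D₂.E.map (D.i Q.fst) := by
    have := β.naturality (D.i P.fst)
    rw [← reassoc_of% h', ← D₂.E.map_comp, D.nat, D₂.E.map_comp, Category.assoc,
      reassoc_of% this]
  exact key

lemma IsInd.whiskerRight {D₁ : Datum σ A B} {D₂ : Datum σ' A B} {η : ECell σ σ'}
    {β : BasedNatTrans D₁.E D₂.E} (D : Datum τ B C) (h : IsInd D₁ D₂ η β) :
    IsInd (D₁.comp D) (D₂.comp D) (η.whiskerRight τ) (BasedCategory.whiskerRight β D.E) := by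
  intro P Q φ
  obtain ⟨ω, hω⟩ := SPt.exists_srcMap (P := P.snd) (Q := Q.snd)
    (η.mapHom (P := P.fst) (Q := Q.fst) φ)
  have e : (η.whiskerRight τ).mapHom φ = SPt.tgtMap ω := by
    have ha : Pt.Hom.a ω = Pt.Hom.a φ := congrArg Pt.Hom.a hω
    have hg : Pt.Hom.g ω ≫ τ.s.f₁ = Pt.Hom.g (η.mapHom (P := P.fst) (Q := Q.fst) φ) :=
      congrArg Pt.Hom.g hω
    refine Pt.hom_ext ha.symm ?_
    rw [ECell.mapHom_g, ECell.whiskerRight_ev _ _ (by rw [ECell.g_comp_s]; rfl)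
      (by rw [ECell.g_comp_t]; rfl)]
    have e₁ := lf_arrow (σ := τ) (z := P.z ≫ (Span.snd σ τ).f₀)
      (z' := (Pt.Hom.a φ ≫ Q.z) ≫ (Span.snd σ' τ).f₀) (Pt.Hom.g ω) (Pt.Hom.g_s ω)
      (by rw [Pt.Hom.g_t, ha, Category.assoc])
    refine Eq.trans ?_ e₁
    rw [hg, ECell.mapHom_g]
    exact congrArg (fun z => lf τ _ _ (η.ev _ z _)) (Category.assoc _ _ _)
  have h' := h (P := P.fst) (Q := Q.fst) φ
  unfold IndAt at h' ⊢
  rw [e]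
  have key : (D.i P.snd ≫ D.E.map (D₁.i P.fst)) ≫ D.E.map (β.app (A.J.obj P.fst.src)) ≫
      D.E.map (D₂.E.map (A.J.map (X := P.fst.src) (Y := Q.fst.src) φ)) = C.J.map (SPt.tgtMap ω) ≫ D.i Q.snd ≫ D.E.map (D₂.i Q.fst) := by
    rw [reassoc_of% (D.nat ω), hω, ← D.E.map_comp, ← D.E.map_comp, ← h']
    simp
  exact key

end whisker

/-- The identity 2-morphism. -/
lemma IsInd.assoc {σ : Span X Y} {τ : Span Y W} {ρ : Span W V} (D : Datum σ A B) (D' : Datum τ B C)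
    (D'' : Datum ρ C T) : IsInd ((D.comp D').comp D'') (D.comp (D'.comp D''))
      (ECell.ofMap _ (asc_s σ τ ρ) (asc_f σ τ ρ)) (BasedNatTrans.id ((D.comp D').comp D'').E) := by
  refine IsInd.of_map _ _ _ fun P => ?_
  let Q := P.map _ (asc_s σ τ ρ) (asc_f σ τ ρ)
  have e₁ : P.z ≫ (Span.fst (σ.comp τ) ρ).f₀ ≫ (Span.fst σ τ).f₀ =
      (P.z ≫ (asc σ τ ρ).f₀) ≫ (Span.fst σ (τ.comp ρ)).f₀ := by simp
  have e₂ : P.z ≫ (Span.fst (σ.comp τ) ρ).f₀ ≫ (Span.snd σ τ).f₀ =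
      (P.z ≫ (asc σ τ ρ).f₀) ≫ (Span.snd σ (τ.comp ρ)).f₀ ≫ (Span.fst τ ρ).f₀ := by simp
  have e₃ : P.z ≫ (Span.snd (σ.comp τ) ρ).f₀ =
      (P.z ≫ (asc σ τ ρ).f₀) ≫ (Span.snd σ (τ.comp ρ)).f₀ ≫ (Span.snd τ ρ).f₀ := by simp
  have k₁ : P.fst.fst.z = 𝟙 P.M ≫ Q.fst.z := by
    rw [Category.id_comp]
    exact (Category.assoc _ _ _).trans e₁
  have k₂ : P.fst.snd.z = 𝟙 P.M ≫ Q.snd.fst.z := by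
    rw [Category.id_comp]
    exact (Category.assoc _ _ _).trans (e₂.trans (Category.assoc _ _ _).symm)
  have k₃ : P.snd.z = 𝟙 P.M ≫ Q.snd.snd.z := by
    rw [Category.id_comp]
    exact e₃.trans (Category.assoc _ _ _).symm
  have l₁ : P.fst.fst.y = 𝟙 P.M ≫ Q.fst.y := by
    rw [← P.fst.fst.hy, ← Q.fst.hy, k₁, Category.assoc]
  have l₂ : P.fst.snd.y = 𝟙 P.M ≫ Q.snd.fst.y := by
    rw [← P.fst.snd.hy, ← Q.snd.fst.hy, k₂, Category.assoc]
  have h₁ := D.i_naturality (P := P.fst.fst) (Q := Q.fst) (𝟙 P.M) k₁ (Category.id_comp _).symm l₁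
  have h₂ := D'.i_naturality (P := P.fst.snd) (Q := Q.snd.fst) (𝟙 P.M) k₂ l₁ l₂
  have h₃ := D''.i_naturality (P := P.snd) (Q := Q.snd.snd) (𝟙 P.M) k₃ l₂ (Category.id_comp _).symm
  have key : ((D''.i P.snd ≫ D''.E.map (D'.i P.fst.snd ≫ D'.E.map (D.i P.fst.fst)))) ≫ 𝟙 _ =
      (D''.i Q.snd.snd ≫ D''.E.map (D'.i Q.snd.fst)) ≫ D''.E.map (D'.E.map (D.i Q.fst)) := by
    rw [GroupoidIn.Pt.ofEq_id, A.J.map_id, D.E.map_id, Category.comp_id] at h₁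
    rw [GroupoidIn.Pt.ofEq_id, T.J.map_id, Category.id_comp] at h₃
    rw [Category.comp_id, ← h₁, D'.E.map_comp, ← reassoc_of% h₂, D''.E.map_comp, ← reassoc_of% h₃]
    simp
  exact key

lemma IsInd.leftUnitor {σ : Span X Y} (D : Datum σ A B) : IsInd ((Datum.id A).comp D) D
      (ECell.ofMap _ (snd_s σ) (snd_f σ)) (BasedNatTrans.id D.E) := by
  refine IsInd.of_map _ _ _ fun P => ?_
  have h := D.i_naturality (P := P.snd) (Q := P.map _ (snd_s σ) (snd_f σ)) (𝟙 P.M)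
    (Category.id_comp _).symm (by
      rw [← P.snd.hx, ← (P.map _ (snd_s σ) (snd_f σ)).hx, Category.id_comp])
    (Category.id_comp _).symm
  rw [GroupoidIn.Pt.ofEq_id, B.J.map_id, Category.id_comp] at h
  exact (Category.comp_id _).trans h.symm

lemma IsInd.rightUnitor {σ : Span X Y} (D : Datum σ A B) : IsInd (D.comp (Datum.id B)) D
      (ECell.ofMap _ (fst_s σ) (fst_f σ)) (BasedNatTrans.id D.E) := by
  refine IsInd.of_map _ _ _ fun P => ?_
  have h := D.i_naturality (P := P.map _ (fst_s σ) (fst_f σ)) (Q := P.fst) (𝟙 P.M)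
    (Category.id_comp _).symm (Category.id_comp _).symm (by
      rw [← P.fst.hy, ← (P.map _ (fst_s σ) (fst_f σ)).hy, Category.id_comp])
  rw [GroupoidIn.Pt.ofEq_id, A.J.map_id, D.E.map_id, Category.comp_id] at h
  exact (Category.comp_id _).trans h

lemma IsInd.one {σ : Span X Y} (D : Datum σ A B) :
    IsInd D D (ECell.one σ) (BasedNatTrans.id D.E) := by
  refine IsInd.of_map _ _ _ fun P => ?_
  exact (Category.comp_id _).trans (D.i_congr (Category.comp_id _).symm _ _ _ _)

end Datum

end Orbi

namespace Orbi

open GroupoidIn Orbi.Span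

variable {S : SpaceCat.{0, 1}} [S.IsGeometric] 

open Datum

section bij

variable {X Y : GroupoidIn S} [IsSGroupoid X] [IsSGroupoid Y]
variable {A : AssocStack X} {B : AssocStack Y} {σ τ ρ : Span X Y}

/-- The 2-morphism induced by an extended 2-morphism. -/
noncomputable def Datum.ind (hS : IsGoodSite S) (D : Datum σ A B) (D' : Datum τ A B) (η : ECell σ τ) :
    D.E ⟶ D'.E :=
  (exists_isInd hS D D' η).choose

lemma Datum.isInd_ind (hS : IsGoodSite S) (D : Datum σ A B) (D' : Datum τ A B) (η : ECell σ τ) :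
    IsInd D D' η (D.ind hS D' η) :=
  (exists_isInd hS D D' η).choose_spec

/-- The isomorphism induced by an isomorphism of spans. -/
noncomputable def Datum.indIso (hS : IsGoodSite S) (D D' : Datum σ A B) : D.E ≅ D'.E where
  hom := D.ind hS D' (ECell.one σ)
  inv := D'.ind hS D (ECell.one σ)
  hom_inv_id := by
    have h := (isInd_ind hS D D' (ECell.one σ)).comp hS (isInd_ind hS D' D (ECell.one σ))
    rw [ECell.one_comp] at h
    exact h.unique hS (IsInd.one D)
  inv_hom_id := by
    have h := (isInd_ind hS D' D (ECell.one σ)).comp hS (isInd_ind hS D D' (ECell.one σ))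
    rw [ECell.one_comp] at h
    exact h.unique hS (IsInd.one D')

lemma Datum.ind_injective (hS : IsGoodSite S) (D : Datum σ A B) (D' : Datum τ A B) :
    Function.Injective (D.ind hS D') := by
  intro η θ h
  have h₁ := isInd_ind hS D D' η
  have h₂ := isInd_ind hS D D' θ
  rw [h] at h₁
  refine ECell.mapHom_injective fun {P Q} φ => ?_
  have := (h₁ φ).symm.trans (h₂ φ)
  rw [cancel_mono] at this
  exact B.J.map_injective this

lemma Datum.ind_surjective (hS : IsGoodSite S) (D : Datum σ A B) (D' : Datum τ A B) :
    Function.Surjective (D.ind hS D') := by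
  intro β
  have key {P : SPt σ} {Q : SPt τ} (φ : P.src ⟶ Q.src) : ∃ ψ : P.tgt ⟶ Q.tgt,
      D.i P ≫ β.app (A.J.obj P.src) ≫ D'.E.map (A.J.map φ) = B.J.map ψ ≫ D'.i Q ∧
        Pt.Hom.a ψ = Pt.Hom.a φ := by
    have hQ := D'.isHomLift_i Q
    obtain ⟨ψ, h₁, h₂⟩ := B.exists_J_map (P := P.tgt) (Q := Q.tgt)
      (isHomLift_comp_id (IndAt.isHomLift (D := D) (D' := D') β φ)
        (IsHomLift.lift_id_inv_isIso B.stack.p Q.M (D'.i Q)))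
    exact ⟨ψ, by rw [h₁]; simp, h₂⟩
  choose act hact hact' using @key
  have left {P P' : SPt σ} {Q : SPt τ} (ω : P'.pt ⟶ P.pt) (φ : P.src ⟶ Q.src) :
      act (SPt.srcMap ω ≫ φ) = SPt.tgtMap ω ≫ act φ := by
    apply B.J.map_injective
    rw [← cancel_mono (D'.i Q), ← hact, B.J.map_comp, Category.assoc, ← hact, A.J.map_comp,
      D'.E.map_comp, reassoc_of% (nat_comp β ω)]
  have right {P : SPt σ} {Q Q' : SPt τ} (φ : P.src ⟶ Q.src) (ω : Q.pt ⟶ Q'.pt) :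
      act (φ ≫ SPt.srcMap ω) = act φ ≫ SPt.tgtMap ω := by
    apply B.J.map_injective
    rw [← cancel_mono (D'.i Q'), ← hact, B.J.map_comp, Category.assoc, D'.nat, ← reassoc_of% (hact φ),
      A.J.map_comp, D'.E.map_comp]
  let P (M : S.Obj) (z : M ⟶ σ.Z.G₀) : SPt σ := ⟨M, z, _, _, rfl, rfl⟩
  let Q (M : S.Obj) (z : M ⟶ τ.Z.G₀) : SPt τ := ⟨M, z, _, _, rfl, rfl⟩
  let Φ {M : S.Obj} (z : M ⟶ σ.Z.G₀) (z' : M ⟶ τ.Z.G₀) (x : M ⟶ X.G₁)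
      (h : x ≫ X.s = z ≫ σ.s.f₀) (h' : x ≫ X.t = z' ≫ τ.s.f₀) : (P M z).src ⟶ (Q M z').src :=
    ⟨𝟙 M, x, h, by rw [h', Category.id_comp]⟩
  let η : ECell σ τ :=
    { app := fun z z' x h h' => Pt.Hom.g (act (Φ z z' x h h'))
      app_s := fun z z' x h h' => Pt.Hom.g_s (act (Φ z z' x h h'))
      app_t := fun z z' x h h' => by
        refine (Pt.Hom.g_t (act (Φ z z' x h h'))).trans ?_
        rw [hact']
        exact Category.id_comp _
      nat := fun {M N} q z z' x h h' => by
        let κ : (P N (q ≫ z)).pt ⟶ (P M z).pt := Pt.ofEq q rfl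
        let κ' : (Q N (q ≫ z')).pt ⟶ (Q M z').pt := Pt.ofEq q rfl
        have e : SPt.srcMap κ ≫ Φ z z' x h h' =
            Φ (q ≫ z) (q ≫ z') (q ≫ x) (by simp [h]) (by simp [h']) ≫ SPt.srcMap κ' := by
          rw [SPt.srcMap_ofEq _ _ (Category.assoc _ _ _), SPt.srcMap_ofEq _ _ (Category.assoc _ _ _)]
          refine Pt.hom_ext ((Category.comp_id _).trans (Category.id_comp _).symm) ?_
          rw [Pt.ofEq_comp]
          let φ₁ := Φ (q ≫ z) (q ≫ z') (q ≫ x) (by simp [h]) (by simp [h'])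
          have := Pt.comp_ofEq (R := (Q M z').src) φ₁ q (Category.assoc _ _ _)
          exact this.symm
        have e' := (left κ _).symm.trans ((congrArg act e).trans (right _ κ'))
        rw [SPt.tgtMap_ofEq _ _ (Category.assoc _ _ _), SPt.tgtMap_ofEq _ _ (Category.assoc _ _ _)]
          at e'
        have e'' := congrArg Pt.Hom.g e'
        rw [Pt.ofEq_comp] at e''
        exact e''.trans (Pt.comp_ofEq (R := (Q M z').tgt) (act _) q (Category.assoc _ _ _))
      left := fun {M} a z z₁ z' x y h h' k k' ha ha' hy => by
        let ω : (P M z₁).pt ⟶ (P M z).pt := ⟨𝟙 M, a, ha, by rw [Category.id_comp, ha']⟩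
        have e : Φ z₁ z' y k k' = SPt.srcMap ω ≫ Φ z z' x h h' :=
          Pt.hom_ext (Category.id_comp _).symm
            (hy.trans (congrArg (X.mul _) (Category.id_comp x).symm))
        rw [e, left]
        exact congrArg (Y.mul _) (Category.id_comp _)
      right := fun {M} b z z' z₁ x y h h' k k' hb hb' hy => by
        let ω : (Q M z').pt ⟶ (Q M z₁).pt := ⟨𝟙 M, b, hb, by rw [Category.id_comp, hb']⟩
        have e : Φ z z₁ y k k' = Φ z z' x h h' ≫ SPt.srcMap ω :=
          Pt.hom_ext (Category.id_comp _).symm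
            (hy.trans (congrArg (X.mul _) (Category.id_comp _).symm))
        rw [e, right, Pt.comp_g, hact']
        exact congrArg (Y.mul _) (Category.id_comp _) }
  have hη : IsInd D D' η β := by
    intro P' Q' φ
    obtain ⟨M, z, _, _, rfl, rfl⟩ := P'
    have h₁ := ECell.g_comp_s φ
    have h₂ := ECell.g_comp_t φ
    let κ : (Q M (Pt.Hom.a φ ≫ Q'.z)).pt ⟶ Q'.pt := Pt.ofEq (Pt.Hom.a φ :) rfl
    have hκ : (Q M (Pt.Hom.a φ ≫ Q'.z)).x = Pt.Hom.a φ ≫ Q'.x := by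
      rw [← Q'.hx, ← Category.assoc]
    have e : φ = Φ z (Pt.Hom.a φ ≫ Q'.z) (Pt.Hom.g φ) h₁ h₂ ≫ SPt.srcMap κ := by
      rw [SPt.srcMap_ofEq _ _ hκ]
      let φ₁ := Φ z (Pt.Hom.a φ ≫ Q'.z) (Pt.Hom.g φ) h₁ h₂
      have := Pt.comp_ofEq (R := Q'.src) φ₁ (Pt.Hom.a φ :) hκ
      exact Pt.hom_ext (Category.id_comp _).symm this.symm
    rw [e]
    refine IndAt.right ?_ κ
    refine (hact _).trans ?_
    congr 2
    refine Pt.hom_ext (hact' _) ?_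
    have e₁ : η.ev z (𝟙 M ≫ Pt.Hom.a φ ≫ Q'.z) (Pt.Hom.g φ) =
        Pt.Hom.g (act (Φ z (Pt.Hom.a φ ≫ Q'.z) (Pt.Hom.g φ) h₁ h₂)) := by
      rw [Category.id_comp, ECell.ev_eq _ h₁ h₂]
    exact e₁.symm
  exact ⟨η, (isInd_ind hS D D' η).unique hS hη⟩

end bij

end Orbi

namespace Orbi

open GroupoidIn Orbi.Span

variable {S : SpaceCat.{0, 1}}

/-- The associated stack of a groupoid exists. -/
lemma nonempty_assocStack (hS : IsGoodSite S) (X : GroupoidIn S) : Nonempty (AssocStack X) := by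
  obtain ⟨𝒳, j, h, h'⟩ := exists_isLocalEquiv (𝒜 := toBased X) hS.hasSmallCovers
    (fibG_proj X) (gluesMor_proj X hS)
  exact ⟨⟨𝒳, j, h, h'⟩⟩

namespace AssocStack

variable {X : GroupoidIn S}

/-- A choice of an associated stack. -/
noncomputable def mk' (hS : IsGoodSite S) (X : GroupoidIn S) : AssocStack X :=
  (nonempty_assocStack hS X).some

lemma isAssociatedStack (A : AssocStack X) : IsAssociatedStack A.j where
  isStack := A.isStack
  universal _ h := A.isLocalEquiv.precomp h

end AssocStack

variable [S.IsGeometric]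

namespace Datum

variable {X Y : GroupoidIn S} [IsSGroupoid X] [IsSGroupoid Y] {A : AssocStack X} {B : AssocStack Y}

/-- Every span presents a functor between the associated stacks. -/
lemma nonempty (hS : IsGoodSite S) (σ : Span X Y) (A : AssocStack X) (B : AssocStack Y) :
    Nonempty (Datum σ A B) := by
  obtain ⟨E, i, hi, hi'⟩ := ((isLocalEquiv_toBasedMap hS σ.s).comp A.isLocalEquiv).exists_extension
    B.isStack.fibG B.isStack.gluesMor B.isStack.gluesObj (toBasedMap σ.f ≫ B.j)
  let j (P : SPt σ) : B.J.obj P.tgt ⟶ E.obj (A.J.obj P.src) := by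
    obtain ⟨M, z, x, y, hx, hy⟩ := P
    subst hx hy
    exact i (⟨M, z⟩ : Pt σ.Z)
  have hj (P : SPt σ) : B.stack.p.IsHomLift (𝟙 P.M) (j P) := by
    obtain ⟨M, z, x, y, hx, hy⟩ := P
    subst hx hy
    exact hi (⟨M, z⟩ : Pt σ.Z)
  refine ⟨⟨E, j, hj, fun {P Q} ω => ?_⟩⟩
  obtain ⟨M, z, x, y, hx, hy⟩ := P
  subst hx hy
  obtain ⟨M', z', x', y', hx', hy'⟩ := Q
  subst hx' hy'
  exact hi' ω

/-- A functor that is presented by a span is compatible with the legs of the span. -/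
lemma nonempty_iso {σ : Span X Y} (D : Datum σ A B) :
    Nonempty (toBasedMap σ.s ≫ A.j ≫ D.E ≅ toBasedMap σ.f ≫ B.j) := by
  let α : BasedNatTrans (BasedFunctor.comp (toBasedMap σ.f) B.j)
      (BasedFunctor.comp (toBasedMap σ.s) (BasedFunctor.comp A.j D.E)) :=
    { app := fun P : Pt σ.Z => D.i (SPt.mk' σ P)
      naturality := fun P Q ω => D.nat (P := SPt.mk' σ P) (Q := SPt.mk' σ Q) ω
      isHomLift' := fun P : Pt σ.Z => D.isHomLift_i (SPt.mk' σ P) }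
  have : ∀ a, IsIso (α.app a) := fun a => B.isStack.fibG.isIso_of_id (D.isHomLift_i (SPt.mk' σ a))
  have : IsIso α.toNatTrans := NatIso.isIso_of_isIso_app _
  have : IsIso (C := BasedFunctor σ.Z.toBased B.stack) α := BasedNatIso.isIso_of_toNatTrans_isIso α
  exact ⟨(asIso (C := BasedFunctor σ.Z.toBased B.stack) α).symm⟩

lemma isInd_indIso_hom (hS : IsGoodSite S) {σ : Span X Y} (D D' : Datum σ A B) :
    IsInd D D' (ECell.one σ) (indIso hS D D').hom :=
  isInd_ind hS D D' _

lemma isInd_indIso_inv (hS : IsGoodSite S) {σ : Span X Y} (D D' : Datum σ A B) :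
    IsInd D' D (ECell.one σ) (indIso hS D D').inv :=
  isInd_ind hS D' D _

lemma isInd_ind_symm (hS : IsGoodSite S) {σ τ : Span X Y} (D : Datum σ A B) (D' : Datum τ A B)
    (η : ECell σ τ) : IsInd D D' η (D.ind hS D' (ECell.equiv σ τ ((ECell.equiv σ τ).symm η))) := by
  rw [Equiv.apply_symm_apply]
  exact isInd_ind hS D D' η

end Datum

open Datum Bicategory

/-- The orbifold presented by a groupoid. -/
noncomputable def SGroupoid.orbifold (hS : IsGoodSite S) (X : SGroupoid S) : OrbiCat S :=
  (⟨(AssocStack.mk' hS X.gpd).stack, (AssocStack.mk' hS X.gpd).isStack, X, _, _,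
    (AssocStack.mk' hS X.gpd).isAssociatedStack, ⟨Bicategory.Equivalence.id _⟩⟩ : Orbifold S)

/-- A choice of a functor that is presented by a span. -/
noncomputable def Span.datum (hS : IsGoodSite S) {X Y : SGroupoid S} (σ : Span X.gpd Y.gpd) :
    Datum σ (AssocStack.mk' hS X.gpd) (AssocStack.mk' hS Y.gpd) :=
  (Datum.nonempty hS σ _ _).some

/-- The pseudofunctor from groupoids to orbifolds. -/
noncomputable def orbifoldPseudofunctor (hS : IsGoodSite S) :
    Pseudofunctor (SGroupoid S) (OrbiCat S) where
  obj X := X.orbifold hS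
  map {X Y} (σ : Span X.gpd Y.gpd) := InducedBicategory.mkHom (σ.datum hS).E
  map₂ {X Y} (σ τ : Span X.gpd Y.gpd) θ := ⟨(σ.datum hS).ind hS (τ.datum hS) (ECell.equiv σ τ θ)⟩
  map₂_id {X Y} (σ : Span X.gpd Y.gpd) := by
    apply InducedBicategory.Hom₂.ext
    exact (isInd_ind_symm hS (σ.datum hS) (σ.datum hS) (ECell.one σ)).unique hS (IsInd.one _)
  map₂_comp {X Y} (σ τ ρ : Span X.gpd Y.gpd) θ θ' := by
    apply InducedBicategory.Hom₂.ext
    exact (isInd_ind_symm hS (σ.datum hS) (ρ.datum hS)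
      ((ECell.equiv σ τ θ).comp (ECell.equiv τ ρ θ'))).unique hS
      ((isInd_ind hS (σ.datum hS) (τ.datum hS) _).comp hS (isInd_ind hS _ _ _))
  mapId X := InducedBicategory.isoMk (indIso hS ((Span.id X.gpd).datum hS) (Datum.id _))
  mapComp {X Y W} (σ : Span X.gpd Y.gpd) (τ : Span Y.gpd W.gpd) :=
    InducedBicategory.isoMk (indIso hS ((σ.comp τ).datum hS) ((σ.datum hS).comp (τ.datum hS)))
  map₂_whisker_left {X Y W} (σ : Span X.gpd Y.gpd) (τ ρ : Span Y.gpd W.gpd) θ := by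
    apply InducedBicategory.Hom₂.ext
    have h := (isInd_indIso_hom hS ((σ.comp τ).datum hS) ((σ.datum hS).comp (τ.datum hS))).comp hS
      (((isInd_ind hS (τ.datum hS) (ρ.datum hS) (ECell.equiv τ ρ θ)).whiskerLeft
        (σ.datum hS)).comp hS
      (isInd_indIso_inv hS ((σ.comp ρ).datum hS) ((σ.datum hS).comp (ρ.datum hS))))
    rw [ECell.one_comp, ECell.comp_one] at h
    exact (isInd_ind_symm hS _ _ _).unique hS h
  map₂_whisker_right {X Y W} (σ σ' : Span X.gpd Y.gpd) θ (τ : Span Y.gpd W.gpd) := by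
    apply InducedBicategory.Hom₂.ext
    have h := (isInd_indIso_hom hS ((σ.comp τ).datum hS) ((σ.datum hS).comp (τ.datum hS))).comp hS
      (((isInd_ind hS (σ.datum hS) (σ'.datum hS) (ECell.equiv σ σ' θ)).whiskerRight
        (τ.datum hS)).comp hS
      (isInd_indIso_inv hS ((σ'.comp τ).datum hS) ((σ'.datum hS).comp (τ.datum hS))))
    rw [ECell.one_comp, ECell.comp_one] at h
    exact (isInd_ind_symm hS _ _ _).unique hS h
  map₂_associator {X Y W V} (σ : Span X.gpd Y.gpd) (τ : Span Y.gpd W.gpd)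
      (ρ : Span W.gpd V.gpd) := by
    apply InducedBicategory.Hom₂.ext
    have h₁ := isInd_indIso_hom hS (((σ.comp τ).comp ρ).datum hS)
      (((σ.comp τ).datum hS).comp (ρ.datum hS))
    have h₂ := (isInd_indIso_hom hS ((σ.comp τ).datum hS)
      ((σ.datum hS).comp (τ.datum hS))).whiskerRight (ρ.datum hS)
    have h₃ := IsInd.assoc (σ.datum hS) (τ.datum hS) (ρ.datum hS)
    have h₄ := (isInd_indIso_inv hS ((τ.comp ρ).datum hS)
      ((τ.datum hS).comp (ρ.datum hS))).whiskerLeft (σ.datum hS)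
    have h₅ := isInd_indIso_inv hS ((σ.comp (τ.comp ρ)).datum hS)
      ((σ.datum hS).comp ((τ.comp ρ).datum hS))
    have h := h₁.comp hS (h₂.comp hS (h₃.comp hS (h₄.comp hS h₅)))
    rw [ECell.comp_one, ECell.one_comp, ECell.whiskerLeft_one, ECell.one_whiskerRight,
      ECell.one_comp, ECell.comp_one] at h
    exact (isInd_ind_symm hS _ _ _).unique hS h
  map₂_left_unitor {X Y} (σ : Span X.gpd Y.gpd) := by
    apply InducedBicategory.Hom₂.ext
    have h := (isInd_indIso_hom hS (((Span.id X.gpd).comp σ).datum hS)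
      (((Span.id X.gpd).datum hS).comp (σ.datum hS))).comp hS
      (((isInd_indIso_hom hS ((Span.id X.gpd).datum hS) (Datum.id _)).whiskerRight
        (σ.datum hS)).comp hS (IsInd.leftUnitor (σ.datum hS)))
    rw [ECell.one_comp, ECell.one_whiskerRight, ECell.one_comp] at h
    exact (isInd_ind_symm hS _ _ _).unique hS h
  map₂_right_unitor {X Y} (σ : Span X.gpd Y.gpd) := by
    apply InducedBicategory.Hom₂.ext
    have h := (isInd_indIso_hom hS ((σ.comp (Span.id Y.gpd)).datum hS)
      ((σ.datum hS).comp ((Span.id Y.gpd).datum hS))).comp hS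
      (((isInd_indIso_hom hS ((Span.id Y.gpd).datum hS) (Datum.id _)).whiskerLeft
        (σ.datum hS)).comp hS (IsInd.rightUnitor (σ.datum hS)))
    rw [ECell.one_comp, ECell.whiskerLeft_one, ECell.one_comp] at h
    exact (isInd_ind_symm hS _ _ _).unique hS h

end Orbi

namespace Orbi

open GroupoidIn Orbi.Span

variable {S : SpaceCat.{v, u}}

namespace GroupoidIn

section ofCartesian

variable (X : GroupoidIn S) {N Z₁ : S.Obj} (q : N ⟶ X.G₀) (s t : Z₁ ⟶ N) (f₁ : Z₁ ⟶ X.G₁)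

/-- The arrows of a groupoid that is induced along `q`. -/
structure IsInducedArrows : Prop where
  f_s : f₁ ≫ X.s = s ≫ q
  f_t : f₁ ≫ X.t = t ≫ q
  cartesian : ∀ {M : S.Obj} (z z' : M ⟶ N) (x : M ⟶ X.G₁), x ≫ X.s = z ≫ q → x ≫ X.t = z' ≫ q →
    ∃! w : M ⟶ Z₁, w ≫ s = z ∧ w ≫ t = z' ∧ w ≫ f₁ = x

variable {X q s t f₁} (h : IsInducedArrows X q s t f₁)

namespace IsInducedArrows

include h

lemma hom_ext {M : S.Obj} {w w' : M ⟶ Z₁} (h₁ : w ≫ s = w' ≫ s) (h₂ : w ≫ t = w' ≫ t)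
    (h₃ : w ≫ f₁ = w' ≫ f₁) : w = w' :=
  (h.cartesian (w' ≫ s) (w' ≫ t) (w' ≫ f₁) (by simp [h.f_s]) (by simp [h.f_t])).unique
    ⟨h₁, h₂, h₃⟩ ⟨rfl, rfl, rfl⟩

lemma comp_f_s {M : S.Obj} (w : M ⟶ Z₁) : (w ≫ f₁) ≫ X.s = (w ≫ s) ≫ q := by simp [h.f_s]

lemma comp_f_t {M : S.Obj} (w : M ⟶ Z₁) : (w ≫ f₁) ≫ X.t = (w ≫ t) ≫ q := by simp [h.f_t]

lemma composable {M : S.Obj} {a b : M ⟶ Z₁} (e : a ≫ t = b ≫ s) :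
    (a ≫ f₁) ≫ X.t = (b ≫ f₁) ≫ X.s := by
  rw [h.comp_f_s, h.comp_f_t, e]

lemma exists_comp [HasPullback t s] : ∃ c : pullback t s ⟶ Z₁,
    c ≫ s = pullback.fst t s ≫ s ∧ c ≫ t = pullback.snd t s ≫ t ∧
    c ≫ f₁ = X.mul (pullback.fst t s ≫ f₁) (pullback.snd t s ≫ f₁) := by
  have e := h.composable (pullback.condition (f := t) (g := s))
  exact (h.cartesian (pullback.fst t s ≫ s) (pullback.snd t s ≫ t) _
    (by rw [X.mul_s e, h.comp_f_s]) (by rw [X.mul_t e, h.comp_f_t])).exists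

lemma exists_unit : ∃ ι : N ⟶ Z₁, ι ≫ s = 𝟙 N ∧ ι ≫ t = 𝟙 N ∧ ι ≫ f₁ = q ≫ X.ι :=
  (h.cartesian (𝟙 N) (𝟙 N) (q ≫ X.ι) (by simp) (by simp)).exists

lemma lift_exists_comp [HasPullback t s] {M : S.Obj} (a b : M ⟶ Z₁) (e : a ≫ t = b ≫ s) :
    (pullback.lift a b e ≫ h.exists_comp.choose) ≫ s = a ≫ s ∧
    (pullback.lift a b e ≫ h.exists_comp.choose) ≫ t = b ≫ t ∧
    (pullback.lift a b e ≫ h.exists_comp.choose) ≫ f₁ = X.mul (a ≫ f₁) (b ≫ f₁) := by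
  obtain ⟨h₁, h₂, h₃⟩ := h.exists_comp.choose_spec
  refine ⟨?_, ?_, ?_⟩
  · rw [Category.assoc, h₁, pullback.lift_fst_assoc]
  · rw [Category.assoc, h₂, pullback.lift_snd_assoc]
  · rw [Category.assoc, h₃, X.comp_mul _ (h.composable pullback.condition),
      pullback.lift_fst_assoc, pullback.lift_snd_assoc]

/-- The groupoid that is induced along a morphism. -/
noncomputable def groupoid [HasPullback t s] : GroupoidIn S where
  G₀ := N
  G₁ := Z₁
  s := s
  t := t
  ι := h.exists_unit.choose
  c := h.exists_comp.choose
  ι_s := h.exists_unit.choose_spec.1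
  ι_t := h.exists_unit.choose_spec.2.1
  c_s := h.exists_comp.choose_spec.1
  c_t := h.exists_comp.choose_spec.2.1
  id_comp a e := by
    obtain ⟨h₁, h₂, h₃⟩ := h.lift_exists_comp _ _ e
    obtain ⟨k₁, k₂, k₃⟩ := h.exists_unit.choose_spec
    refine h.hom_ext (h₁.trans ?_) h₂ (h₃.trans ?_)
    · rw [Category.assoc, k₁, Category.comp_id]
    · rw [Category.assoc, k₃, ← Category.assoc]
      exact X.one_mul (h.comp_f_s a)
  comp_id a e := by
    obtain ⟨h₁, h₂, h₃⟩ := h.lift_exists_comp _ _ e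
    obtain ⟨k₁, k₂, k₃⟩ := h.exists_unit.choose_spec
    refine h.hom_ext h₁ (h₂.trans ?_) (h₃.trans ?_)
    · rw [Category.assoc, k₂, Category.comp_id]
    · rw [Category.assoc, k₃, ← Category.assoc]
      exact X.mul_one (h.comp_f_t a)
  assoc a b d e e' e₁ e₂ := by
    obtain ⟨h₁, h₂, h₃⟩ := h.lift_exists_comp _ _ e₁
    obtain ⟨k₁, k₂, k₃⟩ := h.lift_exists_comp _ _ e₂
    obtain ⟨l₁, l₂, l₃⟩ := h.lift_exists_comp _ _ e
    obtain ⟨m₁, m₂, m₃⟩ := h.lift_exists_comp _ _ e'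
    refine h.hom_ext (h₁.trans (l₁.trans k₁.symm)) (h₂.trans (m₂.symm.trans k₂.symm))
      (h₃.trans (Eq.trans ?_ k₃.symm))
    rw [l₃, m₃]
    exact X.mul_assoc (h.composable e) (h.composable e')
  exists_inv a := by
    obtain ⟨b, b₁, b₂, b₃, b₄⟩ := X.exists_mul_inv (a ≫ f₁)
    obtain ⟨w, w₁, w₂, w₃⟩ := (h.cartesian (a ≫ t) (a ≫ s) b (by rw [b₁, h.comp_f_t])
      (by rw [b₂, h.comp_f_s])).exists
    obtain ⟨k₁, k₂, k₃⟩ := h.exists_unit.choose_spec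
    refine ⟨w, w₁.symm, w₂, ?_, ?_⟩
    · obtain ⟨h₁, h₂, h₃⟩ := h.lift_exists_comp _ _ w₁.symm
      refine h.hom_ext (h₁.trans ?_) (h₂.trans ?_) (h₃.trans ?_)
      · rw [Category.assoc, k₁, Category.comp_id]
      · rw [Category.assoc, k₂, Category.comp_id, w₂]
      · rw [w₃, b₃, Category.assoc (a ≫ s), k₃, h.comp_f_s, Category.assoc, Category.assoc]
    · obtain ⟨h₁, h₂, h₃⟩ := h.lift_exists_comp _ _ w₂
      refine h.hom_ext (h₁.trans ?_) (h₂.trans ?_) (h₃.trans ?_)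
      · rw [Category.assoc, k₁, Category.comp_id, w₁]
      · rw [Category.assoc, k₂, Category.comp_id]
      · rw [w₃, b₄, Category.assoc (a ≫ t), k₃, h.comp_f_t, Category.assoc, Category.assoc]

lemma groupoid_mul [HasPullback t s] {M : S.Obj} {a b : M ⟶ Z₁} (e : a ≫ t = b ≫ s) :
    h.groupoid.mul a b ≫ s = a ≫ s ∧ h.groupoid.mul a b ≫ t = b ≫ t ∧
      h.groupoid.mul a b ≫ f₁ = X.mul (a ≫ f₁) (b ≫ f₁) := by
  have : h.groupoid.mul a b = pullback.lift a b e ≫ h.exists_comp.choose :=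
    h.groupoid.mul_eq (a := a) (b := b) e
  rw [this]
  exact h.lift_exists_comp a b e

/-- The morphism from the induced groupoid. -/
noncomputable def hom [HasPullback t s] : h.groupoid ⟶ X where
  f₀ := q
  f₁ := f₁
  f₁_s := h.f_s
  f₁_t := h.f_t
  ι_f₁ := h.exists_unit.choose_spec.2.2
  mul_f₁ _ _ e := (h.groupoid_mul e).2.2

variable [S.IsGeometric] [HasPullback t s] [IsSGroupoid X]

omit [HasPullback t s] in
lemma etale (hq : S.etale q) : S.etale s ∧ S.etale t := by
  refine ⟨(etale_of_cartesian X.s X.t s t q f₁ IsSGroupoid.etale_s hq h.f_s h.f_t h.cartesian).2,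
    (etale_of_cartesian X.t X.s t s q f₁ IsSGroupoid.etale_t hq h.f_t h.f_s
      fun z z' x e e' => ?_).2⟩
  obtain ⟨w, ⟨h₁, h₂, h₃⟩, hw⟩ := h.cartesian z' z x e' e
  exact ⟨w, ⟨h₂, h₁, h₃⟩, fun w' hw' => hw w' ⟨hw'.2.1, hw'.1, hw'.2.2⟩⟩

lemma isSGroupoid (hq : S.etale q) : IsSGroupoid h.groupoid where
  etale_s := (h.etale hq).1
  etale_t := (h.etale hq).2
  separated := SpaceCat.IsGeometric.properPair X.s X.t s t q f₁ IsSGroupoid.etale_s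
    IsSGroupoid.etale_t hq h.f_s h.f_t h.cartesian IsSGroupoid.separated

lemma isAcyclicFib (hq : S.etale q) (hq' : S.surj q) : IsAcyclicFib h.hom where
  etale := hq
  surj := hq'
  cartesian := h.cartesian

end IsInducedArrows

lemma exists_isInducedArrows [S.IsGeometric] (X : GroupoidIn S) [IsSGroupoid X] {N : S.Obj}
    (q : N ⟶ X.G₀) (hq : S.etale q) : ∃ (Z₁ : S.Obj) (s t : Z₁ ⟶ N) (f₁ : Z₁ ⟶ X.G₁),
      IsInducedArrows X q s t f₁ := by
  have := SpaceCat.IsGeometric.hasPullback X.s q hq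
  have := SpaceCat.IsGeometric.hasPullback (pullback.fst X.s q ≫ X.t) q hq
  refine ⟨pullback (pullback.fst X.s q ≫ X.t) q, pullback.fst _ _ ≫ pullback.snd _ _,
    pullback.snd _ _, pullback.fst _ _ ≫ pullback.fst _ _, by simp [pullback.condition],
    by simp [pullback.condition], fun z z' x e e' => ?_⟩
  refine ⟨pullback.lift (pullback.lift x z e) z' (by rw [pullback.lift_fst_assoc, e']),
    ⟨by simp [pullback.lift_fst_assoc, pullback.lift_snd], by simp [pullback.lift_snd],
      by simp [pullback.lift_fst_assoc, pullback.lift_fst]⟩, ?_⟩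
  rintro w ⟨h₁, h₂, h₃⟩
  apply pullback.hom_ext
  · apply pullback.hom_ext
    · simpa [pullback.lift_fst_assoc, pullback.lift_fst] using h₃
    · simpa [pullback.lift_fst_assoc, pullback.lift_snd, pullback.lift_fst] using h₁
  · simpa [pullback.lift_snd] using h₂

end ofCartesian

end GroupoidIn

lemma AssocStack.exists_cover (hS : IsGoodSite S) {Y : GroupoidIn S} (B : AssocStack Y)
    (b : B.stack.obj) {M : S.Obj} (hb : B.stack.p.obj b = M) :
    ∃ (N : S.Obj) (q : N ⟶ M) (y : N ⟶ Y.G₀) (k : B.J.obj ⟨N, y⟩ ⟶ b),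
      S.etale q ∧ S.surj q ∧ B.stack.p.IsHomLift q k := by
  subst hb
  obtain ⟨N, q, I, U, inc, hq, hq', hm, hc, hi, hd⟩ :=
    hS.exists_disjoint_cover _ (B.isLocalEquiv.cov b)
  have loc (i : I) : ∃ (y : U i ⟶ Y.G₀) (k : B.J.obj ⟨U i, y⟩ ⟶ b),
      B.stack.p.IsHomLift (inc i ≫ q) k := by
    obtain ⟨⟨a, k⟩, n, hn⟩ := (Sieve.mem_ofArrows_iff _ _ _).1 (hi i)
    let n' : U i ⟶ Pt.M a := n ≫ eqToHom (B.p_J a)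
    let φ : (⟨U i, n' ≫ Pt.x a⟩ : Pt Y) ⟶ a := Pt.ofEq n' rfl
    have h₁ := B.isHomLift_J φ
    have h₂ : B.stack.p.IsHomLift (eqToHom (B.p_J a).symm ≫ B.stack.p.map k) k :=
      (IsHomLift.lift_eqToHom_comp_iff B.stack.p (B.stack.p.map k) k (B.p_J a).symm).2
        (IsHomLift.map _ k)
    have h₃ := isHomLift_comp h₁ h₂
    refine ⟨n' ≫ Pt.x a, B.J.map φ ≫ k, ?_⟩
    have e : Pt.Hom.a φ ≫ eqToHom (B.p_J a).symm ≫ B.stack.p.map k = inc i ≫ q := by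
      rw [hn]
      have {V W T : S.Obj} (e : V = W) (n : U i ⟶ V) (m : V ⟶ T) :
          (n ≫ eqToHom e) ≫ eqToHom e.symm ≫ m = n ≫ m := by simp
      exact this _ _ _
    rwa [e] at h₃
  choose y k hk using loc
  have hy {L : S.Obj} {f : L ⟶ N} (hf : Sieve.ofArrows U inc f) :
      ∃ g : L ⟶ Y.G₀, ∀ (i : I) (a : L ⟶ U i), a ≫ inc i = f → g = a ≫ y i := by
    obtain ⟨i, a, rfl⟩ := (Sieve.mem_ofArrows_iff _ _ _).1 hf
    refine ⟨a ≫ y i, fun j a' e => ?_⟩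
    by_cases hij : i = j
    · subst hij
      have := hm i
      rw [(cancel_mono (inc i)).1 e]
    · exact hS.hom_ext (hd hij a a' e.symm) (fun _ h => h.elim)
  choose g hg using @hy
  obtain ⟨y₀, hy₀, -⟩ := hS.existsUnique_glue hc (fun f hf => g hf) (fun l f hf hlf => by
    obtain ⟨i, a, e⟩ := (Sieve.mem_ofArrows_iff _ _ _).1 hf
    rw [hg hf i a e.symm, hg hlf i (l ≫ a) (by rw [Category.assoc, ← e]), Category.assoc])
  have hy₁ (i : I) : inc i ≫ y₀ = y i := by
    rw [hy₀ (inc i) (Sieve.ofArrows_mk _ _ i), hg _ i (𝟙 _) (Category.id_comp _), Category.id_comp]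
  let φ (i : I) : (⟨U i, y i⟩ : Pt Y) ⟶ ⟨N, y₀⟩ := Pt.ofEq (inc i) (hy₁ i).symm
  have base {i : I} {d : B.stack.obj} (χ : d ⟶ B.J.obj ⟨U i, y i⟩) :
      ∃ a : B.stack.p.obj d ⟶ U i, B.stack.p.IsHomLift a χ :=
    ⟨B.stack.p.map χ ≫ eqToHom (B.p_J ⟨U i, y i⟩), inferInstance⟩
  obtain ⟨K, ⟨hK, -⟩, -⟩ := B.isStack.gluesMor.existsUnique B.isStack.fibG q (B.p_J _) rfl U inc
    (fun i => B.J.obj ⟨U i, y i⟩) (fun i => B.J.map (φ i)) k (fun i => B.isHomLift_J (φ i)) hk hc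
    (fun i j d χ χ' e => by
      obtain ⟨a, ha⟩ := base χ
      obtain ⟨a', ha'⟩ := base χ'
      have e' : a ≫ inc i = a' ≫ inc j :=
        isHomLift_unique (isHomLift_comp ha (B.isHomLift_J (φ i)))
          (by rw [e]; exact isHomLift_comp ha' (B.isHomLift_J (φ j)))
      by_cases hij : i = j
      · subst hij
        have := hm i
        obtain rfl := (cancel_mono (inc i)).1 e'
        rw [B.isStack.fibG.hom_ext _ ha ha' e]
      · have h₁ := isHomLift_comp ha (hk i)
        have h₂ := isHomLift_comp ha' (hk j)
        rw [← Category.assoc, ← e', Category.assoc] at h₂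
        refine B.isStack.gluesMor.ext B.isStack.fibG (I := PEmpty.{1}) (fun i => i.elim)
          (fun i => i.elim) (fun i => i.elim) (fun i => i.elim) (fun i => i.elim) ?_ h₁ h₂
          (fun i => i.elim)
        exact S.topology.superset_covering bot_le (hd hij a a' e'))
  exact ⟨N, q, y₀, K, hq, hq', hK⟩

end Orbi

namespace Orbi

open GroupoidIn Orbi.Span

variable {S : SpaceCat.{v, u}} [S.IsGeometric]

/-- Every functor between associated stacks is presented by a span. -/
lemma Datum.exists_eq (hS : IsGoodSite S) {X Y : GroupoidIn S} [IsSGroupoid X] {A : AssocStack X}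
    {B : AssocStack Y} (Φ : BasedFunctor A.stack B.stack) :
    ∃ (σ : Span X Y) (D : Datum σ A B), D.E = Φ := by
  let X₀ : Pt X := ⟨X.G₀, 𝟙 _⟩
  obtain ⟨N, q, y, k, hq, hq', hk⟩ := B.exists_cover hS (Φ.obj (A.J.obj X₀)) (M := X.G₀)
    ((Φ.w_obj _).trans (A.p_J _))
  obtain ⟨Z₁, s, t, f₁, h⟩ := exists_isInducedArrows X q hq
  have hfib := B.isStack.fibG
  let P {M : S.Obj} (z : M ⟶ N) : Pt X := ⟨M, z ≫ q⟩
  let Q {M : S.Obj} (z : M ⟶ N) : Pt Y := ⟨M, z ≫ y⟩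
  let eP {M : S.Obj} (z : M ⟶ N) : P z ⟶ X₀ := Pt.ofEq (z ≫ q) (Category.comp_id _).symm
  let eQ {M : S.Obj} (z : M ⟶ N) : Q z ⟶ ⟨N, y⟩ := Pt.ofEq z rfl
  have hi {M : S.Obj} (z : M ⟶ N) : ∃ i : B.J.obj (Q z) ⟶ Φ.obj (A.J.obj (P z)),
      B.stack.p.IsHomLift (𝟙 M) i ∧ i ≫ Φ.map (A.J.map (eP z)) = B.J.map (eQ z) ≫ k :=
    hfib.exists_fac_id (Datum.isHomLift_E Φ (eP z)) (isHomLift_comp (B.isHomLift_J (eQ z)) hk)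
  choose i hi hi' using @hi
  have iso {M : S.Obj} (z : M ⟶ N) : IsIso (i z) := hfib.isIso_of_id (hi z)
  have hact {M M' : S.Obj} {z : M ⟶ N} {z' : M' ⟶ N} (φ : P z ⟶ P z') : ∃ ψ : Q z ⟶ Q z',
      i z ≫ Φ.map (A.J.map φ) = B.J.map ψ ≫ i z' ∧ Pt.Hom.a ψ = Pt.Hom.a φ := by
    have h' := hi z'
    obtain ⟨ψ, h₁, h₂⟩ := B.exists_J_map (P := Q z) (Q := Q z')
      (isHomLift_comp_id (isHomLift_id_comp (hi z) (Datum.isHomLift_E Φ φ))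
        (IsHomLift.lift_id_inv_isIso B.stack.p M' (i z')))
    exact ⟨ψ, by rw [h₁]; simp, h₂⟩
  choose act hact hact' using @hact
  have act_comp {M M' M'' : S.Obj} {z : M ⟶ N} {z' : M' ⟶ N} {z'' : M'' ⟶ N} (φ : P z ⟶ P z')
      (ψ : P z' ⟶ P z'') : act (φ ≫ ψ) = act φ ≫ act ψ := by
    apply B.J.map_injective
    rw [← cancel_mono (i z''), ← hact, B.J.map_comp, Category.assoc, ← hact, A.J.map_comp,
      Φ.map_comp, reassoc_of% (hact φ)]
  have act_ofEq {M M' : S.Obj} {z : M ⟶ N} {z' : M' ⟶ N} (a : M ⟶ M') (e : z = a ≫ z')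
      (e₁ : z ≫ q = a ≫ z' ≫ q) (e₂ : z ≫ y = a ≫ z' ≫ y) :
      act (Pt.ofEq (P := P z) (Q := P z') a e₁) = Pt.ofEq (P := Q z) (Q := Q z') a e₂ := by
    let ε : P z ⟶ P z' := Pt.ofEq a e₁
    let δ : Q z ⟶ Q z' := Pt.ofEq a e₂
    have h₁ : ε ≫ eP z' = eP z :=
      Pt.hom_ext e₁.symm (by
        refine (Pt.ofEq_comp (P := P z) (Q := P z') (R := X₀) a e₁ (eP z')).trans ?_
        change a ≫ (z' ≫ q) ≫ X.ι = (z ≫ q) ≫ X.ι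
        rw [e₁, Category.assoc a])
    have h₂ : δ ≫ eQ z' = eQ z :=
      Pt.hom_ext e.symm (by
        refine (Pt.ofEq_comp (P := Q z) (Q := Q z') (R := ⟨N, y⟩) a e₂ (eQ z')).trans ?_
        change a ≫ (z' ≫ y) ≫ Y.ι = (z ≫ y) ≫ Y.ι
        rw [e₂, Category.assoc a])
    apply B.J.map_injective
    rw [← cancel_mono (i z'), ← hact]
    change i z ≫ Φ.map (A.J.map ε) = B.J.map δ ≫ i z'
    refine hfib.hom_ext (Φ.map (A.J.map (eP z'))) (k := a)
      (isHomLift_id_comp (hi z) (Datum.isHomLift_E Φ ε))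
      (isHomLift_comp_id (B.isHomLift_J δ) (hi z')) ?_
    rw [Category.assoc, Category.assoc, ← Φ.map_comp, ← A.J.map_comp, h₁, hi', hi',
      ← B.J.map_comp_assoc, h₂]
  let γ {M : S.Obj} (z z' : M ⟶ N) (x : M ⟶ X.G₁) (e : x ≫ X.s = z ≫ q) (e' : x ≫ X.t = z' ≫ q) :
    P z ⟶ P z' := ⟨𝟙 M, x, e, by rw [e', Category.id_comp]⟩
  let F : Z₁ ⟶ Y.G₁ := Pt.Hom.g (act (γ s t f₁ h.f_s h.f_t))
  have hF {M : S.Obj} (w : M ⟶ Z₁) (z z' : M ⟶ N) (x : M ⟶ X.G₁) (e : x ≫ X.s = z ≫ q)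
      (e' : x ≫ X.t = z' ≫ q) (h₁ : w ≫ s = z) (h₂ : w ≫ t = z') (h₃ : w ≫ f₁ = x) :
      w ≫ F = Pt.Hom.g (act (γ z z' x e e')) := by
    subst h₁ h₂ h₃
    let ε : P (w ≫ s) ⟶ P s := Pt.ofEq w (Category.assoc _ _ _)
    let ε' : P (w ≫ t) ⟶ P t := Pt.ofEq w (Category.assoc _ _ _)
    have h₁ : γ (w ≫ s) (w ≫ t) (w ≫ f₁) e e' ≫ ε' = ε ≫ γ s t f₁ h.f_s h.f_t :=
      Pt.hom_ext ((Category.id_comp _).trans (Category.comp_id _).symm)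
        ((Pt.comp_ofEq (R := P t) (γ _ _ _ e e') w _).trans
          (Eq.trans (b := w ≫ f₁) rfl
            (Pt.ofEq_comp (P := P (w ≫ s)) (Q := P s) (R := P t) w (Category.assoc _ _ _) (γ s t f₁ h.f_s h.f_t)).symm))
    have h₂ := (act_comp _ ε').symm.trans ((congrArg act h₁).trans (act_comp ε _))
    rw [act_ofEq w rfl _ (Category.assoc _ _ _), act_ofEq w rfl _ (Category.assoc _ _ _)] at h₂
    have h₃ := congrArg Pt.Hom.g h₂
    exact (Pt.ofEq_comp (P := Q (w ≫ s)) (Q := Q s) (R := Q t) w (Category.assoc _ _ _)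
      (act (γ s t f₁ h.f_s h.f_t))).symm.trans
      (h₃.symm.trans (Pt.comp_ofEq (R := Q t) (act (γ _ _ _ e e')) w (Category.assoc _ _ _)))
  have nat {M M' : S.Obj} (z : M ⟶ N) (z' : M' ⟶ N) (a : M ⟶ M') (g : M ⟶ Z₁) (hs : g ≫ s = z)
      (ht : g ≫ t = a ≫ z') {ψ : Q z ⟶ Q z'} {φ : P z ⟶ P z'} (hψa : Pt.Hom.a ψ = a)
      (hψg : Pt.Hom.g ψ = g ≫ F) (hφa : Pt.Hom.a φ = a) (hφg : Pt.Hom.g φ = g ≫ f₁) :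
      B.J.map ψ ≫ i z' = i z ≫ Φ.map (A.J.map φ) := by
    have e₁ : (g ≫ f₁) ≫ X.s = z ≫ q := by rw [h.comp_f_s, hs]
    have e₂ : (g ≫ f₁) ≫ X.t = (a ≫ z') ≫ q := by rw [h.comp_f_t, ht]
    let ε : P (a ≫ z') ⟶ P z' := Pt.ofEq a (Category.assoc _ _ _)
    have hφ : φ = γ z (a ≫ z') (g ≫ f₁) e₁ e₂ ≫ ε :=
      Pt.hom_ext (hφa.trans (Category.id_comp _).symm) (hφg.trans
        (Pt.comp_ofEq (R := P z') (γ _ _ _ e₁ e₂) a (Category.assoc _ _ _)).symm)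
    have hψ : act φ = ψ := by
      refine Pt.hom_ext ((hact' φ).trans (hφa.trans hψa.symm)) ?_
      rw [hφ, act_comp, act_ofEq a rfl _ (Category.assoc _ _ _), hψg]
      exact (Pt.comp_ofEq (R := Q z') (act (γ _ _ _ e₁ e₂)) a (Category.assoc _ _ _)).trans
        (hF g _ _ _ e₁ e₂ hs ht rfl).symm
    rw [hact, hψ]
  have := SpaceCat.IsGeometric.hasPullback t s (h.etale hq).1
  have := h.isSGroupoid hq
  have := h.isAcyclicFib hq hq'
  let f : h.groupoid ⟶ Y :=
    { f₀ := y
      f₁ := F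
      f₁_s := Pt.Hom.g_s (act (γ s t f₁ h.f_s h.f_t))
      f₁_t := by
        refine (Pt.Hom.g_t (act (γ s t f₁ h.f_s h.f_t))).trans ?_
        rw [hact']
        exact Category.id_comp _
      ι_f₁ := by
        obtain ⟨k₁, k₂, k₃⟩ := h.exists_unit.choose_spec
        have e : (q ≫ X.ι) ≫ X.s = 𝟙 N ≫ q := by simp
        have e' : (q ≫ X.ι) ≫ X.t = 𝟙 N ≫ q := by simp
        refine (hF _ (𝟙 N) (𝟙 N) (q ≫ X.ι) e e' k₁ k₂ k₃).trans ?_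
        have h₁ : γ (𝟙 N) (𝟙 N) (q ≫ X.ι) e e' =
            Pt.ofEq (P := P (𝟙 N)) (Q := P (𝟙 N)) (𝟙 N) (Category.id_comp _).symm :=
          Pt.hom_ext rfl (by
            change q ≫ X.ι = (𝟙 N ≫ q) ≫ X.ι
            rw [Category.id_comp])
        rw [h₁, act_ofEq (𝟙 N) (Category.id_comp _).symm _ (Category.id_comp _).symm]
        exact congrArg (· ≫ Y.ι) (Category.id_comp y)
      mul_f₁ := fun {M} (a b : M ⟶ Z₁) (e : a ≫ t = b ≫ s) => by
        obtain ⟨k₁, k₂, k₃⟩ := h.groupoid_mul e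
        have e₁ := h.composable e
        have e₂ : (b ≫ f₁) ≫ X.s = (a ≫ t) ≫ q := by rw [h.comp_f_s, e]
        have e₃ : X.mul (a ≫ f₁) (b ≫ f₁) ≫ X.s = (a ≫ s) ≫ q := by rw [X.mul_s e₁, h.comp_f_s]
        have e₄ : X.mul (a ≫ f₁) (b ≫ f₁) ≫ X.t = (b ≫ t) ≫ q := by rw [X.mul_t e₁, h.comp_f_t]
        have h₁ : γ (a ≫ s) (b ≫ t) (X.mul (a ≫ f₁) (b ≫ f₁)) e₃ e₄ =
            γ (a ≫ s) (a ≫ t) (a ≫ f₁) (h.comp_f_s a) (h.comp_f_t a) ≫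
              γ (a ≫ t) (b ≫ t) (b ≫ f₁) e₂ (h.comp_f_t b) :=
          Pt.hom_ext (Category.id_comp _).symm
            (congrArg (X.mul _) (Category.id_comp _).symm)
        refine (hF (h.groupoid.mul a b) _ _ _ e₃ e₄ k₁ k₂ k₃).trans ?_
        rw [h₁, act_comp, Pt.comp_g, hact']
        exact congrArg₂ Y.mul (hF a _ _ _ (h.comp_f_s a) (h.comp_f_t a) rfl rfl rfl).symm
          ((Category.id_comp _).trans (hF b _ _ _ e₂ (h.comp_f_t b) e.symm rfl rfl).symm) }
  let σ : Span X Y := ⟨h.groupoid, h.hom, f⟩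
  let D : Datum σ A B :=
    { E := Φ
      i := fun p => by
        obtain ⟨M, z, x, y', hx, hy⟩ := p
        subst hx hy
        exact i z
      isHomLift_i := fun p => by
        obtain ⟨M, z, x, y', hx, hy⟩ := p
        subst hx hy
        exact hi z
      nat := fun {p p'} ω => by
        obtain ⟨M, z, x, y₁, hx, hy⟩ := p
        subst hx hy
        obtain ⟨M', z', x', y₂, hx', hy'⟩ := p'
        subst hx' hy'
        exact nat z z' (Pt.Hom.a ω) (Pt.Hom.g ω) (Pt.Hom.g_s ω) (Pt.Hom.g_t ω)
          rfl rfl rfl rfl }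
  exact ⟨σ, D, rfl⟩

end Orbi

namespace Orbi

open GroupoidIn Orbi.Span Bicategory

section

variable {S : SpaceCat.{v, u}}

/-- Two stacks that are associated with the same groupoid are equivalent. -/
lemma IsAssociatedStack.nonempty_equivalence {𝒜 𝒳 𝒴 : BasedCategory.{v, max u v} S.Obj}
    {j : 𝒜 ⟶ 𝒳} {k : 𝒜 ⟶ 𝒴} (hj : IsAssociatedStack j) (hk : IsAssociatedStack k) :
    Nonempty (Bicategory.Equivalence 𝒳 𝒴) := by
  have e₁ := hj.universal 𝒴 hk.isStack
  have e₂ := hk.universal 𝒳 hj.isStack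
  have e₃ := hj.universal 𝒳 hj.isStack
  have e₄ := hk.universal 𝒴 hk.isStack
  let f : 𝒳 ⟶ 𝒴 := (precomp 𝒴 j).objPreimage k
  let g : 𝒴 ⟶ 𝒳 := (precomp 𝒳 k).objPreimage j
  let α : j ≫ f ≅ k := (precomp 𝒴 j).objObjPreimageIso k
  let β : k ≫ g ≅ j := (precomp 𝒳 k).objObjPreimageIso j
  let unit : 𝟙 𝒳 ≅ f ≫ g := (precomp 𝒳 j).preimageIso
    (ρ_ j ≪≫ β.symm ≪≫ whiskerRightIso α.symm g ≪≫ α_ j f g)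
  let counit : g ≫ f ≅ 𝟙 𝒴 := (precomp 𝒴 k).preimageIso
    ((α_ k g f).symm ≪≫ whiskerRightIso β f ≪≫ α ≪≫ (ρ_ k).symm)
  exact ⟨Bicategory.Equivalence.mkOfAdjointifyCounit unit counit⟩

end

variable {S : SpaceCat.{0, 1}} [S.IsGeometric]

lemma orbifoldPseudofunctor_isEquivalence (hS : IsGoodSite S) (X Y : SGroupoid S) :
    ((orbifoldPseudofunctor hS).mapFunctor X Y).IsEquivalence where
  faithful := ⟨fun {σ τ : Span X.gpd Y.gpd} (θ θ' : σ ⟶ τ) h => by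
    have h' := congrArg InducedBicategory.Hom₂.hom h
    exact (ECell.equiv σ τ).injective (Datum.ind_injective hS (σ.datum hS) (τ.datum hS) h')⟩
  full := ⟨fun {σ τ : Span X.gpd Y.gpd} β => by
    obtain ⟨η, hη⟩ := Datum.ind_surjective hS (σ.datum hS) (τ.datum hS) β.hom
    refine ⟨(ECell.equiv σ τ).symm η, InducedBicategory.Hom₂.ext ?_⟩
    refine Eq.trans ?_ hη
    exact congrArg (Datum.ind hS (σ.datum hS) (τ.datum hS))
      (Equiv.apply_symm_apply (ECell.equiv σ τ) η)⟩
  essSurj := ⟨fun Φ => by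
    obtain ⟨σ, D, hD⟩ := Datum.exists_eq hS (A := AssocStack.mk' hS X.gpd)
      (B := AssocStack.mk' hS Y.gpd) Φ.hom
    exact ⟨σ, ⟨InducedBicategory.isoMk (Datum.indIso hS (σ.datum hS) D ≪≫ eqToIso hD)⟩⟩⟩

lemma orbifoldPseudofunctor_isBiequivalence (hS : IsGoodSite S) :
    IsBiequivalence (orbifoldPseudofunctor hS) where
  isEquivalence := orbifoldPseudofunctor_isEquivalence hS
  essSurj 𝒳 := by
    obtain ⟨X, 𝒴, j, hj, ⟨e⟩⟩ := 𝒳.isOrbifold.exists_groupoid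
    obtain ⟨e'⟩ := (AssocStack.mk' hS X.gpd).isAssociatedStack.nonempty_equivalence hj
    let f : (orbifoldPseudofunctor hS).obj X ⟶ 𝒳 := InducedBicategory.mkHom (e'.hom ≫ e.inv)
    let g : 𝒳 ⟶ (orbifoldPseudofunctor hS).obj X := InducedBicategory.mkHom (e.hom ≫ e'.inv)
    let unit : 𝟙 _ ≅ f ≫ g := InducedBicategory.isoMk (e'.unit ≪≫ whiskerLeftIso e'.hom
      ((λ_ e'.inv).symm ≪≫ whiskerRightIso e.counit.symm _ ≪≫ α_ _ _ _) ≪≫ (α_ _ _ _).symm)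
    let counit : g ≫ f ≅ 𝟙 _ := InducedBicategory.isoMk (α_ _ _ _ ≪≫ whiskerLeftIso e.hom
      ((α_ _ _ _).symm ≪≫ whiskerRightIso e'.counit _ ≪≫ λ_ _) ≪≫ e.unit.symm)
    exact ⟨X, ⟨Bicategory.Equivalence.mkOfAdjointifyCounit unit counit⟩⟩

theorem exists_pseudofunctor (hS : IsGoodSite S) :
    ∃ (F : Pseudofunctor (SGroupoid S) (OrbiCat S)),
      IsBiequivalence F ∧
      ∃ j : ∀ X : SGroupoid S, X.gpd.toBased ⟶ Orbifold.stack (F.obj X),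
        (∀ X : SGroupoid S, IsAssociatedStack (j X)) ∧
        ∀ (X Y : SGroupoid S) (σ : Span X.gpd Y.gpd),
          Nonempty (toBasedMap σ.s ≫ j X ≫ (F.map (X := X) (Y := Y) σ).hom ≅
            toBasedMap σ.f ≫ j Y) :=
  ⟨orbifoldPseudofunctor hS, orbifoldPseudofunctor_isBiequivalence hS,
    fun X => (AssocStack.mk' hS X.gpd).j, fun X => (AssocStack.mk' hS X.gpd).isAssociatedStack,
    fun _ _ σ => (σ.datum hS).nonempty_iso⟩

end Orbi

namespace Orbi

open TopologicalSpace Topology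

/-- The fiber product of topological spaces along a local homeomorphism. -/
lemma isLocalHomeomorph_pullback_fst {α β γ : Type*} [TopologicalSpace α] [TopologicalSpace β]
    [TopologicalSpace γ] {f : α → β} {g : γ → β} (hf : IsLocalHomeomorph f) (hg : Continuous g) :
    IsLocalHomeomorph (fun p : {p : γ × α // g p.1 = f p.2} => p.1.1) := by
  rw [isLocalHomeomorph_iff_isOpenEmbedding_restrict]
  rintro ⟨⟨c₀, a₀⟩, h₀⟩
  obtain ⟨e, ha, rfl⟩ := hf a₀
  let W : Set {p : γ × α // g p.1 = e p.2} := {p | p.1.2 ∈ e.source}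
  have hW : IsOpen W := e.open_source.preimage (continuous_snd.comp continuous_subtype_val)
  refine ⟨W, hW.mem_nhds ha, ?_⟩
  let T : Set γ := g ⁻¹' e.target
  have hT : IsOpen T := e.open_target.preimage hg
  let k : W ≃ₜ T :=
    { toFun := fun p => ⟨p.1.1.1, by
        change g p.1.1.1 ∈ e.target
        rw [p.1.2]
        exact e.map_source p.2⟩
      invFun := fun c => ⟨⟨(c.1, e.symm (g c.1)), (e.right_inv c.2).symm⟩, e.map_target c.2⟩
      left_inv := by
        rintro ⟨⟨⟨c, a⟩, h⟩, h'⟩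
        refine Subtype.ext (Subtype.ext (Prod.ext rfl ?_))
        change e.symm (g c) = a
        rw [show g c = e a from h]
        exact e.left_inv h'
      right_inv := fun _ => rfl
      continuous_toFun := by fun_prop
      continuous_invFun := by
        refine Continuous.subtype_mk (Continuous.subtype_mk (continuous_subtype_val.prodMk ?_) _) _
        exact e.continuousOn_symm.comp_continuous (hg.comp continuous_subtype_val) fun c => c.2 }
  exact hT.isOpenEmbedding_subtypeVal.comp k.isOpenEmbedding

lemma isProperMap_of_cartesian {α β γ δ : Type*} [TopologicalSpace α] [TopologicalSpace β]
    [TopologicalSpace γ] [TopologicalSpace δ] {φ : α → β} {ψ : γ → β} {f : δ → α} {g : δ → γ}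
    (hφ : IsProperMap φ) (hψ : Continuous ψ) (hg : Continuous g) (h : ∀ d, φ (f d) = ψ (g d))
    (hcl : IsClosedEmbedding fun d => (f d, g d)) : IsProperMap g := by
  have h₁ : IsProperMap (fun d => (φ (f d), g d)) :=
    (hφ.prodMap isProperMap_id).comp hcl.isProperMap
  have h₂ : (fun d => (φ (f d), g d)) = (fun c => (ψ c, c)) ∘ g := funext fun d =>
    Prod.ext (h d) rfl
  rw [h₂] at h₁
  exact isProperMap_of_comp_of_inj hg (by fun_prop) h₁ fun _ _ e => (Prod.ext_iff.1 e).2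

/-- A category of spaces with underlying Hausdorff topological spaces, which are second countable
if `b` holds, and in which étale morphisms are determined by local homeomorphisms of topological
spaces. -/
structure IsTopLikeCore {C : Type u} [Category.{v} C] (U : C ⥤ TopCat.{0}) (et : MorphismProperty C)
    (b : Prop) : Prop where
  t2 : ∀ A, T2Space (U.obj A)
  secondCountable : b → ∀ A, SecondCountableTopology (U.obj A)
  isLocalHomeomorph : ∀ {A B : C} {f : A ⟶ B}, et f → IsLocalHomeomorph (U.map f)
  cartesian : ∀ {A B L : C} {f : A ⟶ B}, et f → ∀ (g : L ⟶ B) (h : U.obj L ⟶ U.obj A),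
    h ≫ U.map f = U.map g → ∃! k : L ⟶ A, k ≫ f = g ∧ U.map k = h
  iso_comp : ∀ {A A' B : C} (e : A' ⟶ A) [IsIso e] {f : A ⟶ B}, et f → et (e ≫ f)
  exists_lift : ∀ {A : C} {P : TopCat.{0}} (p : P ⟶ U.obj A), IsLocalHomeomorph p → T2Space P →
    (b → SecondCountableTopology P) → ∃ (A' : C) (f : A' ⟶ A) (e : P ≅ U.obj A'), et f ∧
      e.hom ≫ U.map f = p

namespace IsTopLikeCore

variable {C : Type u} [Category.{v} C] {U : C ⥤ TopCat.{0}} {et : MorphismProperty C}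
    {b : Prop} (H : IsTopLikeCore U et b)
include H

lemma etale_of_cartesian {A B : C} {f : A ⟶ B} (h : IsLocalHomeomorph (U.map f))
    (hc : ∀ {L : C} (g : L ⟶ B) (h : U.obj L ⟶ U.obj A), h ≫ U.map f = U.map g →
      ∃! k : L ⟶ A, k ≫ f = g ∧ U.map k = h) : et f := by
  obtain ⟨A', f', e, hf', he⟩ := H.exists_lift (U.map f) h (H.t2 A) (fun hb => H.secondCountable hb A)
  obtain ⟨k, ⟨hk, hk'⟩, -⟩ := H.cartesian hf' f e.hom he
  obtain ⟨l, ⟨hl, hl'⟩, -⟩ := hc f' e.inv (by rw [← he, e.inv_hom_id_assoc])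
  have : IsIso k := ⟨l, (hc f (𝟙 _) (Category.id_comp _)).unique
    ⟨by rw [Category.assoc, hl, hk], by rw [U.map_comp, hk', hl', e.hom_inv_id]⟩
    ⟨Category.id_comp _, U.map_id _⟩, (H.cartesian hf' f' (𝟙 _) (Category.id_comp _)).unique
    ⟨by rw [Category.assoc, hk, hl], by rw [U.map_comp, hk', hl', e.inv_hom_id]⟩
    ⟨Category.id_comp _, U.map_id _⟩⟩
  rw [← hk]
  exact H.iso_comp k hf'

lemma etale_id (A : C) : et (𝟙 A) := by
  refine H.etale_of_cartesian ?_ fun {L} g h hgh => ⟨g, ⟨Category.comp_id _, ?_⟩, ?_⟩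
  · rw [U.map_id]
    exact (Homeomorph.refl _).isLocalHomeomorph
  · rw [← hgh, U.map_id, Category.comp_id]
  · rintro k ⟨hk, -⟩
    rw [← hk, Category.comp_id]

lemma etale_comp {A B D : C} {f : A ⟶ B} {g : B ⟶ D} (hf : et f) (hg : et g) : et (f ≫ g) := by
  refine H.etale_of_cartesian ?_ fun {L} k h hgh => ?_
  · rw [U.map_comp, TopCat.coe_comp]
    exact (H.isLocalHomeomorph hg).comp (H.isLocalHomeomorph hf)
  · obtain ⟨l, ⟨hl, hl'⟩, hu⟩ := H.cartesian hg k (h ≫ U.map f) (by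
      rw [Category.assoc, ← U.map_comp, hgh])
    obtain ⟨m, ⟨hm, hm'⟩, hu'⟩ := H.cartesian hf l h hl'.symm
    refine ⟨m, ⟨by rw [reassoc_of% hm, hl], hm'⟩, ?_⟩
    rintro m' ⟨h₁, h₂⟩
    exact hu' m' ⟨hu (m' ≫ f) ⟨by rw [Category.assoc, h₁], by rw [U.map_comp, h₂]⟩, h₂⟩

/-- Fiber products along étale morphisms. -/
lemma exists_isPullback {A B D : C} (g : D ⟶ B) (f : A ⟶ B) (hf : et f) :
    ∃ (P : C) (fst : P ⟶ D) (snd : P ⟶ A), IsPullback fst snd g f ∧ et fst ∧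
      IsEmbedding (fun x : U.obj P => (U.map fst x, U.map snd x)) ∧
      ∀ d a, U.map g d = U.map f a → ∃ x, U.map fst x = d ∧ U.map snd x = a := by
  have := H.t2 A
  have := H.t2 D
  let P₀ : TopCat := TopCat.of {p : U.obj D × U.obj A // U.map g p.1 = U.map f p.2}
  let p₁ : P₀ ⟶ U.obj D := TopCat.ofHom ⟨fun p => p.1.1, by fun_prop⟩
  let p₂ : P₀ ⟶ U.obj A := TopCat.ofHom ⟨fun p => p.1.2, by fun_prop⟩
  have hp : p₁ ≫ U.map g = p₂ ≫ U.map f := TopCat.hom_ext (ContinuousMap.ext fun p => p.2)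
  obtain ⟨P, fst, e, hfst, he⟩ := H.exists_lift p₁
    (isLocalHomeomorph_pullback_fst (H.isLocalHomeomorph hf) (U.map g).hom.continuous)
    inferInstance (fun hb => by
      have := H.secondCountable hb A
      have := H.secondCountable hb D
      exact (IsEmbedding.subtypeVal (p := fun p : U.obj D × U.obj A =>
        U.map g p.1 = U.map f p.2)).secondCountableTopology)
  obtain ⟨snd, ⟨h₁, h₂⟩, -⟩ := H.cartesian hf (fst ≫ g) (e.inv ≫ p₂) (by
    rw [Category.assoc, ← hp, U.map_comp, ← he, Category.assoc, e.inv_hom_id_assoc])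
  have he' : U.map fst = e.inv ≫ p₁ := by rw [← he, e.inv_hom_id_assoc]
  have hi (x : U.obj P) : (e.inv x : U.obj D × U.obj A) = (U.map fst x, U.map snd x) := by
    rw [he', h₂]
    rfl
  have key {L : C} (d : L ⟶ D) (a : L ⟶ A) (w : d ≫ g = a ≫ f) :
      ∃! k : L ⟶ P, k ≫ fst = d ∧ k ≫ snd = a := by
    let l : U.obj L ⟶ P₀ := TopCat.ofHom ⟨fun x => ⟨(U.map d x, U.map a x), by
      have := congrArg (fun φ => U.map φ x) w
      simpa using this⟩, by fun_prop⟩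
    have l₁ : l ≫ p₁ = U.map d := rfl
    have l₂ : l ≫ p₂ = U.map a := rfl
    obtain ⟨k, ⟨hk, hk'⟩, hu⟩ := H.cartesian hfst d (l ≫ e.hom) (by rw [Category.assoc, he, l₁])
    refine ⟨k, ⟨hk, ?_⟩, ?_⟩
    · refine (H.cartesian hf (d ≫ g) (U.map a) (by rw [← U.map_comp, w])).unique ⟨?_, ?_⟩
        ⟨w.symm, rfl⟩
      · rw [Category.assoc, h₁, reassoc_of% hk]
      · rw [U.map_comp, hk', h₂, Category.assoc, e.hom_inv_id_assoc, l₂]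
    · rintro k' ⟨e₁, e₂⟩
      refine hu k' ⟨e₁, ?_⟩
      rw [← cancel_mono e.inv, Category.assoc, e.hom_inv_id, Category.comp_id]
      refine TopCat.hom_ext (ContinuousMap.ext fun x => Subtype.ext ((hi _).trans ?_))
      rw [← e₁] at l₁
      rw [← e₂] at l₂
      refine Prod.ext ?_ ?_
      · exact (congrArg (fun φ => φ x) (l₁.trans (U.map_comp _ _))).symm
      · exact (congrArg (fun φ => φ x) (l₂.trans (U.map_comp _ _))).symm
  refine ⟨P, fst, snd, ⟨⟨h₁.symm⟩, ⟨PullbackCone.IsLimit.mk _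
    (fun s => (key s.fst s.snd s.condition).choose)
    (fun s => (key s.fst s.snd s.condition).choose_spec.1.1)
    (fun s => (key s.fst s.snd s.condition).choose_spec.1.2)
    (fun s m hm hm' => (key s.fst s.snd s.condition).choose_spec.2 m ⟨hm, hm'⟩)⟩⟩, hfst, ?_, ?_⟩
  · have : (fun x : U.obj P => (U.map fst x, U.map snd x)) = Subtype.val ∘ e.inv :=
      funext fun x => (hi x).symm
    rw [this]
    exact IsEmbedding.subtypeVal.comp (TopCat.homeoOfIso e.symm).isEmbedding
  · intro d a h
    let x : P₀ := ⟨(d, a), h⟩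
    have e₁ := hi (e.hom x)
    rw [show e.inv (e.hom x) = x by simp] at e₁
    exact ⟨e.hom x, (congrArg Prod.fst e₁).symm, (congrArg Prod.snd e₁).symm⟩

lemma hasPullback {A B D : C} (g : D ⟶ B) (f : A ⟶ B) (hf : et f) : HasPullback g f := by
  obtain ⟨P, fst, snd, h, -⟩ := H.exists_isPullback g f hf
  exact h.hasPullback

lemma isPullback {P A B D : C} {fst : P ⟶ D} {snd : P ⟶ A} {g : D ⟶ B} {f : A ⟶ B}
    (hf : et f) (h : IsPullback fst snd g f) : et fst ∧
      IsEmbedding (fun x : U.obj P => (U.map fst x, U.map snd x)) ∧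
      ∀ d a, U.map g d = U.map f a → ∃ x, U.map fst x = d ∧ U.map snd x = a := by
  obtain ⟨P', fst', snd', h', h₁, h₂, h₃⟩ := H.exists_isPullback g f hf
  let e := h.isoIsPullback _ _ h'
  have e₁ : e.hom ≫ fst' = fst := IsPullback.isoIsPullback_hom_fst _ _ _ _
  have e₂ : e.hom ≫ snd' = snd := IsPullback.isoIsPullback_hom_snd _ _ _ _
  refine ⟨e₁ ▸ H.iso_comp e.hom h₁, ?_, fun d a w => ?_⟩
  · rw [← e₁, ← e₂]
    simpa [Function.comp_def] using h₂.comp (TopCat.homeoOfIso (U.mapIso e)).isEmbedding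
  · obtain ⟨x, rfl, rfl⟩ := h₃ d a w
    refine ⟨U.map e.inv x, ?_, ?_⟩
    · rw [← e₁, ← ConcreteCategory.comp_apply, ← U.map_comp, e.inv_hom_id_assoc]
    · rw [← e₂, ← ConcreteCategory.comp_apply, ← U.map_comp, e.inv_hom_id_assoc]

/-- Open subspaces. -/
lemma exists_restrict {A : C} (V : Opens (U.obj A)) :
    ∃ (A' : C) (i : A' ⟶ A), et i ∧ Function.Injective (U.map i) ∧ Set.range (U.map i) = V := by
  have := H.t2 A
  obtain ⟨A', i, e, hi, he⟩ := H.exists_lift (P := TopCat.of V)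
    (TopCat.ofHom ⟨Subtype.val, continuous_subtype_val⟩)
    V.isOpenEmbedding'.isLocalHomeomorph (inferInstanceAs (T2Space V)) (fun hb => by
      have := H.secondCountable hb A
      exact inferInstanceAs (SecondCountableTopology V))
  have he' : U.map i = e.inv ≫ TopCat.ofHom ⟨Subtype.val, continuous_subtype_val⟩ := by
    rw [← he, e.inv_hom_id_assoc]
  refine ⟨A', i, hi, ?_, ?_⟩
  · rw [he', TopCat.coe_comp]
    exact Subtype.val_injective.comp (TopCat.homeoOfIso e.symm).injective
  · rw [he', TopCat.coe_comp, Set.range_comp, show Set.range e.inv = Set.univ from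
      (TopCat.homeoOfIso e.symm).surjective.range_eq]
    exact Set.image_univ.trans Subtype.range_coe

end IsTopLikeCore

/-- A category of spaces as in `IsTopLikeCore` in which morphisms can be glued. -/
structure IsTopLike {C : Type u} [Category.{v} C] (U : C ⥤ TopCat.{0}) (et : MorphismProperty C)
    (b : Prop) : Prop extends IsTopLikeCore U et b where
  hom_ext : ∀ {M Y : C} {I : Type} {V : I → C} (inc : ∀ i, V i ⟶ M),
    (∀ i, et (inc i) ∧ Function.Injective (U.map (inc i))) →
    (∀ x, ∃ i, x ∈ Set.range (U.map (inc i))) →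
    ∀ (y y' : M ⟶ Y), (∀ i, inc i ≫ y = inc i ≫ y') → y = y'
  glue : ∀ {M Y : C} {I : Type} {V : I → C} (inc : ∀ i, V i ⟶ M),
    (∀ i, et (inc i) ∧ Function.Injective (U.map (inc i))) →
    (∀ x, ∃ i, x ∈ Set.range (U.map (inc i))) →
    ∀ (y : ∀ i, V i ⟶ Y) (h : U.obj M ⟶ U.obj Y), (∀ i, U.map (inc i) ≫ h = U.map (y i)) →
    (∀ i j (L : C) (a : L ⟶ V i) (b : L ⟶ V j), a ≫ inc i = b ≫ inc j → a ≫ y i = b ≫ y j) →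
    ∃ k : M ⟶ Y, ∀ i, inc i ≫ k = y i

end Orbi

namespace Orbi

open TopologicalSpace Topology

namespace IsTopLike

variable {C : Type u} [Category.{0} C] {U : C ⥤ TopCat.{0}} {et : MorphismProperty C}
    {b : Prop} (H : IsTopLike U et b)

/-- A sieve that contains the inclusions of the members of an open cover. -/
def HasOpenCover (U : C ⥤ TopCat.{0}) (et : MorphismProperty C) {M : C} (R : Sieve M) : Prop :=
  ∀ x : U.obj M, ∃ (Y : C) (f : Y ⟶ M), R f ∧ (et f ∧ Function.Injective (U.map f)) ∧
    x ∈ Set.range (U.map f)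

include H

lemma mem_topology_iff {M : C} (R : Sieve M) :
    R ∈ (SpaceCat.ofTop C U et).topology M ↔ HasOpenCover U et R := by
  constructor
  · intro hR
    induction hR with
    | of X R hR =>
      intro x
      obtain ⟨Y, f, hf, hx⟩ := hR.2 x
      exact ⟨Y, f, Sieve.le_generate R _ _ hf, hR.1 f hf, hx⟩
    | top X =>
      intro x
      refine ⟨X, 𝟙 X, trivial, ⟨H.etale_id X, ?_⟩, x, ?_⟩ <;> rw [U.map_id]
      exacts [fun _ _ h => h, rfl]
    | pullback X R hR Y g h =>
      intro y
      obtain ⟨Z, f, hf, ⟨hf', hi⟩, z, hz⟩ := h (U.map g y)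
      obtain ⟨P, fst, snd, hP, h₁, h₂, h₃⟩ := H.exists_isPullback g f hf'
      obtain ⟨p, hp, -⟩ := h₃ y z hz.symm
      refine ⟨P, fst, ?_, ⟨h₁, fun p p' e => h₂.injective (Prod.ext e (hi ?_))⟩, p, hp⟩
      · change R (fst ≫ g)
        rw [hP.w]
        exact R.downward_closed hf _
      · have e' := congrArg (U.map g) e
        simp only [← ConcreteCategory.comp_apply, ← U.map_comp, hP.w] at e'
        simpa using e'
    | transitive X R T hR hT h h' =>
      intro x
      obtain ⟨Y, f, hf, ⟨h₁, h₂⟩, y, rfl⟩ := h x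
      obtain ⟨Z, g, hg, ⟨h₃, h₄⟩, z, rfl⟩ := h' hf y
      refine ⟨Z, g ≫ f, hg, ⟨H.etale_comp h₃ h₁, ?_⟩, z, by simp⟩
      rw [U.map_comp, TopCat.coe_comp]
      exact h₂.comp h₄
  · intro hR
    refine GrothendieckTopology.superset_covering _
      (S := Sieve.generate (fun Y (f : Y ⟶ M) => R f ∧ et f ∧ Function.Injective (U.map f))) ?_ ?_
    · rw [Sieve.generate_le_iff]
      exact fun Y f hf => hf.1
    · refine Precoverage.generate_mem_toGrothendieck ⟨fun Y f hf => hf.2, fun x => ?_⟩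
      obtain ⟨Y, f, hf, hf', hx⟩ := hR x
      exact ⟨Y, f, ⟨hf, hf'⟩, hx⟩

lemma isSheafFor {M : C} (R : Sieve M) (hR : HasOpenCover U et R) (Y : C) :
    Presieve.IsSheafFor (yoneda.obj Y) R.arrows := by
  choose V inc hV hinc hx using hR
  have cov : ∀ x, ∃ i, x ∈ Set.range (U.map (inc i)) := fun x => ⟨x, hx x⟩
  have ext {m m' : M ⟶ Y} (e : ∀ i, inc i ≫ m = inc i ≫ m') : m = m' :=
    H.hom_ext (I := U.obj M) inc hinc cov m m' e
  intro y hy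
  rw [Presieve.compatible_iff_sieveCompatible] at hy
  have hy' {L L' : C} (f : L ⟶ M) (g : L' ⟶ L) (hf : R f) : y (g ≫ f) (R.downward_closed hf g) =
      g ≫ (y f hf : L ⟶ Y) := hy f g hf
  let yi (i : U.obj M) : V i ⟶ Y := y (inc i) (hV i)
  have compat (i j) (L : C) (a : L ⟶ V i) (b : L ⟶ V j) (e : a ≫ inc i = b ≫ inc j) :
      a ≫ yi i = b ≫ yi j := by
    rw [← hy' _ _ (hV i), ← hy' _ _ (hV j)]
    congr 1
  have val {i j} (p : U.obj (V i)) (q : U.obj (V j)) (e : U.map (inc i) p = U.map (inc j) q) :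
      U.map (yi i) p = U.map (yi j) q := by
    obtain ⟨P, fst, snd, hP, -, -, h⟩ := H.exists_isPullback (inc i) (inc j) (hinc j).1
    obtain ⟨r, rfl, rfl⟩ := h p q e
    simp only [← ConcreteCategory.comp_apply, ← U.map_comp, compat i j P fst snd hP.w]
  choose s hs using hx
  let h : U.obj M → U.obj Y := fun x => U.map (yi x) (s x)
  have hh (i) : h ∘ U.map (inc i) = U.map (yi i) := funext fun p => val _ _ (hs _)
  have hc : Continuous h := by
    rw [continuous_iff_continuousAt]
    intro x
    have h₁ := (H.isLocalHomeomorph (hinc x).1).map_nhds_eq (s x)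
    rw [hs] at h₁
    rw [ContinuousAt, ← h₁, Filter.tendsto_map'_iff, hh]
    exact (U.map (yi x)).hom.continuous.continuousAt
  obtain ⟨k, hk⟩ := H.glue inc hinc cov yi (TopCat.ofHom ⟨h, hc⟩)
    (fun i => TopCat.hom_ext (ContinuousMap.ext fun p => congrFun (hh i) p)) compat
  have hk' {L : C} (f : L ⟶ M) (hf : R f) : f ≫ k = y f hf := by
    have hP (i) := H.exists_isPullback f (inc i) (hinc i).1
    choose P fst snd hP h₁ h₂ h₃ using hP
    refine H.hom_ext (I := U.obj M) fst (fun i => ⟨h₁ i, fun p p' e => (h₂ i).injective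
      (Prod.ext e ((hinc i).2 ?_))⟩) (fun x => ?_) _ _ fun i => ?_
    · have e' := congrArg (U.map f) e
      simp only [← ConcreteCategory.comp_apply, ← U.map_comp, (hP i).w] at e'
      simpa using e'
    · obtain ⟨p, hp, -⟩ := h₃ (U.map f x) x (s _) (hs _).symm
      exact ⟨_, p, hp⟩
    · rw [← hy' _ _ hf, (hP i).w_assoc, hk, ← hy' _ _ (hV i)]
      congr 1
      exact (hP i).w.symm
  exact ⟨k, fun L f hf => hk' f hf, fun m hm => ext fun i => (hm _ (hV i)).trans (hk' _ _).symm⟩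

lemma subcanonical : (SpaceCat.ofTop C U et).topology.Subcanonical :=
  GrothendieckTopology.Subcanonical.of_isSheaf_yoneda_obj _ fun Y _ R hR =>
    H.isSheafFor R ((H.mem_topology_iff R).1 hR) Y

/-- Étale surjective morphisms have local sections. -/
lemma hasOpenCover_generate {A B : C} (f : A ⟶ B) (hf : et f)
    (hs : Function.Surjective (U.map f)) :
    HasOpenCover U et (Sieve.generate (Presieve.singleton f)) := by
  intro x
  obtain ⟨a, rfl⟩ := hs x
  obtain ⟨V, hV, hV'⟩ := isLocalHomeomorph_iff_isOpenEmbedding_restrict.1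
    (H.isLocalHomeomorph hf) a
  obtain ⟨V₀, h₁, h₂, h₃⟩ := mem_nhds_iff.1 hV
  obtain ⟨A', i, hi, hi', hr⟩ := H.exists_restrict (A := A) ⟨V₀, h₂⟩
  have hr' : Set.range (U.map i) = V₀ := hr
  obtain ⟨a', rfl⟩ : a ∈ Set.range (U.map i) := hr' ▸ h₃
  refine ⟨A', i ≫ f, ⟨_, i, f, ⟨⟩, rfl⟩, ⟨H.etale_comp hi hf, fun p q e => hi' ?_⟩, a', by simp⟩
  have m (p) : U.map i p ∈ V := h₁ (hr' ▸ Set.mem_range_self p)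
  have := @hV'.injective ⟨_, m p⟩ ⟨_, m q⟩ (by simpa using e)
  exact congrArg Subtype.val this

lemma effectiveEpi {A B : C} (f : A ⟶ B) (hf : et f) (hs : Function.Surjective (U.map f)) :
    EffectiveEpi f := by
  rw [← Sieve.effectiveEpimorphic_singleton]
  exact (Sieve.EffectiveEpimorphic.iff_forall_isSheafFor_yoneda _).2 fun Y => H.isSheafFor _ (H.hasOpenCover_generate f hf hs) Y

lemma properPair {X₀ X₁ Z₀ Z₁ : C} (s t : X₁ ⟶ X₀) (s' t' : Z₁ ⟶ Z₀) (f₀ : Z₀ ⟶ X₀)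
    (f₁ : Z₁ ⟶ X₁) (hf : et f₀) (h₁ : f₁ ≫ s = s' ≫ f₀) (h₂ : f₁ ≫ t = t' ≫ f₀)
    (h : ∀ {M : C} (z z' : M ⟶ Z₀) (x : M ⟶ X₁), x ≫ s = z ≫ f₀ → x ≫ t = z' ≫ f₀ →
      ∃! w : M ⟶ Z₁, w ≫ s' = z ∧ w ≫ t' = z' ∧ w ≫ f₁ = x)
    (hp : IsProperMap (fun x => (U.map s x, U.map t x))) :
    IsProperMap (fun x => (U.map s' x, U.map t' x)) := by
  obtain ⟨P, p₁, p₂, hP, -, he, hr⟩ := H.exists_isPullback s f₀ hf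
  obtain ⟨Q, q₁, q₂, hQ, -, he', hr'⟩ := H.exists_isPullback (p₁ ≫ t) f₀ hf
  obtain ⟨k, ⟨hk₁, hk₂, hk₃⟩, -⟩ := h (q₁ ≫ p₂) q₂ (q₁ ≫ p₁) (by simp [hP.w])
    (by rw [Category.assoc, hQ.w])
  let l : Z₁ ⟶ Q := hQ.lift (hP.lift f₁ s' h₁) t' (by simp [h₂])
  have hkl : k ≫ l = 𝟙 _ := by
    apply hQ.hom_ext
    · apply hP.hom_ext <;> simp [l, hk₁, hk₃]
    · simp [l, hk₂]
  have hlk : l ≫ k = 𝟙 _ :=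
    (h s' t' f₁ h₁ h₂).unique ⟨by simp [l, hk₁], by simp [l, hk₂], by simp [l, hk₃]⟩ (by simp)
  let e : Z₁ ≅ Q := ⟨l, k, hlk, hkl⟩
  have := H.t2 X₀
  have := H.t2 Z₀
  have hl := (TopCat.homeoOfIso (U.mapIso e)).isEmbedding
  have el : ⇑(TopCat.homeoOfIso (U.mapIso e)) = U.map l := rfl
  have e₁ : l ≫ q₁ ≫ p₁ = f₁ := by simp [l]
  have e₂ : l ≫ q₁ ≫ p₂ = s' := by simp [l]
  have e₃ : l ≫ q₂ = t' := by simp [l]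
  have emb : IsEmbedding (fun z => (U.map f₁ z, U.map s' z, U.map t' z)) := by
    have := (Homeomorph.prodAssoc (U.obj X₁) (U.obj Z₀) (U.obj Z₀)).isEmbedding.comp
      ((he.prodMap IsEmbedding.id).comp (he'.comp hl))
    rw [el] at this
    convert this using 1
    funext z
    simp [← e₁, ← e₂, ← e₃]
    rfl
  refine isProperMap_of_cartesian (f := U.map f₁) (g := fun x => (U.map s' x, U.map t' x))
    (ψ := fun z => (U.map f₀ z.1, U.map f₀ z.2)) hp (by fun_prop) (by fun_prop) (fun d => ?_)
    ⟨emb, ?_⟩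
  · simp only [← ConcreteCategory.comp_apply, ← U.map_comp, h₁, h₂]
  · have : Set.range (fun z => (U.map f₁ z, U.map s' z, U.map t' z)) =
        {p | U.map s p.1 = U.map f₀ p.2.1} ∩ {p | U.map t p.1 = U.map f₀ p.2.2} := by
      ext ⟨x, z, z'⟩
      constructor
      · rintro ⟨w, hw⟩
        simp only [Prod.mk.injEq] at hw
        obtain ⟨rfl, rfl, rfl⟩ := hw
        constructor <;>
        simp only [Set.mem_ofPred_eq, ← ConcreteCategory.comp_apply, ← U.map_comp, h₁, h₂]
      · rintro ⟨ha, hb⟩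
        obtain ⟨p, rfl, rfl⟩ := hr x z ha
        obtain ⟨q, rfl, rfl⟩ := hr' p z' (by simpa using hb)
        refine ⟨U.map k q, ?_⟩
        simp only [← ConcreteCategory.comp_apply, ← U.map_comp, hk₁, hk₂, hk₃]
    rw [this]
    exact (isClosed_eq (by fun_prop) (by fun_prop)).inter (isClosed_eq (by fun_prop) (by fun_prop))

lemma surjective_id (A : C) : Function.Surjective (U.map (𝟙 A)) := by
  rw [U.map_id]
  exact Function.surjective_id

lemma surjective_comp {A B D : C} {f : A ⟶ B} {g : B ⟶ D} (hf : Function.Surjective (U.map f))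
    (hg : Function.Surjective (U.map g)) : Function.Surjective (U.map (f ≫ g)) := by
  rw [U.map_comp, TopCat.coe_comp]
  exact hg.comp hf

lemma isGeometric : (SpaceCat.ofTop C U et).IsGeometric where
  etale_mul :=
    { id_mem := H.etale_id
      comp_mem := fun _ _ => H.etale_comp }
  etale_baseChange := ⟨fun {_ _ _ _ _ _ _ _} h hg => (H.isPullback hg h.flip).1⟩
  etaleSurj_mul :=
    { id_mem := fun A => ⟨H.etale_id A, H.surjective_id A⟩
      comp_mem := fun f g hf hg => ⟨H.etale_comp hf.1 hg.1, H.surjective_comp hf.2 hg.2⟩ }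
  etaleSurj_baseChange := ⟨fun {_ _ _ _ _ _ _ _} h hg => by
    obtain ⟨h₁, -, h₂⟩ := H.isPullback hg.1 h.flip
    refine ⟨h₁, fun d => ?_⟩
    obtain ⟨a, ha⟩ := hg.2 (U.map _ d)
    obtain ⟨x, hx, -⟩ := h₂ d a ha.symm
    exact ⟨x, hx⟩⟩
  hasPullback f g hg := H.hasPullback f g hg
  effectiveEpi f hf hs := H.effectiveEpi f hf hs
  properPair s t s' t' f₀ f₁ _ _ hf h₁ h₂ h hp := H.properPair s t s' t' f₀ f₁ hf h₁ h₂ h hp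

lemma etale_of_comp {A B D : C} {f : A ⟶ B} {g : B ⟶ D} (hg : et g) (hfg : et (f ≫ g))
    (hf : IsLocalHomeomorph (U.map f)) : et f := by
  refine H.etale_of_cartesian hf fun {L} l h hl => ?_
  have e : (h ≫ U.map f) ≫ U.map g = U.map (l ≫ g) := by rw [hl, U.map_comp]
  obtain ⟨k, ⟨hk, hk'⟩, hu⟩ := H.cartesian hfg (l ≫ g) h (by rw [← e, U.map_comp, Category.assoc])
  refine ⟨k, ⟨(H.cartesian hg (l ≫ g) (U.map l) (U.map_comp _ _).symm).unique
    ⟨by rw [Category.assoc, hk], by rw [U.map_comp, hk', hl]⟩ ⟨rfl, rfl⟩, hk'⟩, ?_⟩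
  rintro k' ⟨h₁, h₂⟩
  exact hu k' ⟨by rw [← h₁, Category.assoc], h₂⟩

lemma mono {A B : C} {f : A ⟶ B} (hf : et f) (hi : Function.Injective (U.map f)) : Mono f where
  right_cancellation g h e := (H.cartesian hf (g ≫ f) (U.map g) (U.map_comp _ _).symm).unique
    ⟨rfl, rfl⟩ ⟨e.symm, TopCat.hom_ext (ContinuousMap.ext fun x => hi (by
      simp only [← ConcreteCategory.comp_apply, ← U.map_comp, e]))⟩

lemma exists_disjoint_cover {M : C} {R : Sieve M} (hR : HasOpenCover U et R) :
    ∃ (N : C) (q : N ⟶ M) (I : Type) (V : I → C) (inc : ∀ i, V i ⟶ N),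
      et q ∧ Function.Surjective (U.map q) ∧
      (∀ i, et (inc i) ∧ Function.Injective (U.map (inc i))) ∧
      (∀ x, ∃ i, x ∈ Set.range (U.map (inc i))) ∧ (∀ i, R (inc i ≫ q)) ∧
      ∀ {i j : I}, i ≠ j → ∀ x y, U.map (inc i) x ≠ U.map (inc j) y := by
  choose V f hf hf' hx using hR
  have ho (x) : IsOpenEmbedding (U.map (f x)) :=
    (H.isLocalHomeomorph (hf' x).1).isOpenEmbedding_of_injective (hf' x).2
  obtain ⟨I, hI, hI'⟩ : ∃ I : Set (U.obj M), (b → Countable I) ∧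
      ∀ x, ∃ i ∈ I, x ∈ Set.range (U.map (f i)) := by
    by_cases hb : b
    · have := H.secondCountable hb M
      obtain ⟨I, hI, hI'⟩ := TopologicalSpace.countable_cover_nhds
        fun x => (ho x).isOpen_range.mem_nhds (hx x)
      exact ⟨I, fun _ => hI.to_subtype, fun x => by simpa using hI'.ge (Set.mem_univ x)⟩
    · exact ⟨Set.univ, fun h => (hb h).elim, fun x => ⟨x, trivial, hx x⟩⟩
  have := fun x => H.t2 (V x)
  let P : TopCat := TopCat.of (Σ i : I, U.obj (V i))
  have hι (i : I) := continuous_sigmaMk (σ := fun i : I => U.obj (V i)) (i := i)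
  let ι (i : I) : U.obj (V i) ⟶ P := TopCat.ofHom ⟨_, hι i⟩
  let p : P ⟶ U.obj M := TopCat.ofHom ⟨fun x => U.map (f x.1) x.2,
    continuous_sigma fun i => (U.map (f i)).hom.continuous⟩
  have hp : IsLocalHomeomorph p := by
    rw [isLocalHomeomorph_iff_isOpenEmbedding_restrict]
    rintro ⟨i, x⟩
    refine ⟨Set.range (Sigma.mk i), isOpen_range_sigmaMk.mem_nhds ⟨x, rfl⟩, ?_⟩
    have h : IsOpenEmbedding (fun y : U.obj (V i) => p (ι i y)) := ho i
    refine IsOpenEmbedding.of_continuous_injective_isOpenMap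
      (p.hom.continuous.comp continuous_subtype_val) ?_ ?_
    · rintro ⟨_, x, rfl⟩ ⟨_, y, rfl⟩ e
      exact Subtype.ext (congrArg (Sigma.mk i) (h.injective e))
    · rintro W hW
      have : (Set.range (Sigma.mk i)).domRestrict p '' W = (fun y => p (ι i y)) ''
          ((fun y => (⟨Sigma.mk i y, y, rfl⟩ : Set.range (Sigma.mk i))) ⁻¹' W) := by
        ext z
        constructor
        · rintro ⟨⟨_, y, rfl⟩, hy, rfl⟩
          exact ⟨y, hy, rfl⟩
        · rintro ⟨y, hy, rfl⟩
          exact ⟨⟨_, y, rfl⟩, hy, rfl⟩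
      rw [this]
      exact h.isOpenMap _ (hW.preimage (by fun_prop))
  obtain ⟨N, q, e, hq, he⟩ := H.exists_lift p hp
    (inferInstanceAs (T2Space (Σ i : I, U.obj (V i)))) (fun hb => by
      have := hI hb
      have := fun x => H.secondCountable hb (V x)
      exact inferInstanceAs (SecondCountableTopology (Σ i : I, U.obj (V i))))
  have hc (i : I) := (H.cartesian hq (f i) (ι i ≫ e.hom) (by rw [Category.assoc, he]; rfl)).exists
  choose inc hinc hinc' using hc
  have hval (i x) : U.map (inc i) x = e.hom ⟨i, x⟩ := by
    rw [hinc']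
    rfl
  refine ⟨N, q, I, fun i => V i, inc, hq, fun x => ?_, fun i => ?_, fun x => ?_,
    fun i => by rw [hinc]; exact hf i, fun {i j} hij x y => ?_⟩
  · obtain ⟨i, hi, y, rfl⟩ := hI' x
    refine ⟨U.map (inc ⟨i, hi⟩) y, ?_⟩
    simp only [← ConcreteCategory.comp_apply, ← U.map_comp, hinc]
  · refine ⟨H.etale_of_comp hq (by rw [hinc]; exact (hf' i).1) ?_, fun x y h => ?_⟩
    · rw [hinc', TopCat.coe_comp]
      exact (TopCat.homeoOfIso e).isLocalHomeomorph.comp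
        (IsOpenEmbedding.sigmaMk (i := i)).isLocalHomeomorph
    · rw [hval, hval] at h
      exact sigma_mk_injective (β := fun i : I => U.obj (V i)) ((TopCat.homeoOfIso e).injective h)
  · obtain ⟨⟨i, y⟩, rfl⟩ := (TopCat.homeoOfIso e).surjective x
    exact ⟨i, y, hval _ _⟩
  · rw [hval, hval]
    exact fun h => hij (congrArg Sigma.fst ((TopCat.homeoOfIso e).injective h))

lemma isGoodSite : IsGoodSite (SpaceCat.ofTop C U et) where
  subcanonical := H.subcanonical
  generate_mem f hf hs := (H.mem_topology_iff _).2 (H.hasOpenCover_generate f hf hs)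
  exists_disjoint_cover {M} R hR := by
    obtain ⟨N, q, I, V, inc, h₁, h₂, h₃, h₄, h₅, h₆⟩ :=
      H.exists_disjoint_cover ((H.mem_topology_iff R).1 hR)
    refine ⟨N, q, I, V, inc, h₁, h₂, fun i => H.mono (h₃ i).1 (h₃ i).2,
      (H.mem_topology_iff _).2 fun x => ?_, h₅, fun {i j} hij L a b e =>
      (H.mem_topology_iff _).2 fun x => (h₆ hij (U.map a x) (U.map b x) ?_).elim⟩
    · obtain ⟨i, hi⟩ := h₄ x
      exact ⟨V i, inc i, (Sieve.mem_ofArrows_iff _ _ _).2 ⟨i, 𝟙 _, (Category.id_comp _).symm⟩,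
        h₃ i, hi⟩
    · have := congrArg (fun φ => U.map φ x) e
      exact (congrArg (fun φ => φ x) (U.map_comp a (inc i))).symm.trans
        (this.trans (congrArg (fun φ => φ x) (U.map_comp b (inc j))))

end IsTopLike

end Orbi

namespace Orbi

open TopologicalSpace Topology

/-- Hausdorff topological spaces. -/
lemma isTopLike_topSpaces : IsTopLike
    (ObjectProperty.ι fun X : TopCat.{0} => T2Space X)
    (fun _ _ f => IsLocalHomeomorph f.hom) False where
  t2 A := A.property
  secondCountable h := h.elim
  isLocalHomeomorph h := h
  cartesian {A B L f} hf g h e := by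
    refine ⟨ObjectProperty.homMk h, ⟨ObjectProperty.hom_ext _ e, rfl⟩, ?_⟩
    rintro k ⟨-, rfl⟩
    rfl
  iso_comp {A A' B} e _ f hf := by
    have := (TopCat.homeoOfIso ((ObjectProperty.ι _).mapIso (asIso e))).isLocalHomeomorph
    exact hf.comp this
  exists_lift {A P} p hp hP _ := ⟨⟨P, hP⟩, ObjectProperty.homMk p, Iso.refl _, hp, rfl⟩
  hom_ext {M Y I V} inc _ hc y y' h := by
    refine ObjectProperty.hom_ext _ (TopCat.hom_ext (ContinuousMap.ext fun x => ?_))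
    obtain ⟨i, z, rfl⟩ := hc x
    exact congrArg (fun φ => φ.hom z) (h i)
  glue {M Y I V} inc _ _ y h hh _ :=
    ⟨ObjectProperty.homMk h, fun i => ObjectProperty.hom_ext _ (hh i)⟩

end Orbi

namespace Orbi

open TopologicalSpace Topology Manifold

section Pullback

variable {H α β : Type*} [TopologicalSpace H] [TopologicalSpace α] [TopologicalSpace β]

/-- The charts of a space that is locally homeomorphic to a charted space. -/
@[reducible] noncomputable def chartedSpaceOfLocalHomeomorph [ChartedSpace H β] (p : α → β)
    (hp : IsLocalHomeomorph p) : ChartedSpace H α where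
  atlas := {e | ∃ (φ : OpenPartialHomeomorph α β) (c : OpenPartialHomeomorph β H),
    c ∈ atlas H β ∧ φ = p ∧ e = φ.trans c}
  chartAt x := (hp x).choose.trans (chartAt H (p x))
  mem_chart_source x := by
    have h := (hp x).choose_spec
    refine ⟨h.1, ?_⟩
    change (hp x).choose x ∈ (chartAt H (p x)).source
    rw [← h.2]
    exact mem_chart_source H (p x)
  chart_mem_atlas x := ⟨_, _, chart_mem_atlas H (p x), (hp x).choose_spec.2.symm, rfl⟩

lemma hasGroupoid_of_isLocalHomeomorph [ChartedSpace H β] (G : StructureGroupoid H)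
    [ClosedUnderRestriction G] [HasGroupoid β G] (p : α → β) (hp : IsLocalHomeomorph p) :
    letI := chartedSpaceOfLocalHomeomorph (H := H) p hp
    HasGroupoid α G := by
  let _ := chartedSpaceOfLocalHomeomorph (H := H) p hp
  constructor
  rintro _ _ ⟨φ, c, hc, hφ, rfl⟩ ⟨φ', c', hc', hφ', rfl⟩
  have key : ∀ y ∈ ((φ.trans c).symm.trans (φ'.trans c')).source, φ' (φ.symm (c.symm y)) = c.symm y := by
    intro y hy
    rw [hφ', ← hφ]
    simp only [OpenPartialHomeomorph.trans_source, OpenPartialHomeomorph.symm_source,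
      OpenPartialHomeomorph.trans_target, Set.mem_inter_iff, Set.mem_preimage] at hy
    exact φ.right_inv hy.1.2
  have ho := ((φ.trans c).symm.trans (φ'.trans c')).open_source
  refine G.mem_of_eqOnSource (closedUnderRestriction' (G.compatible hc hc') ho) ⟨?_, ?_⟩
  · ext y
    rw [OpenPartialHomeomorph.restr_source, ho.interior_eq]
    refine ⟨fun hy => ⟨?_, hy⟩, fun hy => hy.2⟩
    have hk := key y hy
    simp only [OpenPartialHomeomorph.trans_source, OpenPartialHomeomorph.symm_source,
      OpenPartialHomeomorph.trans_target, Set.mem_inter_iff, Set.mem_preimage] at hy ⊢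
    refine ⟨hy.1.1, ?_⟩
    rw [← hk]
    exact hy.2.2
  · intro y hy
    exact congrArg c' (key y hy)

variable {𝕜 E : Type*} [NontriviallyNormedField 𝕜] [NormedAddCommGroup E] [NormedSpace 𝕜 E]
  (I : ModelWithCorners 𝕜 E H) (n : WithTop ℕ∞)

lemma isManifold_of_isLocalHomeomorph [ChartedSpace H β] [IsManifold I n β] (p : α → β)
    (hp : IsLocalHomeomorph p) :
    letI := chartedSpaceOfLocalHomeomorph (H := H) p hp
    IsManifold I n α := by
  let _ := chartedSpaceOfLocalHomeomorph (H := H) p hp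
  have := hasGroupoid_of_isLocalHomeomorph (contDiffGroupoid n I) p hp
  exact IsManifold.mk' I n α

lemma isLocalDiffeomorph_of_isLocalHomeomorph [ChartedSpace H β] [IsManifold I n β] (p : α → β)
    (hp : IsLocalHomeomorph p) :
    letI := chartedSpaceOfLocalHomeomorph (H := H) p hp
    IsLocalDiffeomorph I I n p := by
  let _ := chartedSpaceOfLocalHomeomorph (H := H) p hp
  have := isManifold_of_isLocalHomeomorph I n p hp
  intro x
  let e := chartAt H x
  let c := chartAt H (p x)
  have he : e ∈ IsManifold.maximalAtlas I n α := IsManifold.chart_mem_maximalAtlas x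
  have hc : c ∈ IsManifold.maximalAtlas I n β := IsManifold.chart_mem_maximalAtlas (p x)
  refine ⟨{ __ := (e.trans c.symm).toPartialEquiv
            open_source := (e.trans c.symm).open_source
            open_target := (e.trans c.symm).open_target
            contMDiffOn_toFun := (contMDiffOn_symm_of_mem_maximalAtlas hc).comp
              ((contMDiffOn_of_mem_maximalAtlas he).mono Set.inter_subset_left)
              Set.inter_subset_right
            contMDiffOn_invFun := (contMDiffOn_symm_of_mem_maximalAtlas he).comp
              ((contMDiffOn_of_mem_maximalAtlas hc).mono (by
                rw [OpenPartialHomeomorph.trans_target]; exact Set.inter_subset_left))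
              (by
                rw [OpenPartialHomeomorph.trans_target]; exact Set.inter_subset_right)
              }, ?_, fun y hy => ?_⟩
  · exact ⟨mem_chart_source H x, e.map_source (mem_chart_source H x) |>.1⟩
  · have h : (hp x).choose y ∈ c.source := hy.1.2
    refine Eq.trans ?_ (c.left_inv h).symm
    exact congrFun (hp x).choose_spec.2 y

end Pullback

namespace Mfd

variable {𝕜 : Type} [RCLike 𝕜] {n : WithTop ℕ∞}

lemma isLocalDiffeomorph_of_isIso {A B : Mfd 𝕜 n} (e : A ⟶ B) [IsIso e] : localDiffeo e := by
  have h₁ (x) : (inv e).toFun (e.toFun x) = x :=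
    congrArg (fun φ => φ.toFun x) (IsIso.hom_inv_id e)
  have h₂ (x) : e.toFun ((inv e).toFun x) = x :=
    congrArg (fun φ => φ.toFun x) (IsIso.inv_hom_id e)
  exact Diffeomorph.isLocalDiffeomorph (n := n)
    ⟨⟨e.toFun, (inv e).toFun, h₁, h₂⟩, e.contMDiff, (inv e).contMDiff⟩

lemma exists_lift {A : Mfd 𝕜 n} {P : Type} [TopologicalSpace P] [T2Space P]
    [SecondCountableTopology P] (p : P → A.carrier)
    (hp : IsLocalHomeomorph p) : ∃ (A' : Mfd 𝕜 n) (f : A' ⟶ A) (e : P ≃ₜ A'.carrier),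
      localDiffeo f ∧ ∀ x, f.toFun (e x) = p x := by
  let _ := chartedSpaceOfLocalHomeomorph (H := EuclideanSpace 𝕜 (Fin A.dim)) p hp
  have := isManifold_of_isLocalHomeomorph 𝓘(𝕜, EuclideanSpace 𝕜 (Fin A.dim)) n p hp
  have hd := isLocalDiffeomorph_of_isLocalHomeomorph 𝓘(𝕜, EuclideanSpace 𝕜 (Fin A.dim)) n p hp
  let A' : Mfd 𝕜 n := ⟨P, A.dim⟩
  exact ⟨A', ⟨p, hd.contMDiff⟩, Homeomorph.refl P, hd, fun _ => rfl⟩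

lemma isTopLike : IsTopLike (forgetToTop (𝕜 := 𝕜) (n := n)) localDiffeo True where
  t2 A := A.t2Space
  secondCountable _ A := A.secondCountable
  isLocalHomeomorph h := h.isLocalHomeomorph
  cartesian {A B L f} hf g h e := by
    have e' (x : L.carrier) : f.toFun (h x) = g.toFun x := congrArg (fun φ => φ x) e
    refine ⟨⟨h, fun x => ?_⟩, ⟨Hom.ext (funext e'), rfl⟩, ?_⟩
    · have H := hf (h x)
      have h₁ := H.localInverse_contMDiffAt
      rw [e'] at h₁
      refine (h₁.comp x g.contMDiff.contMDiffAt).congr_of_eventuallyEq ?_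
      have := h.hom.continuous.continuousAt (x := x) H.localInverse_eventuallyEq_left
      filter_upwards [this] with y hy
      rw [Function.comp_apply, ← e']
      exact hy.symm
    · rintro k ⟨-, rfl⟩
      rfl
  iso_comp {A A' B} e _ f hf := fun x =>
    (isLocalDiffeomorph_of_isIso e x).comp 𝓘(𝕜, EuclideanSpace 𝕜 (Fin B.dim)) B.carrier (hf _)
  exists_lift {A P} p hp hP hP' := by
    have := hP' trivial
    obtain ⟨A', f, e, h, he⟩ := exists_lift (A := A) (P := P) p hp
    exact ⟨A', f, TopCat.isoOfHomeo e, h, TopCat.hom_ext (ContinuousMap.ext he)⟩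
  hom_ext {M Y I V} inc _ hc y y' h := by
    refine Hom.ext (funext fun x => ?_)
    obtain ⟨i, z, rfl⟩ := hc x
    exact congrArg (fun φ => φ.toFun z) (h i)
  glue {M Y I V} inc hi hc y h hh _ := by
    have hh' (i z) : h ((inc i).toFun z) = (y i).toFun z := congrArg (fun φ => φ z) (hh i)
    refine ⟨⟨h, fun x => ?_⟩, fun i => Hom.ext (funext (hh' i))⟩
    obtain ⟨i, z, rfl⟩ := hc x
    have H := (hi i).1 z
    refine ((y i).contMDiff.contMDiffAt.comp _ H.localInverse_contMDiffAt).congr_of_eventuallyEq ?_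
    filter_upwards [H.localInverse_eventuallyEq_right] with w hw
    rw [Function.comp_apply, ← hh']
    exact congrArg h hw.symm

end Mfd

end Orbi

namespace Orbi

open TopologicalSpace Topology Opposite AlgebraicGeometry TopCat

section Germs

variable {X : TopCat.{u}} (F : TopCat.Sheaf CommRingCat.{u} X)

lemma exists_section_of_germs (U : Opens X) (g : ∀ x ∈ U, F.presheaf.stalk x)
    (hg : ∀ x ∈ U, ∃ (W : Opens X) (_ : x ∈ W) (t : F.presheaf.obj (op W)),
      ∀ y (hy : y ∈ W) (hy' : y ∈ U), F.presheaf.germ W y hy t = g y hy') :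
    ∃ s : F.presheaf.obj (op U), ∀ x (hx : x ∈ U), F.presheaf.germ U x hx s = g x hx := by
  choose W hW t ht using hg
  obtain ⟨s, hs, -⟩ := F.existsUnique_gluing' (fun x : U => W x.1 x.2 ⊓ U) U
    (fun x => homOfLE inf_le_right) (fun x hx => Opens.mem_iSup.2 ⟨⟨x, hx⟩, hW x hx, hx⟩)
    (fun x => F.presheaf.map (homOfLE inf_le_left).op (t x.1 x.2)) (fun x y => by
      refine TopCat.Presheaf.section_ext F _ _ _ fun z hz => ?_
      rw [F.presheaf.germ_res_apply, F.presheaf.germ_res_apply, F.presheaf.germ_res_apply,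
        F.presheaf.germ_res_apply, ht _ _ _ _ hz.1.2, ht _ _ _ _ hz.1.2])
  refine ⟨s, fun x hx => ?_⟩
  have hx' : x ∈ W x hx ⊓ U := ⟨hW x hx, hx⟩
  exact (F.presheaf.germ_res_apply (homOfLE inf_le_right) x hx' s).symm.trans <|
    (congrArg (F.presheaf.germ (W x hx ⊓ U) x hx') (hs ⟨x, hx⟩)).trans <|
    (F.presheaf.germ_res_apply _ x hx' _).trans (ht _ _ _ _ hx)

end Germs

namespace LRS

variable {X Y Z : LocallyRingedSpace.{u}}

lemma section_ext {U : Opens X.toTopCat} (s t : X.presheaf.obj (op U))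
    (h : ∀ x (hx : x ∈ U), X.presheaf.germ U x hx s = X.presheaf.germ U x hx t) : s = t :=
  TopCat.Presheaf.section_ext X.𝒪 U s t h

lemma hom_ext {f g : X ⟶ Y} (h : ∀ x, f.base x = g.base x)
    (h' : ∀ (V : Opens Y.toTopCat) (s : Y.presheaf.obj (op V)) (x) (hx : f.base x ∈ V)
      (hx' : g.base x ∈ V), X.presheaf.germ ((Opens.map f.base).obj V) x hx (f.c.app (op V) s) =
        X.presheaf.germ ((Opens.map g.base).obj V) x hx' (g.c.app (op V) s)) : f = g := by
  obtain ⟨⟨fb, fc⟩, fp⟩ := f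
  obtain ⟨⟨gb, gc⟩, gp⟩ := g
  obtain rfl : fb = gb := TopCat.hom_ext (ContinuousMap.ext h)
  obtain rfl : fc = gc := by
    refine NatTrans.ext (funext fun V => CommRingCat.hom_ext (RingHom.ext fun s => ?_))
    exact section_ext (U := (Opens.map fb).obj V.unop) _ _ fun x hx => h' V.unop s x hx hx
  rfl

lemma germ_congr {f g : X ⟶ Y} (e : f = g) (V : Opens Y.toTopCat) (s : Y.presheaf.obj (op V)) (x)
    (hx : f.base x ∈ V) (hx' : g.base x ∈ V) :
    X.presheaf.germ ((Opens.map f.base).obj V) x hx (f.c.app (op V) s) =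
        X.presheaf.germ ((Opens.map g.base).obj V) x hx' (g.c.app (op V) s) := by
  subst e
  rfl

/-- Construction of a morphism of locally ringed spaces from its action on stalks. -/
theorem exists_hom (h : X.toTopCat ⟶ Y.toTopCat)
    (φ : ∀ x, Y.presheaf.stalk (h x) →+* X.presheaf.stalk x) (hφ : ∀ x, IsLocalHom (φ x))
    (hc : ∀ (V : Opens Y.toTopCat) (s : Y.presheaf.obj (op V)) (x) (_ : h x ∈ V),
      ∃ (W : Opens X.toTopCat) (_ : x ∈ W) (t : X.presheaf.obj (op W)),
        ∀ y (hy : y ∈ W) (hy' : h y ∈ V),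
          X.presheaf.germ W y hy t = φ y (Y.presheaf.germ V (h y) hy' s)) :
    ∃ k : X ⟶ Y, k.base = h ∧ ∀ (V : Opens Y.toTopCat) (s : Y.presheaf.obj (op V)) (x)
      (hx : h x ∈ V) (hx' : k.base x ∈ V),
      X.presheaf.germ ((Opens.map k.base).obj V) x hx' (k.c.app (op V) s) =
        φ x (Y.presheaf.germ V (h x) hx s) := by
  have key (V : Opens Y.toTopCat) (s : Y.presheaf.obj (op V)) :
      ∃ t : X.presheaf.obj (op ((Opens.map h).obj V)), ∀ x (hx : h x ∈ V),
        X.presheaf.germ ((Opens.map h).obj V) x hx t = φ x (Y.presheaf.germ V (h x) hx s) :=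
    exists_section_of_germs X.𝒪 ((Opens.map h).obj V) _ (hc V s)
  choose r hr using key
  let ρ (V : Opens Y.toTopCat) :
      Y.presheaf.obj (op V) →+* X.presheaf.obj (op ((Opens.map h).obj V)) :=
    { toFun := r V
      map_one' := section_ext _ _ fun x hx => by rw [hr V _ x hx, map_one, map_one, map_one]
      map_zero' := section_ext _ _ fun x hx => by rw [hr V _ x hx, map_zero, map_zero, map_zero]
      map_mul' := fun a b => section_ext _ _ fun x hx => by
        rw [hr V _ x hx, map_mul, map_mul, map_mul, hr V _ x hx, hr V _ x hx]
      map_add' := fun a b => section_ext _ _ fun x hx => by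
        rw [hr V _ x hx, map_add, map_add, map_add, hr V _ x hx, hr V _ x hx] }
  let k₀ : X.toPresheafedSpace.Hom Y.toPresheafedSpace :=
    { base := h
      c :=
        { app := fun V => CommRingCat.ofHom (ρ V.unop)
          naturality := fun V V' i => CommRingCat.hom_ext (RingHom.ext fun s =>
            section_ext (U := (Opens.map h).obj V'.unop) _ _ fun x hx =>
              ((hr _ _ x hx).trans (congrArg (φ x) (Y.presheaf.germ_res_apply' i (h x) hx s))).trans
              ((X.presheaf.germ_res_apply' ((Opens.map h).op.map i) x hx _).trans
                (hr _ _ x (i.unop.le hx))).symm) } }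
  have hk (x) : (k₀.stalkMap x).hom = φ x := by
    have : k₀.stalkMap x = CommRingCat.ofHom (φ x) := by
      refine TopCat.Presheaf.stalk_hom_ext _ fun U hU => ?_
      refine (PresheafedSpace.stalkMap_germ k₀ U x hU).trans ?_
      exact CommRingCat.hom_ext (RingHom.ext fun s => hr U s x hU)
    rw [this]
    rfl
  exact ⟨⟨k₀, fun x => by rw [hk]; exact hφ x⟩, rfl, fun V s x hx _ => hr V s x hx⟩

end LRS

end Orbi

namespace Orbi

open TopologicalSpace Topology Opposite AlgebraicGeometry TopCat

namespace LRS

variable {X Y Z L : LocallyRingedSpace.{u}}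

lemma germ_app_of_germ_eq (k : X ⟶ Y) {x : X.toTopCat} {V V' : Opens Y.toTopCat}
    {s : Y.presheaf.obj (op V)} {s' : Y.presheaf.obj (op V')} (hV : k.base x ∈ V)
    (hV' : k.base x ∈ V') (h : Y.presheaf.germ V (k.base x) hV s =
      Y.presheaf.germ V' (k.base x) hV' s') :
    X.presheaf.germ ((Opens.map k.base).obj V) x hV (k.c.app (op V) s) =
      X.presheaf.germ ((Opens.map k.base).obj V') x hV' (k.c.app (op V') s') := by
  rw [← LocallyRingedSpace.stalkMap_germ_apply, ← LocallyRingedSpace.stalkMap_germ_apply, h]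

lemma exists_stalkMap (g : X ⟶ Y) {x : X.toTopCat} {y : Y.toTopCat} (e : g.base x = y) :
    ∃ φ : Y.presheaf.stalk y →+* X.presheaf.stalk x, IsLocalHom φ ∧
      ∀ (V : Opens Y.toTopCat) (s : Y.presheaf.obj (op V)) (hy : y ∈ V) (hx : g.base x ∈ V),
        φ (Y.presheaf.germ V y hy s) =
          X.presheaf.germ ((Opens.map g.base).obj V) x hx (g.c.app (op V) s) := by
  subst e
  exact ⟨(g.stalkMap x).hom, inferInstance, fun V s hy _ =>
    LocallyRingedSpace.stalkMap_germ_apply g V x hy s⟩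

/-- If `f` is surjective on stalks, sections of the source are locally pulled back from the
target. -/
lemma exists_local_pullback (f : X ⟶ Y) (hf : ∀ x, Function.Surjective (f.stalkMap x).hom)
    {V : Opens X.toTopCat} (s : X.presheaf.obj (op V)) {z : X.toTopCat} (hz : z ∈ V) :
    ∃ (N : Opens Y.toTopCat) (r : Y.presheaf.obj (op N)) (W : Opens X.toTopCat), z ∈ W ∧
      ∀ y ∈ W, ∃ (hy : y ∈ V) (hy' : f.base y ∈ N), X.presheaf.germ V y hy s =
        X.presheaf.germ ((Opens.map f.base).obj N) y hy' (f.c.app (op N) r) := by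
  obtain ⟨r', hr'⟩ := hf z (X.presheaf.germ V z hz s)
  obtain ⟨N, hN, r, rfl⟩ := Y.presheaf.exists_germ_eq r'
  have h := (LocallyRingedSpace.stalkMap_germ_apply f N z hN r).symm.trans hr'
  obtain ⟨W, hW, i₁, i₂, e⟩ := X.presheaf.germ_eq z _ _ _ _ h
  refine ⟨N, r, W, hW, fun y hy => ⟨i₂.le hy, i₁.le hy, ?_⟩⟩
  exact (X.presheaf.germ_res_apply i₂ y hy s).symm.trans <|
    (congrArg (X.presheaf.germ W y hy) e.symm).trans (X.presheaf.germ_res_apply i₁ y hy _)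

/-- Morphisms that are bijective on stalks are cartesian over their underlying continuous map. -/
theorem exists_unique_lift (f : X ⟶ Y) (hf : ∀ x, Function.Bijective (f.stalkMap x).hom)
    (g : L ⟶ Y) (h : L.toTopCat ⟶ X.toTopCat) (e : h ≫ f.base = g.base) :
    ∃! k : L ⟶ X, k ≫ f = g ∧ k.base = h := by
  have e' (x) : g.base x = f.base (h x) := (congrArg (fun φ => φ x) e).symm
  have hψ (x) := exists_stalkMap g (e' x)
  choose ψ hψ hψ' using hψ
  let E (x) := RingEquiv.ofBijective (f.stalkMap (h x)).hom (hf (h x))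
  have hE (x) (N : Opens Y.toTopCat) (r : Y.presheaf.obj (op N)) (hN : f.base (h x) ∈ N) :
      (E x).symm (X.presheaf.germ ((Opens.map f.base).obj N) (h x) hN (f.c.app (op N) r)) =
        Y.presheaf.germ N (f.base (h x)) hN r := by
    rw [RingEquiv.symm_apply_eq]
    exact (LocallyRingedSpace.stalkMap_germ_apply f N (h x) hN r).symm
  obtain ⟨k, hk, hk'⟩ := exists_hom h (fun x => (ψ x).comp ((E x).symm : _ →+* _))
    (fun x => RingHom.isLocalHom_comp _ _) (fun V s x hx => by
      obtain ⟨N, r, W, hW, H⟩ := exists_local_pullback f (fun x => (hf x).2) s hx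
      refine ⟨(Opens.map h).obj W ⊓ (Opens.map g.base).obj N, ⟨hW, ?_⟩,
        L.presheaf.map (homOfLE inf_le_right).op (g.c.app (op N) r), fun y hy hy' => ?_⟩
      · obtain ⟨-, h₁, -⟩ := H _ hW
        change g.base x ∈ N
        rw [e']
        exact h₁
      · obtain ⟨h₀, h₁, h₂⟩ := H _ hy.1
        refine (L.presheaf.germ_res_apply _ y hy _).trans ?_
        refine (hψ' y N r h₁ hy.2).symm.trans (congrArg (ψ y) ?_)
        exact (hE y N r h₁).symm.trans (congrArg (E y).symm h₂.symm))
  have hkf : k ≫ f = g := by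
    refine hom_ext (fun x => by rw [LocallyRingedSpace.comp_base, hk, e]) fun N r x hx hx' => ?_
    have hx₁ : f.base (h x) ∈ N := by rw [← e']; exact hx'
    refine (hk' ((Opens.map f.base).obj N) (f.c.app (op N) r) x hx₁ hx).trans ?_
    exact (congrArg (ψ x) (hE x N r hx₁)).trans (hψ' x N r hx₁ hx')
  refine ⟨k, ⟨hkf, hk⟩, ?_⟩
  · rintro k' ⟨h₁, h₂⟩
    refine hom_ext (fun x => by rw [h₂, hk]) fun V s x hx hx' => ?_
    obtain ⟨N, r, W, hW, H⟩ := exists_local_pullback f (fun x => (hf x).2) s hx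
    have hW' : k.base x ∈ W := by rw [hk, ← h₂]; exact hW
    obtain ⟨a₀, a₁, a₂⟩ := H _ hW
    obtain ⟨b₀, b₁, b₂⟩ := H _ hW'
    refine (germ_app_of_germ_eq k' _ a₁ a₂).trans ((germ_congr (f := k' ≫ f) (g := k ≫ f)
      (h₁.trans hkf.symm) N r x
      a₁ b₁).trans (germ_app_of_germ_eq k _ b₁ b₂).symm)

lemma hom_ext_of_cover {M : LocallyRingedSpace.{u}} {I : Type*} {V : I → LocallyRingedSpace.{u}}
    (inc : ∀ i, V i ⟶ M) (hinc : ∀ i x, Function.Injective ((inc i).stalkMap x).hom)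
    (cov : ∀ x, ∃ i, x ∈ Set.range (inc i).base) {y y' : M ⟶ Y}
    (h : ∀ i, inc i ≫ y = inc i ≫ y') : y = y' := by
  refine hom_ext (fun x => ?_) fun N s x hx hx' => ?_
  · obtain ⟨i, z, rfl⟩ := cov x
    exact congrArg (fun φ => φ.base z) (h i)
  · obtain ⟨i, z, rfl⟩ := cov x
    refine hinc i z ?_
    refine (LocallyRingedSpace.stalkMap_germ_apply (inc i) _ z hx _).trans ?_
    refine Eq.trans ?_ (LocallyRingedSpace.stalkMap_germ_apply (inc i) _ z hx' _).symm
    exact germ_congr (h i) N s z hx hx'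

/-- Gluing of morphisms of locally ringed spaces. -/
theorem exists_glue {M : LocallyRingedSpace.{u}} {I : Type*} {V : I → LocallyRingedSpace.{u}}
    (inc : ∀ i, V i ⟶ M) (ho : ∀ i, IsOpenMap (inc i).base)
    (hinc : ∀ i x, Function.Bijective ((inc i).stalkMap x).hom)
    (cov : ∀ x, ∃ i, x ∈ Set.range (inc i).base) (y : ∀ i, V i ⟶ Y)
    (h : M.toTopCat ⟶ Y.toTopCat) (hh : ∀ i z, (y i).base z = h ((inc i).base z))
    (compat : ∀ i j z z', (inc i).base z = (inc j).base z' →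
      ∃ (L : LocallyRingedSpace.{u}) (a : L ⟶ V i) (b : L ⟶ V j) (l : L.toTopCat),
        a.base l = z ∧ b.base l = z' ∧ Function.Injective (b.stalkMap l).hom ∧
        a ≫ inc i = b ≫ inc j ∧ a ≫ y i = b ≫ y j) :
    ∃ k : M ⟶ Y, k.base = h ∧ ∀ i, inc i ≫ k = y i := by
  have key (x) : ∃ φ : Y.presheaf.stalk (h x) →+* M.presheaf.stalk x, IsLocalHom φ ∧
      ∀ (i) (z : (V i).toTopCat), (inc i).base z = x →
      ∀ (N : Opens Y.toTopCat) (s : Y.presheaf.obj (op N)) (hN : h x ∈ N) (W : Opens M.toTopCat)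
        (t : M.presheaf.obj (op W)) (hW : x ∈ W),
        M.presheaf.germ W x hW t = φ (Y.presheaf.germ N (h x) hN s) →
        ∀ (hz : (inc i).base z ∈ W) (hz' : (y i).base z ∈ N),
        (V i).presheaf.germ ((Opens.map (inc i).base).obj W) z hz ((inc i).c.app (op W) t) =
        (V i).presheaf.germ ((Opens.map (y i).base).obj N) z hz' ((y i).c.app (op N) s) := by
    obtain ⟨i, z, rfl⟩ := cov x
    obtain ⟨ψ, hψ, hψ'⟩ := exists_stalkMap (y i) (hh i z)
    let E := RingEquiv.ofBijective ((inc i).stalkMap z).hom (hinc i z)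
    refine ⟨(E.symm : _ →+* _).comp ψ, RingHom.isLocalHom_comp _ _, ?_⟩
    intro j z' e N s hN W t hW ht hz hz'
    have hz₀ : (y i).base z ∈ N := by rw [hh]; exact hN
    have h₁ : (V i).presheaf.germ ((Opens.map (inc i).base).obj W) z hW ((inc i).c.app (op W) t) =
        (V i).presheaf.germ ((Opens.map (y i).base).obj N) z hz₀ ((y i).c.app (op N) s) := by
      rw [← hψ' N s hN hz₀, ← LocallyRingedSpace.stalkMap_germ_apply, ht]
      exact E.apply_symm_apply _
    obtain ⟨L, a, b, l, rfl, rfl, hb, w, w'⟩ := compat i j z z' e.symm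
    refine hb ?_
    refine (LocallyRingedSpace.stalkMap_germ_apply b _ l hz _).trans ?_
    refine Eq.trans ?_ (LocallyRingedSpace.stalkMap_germ_apply b _ l hz' _).symm
    refine (germ_congr w.symm W t l hz hW).trans (Eq.trans ?_ (germ_congr w' N s l hz₀ hz'))
    exact germ_app_of_germ_eq a _ _ h₁
  choose φ hφ hφ' using key
  obtain ⟨k, hk, hk'⟩ := exists_hom h φ hφ fun N s x hx => by
    obtain ⟨i, z, rfl⟩ := cov x
    have hz : (y i).base z ∈ N := by rw [hh]; exact hx
    obtain ⟨N', r, W, hW, H⟩ := exists_local_pullback (inc i) (fun z => (hinc i z).2)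
      (V := (Opens.map (y i).base).obj N) ((y i).c.app (op N) s) hz
    refine ⟨⟨(inc i).base '' (W : Set (V i).toTopCat), ho i _ W.2⟩ ⊓ N', ⟨⟨z, hW, rfl⟩, (H z hW).2.1⟩,
      M.presheaf.map (homOfLE inf_le_right).op r, ?_⟩
    rintro _ ⟨⟨z', hz', rfl⟩, hy⟩ hy'
    refine (M.presheaf.germ_res_apply _ _ _ _).trans ?_
    obtain ⟨W', hW', t, ht⟩ := M.presheaf.exists_germ_eq
      (φ _ (Y.presheaf.germ N (h ((inc i).base z')) hy' s))
    obtain ⟨h₀, h₁, h₂⟩ := H z' hz'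
    rw [← ht]
    refine (hinc i z').1 ?_
    refine (LocallyRingedSpace.stalkMap_germ_apply (inc i) _ z' hy _).trans ?_
    refine Eq.trans ?_ (LocallyRingedSpace.stalkMap_germ_apply (inc i) _ z' hW' _).symm
    exact h₂.symm.trans (hφ' _ i z' rfl N s hy' W' t hW' ht hW' h₀).symm
  refine ⟨k, hk, fun i => hom_ext (fun z => ?_) fun N s z hz hz' => ?_⟩
  · rw [hh, ← hk]
    rfl
  · have hN : h ((inc i).base z) ∈ N := by rw [← hh]; exact hz'
    exact hφ' _ i z rfl N s hN _ _ hz (hk' N s _ hN hz) hz hz'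

end LRS

end Orbi

namespace Orbi

open TopologicalSpace Topology Opposite AlgebraicGeometry TopCat

namespace LRS

section Lift

variable {A : LocallyRingedSpace.{u}} {P : TopCat.{u}} (p : P ⟶ A.toTopCat)

/-- The sections of the inverse image of the structure sheaf. -/
noncomputable def pullbackSections (W : Opens P) : Subring (∀ x : W, A.presheaf.stalk (p x)) where
  carrier := {g | ∀ x : W, ∃ (V : Opens A.toTopCat) (s : A.presheaf.obj (op V)) (N : Opens P),
    x.1 ∈ N ∧ ∀ y : W, y.1 ∈ N → ∃ hy : p y ∈ V, g y = A.presheaf.germ V (p y) hy s}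
  one_mem' x := ⟨⊤, 1, ⊤, trivial, fun y _ => ⟨trivial, (map_one _).symm⟩⟩
  zero_mem' x := ⟨⊤, 0, ⊤, trivial, fun y _ => ⟨trivial, (map_zero _).symm⟩⟩
  neg_mem' {g} hg x := by
    obtain ⟨V, s, N, hx, h⟩ := hg x
    refine ⟨V, -s, N, hx, fun y hy => ⟨(h y hy).1, ?_⟩⟩
    rw [map_neg, ← (h y hy).2]
    rfl
  mul_mem' {g g'} hg hg' x := by
    obtain ⟨V, s, N, hx, h⟩ := hg x
    obtain ⟨V', s', N', hx', h'⟩ := hg' x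
    refine ⟨V ⊓ V', A.presheaf.map (homOfLE inf_le_left).op s *
      A.presheaf.map (homOfLE inf_le_right).op s', N ⊓ N', ⟨hx, hx'⟩, fun y hy => ?_⟩
    obtain ⟨h₁, h₂⟩ := h y hy.1
    obtain ⟨h₁', h₂'⟩ := h' y hy.2
    have hm : p y ∈ V ⊓ V' := ⟨h₁, h₁'⟩
    refine ⟨hm, ?_⟩
    rw [map_mul, A.presheaf.germ_res_apply, A.presheaf.germ_res_apply, ← h₂, ← h₂']
    rfl
  add_mem' {g g'} hg hg' x := by
    obtain ⟨V, s, N, hx, h⟩ := hg x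
    obtain ⟨V', s', N', hx', h'⟩ := hg' x
    refine ⟨V ⊓ V', A.presheaf.map (homOfLE inf_le_left).op s +
      A.presheaf.map (homOfLE inf_le_right).op s', N ⊓ N', ⟨hx, hx'⟩, fun y hy => ?_⟩
    obtain ⟨h₁, h₂⟩ := h y hy.1
    obtain ⟨h₁', h₂'⟩ := h' y hy.2
    have hm : p y ∈ V ⊓ V' := ⟨h₁, h₁'⟩
    refine ⟨hm, ?_⟩
    rw [map_add, A.presheaf.germ_res_apply, A.presheaf.germ_res_apply, ← h₂, ← h₂']
    rfl

/-- The inverse image of the structure sheaf, as a presheaf. -/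
noncomputable def pullbackPresheaf : TopCat.Presheaf CommRingCat.{u} P where
  obj W := CommRingCat.of (pullbackSections p W.unop)
  map {W W'} i := CommRingCat.ofHom
    { toFun := fun g => ⟨fun x => g.1 ⟨x.1, i.unop.le x.2⟩, fun x => by
        obtain ⟨V, s, N, hx, h⟩ := g.2 ⟨x.1, i.unop.le x.2⟩
        exact ⟨V, s, N, hx, fun y hy => h ⟨y.1, i.unop.le y.2⟩ hy⟩⟩
      map_one' := rfl
      map_zero' := rfl
      map_mul' := fun _ _ => rfl
      map_add' := fun _ _ => rfl }

lemma isSheaf_pullbackPresheaf : (pullbackPresheaf p).IsSheaf := by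
  rw [TopCat.Presheaf.isSheaf_iff_isSheafUniqueGluing]
  intro ι U sf hsf
  change ∀ i : ι, pullbackSections p (U i) at sf
  have hc (i j : ι) (x : P) (hi : x ∈ U i) (hj : x ∈ U j) : (sf i).1 ⟨x, hi⟩ = (sf j).1 ⟨x, hj⟩ :=
    congrFun (congrArg Subtype.val (hsf i j)) ⟨x, hi, hj⟩
  have hm (x : (iSup U : Opens P)) : ∃ i, x.1 ∈ U i := Opens.mem_iSup.1 x.2
  choose i hi using hm
  have hs : (fun x => (sf (i x)).1 ⟨x.1, hi x⟩) ∈ pullbackSections p (iSup U) := by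
    intro x
    obtain ⟨V, s, N, hx, h⟩ := (sf (i x)).2 ⟨x.1, hi x⟩
    refine ⟨V, s, N ⊓ U (i x), ⟨hx, hi x⟩, fun y hy => ?_⟩
    obtain ⟨h₁, h₂⟩ := h ⟨y.1, hy.2⟩ hy.1
    exact ⟨h₁, (hc (i y) (i x) y.1 (hi y) hy.2).trans h₂⟩
  refine ⟨(⟨_, hs⟩ : pullbackSections p (iSup U)), fun j => ?_, fun t ht => ?_⟩
  · exact Subtype.ext (funext fun x => hc _ _ _ _ _)
  · change pullbackSections p (iSup U) at t
    refine Subtype.ext (funext fun x => ?_)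
    exact congrFun (congrArg Subtype.val (ht (i x))) ⟨x.1, hi x⟩

/-- The projection from the inverse image, as a morphism of ringed spaces. -/
noncomputable def pullbackHom : PresheafedSpace.Hom (⟨P, pullbackPresheaf p⟩ : PresheafedSpace CommRingCat.{u})
    A.toPresheafedSpace where
  base := p
  c :=
    { app := fun V => CommRingCat.ofHom (S := pullbackSections p ((Opens.map p).obj V.unop))
        { toFun := fun s => ⟨fun x => A.presheaf.germ V.unop (p x) x.2 s,
            fun _ => ⟨V.unop, s, ⊤, trivial, fun y _ => ⟨y.2, rfl⟩⟩⟩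
          map_one' := Subtype.ext (funext fun _ => map_one _)
          map_zero' := Subtype.ext (funext fun _ => map_zero _)
          map_mul' := fun _ _ => Subtype.ext (funext fun _ => map_mul _ _ _)
          map_add' := fun _ _ => Subtype.ext (funext fun _ => map_add _ _ _) }
      naturality := fun _ _ i => CommRingCat.hom_ext (RingHom.ext fun s =>
        Subtype.ext (funext fun x => A.presheaf.germ_res_apply' i (p x) x.2 s)) }

lemma bijective_stalkMap_pullbackHom (x : P) :
    Function.Bijective ((pullbackHom p).stalkMap x).hom := by
  have hg (V : Opens A.toTopCat) (s : A.presheaf.obj (op V)) (hV : p x ∈ V) :=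
    PresheafedSpace.stalkMap_germ_apply (pullbackHom p) V x hV s
  constructor
  · intro a b hab
    obtain ⟨V, hV, s, rfl⟩ := A.presheaf.exists_germ_eq a
    obtain ⟨V', hV', s', rfl⟩ := A.presheaf.exists_germ_eq b
    have h := (hg V s hV).symm.trans (hab.trans (hg V' s' hV'))
    obtain ⟨W, hW, i₁, i₂, e⟩ := (pullbackPresheaf p).germ_eq x _ _ _ _ h
    exact congrFun (congrArg Subtype.val e) ⟨x, hW⟩
  · intro b
    obtain ⟨W, hW, g, rfl⟩ := (pullbackPresheaf p).exists_germ_eq b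
    obtain ⟨V, s, N, hN, h⟩ := g.2 ⟨x, hW⟩
    refine ⟨A.presheaf.germ V (p x) (h ⟨x, hW⟩ hN).1 s, (hg V s _).trans ?_⟩
    have hxN : x ∈ W ⊓ N := ⟨hW, hN⟩
    have i₁ : W ⊓ N ≤ (Opens.map p).obj V := fun y hy => (h ⟨y, hy.1⟩ hy.2).1
    have e : (pullbackPresheaf p).map (homOfLE i₁).op ((pullbackHom p).c.app (op V) s) =
        (pullbackPresheaf p).map (homOfLE inf_le_left).op g :=
      Subtype.ext (funext fun y => (h ⟨y.1, y.2.1⟩ y.2.2).2.symm)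
    exact ((pullbackPresheaf p).germ_res_apply (homOfLE i₁) x hxN _).symm.trans <|
      (congrArg ((pullbackPresheaf p).germ (W ⊓ N) x hxN) e).trans
      ((pullbackPresheaf p).germ_res_apply (homOfLE inf_le_left) x hxN g)

/-- The inverse image of the structure sheaf of a locally ringed space. -/
noncomputable def lift : LocallyRingedSpace.{u} where
  carrier := P
  presheaf := pullbackPresheaf p
  IsSheaf := isSheaf_pullbackPresheaf p
  isLocalRing x := (RingEquiv.ofBijective _ (bijective_stalkMap_pullbackHom p x)).isLocalRing

/-- The projection. -/
noncomputable def liftHom : lift p ⟶ A :=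
  ⟨pullbackHom p, fun x =>
    ⟨fun _ h => (MulEquiv.isUnit_map
      (RingEquiv.ofBijective _ (bijective_stalkMap_pullbackHom p x))).1 h⟩⟩

end Lift

lemma bijective_stalkMap {X Y : LocallyRingedSpace.{u}} (f : X ⟶ Y) (x : X.toTopCat)
    [IsIso (f.stalkMap x)] : Function.Bijective (f.stalkMap x).hom :=
  ConcreteCategory.bijective_of_isIso (f.stalkMap x)

lemma isIso_stalkMap {X Y : LocallyRingedSpace.{u}} (f : X ⟶ Y) (x : X.toTopCat)
    (h : Function.Bijective (f.stalkMap x).hom) : IsIso (f.stalkMap x) :=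
  (ConcreteCategory.isIso_iff_bijective _).2 h

lemma coe_stalkMap_comp {X Y Z : LocallyRingedSpace.{u}} (i : Z ⟶ X) (f : X ⟶ Y)
    (z : Z.toTopCat) : ⇑((i ≫ f).stalkMap z).hom =
      (i.stalkMap z).hom ∘ (f.stalkMap (i.base z)).hom :=
  congrArg (fun φ => ⇑(CommRingCat.Hom.hom φ)) (LocallyRingedSpace.stalkMap_comp i f z)

lemma bijective_stalkMap_of_comp {X Y Z : LocallyRingedSpace.{u}} (i : Z ⟶ X) (f : X ⟶ Y)
    [LocallyRingedSpace.IsOpenImmersion i] [LocallyRingedSpace.IsOpenImmersion (i ≫ f)]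
    (z : Z.toTopCat) : Function.Bijective (f.stalkMap (i.base z)).hom := by
  have h := bijective_stalkMap (i ≫ f) z
  rw [coe_stalkMap_comp] at h
  exact (Function.Bijective.of_comp_iff' (bijective_stalkMap i z) _).1 h

lemma isOpenImmersion_comp {X Y Z : LocallyRingedSpace.{u}} (i : Z ⟶ X) (f : X ⟶ Y)
    [LocallyRingedSpace.IsOpenImmersion i] (h : IsOpenEmbedding (i ≫ f).base)
    (hf : ∀ x, Function.Bijective (f.stalkMap x).hom) :
    LocallyRingedSpace.IsOpenImmersion (i ≫ f) := by
  have (z : Z.toTopCat) : IsIso ((i ≫ f).stalkMap z) := by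
    refine isIso_stalkMap _ z ?_
    rw [coe_stalkMap_comp]
    exact (bijective_stalkMap i z).comp (hf _)
  exact LocallyRingedSpace.IsOpenImmersion.of_stalk_iso _ h

lemma isLocalIsoLRS_iff {X Y : LocallyRingedSpace.{0}} (f : X ⟶ Y) :
    IsLocalIsoLRS f ↔ IsLocalHomeomorph f.base ∧ ∀ x, Function.Bijective (f.stalkMap x).hom := by
  constructor
  · intro h
    refine ⟨isLocalHomeomorph_iff_isOpenEmbedding_restrict.2 fun x => ?_, fun x => ?_⟩
    · obtain ⟨U, hx, hU⟩ := h x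
      exact ⟨(U : Set X.toTopCat), U.2.mem_nhds hx, hU.base_open⟩
    · obtain ⟨U, hx, hU⟩ := h x
      exact bijective_stalkMap_of_comp (X.ofRestrict U.isOpenEmbedding) f ⟨x, hx⟩
  · rintro ⟨h, h'⟩ x
    obtain ⟨V, hV, hV'⟩ := isLocalHomeomorph_iff_isOpenEmbedding_restrict.1 h x
    obtain ⟨U, h₁, h₂, h₃⟩ := mem_nhds_iff.1 hV
    refine ⟨⟨U, h₂⟩, h₃, isOpenImmersion_comp _ f ?_ h'⟩
    refine hV'.comp (g := V.domRestrict f.base) (f := Set.inclusion h₁)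
      ⟨IsEmbedding.inclusion h₁, ?_⟩
    rw [Set.range_inclusion]
    exact h₂.preimage continuous_subtype_val

lemma bijective_stalkMap_liftHom {A : LocallyRingedSpace.{u}} {P : TopCat.{u}}
    (p : P ⟶ A.toTopCat) (x : P) : Function.Bijective ((liftHom p).stalkMap x).hom :=
  bijective_stalkMap_pullbackHom p x

end LRS

end Orbi

namespace Orbi

open TopologicalSpace Topology Opposite AlgebraicGeometry TopCat

namespace LRS

lemma isLocalIsoLRS_liftHom {A : LocallyRingedSpace.{0}} {P : TopCat.{0}} (p : P ⟶ A.toTopCat)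
    (hp : IsLocalHomeomorph p) : IsLocalIsoLRS (liftHom p) :=
  (isLocalIsoLRS_iff _).2 ⟨hp, bijective_stalkMap_liftHom p⟩

lemma isLocalIsoLRS_of_isIso {X Y : LocallyRingedSpace.{0}} (e : X ⟶ Y) [IsIso e] :
    IsLocalIsoLRS e := fun _ =>
  ⟨⊤, trivial, inferInstance⟩

lemma isLocalIsoLRS_comp {X Y Z : LocallyRingedSpace.{0}} {e : X ⟶ Y} {f : Y ⟶ Z}
    (he : IsLocalIsoLRS e) (hf : IsLocalIsoLRS f) : IsLocalIsoLRS (e ≫ f) := by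
  rw [isLocalIsoLRS_iff] at he hf ⊢
  refine ⟨hf.1.comp he.1, fun x => ?_⟩
  rw [coe_stalkMap_comp]
  exact (he.2 x).comp (hf.2 _)

lemma isOpenMap_of_isLocalIsoLRS {X Y : LocallyRingedSpace.{0}} {e : X ⟶ Y}
    (he : IsLocalIsoLRS e) : IsOpenMap e.base :=
  ((isLocalIsoLRS_iff _).1 he).1.isOpenMap

lemma bijective_stalkMap_of_isLocalIsoLRS {X Y : LocallyRingedSpace.{0}} {e : X ⟶ Y}
    (he : IsLocalIsoLRS e) (x) : Function.Bijective (e.stalkMap x).hom :=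
  ((isLocalIsoLRS_iff _).1 he).2 x

end LRS

open LRS

lemma isTopLikeCore_lrsSpaces : IsTopLikeCore
    (ObjectProperty.ι (fun X : LocallyRingedSpace.{0} => T2Space X.toTopCat) ⋙
      LocallyRingedSpace.forgetToTop) (fun _ _ f => IsLocalIsoLRS f.hom) False where
  t2 A := A.property
  secondCountable h := h.elim
  isLocalHomeomorph h := ((isLocalIsoLRS_iff _).1 h).1
  cartesian {A B L f} hf g h e := by
    obtain ⟨k, ⟨h₁, h₂⟩, hk⟩ := exists_unique_lift f.hom (bijective_stalkMap_of_isLocalIsoLRS hf)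
      g.hom h e
    refine ⟨ObjectProperty.homMk k, ⟨ObjectProperty.hom_ext _ h₁, h₂⟩, ?_⟩
    rintro k' ⟨rfl, h₄⟩
    exact ObjectProperty.hom_ext _ (hk k'.hom ⟨rfl, h₄⟩)
  iso_comp {A A' B} e _ f hf := by
    have : IsIso e.hom := inferInstanceAs (IsIso ((ObjectProperty.ι _).map e))
    exact isLocalIsoLRS_comp (isLocalIsoLRS_of_isIso e.hom) hf
  exists_lift {A P} p hp hP _ := ⟨⟨lift p, hP⟩, ObjectProperty.homMk (liftHom p), Iso.refl P,
    isLocalIsoLRS_liftHom p hp, rfl⟩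

/-- Hausdorff locally ringed spaces. -/
lemma isTopLike_lrsSpaces : IsTopLike
    (ObjectProperty.ι (fun X : LocallyRingedSpace.{0} => T2Space X.toTopCat) ⋙
      LocallyRingedSpace.forgetToTop) (fun _ _ f => IsLocalIsoLRS f.hom) False where
  __ := isTopLikeCore_lrsSpaces
  hom_ext {M Y I V} inc hi hc y y' h := ObjectProperty.hom_ext _ <|
    hom_ext_of_cover (fun i => (inc i).hom)
      (fun i x => (bijective_stalkMap_of_isLocalIsoLRS (hi i).1 x).1) hc
      fun i => congrArg (fun φ => φ.hom) (h i)
  glue {M Y I V} inc hi hc y h hh compat := by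
    obtain ⟨k, -, hk⟩ := exists_glue (fun i => (inc i).hom)
      (fun i => isOpenMap_of_isLocalIsoLRS (hi i).1)
      (fun i => bijective_stalkMap_of_isLocalIsoLRS (hi i).1) hc (fun i => (y i).hom) h
      (fun i z => congrArg (fun φ => φ z) (hh i).symm) (fun i j z z' e => by
        obtain ⟨L, a, b, hP, ha, -, h₃⟩ := isTopLikeCore_lrsSpaces.exists_isPullback (inc i) (inc j)
          (hi j).1
        have hb := (isTopLikeCore_lrsSpaces.isPullback (hi i).1 hP.flip).1
        obtain ⟨l, rfl, rfl⟩ := h₃ z z' e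
        exact ⟨L.obj, a.hom, b.hom, l, rfl, rfl, (bijective_stalkMap_of_isLocalIsoLRS hb l).1,
          congrArg (fun φ => φ.hom) hP.w, congrArg (fun φ => φ.hom) (compat i j L a b hP.w)⟩)
    exact ⟨ObjectProperty.homMk k, fun i => ObjectProperty.hom_ext _ (hk i)⟩

end Orbi

namespace Orbi

open TopologicalSpace Topology Opposite AlgebraicGeometry TopCat Manifold
open scoped ContDiff

namespace CSpace

open LRS

/-- The underlying locally ringed space. -/
def forgetToLRS : CSpace ⥤ LocallyRingedSpace.{0} where
  obj A := A.X
  map f := f.hom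

lemma exists_unique_lift {A B L : CSpace} (f : A ⟶ B)
    (hf : ∀ x, Function.Bijective (f.hom.stalkMap x).hom) (g : L ⟶ B)
    (h : L.X.toTopCat ⟶ A.X.toTopCat) (e : h ≫ f.hom.base = g.hom.base) :
    ∃! k : L ⟶ A, k ≫ f = g ∧ k.hom.base = h := by
  obtain ⟨k, ⟨h₁, h₂⟩, hk⟩ := LRS.exists_unique_lift f.hom hf g.hom h e
  refine ⟨⟨k, ?_⟩, ⟨Hom.ext h₁, h₂⟩, ?_⟩
  · rw [← f.str_comp, Category.assoc, ← Functor.map_comp, ← op_comp, h₁, g.str_comp]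
  · rintro k' ⟨rfl, h₄⟩
    exact Hom.ext (hk k'.hom ⟨rfl, h₄⟩)

/-- The inclusion of an open subspace. -/
noncomputable def ofRestrict (A : CSpace) (U : Opens A.X.toTopCat) : A.restrict U ⟶ A :=
  ⟨A.X.ofRestrict U.isOpenEmbedding, rfl⟩

lemma bijective_stalkMap_ofRestrict (A : CSpace) (U : Opens A.X.toTopCat) (x) :
    Function.Bijective ((A.ofRestrict U).hom.stalkMap x).hom := by
  have : LocallyRingedSpace.IsOpenImmersion (A.ofRestrict U).hom :=
    inferInstanceAs (LocallyRingedSpace.IsOpenImmersion (A.X.ofRestrict U.isOpenEmbedding))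
  have : IsIso ((A.ofRestrict U).hom.stalkMap x) :=
    LocallyRingedSpace.IsOpenImmersion.stalk_iso _ x
  exact bijective_stalkMap _ x

lemma bijective_stalkMap_of_comp {A B D : CSpace} (f : A ⟶ B) (g : B ⟶ D)
    (hg : ∀ x, Function.Bijective (g.hom.stalkMap x).hom)
    (h : ∀ x, Function.Bijective ((f ≫ g).hom.stalkMap x).hom) (x) :
    Function.Bijective (f.hom.stalkMap x).hom := by
  have h' := h x
  have e : ⇑((f ≫ g).hom.stalkMap x).hom = _ := coe_stalkMap_comp f.hom g.hom x
  rw [e] at h'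
  exact (Function.Bijective.of_comp_iff _ (hg _)).1 h'

/-- The inclusion of open subsets of `ℂ^n`. -/
noncomputable def domainMap {n : ℕ} {D' D : Opens (EuclideanSpace ℂ (Fin n))} (h : D' ≤ D) :
    domain D' ⟶ domain D where
  hom := ChartedSpace.locallyRingedSpaceMap _
    (contMDiff_inclusion (I := 𝓘(ℂ, EuclideanSpace ℂ (Fin n))) h)
  str_comp := rfl

lemma bijective_stalkMap_domainMap {n : ℕ} {D' D : Opens (EuclideanSpace ℂ (Fin n))}
    (h : D' ≤ D) (x) : Function.Bijective ((domainMap h).hom.stalkMap x).hom := by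
  let f (D : Opens (EuclideanSpace ℂ (Fin n))) := ChartedSpace.locallyRingedSpaceMap _
    (contMDiff_subtype_val (I := 𝓘(ℂ, EuclideanSpace ℂ (Fin n))) (n := ∞) (U := D))
  have hf (D) (x) : Function.Bijective ((f D).stalkMap x).hom := by
    have : IsIso ((f D).stalkMap x) := LocallyRingedSpace.IsOpenImmersion.stalk_iso _ x
    exact bijective_stalkMap _ x
  have h' := hf D' x
  have e : ⇑((f D').stalkMap x).hom = _ := coe_stalkMap_comp (domainMap h).hom (f D) x
  rw [e] at h'
  exact (Function.Bijective.of_comp_iff _ (hf _ _)).1 h'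

lemma IsModelEmbedding.baseChange {A B A' B' : CSpace} {i : A ⟶ B} {k : ℕ}
    {f : Fin k → LocallyRingedSpace.Γ.obj (op B.X)} (hi : IsModelEmbedding i f) (i' : A' ⟶ B')
    (j : B' ⟶ B) (q : A' ⟶ A) (w : i' ≫ j = q ≫ i) (hj : Function.Injective j.hom.base)
    (hj' : ∀ x, Function.Bijective (j.hom.stalkMap x).hom) (hq : IsEmbedding q.hom.base)
    (hq' : ∀ x, Function.Bijective (q.hom.stalkMap x).hom)
    (hr : Set.range q.hom.base = i.hom.base ⁻¹' Set.range j.hom.base) :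
    IsModelEmbedding i' (fun l => LocallyRingedSpace.Γ.map j.hom.op (f l)) := by
  have w' : i'.hom ≫ j.hom = q.hom ≫ i.hom := congrArg Hom.hom w
  have wb (x) : j.hom.base (i'.hom.base x) = i.hom.base (q.hom.base x) :=
    congrArg (fun φ => φ.base x) w'
  have hrange : Set.range i'.hom.base = j.hom.base ⁻¹' Set.range i.hom.base := by
    ext b
    constructor
    · rintro ⟨a, rfl⟩
      exact ⟨_, (wb a).symm⟩
    · rintro ⟨a, ha⟩
      obtain ⟨a', rfl⟩ : a ∈ Set.range q.hom.base := by
        rw [hr]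
        exact ⟨b, ha.symm⟩
      exact ⟨a', hj ((wb a').trans ha)⟩
  refine ⟨⟨?_, ?_⟩, ?_, fun a => ?_, fun a => ?_⟩
  · refine IsEmbedding.of_comp i'.hom.base.hom.continuous j.hom.base.hom.continuous ?_
    have : (fun x => j.hom.base (i'.hom.base x)) = i.hom.base ∘ q.hom.base := funext wb
    change IsEmbedding (fun x => j.hom.base (i'.hom.base x))
    rw [this]
    exact hi.isClosedEmbedding.isEmbedding.comp hq
  · refine (congrArg IsClosed hrange).mpr ?_
    exact hi.isClosedEmbedding.isClosed_range.preimage j.hom.base.hom.continuous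
  · refine hrange.trans ?_
    refine (congrArg (fun s => j.hom.base ⁻¹' s) hi.range_eq).trans ?_
    ext b
    refine (B.X.toRingedSpace.mem_zeroLocus_iff _ _).trans
      (Iff.trans ?_ (B'.X.toRingedSpace.mem_zeroLocus_iff _ _).symm)
    have hb (l) : b ∈ B'.X.toRingedSpace.basicOpen (LocallyRingedSpace.Γ.map j.hom.op (f l)) ↔
        j.hom.base b ∈ B.X.toRingedSpace.basicOpen (f l) := by
      have := LocallyRingedSpace.preimage_basicOpen j.hom (f l)
      exact (SetLike.ext_iff.1 this b).symm
    constructor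
    · rintro H _ ⟨l, rfl⟩ h'
      exact H _ ⟨l, rfl⟩ ((hb l).1 h')
    · rintro H _ ⟨l, rfl⟩ h'
      exact H _ ⟨l, rfl⟩ ((hb l).2 h')
  · have h₁ : Function.Surjective ((q.hom ≫ i.hom).stalkMap a).hom := by
      rw [coe_stalkMap_comp]
      exact (hq' a).2.comp (hi.surjective _)
    rw [← w', coe_stalkMap_comp] at h₁
    exact h₁.of_comp
  · have h₁ : RingHom.ker ((q.hom ≫ i.hom).stalkMap a).hom = Ideal.span (Set.range fun l =>
        B.X.presheaf.germ ⊤ ((q.hom ≫ i.hom).base a) trivial (f l)) := by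
      refine Eq.trans ?_ (hi.ker_eq (q.hom.base a))
      ext r
      refine RingHom.mem_ker.trans (Iff.trans ?_ RingHom.mem_ker.symm)
      have := congrFun (coe_stalkMap_comp q.hom i.hom a) r
      exact (Eq.congr_left this).trans (map_eq_zero_iff _ (hq' a).1)
    rw [← w'] at h₁
    let φ := (j.hom.stalkMap (i'.hom.base a)).hom
    have h₂ : (RingHom.ker (i'.hom.stalkMap a).hom).comap φ = Ideal.span (Set.range fun l =>
        B.X.presheaf.germ ⊤ (j.hom.base (i'.hom.base a)) trivial (f l)) := by
      refine Eq.trans ?_ h₁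
      ext r
      refine Ideal.mem_comap.trans (RingHom.mem_ker.trans (Iff.trans ?_ RingHom.mem_ker.symm))
      exact (Eq.congr_left (congrFun (coe_stalkMap_comp i'.hom j.hom a) r)).symm
    have h₃ := congrArg (Ideal.map φ) h₂
    rw [Ideal.map_comap_of_surjective _ (hj' _).2, Ideal.map_span, ← Set.range_comp] at h₃
    refine h₃.trans (congrArg (fun g => Ideal.span (Set.range g)) (funext fun l => ?_))
    exact LocallyRingedSpace.stalkMap_germ_apply j.hom ⊤ (i'.hom.base a) trivial (f l)

lemma isComplexSpace_of_isLocalIso {A' A : CSpace} (f : A' ⟶ A) (hf : IsLocalIsoLRS f.hom)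
    (hA : A.IsComplexSpace) : A'.IsComplexSpace := by
  obtain ⟨hf₁, hf₂⟩ := (isLocalIsoLRS_iff _).1 hf
  intro x
  obtain ⟨U, hU, n, D, k, fs, i, hi⟩ := hA (f.hom.base x)
  obtain ⟨V, hV, hV'⟩ := isLocalHomeomorph_iff_isOpenEmbedding_restrict.1 hf₁ x
  obtain ⟨V₀, h₁, h₂, h₃⟩ := mem_nhds_iff.1 hV
  let W : Opens A'.X.toTopCat := ⟨V₀, h₂⟩ ⊓ (Opens.map f.hom.base).obj U
  have hWV : (W : Set A'.X.toTopCat) ⊆ V := fun w hw => h₁ hw.1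
  have hW : IsOpenEmbedding (fun w : W => f.hom.base w.1) := by
    refine hV'.comp (g := V.domRestrict f.hom.base)
      (f := Set.inclusion hWV) ⟨IsEmbedding.inclusion _, ?_⟩
    rw [Set.range_inclusion]
    exact W.2.preimage continuous_subtype_val
  obtain ⟨q, ⟨hq, hq'⟩, -⟩ := exists_unique_lift (A.ofRestrict U) (A.bijective_stalkMap_ofRestrict U)
    (A'.ofRestrict W ≫ f) (TopCat.ofHom ⟨fun w : W => (⟨f.hom.base w.1, w.2.2⟩ : U), by
      exact hW.continuous.subtype_mk _⟩) rfl
  have hqv (w) : (q.hom.base w : U).1 = f.hom.base w.1 := by rw [hq']; rfl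
  have hqe : IsOpenEmbedding q.hom.base := by
    refine IsOpenEmbedding.of_comp _ U.isOpenEmbedding (g := (Subtype.val : U → _)) ?_
    have e : (fun w : W => (q.hom.base w : U).1) = fun w : W => f.hom.base w.1 := funext hqv
    rw [← e] at hW
    exact hW
  obtain ⟨D₁, hD₁, hD₁'⟩ := hi.isClosedEmbedding.isInducing.isOpen_iff.1 hqe.isOpen_range
  change Set D at D₁
  let D' : Opens (EuclideanSpace ℂ (Fin n)) :=
    ⟨Subtype.val '' D₁, D.isOpenEmbedding'.isOpenMap _ hD₁⟩
  have hD : D' ≤ D := by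
    rintro _ ⟨d, -, rfl⟩
    exact d.2
  have hm (w) : (i.hom.base (q.hom.base w) : D) ∈ D₁ := hD₁'.ge ⟨w, rfl⟩
  have hc : Continuous (fun w : W => (i.hom.base (q.hom.base w) : D).1) :=
    continuous_subtype_val.comp (q.hom.base ≫ i.hom.base).hom.continuous
  obtain ⟨i', ⟨hi', -⟩, -⟩ := exists_unique_lift (domainMap hD) (bijective_stalkMap_domainMap hD)
    (q ≫ i) (TopCat.ofHom ⟨fun w : W => (⟨(i.hom.base (q.hom.base w) : D).1, _, hm w, rfl⟩ : D'),
      hc.subtype_mk _⟩) rfl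
  refine ⟨W, ⟨h₃, hU⟩, n, D', k, _, i', hi.baseChange i' (domainMap hD) q hi'
    (Set.inclusion_injective hD) (bijective_stalkMap_domainMap hD) hqe.isEmbedding
    (bijective_stalkMap_of_comp q _ (A.bijective_stalkMap_ofRestrict U) ?_) ?_⟩
  · rw [hq]
    intro w
    have e : ⇑((A'.ofRestrict W ≫ f).hom.stalkMap w).hom = _ :=
      coe_stalkMap_comp (A'.ofRestrict W).hom f.hom w
    rw [e]
    exact (A'.bijective_stalkMap_ofRestrict W w).comp (hf₂ _)
  · refine hD₁'.symm.trans (congrArg (fun s => i.hom.base ⁻¹' s) ?_)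
    ext d
    constructor
    · exact fun hd => ⟨(⟨d.1, d, hd, rfl⟩ : D'), rfl⟩
    · rintro ⟨⟨_, d', hd', rfl⟩, rfl⟩
      exact hd'

lemma hom_ext_of_cover {M Y : CSpace} {I : Type*} {V : I → CSpace} (inc : ∀ i, V i ⟶ M)
    (hinc : ∀ i x, Function.Injective ((inc i).hom.stalkMap x).hom)
    (cov : ∀ x, ∃ i, x ∈ Set.range (inc i).hom.base) {y y' : M ⟶ Y}
    (h : ∀ i, inc i ≫ y = inc i ≫ y') : y = y' :=
  Hom.ext (LRS.hom_ext_of_cover (fun i => (inc i).hom) hinc cov fun i => congrArg Hom.hom (h i))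

end CSpace

open LRS

lemma isTopLikeCore_complexSpaces : IsTopLikeCore
    (ObjectProperty.ι (fun A : CSpace => A.IsComplexSpace ∧ T2Space A.X.toTopCat) ⋙
      CSpace.forgetToTop) (fun _ _ f => IsLocalIsoLRS f.hom.hom) False where
  t2 A := A.property.2
  secondCountable h := h.elim
  isLocalHomeomorph h := ((isLocalIsoLRS_iff _).1 h).1
  cartesian {A B L f} hf g h e := by
    obtain ⟨k, ⟨h₁, h₂⟩, hk⟩ := CSpace.exists_unique_lift f.hom
      (bijective_stalkMap_of_isLocalIsoLRS hf) g.hom h e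
    refine ⟨ObjectProperty.homMk k, ⟨ObjectProperty.hom_ext _ h₁, h₂⟩, ?_⟩
    rintro k' ⟨rfl, h₄⟩
    exact ObjectProperty.hom_ext _ (hk k'.hom ⟨rfl, h₄⟩)
  iso_comp {A A' B} e _ f hf := by
    have : IsIso e.hom.hom :=
      inferInstanceAs (IsIso ((ObjectProperty.ι _ ⋙ CSpace.forgetToLRS).map e))
    exact isLocalIsoLRS_comp (isLocalIsoLRS_of_isIso e.hom.hom) hf
  exists_lift {A P} p hp hP _ := by
    let A' : CSpace := ⟨lift p, A.obj.str ≫ LocallyRingedSpace.Γ.map (liftHom p).op⟩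
    let f : A' ⟶ A.obj := ⟨liftHom p, rfl⟩
    have hf : IsLocalIsoLRS f.hom := isLocalIsoLRS_liftHom p hp
    exact ⟨⟨A', CSpace.isComplexSpace_of_isLocalIso f hf A.property.1, hP⟩,
      ObjectProperty.homMk f, Iso.refl P, hf, rfl⟩

/-- Hausdorff complex spaces. -/
lemma isTopLike_complexSpaces : IsTopLike
    (ObjectProperty.ι (fun A : CSpace => A.IsComplexSpace ∧ T2Space A.X.toTopCat) ⋙
      CSpace.forgetToTop) (fun _ _ f => IsLocalIsoLRS f.hom.hom) False where
  __ := isTopLikeCore_complexSpaces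
  hom_ext {M Y I V} inc hi hc y y' h := ObjectProperty.hom_ext _ <|
    CSpace.hom_ext_of_cover (fun i => (inc i).hom)
      (fun i x => (bijective_stalkMap_of_isLocalIsoLRS (hi i).1 x).1) hc
      fun i => congrArg (fun φ => φ.hom) (h i)
  glue {M Y I V} inc hi hc y h hh compat := by
    have hst (i) := bijective_stalkMap_of_isLocalIsoLRS (hi i).1
    obtain ⟨k, -, hk⟩ := exists_glue (fun i => (inc i).hom.hom)
      (fun i => isOpenMap_of_isLocalIsoLRS (hi i).1) hst hc (fun i => (y i).hom.hom) h
      (fun i z => congrArg (fun φ => φ z) (hh i).symm) (fun i j z z' e => by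
        obtain ⟨L, a, b, hP, ha, -, h₃⟩ := isTopLikeCore_complexSpaces.exists_isPullback (inc i)
          (inc j) (hi j).1
        have hb := (isTopLikeCore_complexSpaces.isPullback (hi i).1 hP.flip).1
        obtain ⟨l, rfl, rfl⟩ := h₃ z z' e
        exact ⟨L.obj.X, a.hom.hom, b.hom.hom, l, rfl, rfl,
          (bijective_stalkMap_of_isLocalIsoLRS hb l).1,
          congrArg (fun φ => φ.hom.hom) hP.w, congrArg (fun φ => φ.hom.hom) (compat i j L a b hP.w)⟩)
    have hstr : Y.obj.str ≫ LocallyRingedSpace.Γ.map k.op = M.obj.str := by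
      refine CommRingCat.hom_ext (RingHom.ext fun c => section_ext (U := ⊤) _ _ fun x hx => ?_)
      obtain ⟨i, z, rfl⟩ := hc x
      refine (hst i z).1 ?_
      refine (LocallyRingedSpace.stalkMap_germ_apply (inc i).hom.hom ⊤ z hx _).trans ?_
      refine Eq.trans ?_ (LocallyRingedSpace.stalkMap_germ_apply (inc i).hom.hom ⊤ z hx _).symm
      refine congrArg ((V i).obj.X.presheaf.germ ⊤ z trivial) ?_
      have e₁ : (Y.obj.str ≫ LocallyRingedSpace.Γ.map k.op) ≫
          LocallyRingedSpace.Γ.map (inc i).hom.hom.op = (V i).obj.str := by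
        rw [Category.assoc, ← Functor.map_comp, ← op_comp, hk, (y i).hom.str_comp]
      exact congrArg (fun φ => φ.hom c) (e₁.trans (inc i).hom.str_comp.symm)
    exact ⟨ObjectProperty.homMk ⟨k, hstr⟩,
      fun i => ObjectProperty.hom_ext _ (CSpace.Hom.ext (hk i))⟩

end Orbi

namespace Orbi

open AlgebraicGeometry

namespace EtaleScheme

/-- Morphisms of schemes can be glued along jointly surjective families of étale morphisms. -/
lemma existsUnique_glue {X Y : Scheme.{0}} {I : Type} {V : I → Scheme.{0}} (f : ∀ i, V i ⟶ X)
    (hf : ∀ i, Etale (f i)) (cov : ∀ x : X, ∃ i, x ∈ Set.range (f i)) (y : ∀ i, V i ⟶ Y)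
    (hy : ∀ i j, pullback.fst (f i) (f j) ≫ y i = pullback.snd (f i) (f j) ≫ y j) :
    ∃! k : X ⟶ Y, ∀ i, f i ≫ k = y i := by
  have h : Presieve.ofArrows V f ∈ Scheme.fppfPrecoverage X :=
    (Scheme.ofArrows_mem_precoverage_iff _).2 ⟨cov, fun i => by
      have := hf i
      exact ⟨inferInstance, inferInstance⟩⟩
  have h' := (GrothendieckTopology.Subcanonical.isSheaf_of_isRepresentable
    (J := Scheme.fppfTopology) (yoneda.obj Y)).isSheafFor _
      (Precoverage.generate_mem_toGrothendieck h)
  exact (Presieve.isSheafFor_arrows_iff_pullbacks _ _ ).1 h' y hy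

section sigma

variable {B : Scheme.{0}} {I : Type} {V : I → Scheme.{0}} (d : ∐ V ⟶ B)

/-- The canonical map `Vᵢ ×_B Vⱼ ⟶ (∐ V) ×_B (∐ V)`. -/
noncomputable def sigmaProd (i j : I) :
    pullback (Sigma.ι V i ≫ d) (Sigma.ι V j ≫ d) ⟶ pullback d d :=
  pullback.map _ _ _ _ (Sigma.ι V i) (Sigma.ι V j) (𝟙 B) (Category.comp_id _) (Category.comp_id _)

instance (i j : I) : IsOpenImmersion (sigmaProd d i j) := by
  let 𝒰 : (pullback d d).OpenCover :=
    Scheme.Pullback.openCoverOfLeftRight (sigmaOpenCover V) (sigmaOpenCover V) d d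
  have h : IsOpenImmersion (𝒰.f (i, j)) := 𝒰.map_prop (i, j)
  exact h

lemma exists_sigmaProd_eq (x : ↥(pullback d d)) : ∃ i j q, sigmaProd d i j q = x := by
  obtain ⟨⟨i, j⟩, q, h⟩ := (Scheme.Pullback.openCoverOfLeftRight (sigmaOpenCover V)
    (sigmaOpenCover V) d d).exists_eq x
  exact ⟨i, j, q, h⟩

lemma sigmaProd_fst (i j : I) : sigmaProd d i j ≫ pullback.fst d d =
    pullback.fst (Sigma.ι V i ≫ d) (Sigma.ι V j ≫ d) ≫ Sigma.ι V i := pullback.lift_fst _ _ _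

lemma sigmaProd_snd (i j : I) : sigmaProd d i j ≫ pullback.snd d d =
    pullback.snd (Sigma.ι V i ≫ d) (Sigma.ι V j ≫ d) ≫ Sigma.ι V j := pullback.lift_snd _ _ _

lemma ι_diagonal (i : I) : Sigma.ι V i ≫ pullback.diagonal d =
    pullback.diagonal (Sigma.ι V i ≫ d) ≫ sigmaProd d i i := by
  apply pullback.hom_ext
  · rw [Category.assoc, Category.assoc, sigmaProd_fst, pullback.diagonal_fst,
      pullback.diagonal_fst_assoc, Category.comp_id]
  · rw [Category.assoc, Category.assoc, sigmaProd_snd, pullback.diagonal_snd,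
      pullback.diagonal_snd_assoc, Category.comp_id]

lemma eq_of_diagonal_eq {i j : I} {q : ↥(pullback (Sigma.ι V i ≫ d) (Sigma.ι V j ≫ d))}
    {p : ↥(∐ V)} (e : pullback.diagonal d p = sigmaProd d i j q) :
    p = Sigma.ι V i (pullback.fst (Sigma.ι V i ≫ d) (Sigma.ι V j ≫ d) q) ∧
      p = Sigma.ι V j (pullback.snd (Sigma.ι V i ≫ d) (Sigma.ι V j ≫ d) q) := by
  have e₁ := congrArg (pullback.fst d d) e
  have e₂ := congrArg (pullback.snd d d) e
  rw [← Scheme.Hom.comp_apply, ← Scheme.Hom.comp_apply, pullback.diagonal_fst, sigmaProd_fst,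
    Scheme.Hom.comp_apply] at e₁
  rw [← Scheme.Hom.comp_apply, ← Scheme.Hom.comp_apply, pullback.diagonal_snd, sigmaProd_snd,
    Scheme.Hom.comp_apply] at e₂
  exact ⟨e₁, e₂⟩

lemma isSeparated_of_sigma (hd : ∀ i, IsSeparated (Sigma.ι V i ≫ d)) : IsSeparated d := by
  refine ⟨IsClosedImmersion.of_isPreimmersion _ ?_⟩
  rw [← isOpen_compl_iff, isOpen_iff_forall_mem_open]
  intro x hx
  obtain ⟨i, j, q, rfl⟩ := exists_sigmaProd_eq d x
  by_cases hij : i = j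
  · subst hij
    have hc : IsClosed (Set.range (pullback.diagonal (Sigma.ι V i ≫ d))) :=
      (pullback.diagonal (Sigma.ι V i ≫ d)).isClosedEmbedding.isClosed_range
    refine ⟨sigmaProd d i i '' (Set.range (pullback.diagonal (Sigma.ι V i ≫ d)))ᶜ, ?_,
      (sigmaProd d i i).isOpenEmbedding.isOpenMap _ hc.isOpen_compl, q, ?_, rfl⟩
    · rintro _ ⟨q, hq, rfl⟩ ⟨p, e⟩
      refine hq ⟨pullback.fst (Sigma.ι V i ≫ d) (Sigma.ι V i ≫ d) q,
        (sigmaProd d i i).isOpenEmbedding.injective (Eq.trans ?_ e)⟩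
      rw [(eq_of_diagonal_eq d e).1, ← Scheme.Hom.comp_apply (Sigma.ι V i), ι_diagonal,
        Scheme.Hom.comp_apply]
    · rintro ⟨a, rfl⟩
      refine hx ⟨Sigma.ι V i a, ?_⟩
      rw [← Scheme.Hom.comp_apply, ι_diagonal, Scheme.Hom.comp_apply]
  · refine ⟨Set.range (sigmaProd d i j), ?_, (sigmaProd d i j).isOpenEmbedding.isOpen_range, q, rfl⟩
    rintro _ ⟨q, rfl⟩ ⟨p, e⟩
    obtain ⟨e₁, e₂⟩ := eq_of_diagonal_eq d e
    exact hij (congrArg Sigma.fst ((sigmaι_eq_iff V i j _ _).1 (e₁.symm.trans e₂)))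

end sigma

end EtaleScheme

end Orbi

namespace Orbi

open AlgebraicGeometry

/-- A class of separated schemes over `B` that is closed under separated étale morphisms and
disjoint unions. -/
structure IsEtaleClass (B : Scheme.{0}) (P : ObjectProperty (Over B)) : Prop where
  isSeparated : ∀ X, P X → IsSeparated X.hom
  of_etale : ∀ {X Y : Over B} (f : X ⟶ Y), P Y → Etale f.left → IsSeparated f.left → P X
  sigma : ∀ {I : Type} (X : I → Over B), (∀ i, P (X i)) →
    P (Over.mk (Sigma.desc fun i => (X i).hom))

namespace IsEtaleClass

variable {B : Scheme.{0}} {P : ObjectProperty (Over B)} (H : IsEtaleClass B P)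
include H

lemma isSeparated_left {X Y : P.FullSubcategory} (f : X ⟶ Y) : IsSeparated f.hom.left := by
  have : IsSeparated (f.hom.left ≫ Y.obj.hom) := by
    rw [Over.w]
    exact H.isSeparated _ X.property
  exact IsSeparated.of_comp _ Y.obj.hom

omit H in
lemma isPullback_of_left {Q A D E : P.FullSubcategory} {fst : Q ⟶ A} {snd : Q ⟶ D} {g : A ⟶ E}
    {f : D ⟶ E} (h : IsPullback fst.hom.left snd.hom.left g.hom.left f.hom.left) :
    IsPullback fst snd g f := by
  have w : fst ≫ g = snd ≫ f := ObjectProperty.hom_ext _ (Over.OverMorphism.ext h.w)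
  refine ⟨⟨w⟩, ⟨PullbackCone.IsLimit.mk w
    (fun c => ObjectProperty.homMk (Over.homMk (h.lift c.fst.hom.left c.snd.hom.left
      (congrArg (fun φ => φ.hom.left) c.condition)) ?_)) ?_ ?_ ?_⟩⟩
  · rw [← Over.w fst.hom, h.lift_fst_assoc, Over.w]
  · exact fun c => ObjectProperty.hom_ext _ (Over.OverMorphism.ext (h.lift_fst _ _ _))
  · exact fun c => ObjectProperty.hom_ext _ (Over.OverMorphism.ext (h.lift_snd _ _ _))
  · intro c m h₁ h₂
    refine ObjectProperty.hom_ext _ (Over.OverMorphism.ext (h.hom_ext ?_ ?_))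
    · exact (congrArg (fun φ => φ.hom.left) h₁).trans (h.lift_fst _ _ _).symm
    · exact (congrArg (fun φ => φ.hom.left) h₂).trans (h.lift_snd _ _ _).symm

lemma exists_isPullback {A D E : P.FullSubcategory} (g : A ⟶ E) (f : D ⟶ E)
    (hf : Etale f.hom.left) : ∃ (Q : P.FullSubcategory) (fst : Q ⟶ A) (snd : Q ⟶ D),
      IsPullback fst snd g f ∧ IsPullback fst.hom.left snd.hom.left g.hom.left f.hom.left := by
  have := H.isSeparated_left f
  let Q : P.FullSubcategory := ⟨Over.mk (pullback.fst g.hom.left f.hom.left ≫ A.obj.hom),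
    H.of_etale (Over.homMk (pullback.fst g.hom.left f.hom.left) rfl) A.property
      (inferInstanceAs (Etale (pullback.fst g.hom.left f.hom.left)))
      (inferInstanceAs (IsSeparated (pullback.fst g.hom.left f.hom.left)))⟩
  let fst : Q ⟶ A := ObjectProperty.homMk (Over.homMk (pullback.fst g.hom.left f.hom.left) rfl)
  let snd : Q ⟶ D := ObjectProperty.homMk (Over.homMk (pullback.snd g.hom.left f.hom.left) (by
    change _ = pullback.fst g.hom.left f.hom.left ≫ A.obj.hom
    rw [← Over.w f.hom, ← Over.w g.hom, pullback.condition_assoc]))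
  have h : IsPullback fst.hom.left snd.hom.left g.hom.left f.hom.left :=
    IsPullback.of_hasPullback g.hom.left f.hom.left
  exact ⟨Q, fst, snd, isPullback_of_left h, h⟩

lemma isPullback_left {Q A D E : P.FullSubcategory} {fst : Q ⟶ A} {snd : Q ⟶ D} {g : A ⟶ E}
    {f : D ⟶ E} (h : IsPullback fst snd g f) (hf : Etale f.hom.left) :
    IsPullback fst.hom.left snd.hom.left g.hom.left f.hom.left := by
  obtain ⟨Q', fst', snd', h₁, h₂⟩ := H.exists_isPullback g f hf
  let e := (P.ι ⋙ Over.forget B).mapIso (h₁.isoIsPullback _ _ h)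
  refine h₂.of_iso e (Iso.refl _) (Iso.refl _) (Iso.refl _) ?_ ?_ ?_ ?_
  · have := congrArg (fun φ => φ.hom.left) (h₁.isoIsPullback_hom_fst _ _ h)
    exact (Category.comp_id _).trans this.symm
  · have := congrArg (fun φ => φ.hom.left) (h₁.isoIsPullback_hom_snd _ _ h)
    exact (Category.comp_id _).trans this.symm
  · exact (Category.comp_id _).trans (Category.id_comp _).symm
  · exact (Category.comp_id _).trans (Category.id_comp _).symm

omit H in
/-- A sieve that contains a jointly surjective family of étale morphisms. -/
def HasEtaleCover {M : P.FullSubcategory} (R : Sieve M) : Prop :=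
  ∀ x : M.obj.left, ∃ (Y : P.FullSubcategory) (f : Y ⟶ M), R f ∧ Etale f.hom.left ∧
    x ∈ Set.range f.hom.left

lemma mem_topology_iff {M : P.FullSubcategory} (R : Sieve M) :
    R ∈ (SpaceCat.ofSchemes B P).topology M ↔ HasEtaleCover R := by
  constructor
  · intro hR
    induction hR with
    | of X R hR =>
      intro x
      obtain ⟨Y, f, hf, hx⟩ := hR.2 x
      exact ⟨Y, f, Sieve.le_generate R _ _ hf, hR.1 f hf, hx⟩
    | top X => exact fun x => ⟨X, 𝟙 X, trivial,
        inferInstanceAs (Etale (𝟙 X.obj.left)), x, rfl⟩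
    | pullback X R hR Y g h =>
      intro y
      obtain ⟨Z, f, hf, hf', z, hz⟩ := h (g.hom.left y)
      obtain ⟨Q, fst, snd, h₁, h₂⟩ := H.exists_isPullback g f hf'
      obtain ⟨q, hq, -⟩ := Scheme.exists_preimage_of_isPullback h₂ y z hz.symm
      refine ⟨Q, fst, ?_, MorphismProperty.of_isPullback (P := @Etale) h₂.flip hf', q, hq⟩
      change R (fst ≫ g)
      rw [h₁.w]
      exact R.downward_closed hf _
    | transitive X R T hR hT h h' =>
      intro x
      obtain ⟨Y, f, hf, h₁, y, rfl⟩ := h x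
      obtain ⟨Z, g, hg, h₂, z, rfl⟩ := h' hf y
      exact ⟨Z, g ≫ f, hg, inferInstanceAs (Etale (g.hom.left ≫ f.hom.left)), z,
        Scheme.Hom.comp_apply _ _ _⟩
  · intro hR
    refine GrothendieckTopology.superset_covering _
      (S := Sieve.generate (fun Y (f : Y ⟶ M) => R f ∧ Etale f.hom.left)) ?_ ?_
    · rw [Sieve.generate_le_iff]
      exact fun Y f hf => hf.1
    · refine Precoverage.generate_mem_toGrothendieck ⟨fun Y f hf => hf.2, fun x => ?_⟩
      obtain ⟨Y, f, hf, hf', hx⟩ := hR x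
      exact ⟨Y, f, ⟨hf, hf'⟩, hx⟩

end IsEtaleClass

end Orbi

namespace Orbi

open AlgebraicGeometry

namespace IsEtaleClass

variable {B : Scheme.{0}} {P : ObjectProperty (Over B)} (H : IsEtaleClass B P)
include H

lemma isSheafFor {M : P.FullSubcategory} (R : Sieve M) (hR : HasEtaleCover R)
    (Y : P.FullSubcategory) : Presieve.IsSheafFor (yoneda.obj Y) R.arrows := by
  choose V inc hV hinc cov using hR
  have cov' : ∀ x : M.obj.left, ∃ i, x ∈ Set.range (inc i).hom.left := fun x => ⟨x, cov x⟩
  intro y hy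
  rw [Presieve.compatible_iff_sieveCompatible] at hy
  have hy' {L L' : P.FullSubcategory} (f : L ⟶ M) (g : L' ⟶ L) (hf : R f) :
      y (g ≫ f) (R.downward_closed hf g) = g ≫ (y f hf : L ⟶ Y) := hy f g hf
  let yi (i : M.obj.left) : V i ⟶ Y := y (inc i) (hV i)
  have glue {T : Scheme.{0}} {Z : Scheme.{0}} (g : T ⟶ M.obj.left)
      (z : ∀ i, pullback g (inc i).hom.left ⟶ Z)
      (hz : ∀ i j, pullback.fst (pullback.fst g (inc i).hom.left)
        (pullback.fst g (inc j).hom.left) ≫ z i = pullback.snd _ _ ≫ z j) :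
      ∃! k : T ⟶ Z, ∀ i, pullback.fst g (inc i).hom.left ≫ k = z i := by
    refine EtaleScheme.existsUnique_glue (fun i => pullback.fst g (inc i).hom.left)
      (fun i => ?_) (fun x => ?_) z hz
    · have := hinc i
      infer_instance
    · obtain ⟨p, hp⟩ := cov (g x)
      obtain ⟨q, hq, -⟩ := Scheme.Pullback.exists_preimage_pullback x p hp.symm
      exact ⟨g x, q, hq⟩
  have ext {T Z : Scheme.{0}} (g : T ⟶ M.obj.left) {k k' : T ⟶ Z}
      (e : ∀ i, pullback.fst g (inc i).hom.left ≫ k = pullback.fst g (inc i).hom.left ≫ k') :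
      k = k' :=
    (glue g (fun i => pullback.fst g (inc i).hom.left ≫ k')
      (fun i j => by rw [pullback.condition_assoc])).unique e fun _ => rfl
  have ext' {Z : Scheme.{0}} {k k' : M.obj.left ⟶ Z}
      (e : ∀ i, (inc i).hom.left ≫ k = (inc i).hom.left ≫ k') : k = k' :=
    (EtaleScheme.existsUnique_glue (fun i => (inc i).hom.left) hinc cov'
      (fun i => (inc i).hom.left ≫ k') (fun i j => by rw [pullback.condition_assoc])).unique e
      fun _ => rfl
  obtain ⟨k, hk, -⟩ := EtaleScheme.existsUnique_glue (fun i => (inc i).hom.left) hinc cov'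
    (fun i => (yi i).hom.left) (fun i j => by
      obtain ⟨Q, fst, snd, h₁, h₂⟩ := H.exists_isPullback (inc i) (inc j) (hinc j)
      have e : fst ≫ yi i = snd ≫ yi j := by
        rw [← hy' _ _ (hV i), ← hy' _ _ (hV j)]
        congr 1
        exact h₁.w
      have e' : fst.hom.left ≫ (yi i).hom.left = snd.hom.left ≫ (yi j).hom.left :=
        congrArg (fun φ => φ.hom.left) e
      rw [← h₂.isoPullback_inv_fst, ← h₂.isoPullback_inv_snd, Category.assoc, Category.assoc, e'])
  let k' : M ⟶ Y := ObjectProperty.homMk (Over.homMk k (ext' fun i => by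
    rw [reassoc_of% (hk i), Over.w, Over.w]))
  have hk' (i) : inc i ≫ k' = yi i := ObjectProperty.hom_ext _ (Over.OverMorphism.ext (hk i))
  have amalg {L : P.FullSubcategory} (f : L ⟶ M) (hf : R f) : f ≫ k' = y f hf := by
    refine ObjectProperty.hom_ext _ (Over.OverMorphism.ext (ext f.hom.left fun i => ?_))
    obtain ⟨Q, fst, snd, h₁, h₂⟩ := H.exists_isPullback f (inc i) (hinc i)
    have e : fst ≫ f ≫ k' = fst ≫ y f hf := by
      rw [← hy' _ _ hf, h₁.w_assoc, hk', ← hy' _ _ (hV i)]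
      congr 1
      exact h₁.w.symm
    have e' : fst.hom.left ≫ (f ≫ k').hom.left = fst.hom.left ≫ (y f hf : L ⟶ Y).hom.left :=
      congrArg (fun φ => φ.hom.left) e
    rw [← h₂.isoPullback_inv_fst, Category.assoc, Category.assoc, e']
  refine ⟨k', fun L f hf => amalg f hf, fun m hm =>
    ObjectProperty.hom_ext _ (Over.OverMorphism.ext (ext' fun i => ?_))⟩
  exact congrArg (fun φ => φ.hom.left) ((hm _ (hV i)).trans (amalg _ _).symm)

lemma subcanonical : (SpaceCat.ofSchemes B P).topology.Subcanonical :=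
  GrothendieckTopology.Subcanonical.of_isSheaf_yoneda_obj _ fun Y _ R hR =>
    H.isSheafFor R ((H.mem_topology_iff R).1 hR) Y

lemma hasEtaleCover_generate {A D : P.FullSubcategory} (f : A ⟶ D) (hf : Etale f.hom.left)
    (hs : Surjective f.hom.left) :
    HasEtaleCover (Sieve.generate (Presieve.singleton f)) := by
  intro x
  exact ⟨A, f, Sieve.le_generate _ _ _ ⟨⟩, hf, hs.surj x⟩

lemma effectiveEpi {A D : P.FullSubcategory} (f : A ⟶ D) (hf : Etale f.hom.left)
    (hs : Surjective f.hom.left) : EffectiveEpi f := by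
  rw [← Sieve.effectiveEpimorphic_singleton]
  exact (Sieve.EffectiveEpimorphic.iff_forall_isSheafFor_yoneda _).2 fun Y =>
    H.isSheafFor _ (H.hasEtaleCover_generate f hf hs) Y

lemma properPair {X₀ X₁ Z₀ Z₁ : P.FullSubcategory} (s t : X₁ ⟶ X₀) (s' t' : Z₁ ⟶ Z₀)
    (f₀ : Z₀ ⟶ X₀) (f₁ : Z₁ ⟶ X₁) (hf : Etale f₀.hom.left) (h₁ : f₁ ≫ s = s' ≫ f₀)
    (h₂ : f₁ ≫ t = t' ≫ f₀)
    (h : ∀ {M : P.FullSubcategory} (z z' : M ⟶ Z₀) (x : M ⟶ X₁), x ≫ s = z ≫ f₀ →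
      x ≫ t = z' ≫ f₀ → ∃! w : M ⟶ Z₁, w ≫ s' = z ∧ w ≫ t' = z' ∧ w ≫ f₁ = x)
    (hp : (SpaceCat.ofSchemes B P).ProperPair s t) :
    (SpaceCat.ofSchemes B P).ProperPair s' t' := by
  obtain ⟨A, p₁, p₂, hA, hA'⟩ := H.exists_isPullback s f₀ hf
  obtain ⟨Q, q₁, q₂, hQ, hQ'⟩ := H.exists_isPullback (p₁ ≫ t) f₀ hf
  obtain ⟨k, ⟨hk₁, hk₂, hk₃⟩, -⟩ := h (q₁ ≫ p₂) q₂ (q₁ ≫ p₁) (by simp [hA.w])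
    (by rw [Category.assoc, hQ.w])
  let l : Z₁ ⟶ Q := hQ.lift (hA.lift f₁ s' h₁) t' (by simp [h₂])
  have hl₁ : l ≫ q₁ ≫ p₁ = f₁ := by simp [l]
  have hl₂ : l ≫ q₁ ≫ p₂ = s' := by simp [l]
  have hl₃ : l ≫ q₂ = t' := by simp [l]
  have hlk : l ≫ k = 𝟙 _ :=
    (h s' t' f₁ h₁ h₂).unique ⟨by simp [l, hk₁], by simp [l, hk₂], by simp [l, hk₃]⟩ (by simp)
  have L {X Y : P.FullSubcategory} {a b : X ⟶ Y} (e : a = b) : a.hom.left = b.hom.left :=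
    congrArg (fun φ => φ.hom.left) e
  have hlk' : l.hom.left ≫ k.hom.left = 𝟙 _ := L hlk
  have hk₁' : k.hom.left ≫ s'.hom.left = q₁.hom.left ≫ p₂.hom.left := L hk₁
  have hk₂' : k.hom.left ≫ t'.hom.left = q₂.hom.left := L hk₂
  have hk₃' : k.hom.left ≫ f₁.hom.left = q₁.hom.left ≫ p₁.hom.left := L hk₃
  have hl₁' : l.hom.left ≫ q₁.hom.left ≫ p₁.hom.left = f₁.hom.left := L hl₁
  have hl₂' : l.hom.left ≫ q₁.hom.left ≫ p₂.hom.left = s'.hom.left := L hl₂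
  have hl₃' : l.hom.left ≫ q₂.hom.left = t'.hom.left := L hl₃
  have h₁' : f₁.hom.left ≫ s.hom.left = s'.hom.left ≫ f₀.hom.left := L h₁
  have h₂' : f₁.hom.left ≫ t.hom.left = t'.hom.left ≫ f₀.hom.left := L h₂
  let d := pullback.lift (f := X₀.obj.hom) (g := X₀.obj.hom) s.hom.left t.hom.left
    (by rw [Over.w, Over.w])
  let d' := pullback.lift (f := Z₀.obj.hom) (g := Z₀.obj.hom) s'.hom.left t'.hom.left
    (by rw [Over.w, Over.w])
  let φ : pullback Z₀.obj.hom Z₀.obj.hom ⟶ pullback X₀.obj.hom X₀.obj.hom :=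
    pullback.map _ _ _ _ f₀.hom.left f₀.hom.left (𝟙 B) (by simp) (by simp)
  have hφ₁ : φ ≫ pullback.fst _ _ = pullback.fst _ _ ≫ f₀.hom.left := pullback.lift_fst _ _ _
  have hφ₂ : φ ≫ pullback.snd _ _ = pullback.snd _ _ ≫ f₀.hom.left := pullback.lift_snd _ _ _
  have hd₁ : d ≫ pullback.fst _ _ = s.hom.left := pullback.lift_fst _ _ _
  have hd₂ : d ≫ pullback.snd _ _ = t.hom.left := pullback.lift_snd _ _ _
  have hd₁' : d' ≫ pullback.fst _ _ = s'.hom.left := pullback.lift_fst _ _ _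
  have hd₂' : d' ≫ pullback.snd _ _ = t'.hom.left := pullback.lift_snd _ _ _
  have w : d' ≫ φ = f₁.hom.left ≫ d := by
    apply pullback.hom_ext
    · rw [Category.assoc, Category.assoc, hφ₁, hd₁, reassoc_of% hd₁', h₁']
    · rw [Category.assoc, Category.assoc, hφ₂, hd₂, reassoc_of% hd₂', h₂']
  have lift {T : Scheme.{0}} (b : T ⟶ pullback Z₀.obj.hom Z₀.obj.hom) (a : T ⟶ X₁.obj.left)
      (e : b ≫ φ = a ≫ d) : ∃ m : T ⟶ Z₁.obj.left, m ≫ d' = b ∧ m ≫ f₁.hom.left = a := by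
    have e₁ := congrArg (· ≫ pullback.fst _ _) e
    have e₂ := congrArg (· ≫ pullback.snd _ _) e
    simp only [Category.assoc, hφ₁, hφ₂, hd₁, hd₂] at e₁ e₂
    let u := hA'.lift a (b ≫ pullback.fst _ _) (by rw [Category.assoc, e₁])
    have hu₁ : u ≫ p₁.hom.left = a := hA'.lift_fst _ _ _
    have hu₂ : u ≫ p₂.hom.left = b ≫ pullback.fst _ _ := hA'.lift_snd _ _ _
    let v := hQ'.lift u (b ≫ pullback.snd _ _) (by
      change u ≫ p₁.hom.left ≫ t.hom.left = _
      rw [reassoc_of% hu₁, Category.assoc, e₂])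
    have hv₁ : v ≫ q₁.hom.left = u := hQ'.lift_fst _ _ _
    have hv₂ : v ≫ q₂.hom.left = b ≫ pullback.snd _ _ := hQ'.lift_snd _ _ _
    refine ⟨v ≫ k.hom.left, pullback.hom_ext ?_ ?_, ?_⟩
    · rw [Category.assoc, Category.assoc, hd₁', hk₁', reassoc_of% hv₁, hu₂]
    · rw [Category.assoc, Category.assoc, hd₂', hk₂', hv₂]
    · rw [Category.assoc, hk₃', reassoc_of% hv₁, hu₁]
  have uniq {T : Scheme.{0}} {m m' : T ⟶ Z₁.obj.left} (e : m ≫ d' = m' ≫ d')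
      (e' : m ≫ f₁.hom.left = m' ≫ f₁.hom.left) : m = m' := by
    have e₁ := congrArg (· ≫ pullback.fst _ _) e
    have e₂ := congrArg (· ≫ pullback.snd _ _) e
    simp only [Category.assoc, hd₁', hd₂'] at e₁ e₂
    have : m ≫ l.hom.left = m' ≫ l.hom.left := by
      apply hQ'.hom_ext
      · apply hA'.hom_ext
        · simp only [Category.assoc, hl₁', e']
        · simp only [Category.assoc, hl₂', e₁]
      · simp only [Category.assoc, hl₃', e₂]
    rw [← Category.comp_id m, ← Category.comp_id m', ← hlk', reassoc_of% this]
  have hpb : IsPullback d' f₁.hom.left φ d := by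
    refine ⟨⟨w⟩, ⟨PullbackCone.IsLimit.mk w (fun c => (lift c.fst c.snd c.condition).choose)
      (fun c => (lift c.fst c.snd c.condition).choose_spec.1)
      (fun c => (lift c.fst c.snd c.condition).choose_spec.2) fun c m hm hm' => ?_⟩⟩
    have := (lift c.fst c.snd c.condition).choose_spec
    exact uniq (hm.trans this.1.symm) (hm'.trans this.2.symm)
  exact MorphismProperty.of_isPullback (P := @IsProper) hpb.flip hp

omit H in
lemma comp {X Y Z : P.FullSubcategory} {f : X ⟶ Y} {g : Y ⟶ Z} (hf : Etale f.hom.left)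
    (hg : Etale g.hom.left) : Etale (f ≫ g).hom.left :=
  inferInstanceAs (Etale (f.hom.left ≫ g.hom.left))

omit H in
lemma comp_surj {X Y Z : P.FullSubcategory} {f : X ⟶ Y} {g : Y ⟶ Z}
    (hf : Surjective f.hom.left) (hg : Surjective g.hom.left) : Surjective (f ≫ g).hom.left :=
  inferInstanceAs (Surjective (f.hom.left ≫ g.hom.left))

lemma isGeometric : (SpaceCat.ofSchemes B P).IsGeometric where
  etale_mul :=
    { id_mem := fun A => inferInstanceAs (Etale (𝟙 A.obj.left))
      comp_mem := fun f g hf hg => comp hf hg }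
  etale_baseChange := ⟨fun {_ _ _ _ _ _ _ _} h hg =>
    MorphismProperty.of_isPullback (P := @Etale) (H.isPullback_left h.flip hg).flip hg⟩
  etaleSurj_mul :=
    { id_mem := fun A => ⟨inferInstanceAs (Etale (𝟙 A.obj.left)),
        inferInstanceAs (Surjective (𝟙 A.obj.left))⟩
      comp_mem := fun f g hf hg =>
        ⟨comp hf.1 hg.1, comp_surj hf.2 hg.2⟩ }
  etaleSurj_baseChange := ⟨fun {_ _ _ _ _ _ _ _} h hg =>
    ⟨MorphismProperty.of_isPullback (P := @Etale) (H.isPullback_left h.flip hg.1).flip hg.1,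
      MorphismProperty.of_isPullback (P := @Surjective) (H.isPullback_left h.flip hg.1).flip hg.2⟩⟩
  hasPullback f g hg := by
    obtain ⟨_, _, _, h, -⟩ := H.exists_isPullback f g hg
    exact h.hasPullback
  effectiveEpi f hf hs := H.effectiveEpi f hf hs
  properPair s t s' t' f₀ f₁ _ _ hf h₁ h₂ h hp := H.properPair s t s' t' f₀ f₁ hf h₁ h₂ h hp

end IsEtaleClass

end Orbi

namespace Orbi

open AlgebraicGeometry

lemma EtaleScheme.sigmaDesc_of_hasRingHomProperty (W : MorphismProperty Scheme.{0})
    {Q : ∀ {R S : Type} [CommRing R] [CommRing S], (R →+* S) → Prop} [HasRingHomProperty W Q]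
    {B : Scheme.{0}} {I : Type} {V : I → Scheme.{0}} (f : ∀ i, V i ⟶ B) (h : ∀ i, W (f i)) :
    W (Sigma.desc f) :=
  IsZariskiLocalAtSource.sigmaDesc h

namespace IsEtaleClass

variable {B : Scheme.{0}} {P : ObjectProperty (Over B)} (H : IsEtaleClass B P)
include H

lemma exists_disjoint_cover {M : P.FullSubcategory} {R : Sieve M} (hR : HasEtaleCover R) :
    ∃ (N : P.FullSubcategory) (q : N ⟶ M) (I : Type) (V : I → P.FullSubcategory)
      (inc : ∀ i, V i ⟶ N), Etale q.hom.left ∧ Surjective q.hom.left ∧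
      (∀ i, IsOpenImmersion (inc i).hom.left) ∧
      (∀ x, ∃ i, x ∈ Set.range (inc i).hom.left) ∧ (∀ i, R (inc i ≫ q)) ∧
      ∀ {i j : I}, i ≠ j → ∀ x y, (inc i).hom.left x ≠ (inc j).hom.left y := by
  choose V f hV hf cov using hR
  let N : P.FullSubcategory := ⟨_, H.sigma (fun i => (V i).obj) (fun i => (V i).property)⟩
  let Q : (∐ fun i => (V i).obj.left) ⟶ M.obj.left := Sigma.desc fun i => (f i).hom.left
  have hQ (i) : Sigma.ι (fun i => (V i).obj.left) i ≫ Q = (f i).hom.left := Sigma.ι_desc _ _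
  have hQ' : Q ≫ M.obj.hom = Sigma.desc fun i => (V i).obj.hom :=
    Sigma.hom_ext _ _ fun i => by rw [reassoc_of% (hQ i), Over.w, Sigma.ι_desc]
  let q : N ⟶ M := ObjectProperty.homMk (Over.homMk Q hQ')
  let inc (i) : V i ⟶ N := ObjectProperty.homMk
    (Over.homMk (Sigma.ι (fun i => (V i).obj.left) i) (Sigma.ι_desc _ _))
  have hq (i) : inc i ≫ q = f i := ObjectProperty.hom_ext _ (Over.OverMorphism.ext (hQ i))
  refine ⟨N, q, M.obj.left, V, inc, EtaleScheme.sigmaDesc_of_hasRingHomProperty @Etale (Q := RingHom.Etale) _ hf,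
    ⟨fun x => ?_⟩, fun i => ?_, fun x => ?_, fun i => ?_, fun {i j} hij x y e => ?_⟩
  · obtain ⟨y, hy⟩ := cov x
    refine ⟨Sigma.ι (fun i => (V i).obj.left) x y, ?_⟩
    change Q _ = x
    rw [← Scheme.Hom.comp_apply, hQ, hy]
  · exact (sigmaOpenCover fun i => (V i).obj.left).map_prop i
  · obtain ⟨i, y, h⟩ := (sigmaOpenCover fun i => (V i).obj.left).exists_eq x
    exact ⟨i, y, h⟩
  · rw [hq]
    exact hV i
  · exact hij (congrArg Sigma.fst ((sigmaι_eq_iff (fun i => (V i).obj.left) i j x y).1 e))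

lemma isGoodSite : IsGoodSite (SpaceCat.ofSchemes B P) where
  subcanonical := H.subcanonical
  generate_mem f hf hs := (H.mem_topology_iff _).2 (H.hasEtaleCover_generate f hf hs)
  exists_disjoint_cover {M} R hR := by
    obtain ⟨N, q, I, V, inc, h₁, h₂, h₃, h₄, h₅, h₆⟩ :=
      H.exists_disjoint_cover ((H.mem_topology_iff R).1 hR)
    refine ⟨N, q, I, V, inc, h₁, h₂, fun i => ⟨fun a b e => ?_⟩,
      (H.mem_topology_iff _).2 fun x => ?_, h₅, fun {i j} hij L a b e =>
      (H.mem_topology_iff _).2 fun x => (h₆ hij (a.hom.left x) (b.hom.left x) ?_).elim⟩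
    · have := h₃ i
      have e' : a.hom.left ≫ (inc i).hom.left = b.hom.left ≫ (inc i).hom.left :=
        congrArg (fun φ => φ.hom.left) e
      exact ObjectProperty.hom_ext _ (Over.OverMorphism.ext ((cancel_mono _).1 e'))
    · obtain ⟨i, hi⟩ := h₄ x
      have := h₃ i
      exact ⟨V i, inc i, (Sieve.mem_ofArrows_iff _ _ _).2 ⟨i, 𝟙 _, (Category.id_comp _).symm⟩,
        inferInstance, hi⟩
    · have e' : a.hom.left ≫ (inc i).hom.left = b.hom.left ≫ (inc j).hom.left :=
        congrArg (fun φ => φ.hom.left) e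
      rw [← Scheme.Hom.comp_apply, e', Scheme.Hom.comp_apply]

end IsEtaleClass

lemma isEtaleClass_separated (B : Scheme.{0}) :
    IsEtaleClass B fun X => IsSeparated X.hom where
  isSeparated _ h := h
  of_etale {X Y} f h _ hf := by
    have : IsSeparated Y.hom := h
    rw [← Over.w f]
    infer_instance
  sigma X hX := EtaleScheme.isSeparated_of_sigma _ fun i => by
    have : Sigma.ι (fun i => (X i).left) i ≫ (Over.mk (Sigma.desc fun i => (X i).hom)).hom =
        (X i).hom := Sigma.ι_desc _ _
    exact this ▸ hX i

lemma isEtaleClass_smooth (B : Scheme.{0}) :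
    IsEtaleClass B fun X => Smooth X.hom ∧ IsSeparated X.hom where
  isSeparated _ h := h.2
  of_etale {X Y} f h hf hf' := by
    refine ⟨?_, (isEtaleClass_separated B).of_etale f h.2 hf hf'⟩
    have : Smooth Y.hom := h.1
    rw [← Over.w f]
    infer_instance
  sigma X hX := ⟨EtaleScheme.sigmaDesc_of_hasRingHomProperty @Smooth (Q := RingHom.Smooth) _ fun i =>
    (hX i).1,
    (isEtaleClass_separated B).sigma X fun i => (hX i).2⟩

end Orbi

theorem mainTheorem9 (S : Orbi.SpaceCat.{0, 1}) (hS : S.IsBasic) :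
    ∃ (_ : S.IsGeometric) (F : Pseudofunctor (Orbi.SGroupoid S) (Orbi.OrbiCat S)),
      Orbi.IsBiequivalence F ∧
      ∃ j : ∀ X : Orbi.SGroupoid S, X.gpd.toBased ⟶ Orbi.Orbifold.stack (F.obj X),
        (∀ X : Orbi.SGroupoid S, Orbi.IsAssociatedStack (j X)) ∧
        ∀ (X Y : Orbi.SGroupoid S) (σ : Orbi.Span X.gpd Y.gpd),
          Nonempty (Orbi.GroupoidIn.toBasedMap σ.s ≫ j X ≫ (F.map (X := X) (Y := Y) σ).hom ≅
            Orbi.GroupoidIn.toBasedMap σ.f ≫ j Y) := by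
  cases hS with
  | top => exact ⟨Orbi.isTopLike_topSpaces.isGeometric,
      @Orbi.exists_pseudofunctor _ Orbi.isTopLike_topSpaces.isGeometric
        Orbi.isTopLike_topSpaces.isGoodSite⟩
  | lrs => exact ⟨Orbi.isTopLike_lrsSpaces.isGeometric,
      @Orbi.exists_pseudofunctor _ Orbi.isTopLike_lrsSpaces.isGeometric
        Orbi.isTopLike_lrsSpaces.isGoodSite⟩
  | smoothManifold => exact ⟨Orbi.Mfd.isTopLike.isGeometric,
      @Orbi.exists_pseudofunctor _ Orbi.Mfd.isTopLike.isGeometric Orbi.Mfd.isTopLike.isGoodSite⟩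
  | complexManifold => exact ⟨Orbi.Mfd.isTopLike.isGeometric,
      @Orbi.exists_pseudofunctor _ Orbi.Mfd.isTopLike.isGeometric Orbi.Mfd.isTopLike.isGoodSite⟩
  | complexSpace => exact ⟨Orbi.isTopLike_complexSpaces.isGeometric,
      @Orbi.exists_pseudofunctor _ Orbi.isTopLike_complexSpaces.isGeometric
        Orbi.isTopLike_complexSpaces.isGoodSite⟩
  | smoothScheme k => exact ⟨(Orbi.isEtaleClass_smooth _).isGeometric,
      @Orbi.exists_pseudofunctor _ (Orbi.isEtaleClass_smooth _).isGeometric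
        (Orbi.isEtaleClass_smooth _).isGoodSite⟩
  | scheme B => exact ⟨(Orbi.isEtaleClass_separated B).isGeometric,
      @Orbi.exists_pseudofunctor _ (Orbi.isEtaleClass_separated B).isGeometric
        (Orbi.isEtaleClass_separated B).isGoodSite⟩
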